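/- **Setting.** Let $k$ be an algebraically closed field of characteristic $p>0$. An *idealistic filtration* on a ring $A$ is a sequence of ideals $A=I_0\supseteq I_1\supseteq I_2\supseteq\cdots$ with $I_mI_n\subseteq I_{m+n}$; it is *of i.f.g. type* if $I_1\neq0$ and $\bigoplus_a I_aT^a$ is a finitely generated $A$-algebra. We say that $(f,a)\in\mathcal R$ if $f\in I_a$. A *germ* $(A,\mathcal R,E)$ consists of a Noetherian local domain $A$ over $k$ with maximal ideal $\mathfrak m$ (the local ring at a closed point $P$ of the ambient space), an idealistic filtration $\mathcal R=(I_a)$ on $A$, and a list $E$ of ideals of $A$ (the components through $P$ of the boundary $E_{\rm young}$, from the youngest to the oldest). The point is *in the support* if $I_a\subseteq\mathfrak m^a$ for all $a$. Below, $\widehat A\cong k[[x,y,z]]$ and $\widehat{\mathcal R}=(I_a\widehat A)$. *The invariant $\sigma$.* The differential saturation $\mathcal D\widehat{\mathcal R}$ is the idealistic filtration generated by the pairs $(\delta f,\max\{a-n,0\})$ with $(f,a)\in\widehat{\mathcal R}$ and $\delta$ a $k$-linear differential operator of degree $\le n$. Let $a_n$ be $3$ minus the dimension of the $k$-span of the linear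 forms $\ell$ such that $\ell^{p^n}$ is the class modulo $\widehat{\mathfrak m}^{p^n+1}$ of an element of level $p^n$ in $\mathcal D\widehat{\mathcal R}$ (so $a_n=3-\#\{i: e_i\le n\}$ if the leading algebra is $k[x_1^{p^{e_1}},\dots,x_t^{p^{e_t}}]$). Then $\sigma=(a_n)_{n\ge0}$; values are compared lexicographically. *Monomial case with $\tau=1$ in dimension 3.* There are an identification $\widehat A\cong k[[x,y,z]]$, an integer $e\ge0$, with $q=p^e$, integers $\alpha,\beta\ge0$, $a>0$ and $(h,q)\in\widehat{\mathcal R}$ such that * $\sigma=(a_n)$ with $a_n=3$ for $n<e$ and $a_n=2$ for $n\ge e$ (one leading generator, of level $q$); * $h=z^{q}+a_1z^{q-1}+\cdots+a_{q}$ with $a_i\in k[[x,y]]$ and $\operatorname{ord}(a_i)>i$; * either $E=[H_x]$ and $\beta=0$, or $E$ consists of $H_x$ and $H_y$ in some order, where $H_x\widehat A=(x)$ and $H_y\widehat A=(y)$; * $(x^\alpha y^\beta,a)\in\widehat{\mathcal R}$; * $\widehat{\mathcal R}$ is saturated under the Hasse derivatives $\partial^n_z$ (that is, $(f,\lambda)\in\widehat{\mathcal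 R}$ implies $(\partial_z^nf,\max\{\lambda-n,0\})\in\widehat{\mathcal R}$, where $\partial_z^n z^m=\binom mn z^{m-n}$); * for every $(f,\lambda)\in\widehat{\mathcal R}$, the constant term of the expansion of $f$ in powers of $h$, i.e. the remainder of the Weierstrass division of $f$ by $h$, is divisible by $(x^\alpha y^\beta)^{\lambda/a}$. Such data are called a presentation. Put $\mu_x=\alpha/a$ and, with $r=\operatorname{ord}_{H_x}(a_q)$, $\operatorname{slope}_x=\min\{r/q,\mu_x\}$ (which is $\mu_x$ if $a_q=0$). Write $a_q=x^r(g(y)+x\,\omega(x,y))$. The presentation is *well-adapted* along $H_x$ if $\operatorname{slope}_x=\mu_x$, or $\operatorname{slope}_x=r/q<\mu_x$ and $x^rg(y)$ is not a $q$-th power. The divisor $H_x$ is *good* if $\operatorname{slope}_x=\mu_x$ and *bad* if $\operatorname{slope}_x<\mu_x$, for a well-adapted presentation; when it is bad put $\rho_x=(d-r)/q$, where $d$ is the smallest degree of a monomial which occurs in $x^rg(y)$ and is not a $q$-th power. Exchanging the roles of $x$ and $y$ defines $\mu_y$, $\rho_y$ and good or bad for $H_y$. The invariant $\mathrm{inv}_{\rm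 MON}$ is defined to be 1. $(0,0,\mu_x)$ if $E=[H_x]$ and $H_x$ is good; 2. $(0,0,\min\{\mu_x,\mu_y\},\max\{\mu_x,\mu_y\})$ if $E$ has two components, both good; 3. $(\rho_x,0,\mu_x)$ if $E=[H_x]$ and $H_x$ is bad; 4. $(\min\{\rho_x,\mu_x\},\max\{\rho_x,\mu_x\})$ if $E$ has two components, $H_x$ bad and $H_y$ good; 5. $(\min\{\rho_x,\rho_y\},\max\{\rho_x,\rho_y\})$ if $E$ has two components, both bad. Values are compared lexicographically. *The procedure.* The singular locus of $\widehat{\mathcal R}$ consists of the primes $Q$ of $\widehat A$ such that $I_a\widehat A_Q\subseteq Q^a\widehat A_Q$ for all $a$. If it has a $1$-dimensional component, the centre is such a component contained in a boundary component; if there are two of them, one takes first the one contained in the boundary component with the bigger $\mu$ and, if the two values of $\mu$ agree, the one contained in the younger boundary component. If the singular locus has no $1$-dimensional component, the centre is the point $P$. An ideal $J\subseteq A$ is a prescribed centre if $J\widehat A$ is the ideal of the centre. *The transform.* Let $\widetilde P$ be a closed point over $P$ of the blow up of $A$ along $J$, with local ring $\widetilde A$, and let $t$ be a generator of $J\widetilde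 A$. The transform $(\widetilde A,\widetilde{\mathcal R},\widetilde E)$ has $\widetilde{\mathcal R}$ generated by the pairs $(f/t^a,a)$ with $(f,a)\in\mathcal R$, and $\widetilde E$ consists of the exceptional divisor $(t)$, as youngest component, followed by the strict transforms of the components of $E$ that pass through $\widetilde P$. **Theorem 1.** (1) For every germ with $\mathcal R$ of i.f.g. type, in the monomial case with $\tau=1$ in dimension 3 and in the support, $\mathrm{inv}_{\rm MON}(P)$ is well defined: it has exactly one value, independent of the presentations. (2) For every such germ the procedure prescribes a centre in $\widehat A$. (3) Let $(A,\mathcal R,E)$ be such a germ, $J$ a prescribed centre, and $(\widetilde A,\widetilde{\mathcal R},\widetilde E)$ the transform at a closed point $\widetilde P$ over $P$. Then one of the following holds: $\widetilde P$ is not in the support of $\widetilde{\mathcal R}$; or $\sigma(\widetilde P)<\sigma(P)$; or the transform at $\widetilde P$ is again in the monomial case with $\tau=1$ and $\mathrm{inv}_{\rm MON}(\widetilde P)<\mathrm{inv}_{\rm MON}(P)$. (4) The procedure terminates: there is no infinite sequence of germs, starting with a germ as in (1), in which each germ is the transform of the preceding one along a prescribed centre, at a closed point lying over the preceding point and belonging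 to the support, and in which $\sigma$ never drops. -/

import Mathlib

universe u v

namespace IFP

/-- An idealistic filtration on a ring: a decreasing multiplicative sequence of ideals
`A = level 0 ⊇ level 1 ⊇ level 2 ⊇ ⋯`. -/
@[ext]
structure IdealisticFiltration (A : Type v) [CommRing A] where
  level : ℕ → Ideal A
  level_zero : level 0 = ⊤
  level_succ_le : ∀ n, level (n + 1) ≤ level n
  mul_le : ∀ m n, level m * level n ≤ level (m + n)

namespace IdealisticFiltration

variable {A : Type v} [CommRing A]

/-- The filtration obtained by extending every level along a ring homomorphism. -/
def map {B : Type*} [CommRing B] (R : IdealisticFiltration A) (φ : A →+* B) :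
    IdealisticFiltration B where
  level n := (R.level n).map φ
  level_zero := by rw [R.level_zero, Ideal.map_top]
  level_succ_le n := Ideal.map_mono (R.level_succ_le n)
  mul_le m n := by
    rw [← Ideal.map_mul]
    exact Ideal.map_mono (R.mul_le m n)

/-- The smallest idealistic filtration containing a given set of pairs (element, level). -/
def generate (S : Set (A × ℕ)) : IdealisticFiltration A where
  level n := ⨅ T : {T : IdealisticFiltration A // ∀ s ∈ S, s.1 ∈ T.level s.2}, T.1.level n
  level_zero := by simp [level_zero]
  level_succ_le n := iInf_mono fun T => T.1.level_succ_le n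
  mul_le m n := le_iInf fun T =>
    (Ideal.mul_mono (iInf_le _ T) (iInf_le _ T)).trans (T.1.mul_le m n)

/-- The graded algebra `⨁ (level n) Tⁿ`, as a subalgebra of `A[T]`. -/
def gradedAlgebra (R : IdealisticFiltration A) : Subalgebra A (Polynomial A) where
  carrier := {f | ∀ n, f.coeff n ∈ R.level n}
  mul_mem' := by
    intro f g hf hg n
    rw [Polynomial.coeff_mul]
    refine Ideal.sum_mem _ fun c hc => ?_
    rw [← Finset.HasAntidiagonal.mem_antidiagonal.1 hc]
    exact R.mul_le _ _ (Ideal.mul_mem_mul (hf _) (hg _))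
  add_mem' := by
    intro f g hf hg n
    rw [Polynomial.coeff_add]
    exact Ideal.add_mem _ (hf n) (hg n)
  algebraMap_mem' := by
    intro r n
    rw [Polynomial.algebraMap_apply, Polynomial.coeff_C]
    split_ifs with hn
    · rw [hn, R.level_zero]
      trivial
    · exact Ideal.zero_mem _

/-- Idealistic filtration of i.f.g. type. -/
def IsIFG (R : IdealisticFiltration A) : Prop :=
  R.level 1 ≠ ⊥ ∧ R.gradedAlgebra.FG

end IdealisticFiltration

/-- `k`-linear differential operators on `A` of degree at most `n`. -/
def IsDiffOp (k : Type u) {A : Type v} [Field k] [CommRing A] [Algebra k A] :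
    ℕ → (A →ₗ[k] A) → Prop
  | 0, δ => ∀ b c : A, δ (b * c) = b * δ c
  | n + 1, δ => ∀ b : A,
      IsDiffOp k n (δ ∘ₗ LinearMap.mulLeft k b - LinearMap.mulLeft k b ∘ₗ δ)

/-- The differential saturation, generated by the pairs `(δ f, max (a - n) 0)` with `f` of
level `a` and `δ` a differential operator of degree at most `n`. -/
def diffSat (k : Type u) {A : Type v} [Field k] [CommRing A] [Algebra k A]
    (R : IdealisticFiltration A) : IdealisticFiltration A :=
  IdealisticFiltration.generate
    {s | ∃ (f : A) (a n : ℕ) (δ : A →ₗ[k] A), f ∈ R.level a ∧ IsDiffOp k n δ ∧ s = (δ f, a - n)}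

/-- The power series ring `k[[x, y, z]]`, with `x = X 0`, `y = X 1`, `z = X 2`. -/
abbrev PS (k : Type u) [Field k] : Type u := MvPowerSeries (Fin 3) k

noncomputable section

/-- The invariant `σ = (a_n)` of an idealistic filtration on `k[[x, y, z]]`. If the leading algebra
of the differential saturation is `k[x_1^{p^{e_1}}, …, x_t^{p^{e_t}}]`, its elements of degree `p^n`
which are `p^n`-th powers of linear forms make up a space of dimension `#{i | e_i ≤ n}`, so that
`a_n = 3 - #{i | e_i ≤ n}`. -/
def sigma {k : Type u} [Field k] (p : ℕ) (R : IdealisticFiltration (PS k)) (n : ℕ) : ℕ :=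
  3 - Module.finrank k (Submodule.span k
    {c : Fin 3 → k | ∃ f ∈ (diffSat k R).level (p ^ n),
      f - (∑ i, MvPowerSeries.C (c i) * MvPowerSeries.X i) ^ (p ^ n) ∈
        IsLocalRing.maximalIdeal (PS k) ^ (p ^ n + 1)})

/-- The Hasse derivative `∂ⁿ/∂zⁿ` (divided by `n!`) on `k[[x, y, z]]`. -/
def hasseZ {k : Type u} [Field k] (n : ℕ) (f : PS k) : PS k :=
  fun m => ((m 2 + n).choose n : k) * MvPowerSeries.coeff (m + Finsupp.single 2 n) f

/-- The germ at a closed point `P` of a triplet `(W, 𝓡, E)`: the local ring at `P`, the stalk of the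
idealistic filtration, and the ideals of the components of the boundary `E_young` passing through
`P`, listed from the youngest to the oldest. -/
structure TripletGerm (k : Type u) [Field k] where
  ring : Type v
  [commRing : CommRing ring]
  [isDomain : IsDomain ring]
  [isLocalRing : IsLocalRing ring]
  [isNoetherianRing : IsNoetherianRing ring]
  [algebra : Algebra k ring]
  R : IdealisticFiltration ring
  E : List (Ideal ring)

attribute [instance] TripletGerm.commRing TripletGerm.isDomain TripletGerm.isLocalRing
  TripletGerm.isNoetherianRing TripletGerm.algebra

/-- `ι` identifies the completion of the local ring `A` with `k[[x, y, z]]`. -/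
def IsCompletion {k : Type u} [Field k] {A : Type v} [CommRing A] [IsLocalRing A] [Algebra k A]
    (ι : A →ₐ[k] PS k) : Prop :=
  (∀ (n : ℕ) (a : A), ι a ∈ IsLocalRing.maximalIdeal (PS k) ^ n ↔
      a ∈ IsLocalRing.maximalIdeal A ^ n) ∧
  (∀ (n : ℕ) (f : PS k), ∃ a : A, f - ι a ∈ IsLocalRing.maximalIdeal (PS k) ^ n)

/-- The point belongs to the support: every element of level `a` has order at least `a`. -/
def InSupport {k : Type u} [Field k] (G : TripletGerm.{u, v} k) : Prop :=
  ∀ a : ℕ, G.R.level a ≤ IsLocalRing.maximalIdeal G.ring ^ a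

/-- A presentation of a germ in dimension 3 as a germ in the monomial case with `τ = 1`: coordinates
`(x, y, z)` of the completion, a monomial `(x^α y^β, a)` and the element `h` of a leading generator
system. -/
structure Presentation {k : Type u} [Field k] (p : ℕ) (G : TripletGerm.{u, v} k) where
  chart : G.ring →ₐ[k] PS k
  isCompletion : IsCompletion chart
  e : ℕ
  h : PS k
  α : ℕ
  β : ℕ
  a : ℕ
  a_pos : 0 < a
  Hx : Ideal G.ring
  Hx_eq : Hx.map chart.toRingHom = Ideal.span {MvPowerSeries.X 0}
  boundary : (G.E = [Hx] ∧ β = 0) ∨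
    ∃ Hy : Ideal G.ring, Hy.map chart.toRingHom = Ideal.span {MvPowerSeries.X 1} ∧
      (G.E = [Hx, Hy] ∨ G.E = [Hy, Hx])
  /-- The leading generator system consists of one element, of level `p ^ e`. -/
  sigma_eq : sigma p (G.R.map chart.toRingHom) = fun n => if n < e then 3 else 2
  h_mem : h ∈ (G.R.map chart.toRingHom).level (p ^ e)
  /-- `h = z^q + a_1 z^(q-1) + ⋯ + a_q` with `q = p ^ e`, `a_i ∈ k[[x, y]]` and `ord a_i > i`. -/
  h_coeff_top : MvPowerSeries.coeff (Finsupp.single 2 (p ^ e)) h = 1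
  h_coeff : ∀ n : Fin 3 →₀ ℕ, MvPowerSeries.coeff n h ≠ 0 → n ≠ Finsupp.single 2 (p ^ e) →
    n 2 < p ^ e ∧ p ^ e < n 0 + n 1 + n 2
  monomial_mem : MvPowerSeries.X 0 ^ α * MvPowerSeries.X 1 ^ β ∈
    (G.R.map chart.toRingHom).level a
  saturated : ∀ (l n : ℕ) (f : PS k), f ∈ (G.R.map chart.toRingHom).level l →
    hasseZ n f ∈ (G.R.map chart.toRingHom).level (l - n)
  /-- For `f` of level `l`, the constant term `c` of the expansion `f = ∑ c_b h^b` (the remainder of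
  the Weierstrass division of `f` by `h`) is divisible by `(x^α y^β)^(l/a)`. -/
  const_dvd : ∀ (l : ℕ) (f : PS k), f ∈ (G.R.map chart.toRingHom).level l →
    ∃ c : PS k, h ∣ f - c ∧ ∀ n : Fin 3 →₀ ℕ, MvPowerSeries.coeff n c ≠ 0 →
      n 2 < p ^ e ∧ α * l ≤ a * n 0 ∧ β * l ≤ a * n 1

namespace Presentation

variable {k : Type u} [Field k] {p : ℕ} {G : TripletGerm.{u, v} k}

/-- The exponents of the monomials occurring in the coefficient `a_q ∈ k[[x, y]]` of `h`. -/
def constSupport (P : Presentation p G) : Set (Fin 3 →₀ ℕ) :=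
  {n | n 2 = 0 ∧ MvPowerSeries.coeff n P.h ≠ 0}

/-- The order of `a_q` along `H_x` (when `a_q ≠ 0`). -/
def ordX (P : Presentation p G) : ℕ := sInf {r | ∃ n ∈ P.constSupport, n 0 = r}

/-- `μ` at the generic point of `H_x`. -/
def mu (P : Presentation p G) : ℚ := (P.α : ℚ) / P.a

open scoped Classical in
/-- The slope of `h` at the generic point of `H_x` (where the order of `a_q = 0` is `∞`). -/
def slope (P : Presentation p G) : ℚ :=
  if P.constSupport = ∅ then P.mu else min ((P.ordX : ℚ) / (p : ℚ) ^ P.e) P.mu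

open scoped Classical in
/-- The initial form `x^r g(y)` of `a_q` along `H_x`. -/
def initial (P : Presentation p G) : PS k :=
  fun n => if n ∈ P.constSupport ∧ n 0 = P.ordX then MvPowerSeries.coeff n P.h else 0

/-- `h` is well-adapted at the generic point of `H_x`. -/
def WellAdapted (P : Presentation p G) : Prop :=
  P.slope = P.mu ∨
    (P.slope = (P.ordX : ℚ) / (p : ℚ) ^ P.e ∧ P.slope < P.mu ∧
      ¬ ∃ w : PS k, w ^ (p ^ P.e) = P.initial)

/-- The smallest degree of a monomial of the initial form along `H_x` which is not a `q`-th
power. -/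
def resOrd (P : Presentation p G) : ℕ :=
  sInf {d | ∃ n : Fin 3 →₀ ℕ, MvPowerSeries.coeff n P.initial ≠ 0 ∧
    (¬ ∀ i, p ^ P.e ∣ n i) ∧ d = n 0 + n 1 + n 2}

/-- The invariant `ρ` of the (bad) divisor `H_x`. -/
def rho (P : Presentation p G) : ℚ := ((P.resOrd : ℚ) - P.ordX) / (p : ℚ) ^ P.e

end Presentation

/-- The germ is in the monomial case with `τ = 1` in dimension 3. -/
def MonomialCase {k : Type u} [Field k] (p : ℕ) (G : TripletGerm.{u, v} k) : Prop :=
  Nonempty (Presentation p G)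

/-- The boundary component `D` is good, `μ` being the value of `μ` at its generic point. -/
def IsGood {k : Type u} [Field k] (p : ℕ) (G : TripletGerm.{u, v} k) (D : Ideal G.ring)
    (μ : ℚ) : Prop :=
  ∃ P : Presentation p G, P.Hx = D ∧ P.WellAdapted ∧ P.slope = P.mu ∧ P.mu = μ

/-- The boundary component `D` is bad, `μ` being the value of `μ` at its generic point, and `ρ` the
value of its invariant `ρ` at the point. -/
def IsBad {k : Type u} [Field k] (p : ℕ) (G : TripletGerm.{u, v} k) (D : Ideal G.ring)
    (μ ρ : ℚ) : Prop :=
  ∃ P : Presentation p G, P.Hx = D ∧ P.WellAdapted ∧ P.slope < P.mu ∧ P.mu = μ ∧ P.rho = ρ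

/-- `IsInvMON p G v` says that `v` is the value of the invariant `inv_MON`, defined according to
five configurations. Values are compared lexicographically. -/
inductive IsInvMON {k : Type u} [Field k] (p : ℕ) (G : TripletGerm.{u, v} k) : List ℚ → Prop
  | good (D : Ideal G.ring) (μ : ℚ) (hE : G.E = [D]) (hD : IsGood p G D μ) :
      IsInvMON p G [0, 0, μ]
  | good_good (D D' : Ideal G.ring) (μ μ' : ℚ) (hE : G.E = [D, D'])
      (hD : IsGood p G D μ) (hD' : IsGood p G D' μ') :
      IsInvMON p G [0, 0, min μ μ', max μ μ']
  | bad (D : Ideal G.ring) (μ ρ : ℚ) (hE : G.E = [D]) (hD : IsBad p G D μ ρ) :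
      IsInvMON p G [ρ, 0, μ]
  | bad_good (D D' : Ideal G.ring) (μ ρ μ' : ℚ) (hE : G.E = [D, D'] ∨ G.E = [D', D])
      (hD : IsBad p G D μ ρ) (hD' : IsGood p G D' μ') :
      IsInvMON p G [min ρ μ, max ρ μ]
  | bad_bad (D D' : Ideal G.ring) (μ ρ μ' ρ' : ℚ) (hE : G.E = [D, D'])
      (hD : IsBad p G D μ ρ) (hD' : IsBad p G D' μ' ρ') :
      IsInvMON p G [min ρ ρ', max ρ ρ']

/-- The prime `Q` of `k[[x, y, z]]` belongs to the singular locus of the filtration: every element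
of level `a` has order at least `a` in the localization at `Q`. -/
def InSing {k : Type u} [Field k] (R : IdealisticFiltration (PS k)) (Q : Ideal (PS k)) : Prop :=
  ∀ a : ℕ, ∀ f ∈ R.level a, ∃ s : PS k, s ∉ Q ∧ s * f ∈ Q ^ a

/-- `Q` is the ideal of a 1-dimensional component of the singular locus at the point. -/
def IsSingCurve {k : Type u} [Field k] (R : IdealisticFiltration (PS k)) (Q : Ideal (PS k)) :
    Prop :=
  Q.IsPrime ∧ ringKrullDim (PS k ⧸ Q) = 1 ∧ InSing R Q

/-- The centre chosen by the procedure, in the given coordinates, is defined by `Q`. If the singular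
locus is of dimension 1, it is a 1-dimensional component, contained in a boundary component (which
is named `H_x`); if there is another 1-dimensional component, the boundary component `H_x` must
have the bigger `μ`, or have the same `μ` as the other one and be younger. If the point is isolated
in the singular locus, the centre is the point. -/
def Presentation.Prescribes {k : Type u} [Field k] {p : ℕ} {G : TripletGerm.{u, v} k}
    (P : Presentation p G) (Q : Ideal (PS k)) : Prop :=
  (IsSingCurve (G.R.map P.chart.toRingHom) Q ∧ P.Hx.map P.chart.toRingHom ≤ Q ∧
    ∀ Q' : Ideal (PS k), IsSingCurve (G.R.map P.chart.toRingHom) Q' → Q' ≠ Q →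
      P.β < P.α ∨ (P.β = P.α ∧ G.E.head? = some P.Hx)) ∨
  ((∀ Q' : Ideal (PS k), ¬ IsSingCurve (G.R.map P.chart.toRingHom) Q') ∧
    Q = IsLocalRing.maximalIdeal (PS k))

/-- `J` is the ideal of the centre prescribed by the procedure. -/
def PrescribedCenter {k : Type u} [Field k] (p : ℕ) (G : TripletGerm.{u, v} k)
    (J : Ideal G.ring) : Prop :=
  ∃ P : Presentation p G, P.Prescribes (J.map P.chart.toRingHom)

/-- The saturation `{c | ∃ n, tⁿ c ∈ I}` of an ideal. -/
def saturation {B : Type v} [CommRing B] (I : Ideal B) (t : B) : Ideal B where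
  carrier := {c | ∃ n : ℕ, t ^ n * c ∈ I}
  zero_mem' := ⟨0, by simp⟩
  add_mem' := by
    rintro c d ⟨m, hm⟩ ⟨n, hn⟩
    refine ⟨m + n, ?_⟩
    have key : t ^ (m + n) * (c + d) = t ^ n * (t ^ m * c) + t ^ m * (t ^ n * d) := by ring
    rw [key]
    exact I.add_mem (I.mul_mem_left _ hm) (I.mul_mem_left _ hn)
  smul_mem' := by
    rintro r c ⟨n, hn⟩
    refine ⟨n, ?_⟩
    have key : t ^ n * (r • c) = r * (t ^ n * c) := by
      rw [smul_eq_mul]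
      ring
    rw [key]
    exact I.mul_mem_left _ hn

open scoped Classical in
/-- `G'` is the germ, at some closed point over `P`, of the transform of the triplet under the blow
up with centre defined by `J`. The local ring is the localization of `A[J/t]` at a maximal ideal
lying over the one of `A` (for some `t ∈ J`), `t` is an equation of the exceptional divisor, the
filtration is generated by the pairs `(f / t^a, a)` with `f` of level `a`, and the boundary consists
of the exceptional divisor (the youngest component) and the strict transforms of the old
components which pass through the new point. -/
def IsTransform {k : Type u} [Field k] (G : TripletGerm.{u, v} k) (J : Ideal G.ring)
    (G' : TripletGerm.{u, v} k) : Prop :=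
  ∃ (φ : G.ring →ₐ[k] G'.ring) (t : G.ring), Function.Injective φ ∧ t ∈ J ∧ t ≠ 0 ∧
    (IsLocalRing.maximalIdeal G'.ring).comap φ.toRingHom = IsLocalRing.maximalIdeal G.ring ∧
    (∀ c : G'.ring, ∃ r : k, c - algebraMap k G'.ring r ∈ IsLocalRing.maximalIdeal G'.ring) ∧
    J.map φ.toRingHom = Ideal.span {φ t} ∧
    (∀ c : G'.ring,
      ∃ b ∈ Algebra.adjoin k (Set.range φ ∪ {b : G'.ring | ∃ j ∈ J, φ t * b = φ j}),
      ∃ s ∈ Algebra.adjoin k (Set.range φ ∪ {b : G'.ring | ∃ j ∈ J, φ t * b = φ j}),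
        IsUnit s ∧ s * c = b) ∧
    G'.R = IdealisticFiltration.generate
      {s | ∃ (f : G.ring) (a : ℕ), f ∈ G.R.level a ∧ s.2 = a ∧ φ f = φ t ^ a * s.1} ∧
    G'.E = Ideal.span {φ t} ::
      (G.E.map fun D => saturation (D.map φ.toRingHom) (φ t)).filter fun D => D ≠ ⊤

/-- `s` is the value of the invariant `σ` at the point, computed in the completion. -/
def IsSigma {k : Type u} [Field k] (p : ℕ) (G : TripletGerm.{u, v} k) (s : ℕ → ℕ) : Prop :=
  ∃ ι : G.ring →ₐ[k] PS k, IsCompletion ι ∧ s = sigma p (G.R.map ι.toRingHom)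

/-- The invariant `σ` is smaller (lexicographically) at `G'` than at `G`. -/
def SigmaDrops {k : Type u} [Field k] (p : ℕ) (G G' : TripletGerm.{u, v} k) : Prop :=
  ∃ s s' : ℕ → ℕ, IsSigma p G s ∧ IsSigma p G' s' ∧
    ∃ n, (∀ m < n, s' m = s m) ∧ s' n < s n

end

end IFP

/-! The engine is the effect of a translation `z ↦ z + w(x, y)` on the constant term `a_q` of `h`.
Saturation under the derivatives in `z`, together with the divisibility of remainders, forces the
coefficient of `z^i` in `h`, for `0 < i < q`, to be divisible by `(x^α y^β)^((q-i)/a)`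
(`Frame.mid`). Hence below the weight of `(x^α y^β)^(q/a)` a translation only adds `w^q` to the
constant term (`Frame.coeff_shift`). Over the perfect field `k`, monomials of `a_q` in that range
can be removed when they are `q`-th powers and cannot be removed otherwise. So adapted coordinates
exist for any weight (`Frame.exists_adapted`), and along each divisor one is in exactly one of the
situations `Good` or `Bad`.

Independence of the presentation: two presentations differ by an automorphism `τ` of `k[[x, y, z]]`.
The ratio `α/a` is intrinsic because the monomial of one presentation, up to a unit, must satisfy
the divisibility of the other (`Frame.mul_le`). For a bad divisor let `x^r y^δ` be the
lexicographically lowest monomial of the constant term after the lower `q`-th powers have been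
removed. If another presentation had only higher monomials, one suitable weight would show that `x^r
y^δ` occurs in the `q`-th power `τ(z)^q`, which is absurd (`Frame.not_bad_of_higher`). Thus the
type, `r` and `δ` are intrinsic.

The centre: a singular curve lies on the monomial, hence in `x = 0` or `y = 0`. In the first plane
it must be `x = z - s(y) = 0`, where `-s^q` is the restriction of `a_q` to the plane
(`IsSingCurve.exists_root`), so each plane contains at most one. Conversely the curve `x = z = 0` is
singular as soon as the monomial and `a_q` are divisible enough by `x` (`Frame.isSingCurve`). When
the point is isolated this gives `μ < 1` for a good divisor and `r < q` for a bad one.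

The decrease: coordinates lift to the blow up (`IsBlowUp.exists_chart`) and the data transform to
data of the same kind (`Frame.transform`). Then either `σ` drops, or the initial form of the new `h`
is a `q`-th power and a linear change of `z` restores the presentation (`sigma_dichotomy`,
`IsTransformAt.exists_frame`). Blowing up a curve in `x = 0` lowers `μ_x` by 1, keeps the type of
`H_x` and its `ρ_x`, and lowers `ρ_y` by 1 if `H_y` is bad. Blowing up an isolated point lowers the
`ρ` of the strict transform of a bad divisor, since the new value is `ρ + r/q - 1`. The exceptional
divisor has `μ = μ_x + μ_y - 1`, and its type is controlled by `ExcRel`: its `ρ` is at most `ρ_x` if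
`H_x` is bad and below `μ_y` if `H_x` is good, while if it is good and `H_x` is bad then `μ_y <
ρ_x`. These inequalities give the lexicographic decrease in every configuration.

Termination: a common denominator of `1/q`, `μ_x`, `μ_y` at the start remains one after every blow
up (`Denom`), so the values are lists of length at most 4 with entries in a fixed lattice of
nonnegative rationals, where strict descent stops (`not_decreasing`). -/

namespace IFP
open MvPowerSeries IsLocalRing

noncomputable section

/-! ### Supports, weighted orders and endomorphisms of `k[[x, y, z]]`. -/

section Basics
variable {k : Type u} [Field k]

/-- The weight of an exponent. -/
def wt (w : Fin 3 → ℕ) (n : Fin 3 →₀ ℕ) : ℕ := w 0 * n 0 + w 1 * n 1 + w 2 * n 2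

theorem wt_add (w : Fin 3 → ℕ) (m n : Fin 3 →₀ ℕ) : wt w (m + n) = wt w m + wt w n := by
  simp [wt]; ring

theorem wt_single (w : Fin 3 → ℕ) (i : Fin 3) (c : ℕ) : wt w (Finsupp.single i c) = w i * c := by
  fin_cases i <;> simp [wt]

theorem wt_eq_weight (w : Fin 3 → ℕ) (n : Fin 3 →₀ ℕ) : Finsupp.weight w n = wt w n := by
  rw [Finsupp.weight_apply, Finsupp.sum_fintype _ _ (by simp)]
  simp [Fin.sum_univ_three, wt, mul_comm]

theorem exp_ext {m n : Fin 3 →₀ ℕ} (h0 : m 0 = n 0) (h1 : m 1 = n 1) (h2 : m 2 = n 2) : m = n := by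
  ext i; fin_cases i <;> assumption

/-- The power series with given coefficients. -/
def mkPS (c : (Fin 3 →₀ ℕ) → k) : PS k := c

@[simp] theorem coeff_mkPS (c : (Fin 3 →₀ ℕ) → k) (n : Fin 3 →₀ ℕ) : coeff n (mkPS c) = c n := rfl

/-- The power series all of whose exponents satisfy `U`. -/
def suppIn (U : (Fin 3 →₀ ℕ) → Prop) : Submodule k (PS k) where
  carrier := {f | ∀ n, coeff n f ≠ 0 → U n}
  zero_mem' := by intro n h; simp at h
  add_mem' := by
    intro f g hf hg n h
    by_contra hn
    have h1 : coeff n f = 0 := by by_contra h'; exact hn (hf n h')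
    have h2 : coeff n g = 0 := by by_contra h'; exact hn (hg n h')
    simp [h1, h2] at h
  smul_mem' := by
    intro c f hf n h
    apply hf
    intro h'
    simp [h'] at h

theorem mem_suppIn {U : (Fin 3 →₀ ℕ) → Prop} {f : PS k} :
    f ∈ suppIn U ↔ ∀ n, coeff n f ≠ 0 → U n := Iff.rfl

theorem suppIn_mono {U V : (Fin 3 →₀ ℕ) → Prop} (h : ∀ n, U n → V n) :
    suppIn (k := k) U ≤ suppIn V := fun _ hf n hn => h n (hf n hn)

theorem exists_of_coeff_mul_ne_zero {f g : PS k} {n : Fin 3 →₀ ℕ} (h : coeff n (f * g) ≠ 0) :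
    ∃ a b, a + b = n ∧ coeff a f ≠ 0 ∧ coeff b g ≠ 0 := by
  classical
  rw [coeff_mul] at h
  obtain ⟨c, hc, hne⟩ := Finset.exists_ne_zero_of_sum_ne_zero h
  exact ⟨c.1, c.2, Finset.HasAntidiagonal.mem_antidiagonal.1 hc, left_ne_zero_of_mul hne, right_ne_zero_of_mul hne⟩

theorem mul_mem_suppIn {U V T : (Fin 3 →₀ ℕ) → Prop} {f g : PS k} (hf : f ∈ suppIn U)
    (hg : g ∈ suppIn V) (h : ∀ a, U a → ∀ b, V b → T (a + b)) : f * g ∈ suppIn T := by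
  intro n hn
  obtain ⟨a, b, rfl, ha, hb⟩ := exists_of_coeff_mul_ne_zero hn
  exact h a (hf a ha) b (hg b hb)

theorem monomial_mem_suppIn {U : (Fin 3 →₀ ℕ) → Prop} {n : Fin 3 →₀ ℕ} (h : U n) (c : k) :
    (monomial n c : PS k) ∈ suppIn U := by
  classical
  intro m hm
  rw [coeff_monomial] at hm
  split_ifs at hm with hmn
  · rwa [hmn]
  · exact absurd rfl hm

theorem X_mem_suppIn {U : (Fin 3 →₀ ℕ) → Prop} {i : Fin 3} (h : U (Finsupp.single i 1)) :
    (X i : PS k) ∈ suppIn U := monomial_mem_suppIn h 1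

/-- The ideal of the power series of weight at least `N`. -/
def wIdeal (w : Fin 3 → ℕ) (N : ℕ) : Ideal (PS k) where
  carrier := {f | ∀ n, coeff n f ≠ 0 → N ≤ wt w n}
  zero_mem' := (suppIn (k := k) fun n => N ≤ wt w n).zero_mem
  add_mem' := (suppIn (k := k) fun n => N ≤ wt w n).add_mem
  smul_mem' := by
    intro c f hf
    refine mul_mem_suppIn (U := fun _ => True) (V := fun n => N ≤ wt w n) (fun _ _ => trivial) hf ?_
    intro a _ b hb
    rw [wt_add]
    omega

theorem mem_wIdeal {w : Fin 3 → ℕ} {N : ℕ} {f : PS k} :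
    f ∈ wIdeal w N ↔ ∀ n, coeff n f ≠ 0 → N ≤ wt w n := Iff.rfl

theorem mem_wIdeal_iff {w : Fin 3 → ℕ} {N : ℕ} {f : PS k} :
    f ∈ wIdeal w N ↔ f ∈ suppIn (fun n => N ≤ wt w n) := Iff.rfl

theorem wIdeal_anti (w : Fin 3 → ℕ) {M N : ℕ} (h : M ≤ N) : wIdeal (k := k) w N ≤ wIdeal w M :=
  fun _ hf n hn => h.trans (hf n hn)

theorem mul_mem_wIdeal {w : Fin 3 → ℕ} {M N : ℕ} {f g : PS k} (hf : f ∈ wIdeal w M)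
    (hg : g ∈ wIdeal w N) : f * g ∈ wIdeal w (M + N) := by
  refine mul_mem_suppIn (U := fun n => M ≤ wt w n) (V := fun n => N ≤ wt w n) hf hg ?_
  intro a ha b hb
  rw [wt_add]
  omega

theorem one_mem_wIdeal (w : Fin 3 → ℕ) : (1 : PS k) ∈ wIdeal w 0 := fun _ _ => Nat.zero_le _

theorem mem_wIdeal_zero (w : Fin 3 → ℕ) (f : PS k) : f ∈ wIdeal w 0 := fun _ _ => Nat.zero_le _

theorem pow_mem_wIdeal {w : Fin 3 → ℕ} {N : ℕ} {f : PS k} (hf : f ∈ wIdeal w N) (n : ℕ) :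
    f ^ n ∈ wIdeal w (n * N) := by
  induction n with
  | zero => simpa using one_mem_wIdeal w
  | succ n ih => rw [pow_succ, Nat.succ_mul]; exact mul_mem_wIdeal ih hf

theorem X_mem_wIdeal (w : Fin 3 → ℕ) (i : Fin 3) : (X i : PS k) ∈ wIdeal w (w i) :=
  X_mem_suppIn (U := fun n => w i ≤ wt w n) (by simp [wt_single])

theorem monomial_mem_wIdeal {w : Fin 3 → ℕ} {N : ℕ} {n : Fin 3 →₀ ℕ} (h : N ≤ wt w n) (c : k) :
    (monomial n c : PS k) ∈ wIdeal w N := monomial_mem_suppIn (U := fun n => N ≤ wt w n) h c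

theorem mem_wIdeal_iff_weightedOrder {w : Fin 3 → ℕ} {N : ℕ} {f : PS k} :
    f ∈ wIdeal w N ↔ (N : ℕ∞) ≤ weightedOrder w f := by
  constructor
  · intro h
    refine nat_le_weightedOrder w fun d hd => ?_
    by_contra hne
    have := h d hne
    rw [wt_eq_weight] at hd
    omega
  · intro h n hn
    have := h.trans (weightedOrder_le w hn)
    rw [wt_eq_weight] at this
    exact_mod_cast this

/-- Weighted orders are additive, since `k` has no zero divisors. This cancellation replaces
arguments with initial forms: below it is applied with weights attached to a divisor, to a curve, or
to a single decisive monomial. -/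
theorem mem_wIdeal_of_mul_mem {w : Fin 3 → ℕ} {a n : ℕ} {h f : PS k} (h' : h ∉ wIdeal w (a + 1))
    (hf : h * f ∈ wIdeal w n) : f ∈ wIdeal w (n - a) := by
  rw [mem_wIdeal_iff_weightedOrder] at h' hf ⊢
  rw [weightedOrder_mul] at hf
  cases hx : weightedOrder w h with
  | top => simp [hx] at h'
  | coe x =>
    cases hy : weightedOrder w f with
    | top => simp
    | coe y =>
      rw [hx] at h' hf
      rw [hy] at hf
      norm_cast at h' hf ⊢
      omega

theorem mul_notMem_wIdeal {w : Fin 3 → ℕ} {a b : ℕ} {f g : PS k} (hf : f ∉ wIdeal w (a + 1))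
    (hg : g ∉ wIdeal w (b + 1)) : f * g ∉ wIdeal w (a + b + 1) := by
  intro h
  refine hg (wIdeal_anti w ?_ (mem_wIdeal_of_mul_mem hf h))
  omega

theorem pow_notMem_wIdeal {w : Fin 3 → ℕ} {a : ℕ} {f : PS k} (hf : f ∉ wIdeal w (a + 1)) (n : ℕ) :
    f ^ n ∉ wIdeal w (n * a + 1) := by
  induction n with
  | zero =>
    intro h
    have := h 0 (by simp)
    simp [wt] at this
  | succ n ih =>
    rw [pow_succ, Nat.succ_mul]
    exact mul_notMem_wIdeal ih hf

theorem exists_exact_weight {w : Fin 3 → ℕ} {f : PS k} (hf : f ≠ 0) :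
    ∃ a, f ∈ wIdeal w a ∧ f ∉ wIdeal w (a + 1) := by
  rw [ne_zero_iff_weightedOrder_finite w] at hf
  refine ⟨(weightedOrder w f).toNat, ?_, ?_⟩ <;> rw [mem_wIdeal_iff_weightedOrder, ← hf]
  · simp
  · norm_cast; simp

variable (k) in
/-- The maximal ideal of `k[[x, y, z]]`. -/
abbrev mm : Ideal (PS k) := maximalIdeal (PS k)

theorem mem_mm {f : PS k} : f ∈ mm k ↔ constantCoeff f = 0 := by
  rw [mem_maximalIdeal, mem_nonunits_iff, MvPowerSeries.isUnit_iff_constantCoeff,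
    isUnit_iff_ne_zero, not_not]

theorem X_mem_mm (i : Fin 3) : (X i : PS k) ∈ mm k := mem_mm.2 (by simp)

/-- The ideal generated by the variables `X s`, `s ∈ S`. -/
def varIdeal (S : Finset (Fin 3)) : Ideal (PS k) := Ideal.span ((fun s => (X s : PS k)) '' S)

theorem X_mem_varIdeal {S : Finset (Fin 3)} {s : Fin 3} (h : s ∈ S) :
    (X s : PS k) ∈ varIdeal S := Ideal.subset_span ⟨s, h, rfl⟩

/-- The weight counting the variables which belong to `S`. -/
def ind (S : Finset (Fin 3)) : Fin 3 → ℕ := fun i => if i ∈ S then 1 else 0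

/-- A monomial of positive weight is divisible by some variable of `S`; choosing one such variable
for every exponent sorts the terms of `f` into finitely many series, so no convergence question
arises. -/
theorem mem_of_mem_wIdeal_succ {S : Finset (Fin 3)} {n : ℕ} {f : PS k}
    (hf : f ∈ wIdeal (ind S) (n + 1)) :
    ∃ g : Fin 3 → PS k, (∀ s, g s ∈ wIdeal (ind S) n) ∧ f = ∑ s ∈ S, X s * g s := by
  classical
  have hch : ∀ d : Fin 3 →₀ ℕ, ∃ s : Fin 3, coeff d f ≠ 0 → s ∈ S ∧ 0 < d s := by
    intro d
    by_cases hd : coeff d f = 0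
    · exact ⟨0, fun h => absurd hd h⟩
    · by_contra hcon
      push Not at hcon
      have h1 := hf d hd
      have h0 : ∀ s, ind S s * d s = 0 := by
        intro s
        obtain ⟨_, hs⟩ := hcon s
        by_cases h : s ∈ S
        · have := hs h
          simp only [nonpos_iff_eq_zero] at this
          simp [this]
        · simp [ind, h]
      simp only [wt, h0] at h1
      omega
  choose c hc using hch
  let g : Fin 3 → PS k := fun s m =>
    if c (m + Finsupp.single s 1) = s then coeff (m + Finsupp.single s 1) f else 0
  have hg : ∀ s m, coeff m (g s) =
      if c (m + Finsupp.single s 1) = s then coeff (m + Finsupp.single s 1) f else 0 :=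
    fun s m => rfl
  refine ⟨g, ?_, ?_⟩
  · intro s m hm
    change coeff m (g s) ≠ 0 at hm
    rw [hg] at hm
    split_ifs at hm with h
    · have h1 := hf _ hm
      have h2 := (hc _ hm).1
      rw [h] at h2
      rw [wt_add, wt_single, ind, if_pos h2] at h1
      omega
    · exact absurd rfl hm
  · ext d
    have key : ∀ s, coeff d (X s * g s) = if c d = s ∧ 0 < d s then coeff d f else 0 := by
      intro s
      rw [X, coeff_monomial_mul, one_mul]
      by_cases hs : 0 < d s
      · have hle : Finsupp.single s 1 ≤ d := by
          rw [Finsupp.single_le_iff]; exact hs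
        rw [if_pos hle, hg, tsub_add_cancel_of_le hle]
        simp [hs]
      · have hle : ¬ Finsupp.single s 1 ≤ d := by
          rw [Finsupp.single_le_iff]; exact hs
        rw [if_neg hle]
        simp [hs]
    rw [map_sum, Finset.sum_congr rfl fun s _ => key s]
    by_cases hd : coeff d f = 0
    · simp [hd]
    · rw [Finset.sum_eq_single_of_mem (c d) (hc d hd).1]
      · simp [(hc d hd).2]
      · intro b _ hb
        rw [if_neg]
        rintro ⟨h, _⟩
        exact hb h.symm

/-- Turns membership in a power into a condition on exponents, from which the equality of ordinary
and symbolic powers will follow. -/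
theorem varIdeal_pow (S : Finset (Fin 3)) (n : ℕ) :
    varIdeal (k := k) S ^ n = wIdeal (ind S) n := by
  induction n with
  | zero =>
    rw [pow_zero, Ideal.one_eq_top]
    exact (Ideal.eq_top_iff_one _).2 (one_mem_wIdeal _) |>.symm
  | succ n ih =>
    apply le_antisymm
    · rw [pow_succ, ih]
      refine Ideal.mul_le.2 fun f hf g hg => mul_mem_wIdeal hf ?_
      revert hg
      refine fun hg => (Ideal.span_le (I := wIdeal (ind S) 1)).2 ?_ hg
      rintro _ ⟨s, hs, rfl⟩
      have := X_mem_wIdeal (k := k) (ind S) s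
      rwa [ind, if_pos (by exact hs)] at this
    · intro f hf
      obtain ⟨g, hg, rfl⟩ := mem_of_mem_wIdeal_succ hf
      refine Ideal.sum_mem _ fun s hs => ?_
      rw [pow_succ']
      exact Ideal.mul_mem_mul (X_mem_varIdeal hs) (ih ▸ hg s)

theorem varIdeal_eq (S : Finset (Fin 3)) : varIdeal (k := k) S = wIdeal (ind S) 1 := by
  rw [← varIdeal_pow, pow_one]

/-- The total degree. -/
abbrev deg (n : Fin 3 →₀ ℕ) : ℕ := n 0 + n 1 + n 2

theorem mm_eq_wIdeal : mm k = wIdeal (ind Finset.univ) 1 := by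
  ext f
  rw [mem_mm, mem_wIdeal]
  constructor
  · intro h n hn
    by_contra hlt
    have : n = 0 := exp_ext (by simp [wt, ind] at hlt ⊢; omega) (by simp [wt, ind] at hlt ⊢; omega)
      (by simp [wt, ind] at hlt ⊢; omega)
    rw [this] at hn
    exact hn (by simpa using h)
  · intro h
    by_contra hne
    have := h 0 (by simpa using hne)
    simp [wt] at this

theorem mm_eq_varIdeal : mm k = varIdeal Finset.univ := by
  rw [mm_eq_wIdeal, varIdeal_eq]

theorem mm_pow (n : ℕ) : mm k ^ n = wIdeal (ind Finset.univ) n := by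
  rw [mm_eq_varIdeal, varIdeal_pow]

theorem wt_univ (n : Fin 3 →₀ ℕ) : wt (ind Finset.univ) n = deg n := by simp [wt, ind]

theorem mem_mm_pow {f : PS k} {N : ℕ} : f ∈ mm k ^ N ↔ ∀ n, coeff n f ≠ 0 → N ≤ deg n := by
  rw [mm_pow, mem_wIdeal]
  simp only [wt_univ]

theorem coeff_eq_zero_of_mem_mm_pow {f : PS k} {N : ℕ} (hf : f ∈ mm k ^ N) {n : Fin 3 →₀ ℕ}
    (h : deg n < N) : coeff n f = 0 := by
  by_contra hne
  have := mem_mm_pow.1 hf n hne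
  omega

theorem eq_zero_of_forall_mem {f : PS k} (h : ∀ N, f ∈ mm k ^ N) : f = 0 := by
  ext n
  exact coeff_eq_zero_of_mem_mm_pow (h (deg n + 1)) (Nat.lt_succ_self _)

theorem eq_of_forall_sub_mem {f g : PS k} (h : ∀ N, f - g ∈ mm k ^ N) : f = g :=
  sub_eq_zero.1 (eq_zero_of_forall_mem h)

/-- A finite sum of monomials approximates a power series. -/
theorem exists_trunc (f : PS k) (N : ℕ) :
    ∃ s : Finset (Fin 3 →₀ ℕ), f - ∑ d ∈ s, monomial d (coeff d f) ∈ mm k ^ N ∧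
      ∀ d ∈ s, coeff d f ≠ 0 := by
  classical
  have hfin : {d : Fin 3 →₀ ℕ | deg d < N ∧ coeff d f ≠ 0}.Finite := by
    apply (Set.finite_Iic (Finsupp.equivFunOnFinite.symm fun _ : Fin 3 => N)).subset
    intro d hd i
    simp only [Finsupp.equivFunOnFinite_symm_apply_apply]
    have h1 := hd.1
    simp only [deg] at h1
    fin_cases i <;> simp <;> omega
  refine ⟨hfin.toFinset, ?_, fun d hd => (hfin.mem_toFinset.1 hd).2⟩
  rw [mem_mm_pow]
  intro n hn
  by_contra hlt
  apply hn
  rw [map_sub, map_sum, sub_eq_zero]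
  simp only [coeff_monomial]
  rw [Finset.sum_ite_eq]
  split_ifs with h
  · rfl
  · by_contra hne
    exact h (hfin.mem_toFinset.2 ⟨by omega, hne⟩)

/-- Continuity for the adic topology. -/
def Cont (L : PS k →ₗ[k] PS k) : Prop := ∀ N, ∃ M, ∀ f ∈ mm k ^ M, L f ∈ mm k ^ N

/-- A given coefficient of `L f` depends on a truncation of `f` only, so conditions on exponents,
and identities between continuous maps, need only be checked on monomials. -/
theorem Cont.mem_suppIn {L : PS k →ₗ[k] PS k} (hL : Cont L) {D U : (Fin 3 →₀ ℕ) → Prop} {f : PS k}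
    (hf : f ∈ suppIn D) (h : ∀ d, D d → L (monomial d 1) ∈ suppIn U) : L f ∈ suppIn U := by
  intro n hn
  obtain ⟨M, hM⟩ := hL (deg n + 1)
  obtain ⟨s, hs, hsne⟩ := exists_trunc f M
  have h1 : coeff n (L f) = coeff n (L (∑ d ∈ s, monomial d (coeff d f))) := by
    rw [← sub_eq_zero, ← map_sub, ← map_sub]
    exact coeff_eq_zero_of_mem_mm_pow (hM _ hs) (Nat.lt_succ_self _)
  have h2 : L (∑ d ∈ s, monomial d (coeff d f)) ∈ suppIn U := by
    rw [map_sum]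
    refine Submodule.sum_mem _ fun d hd => ?_
    have : (monomial d (coeff d f) : PS k) = coeff d f • monomial d 1 := by
      rw [← map_smul, smul_eq_mul, mul_one]
    rw [this, map_smul]
    exact Submodule.smul_mem _ _ (h d (hf d (hsne d hd)))
  rw [h1] at hn
  exact h2 n hn

theorem Cont.sub {L L' : PS k →ₗ[k] PS k} (h : Cont L) (h' : Cont L') : Cont (L - L') := by
  intro N
  obtain ⟨M, hM⟩ := h N
  obtain ⟨M', hM'⟩ := h' N
  exact ⟨max M M', fun f hf => Ideal.sub_mem _ (hM f (Ideal.pow_le_pow_right (le_max_left _ _) hf))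
    (hM' f (Ideal.pow_le_pow_right (le_max_right _ _) hf))⟩

theorem Cont.add {L L' : PS k →ₗ[k] PS k} (h : Cont L) (h' : Cont L') : Cont (L + L') := by
  intro N
  obtain ⟨M, hM⟩ := h N
  obtain ⟨M', hM'⟩ := h' N
  exact ⟨max M M', fun f hf => Ideal.add_mem _ (hM f (Ideal.pow_le_pow_right (le_max_left _ _) hf))
    (hM' f (Ideal.pow_le_pow_right (le_max_right _ _) hf))⟩

theorem Cont.comp {L L' : PS k →ₗ[k] PS k} (h : Cont L) (h' : Cont L') : Cont (L ∘ₗ L') := by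
  intro N
  obtain ⟨M, hM⟩ := h N
  obtain ⟨M', hM'⟩ := h' M
  exact ⟨M', fun f hf => hM _ (hM' f hf)⟩

theorem cont_zero : Cont (0 : PS k →ₗ[k] PS k) := fun _ => ⟨0, fun _ _ => by simp⟩

theorem cont_mulLeft (g : PS k) : Cont (LinearMap.mulLeft k g) :=
  fun N => ⟨N, fun _ hf => Ideal.mul_mem_left _ _ hf⟩

theorem cont_sum {ι : Type*} (s : Finset ι) (L : ι → PS k →ₗ[k] PS k) (h : ∀ i ∈ s, Cont (L i)) :
    Cont (∑ i ∈ s, L i) := by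
  classical
  induction s using Finset.induction_on with
  | empty => simpa using cont_zero
  | insert a s ha ih =>
    rw [Finset.sum_insert ha]
    exact (h a (Finset.mem_insert_self _ _)).add (ih fun i hi => h i (Finset.mem_insert_of_mem hi))

theorem Cont.ext {L L' : PS k →ₗ[k] PS k} (h : Cont L) (h' : Cont L')
    (heq : ∀ d, L (monomial d 1) = L' (monomial d 1)) : L = L' := by
  ext1 f
  have := (h.sub h').mem_suppIn (D := fun _ => True) (U := fun _ => False) (f := f) (fun _ _ => trivial)
    (fun d _ => by simp [heq])
  rw [← sub_eq_zero]
  ext n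
  by_contra hne
  exact this n hne

/-- If the constant terms differed, `f` minus the constant term of `θ f` would be a unit with
non-invertible image. Hence every `k`-algebra endomorphism is local, and so continuous, without
further assumption. -/
theorem constantCoeff_algHom (θ : PS k →ₐ[k] PS k) (f : PS k) :
    constantCoeff (θ f) = constantCoeff f := by
  have hC : ∀ c : k, θ (C c) = C c := fun c => θ.commutes c
  by_contra hne
  have h1 : IsUnit (f - C (constantCoeff (θ f))) := by
    rw [MvPowerSeries.isUnit_iff_constantCoeff, isUnit_iff_ne_zero]
    simpa [sub_eq_zero] using fun h => hne (h.symm)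
  have h2 := h1.map θ
  rw [MvPowerSeries.isUnit_iff_constantCoeff, map_sub, hC] at h2
  simp at h2

theorem algHom_mem_mm (θ : PS k →ₐ[k] PS k) {f : PS k} (hf : f ∈ mm k) : θ f ∈ mm k := by
  rw [mem_mm] at hf ⊢
  rw [constantCoeff_algHom, hf]

theorem map_mm_le (θ : PS k →ₐ[k] PS k) (n : ℕ) : (mm k ^ n).map θ.toRingHom ≤ mm k ^ n := by
  rw [Ideal.map_pow]
  exact Ideal.pow_right_mono (Ideal.map_le_iff_le_comap.2 fun f hf =>
    Ideal.mem_comap.2 (algHom_mem_mm θ hf)) n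

theorem algHom_mem_mm_pow (θ : PS k →ₐ[k] PS k) {f : PS k} {n : ℕ} (hf : f ∈ mm k ^ n) :
    θ f ∈ mm k ^ n := map_mm_le θ n (Ideal.mem_map_of_mem θ.toRingHom hf)

theorem cont_algHom (θ : PS k →ₐ[k] PS k) : Cont θ.toLinearMap :=
  fun N => ⟨N, fun _ hf => algHom_mem_mm_pow θ hf⟩

theorem monomial_eq (d : Fin 3 →₀ ℕ) :
    (monomial d 1 : PS k) = X 0 ^ d 0 * X 1 ^ d 1 * X 2 ^ d 2 := by
  rw [X_pow_eq, X_pow_eq, X_pow_eq, monomial_mul_monomial, monomial_mul_monomial]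
  have : d = Finsupp.single 0 (d 0) + Finsupp.single 1 (d 1) + Finsupp.single 2 (d 2) := by
    refine exp_ext ?_ ?_ ?_ <;> simp
  rw [← this, one_mul, one_mul]

theorem algHom_monomial (θ : PS k →ₐ[k] PS k) (d : Fin 3 →₀ ℕ) :
    θ (monomial d 1) = θ (X 0) ^ d 0 * θ (X 1) ^ d 1 * θ (X 2) ^ d 2 := by
  rw [monomial_eq]; simp

theorem algHom_ext {θ θ' : PS k →ₐ[k] PS k} (h : ∀ i, θ (X i) = θ' (X i)) : θ = θ' := by
  have := (cont_algHom θ).ext (cont_algHom θ') (fun d => by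
    simp only [AlgHom.toLinearMap_apply, algHom_monomial, h])
  ext1 f
  exact congrArg (fun L => L f) this

theorem algHom_mem_suppIn (θ : PS k →ₐ[k] PS k) {D U : (Fin 3 →₀ ℕ) → Prop} {f : PS k}
    (hf : f ∈ suppIn D) (h : ∀ d, D d → θ (monomial d 1) ∈ suppIn U) : θ f ∈ suppIn U :=
  (cont_algHom θ).mem_suppIn hf h

theorem algHom_mem_wIdeal (θ : PS k →ₐ[k] PS k) {w v : Fin 3 → ℕ} {N : ℕ} {f : PS k}
    (h : ∀ i, θ (X i) ∈ wIdeal w (v i)) (hf : f ∈ wIdeal v N) : θ f ∈ wIdeal w N := by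
  refine algHom_mem_suppIn θ (U := fun n => N ≤ wt w n) (mem_wIdeal_iff.1 hf) fun d hd => ?_
  rw [← mem_wIdeal_iff]
  rw [algHom_monomial]
  have := mul_mem_wIdeal (mul_mem_wIdeal (pow_mem_wIdeal (h 0) (d 0)) (pow_mem_wIdeal (h 1) (d 1)))
    (pow_mem_wIdeal (h 2) (d 2))
  refine wIdeal_anti w ?_ this
  simp only [wt] at hd
  linarith [mul_comm (v 0) (d 0), mul_comm (v 1) (d 1), mul_comm (v 2) (d 2)]

/-- The endomorphism of `k[[x, y, z]]` with prescribed values on the variables. -/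
theorem exists_algHom (a : Fin 3 → PS k) (h : ∀ i, a i ∈ mm k) :
    ∃ θ : PS k →ₐ[k] PS k, ∀ i, θ (X i) = a i := by
  have ha : HasSubst a := hasSubst_of_constantCoeff_zero fun i => mem_mm.1 (h i)
  exact ⟨substAlgHom ha, fun i => substAlgHom_X ha i⟩

/-- Substitution of power series for the variables. -/
def sub3 (a : Fin 3 → PS k) (h : ∀ i, a i ∈ mm k) : PS k →ₐ[k] PS k := (exists_algHom a h).choose

@[simp] theorem sub3_X (a : Fin 3 → PS k) (h : ∀ i, a i ∈ mm k) (i : Fin 3) :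
    sub3 a h (X i) = a i := (exists_algHom a h).choose_spec i

theorem algHom_eq_self (θ : PS k →ₐ[k] PS k) (h0 : θ (X 0) = X 0) (h1 : θ (X 1) = X 1) {f : PS k}
    (hf : f ∈ suppIn fun n => n 2 = 0) : θ f = f := by
  have := ((cont_algHom θ).sub (cont_algHom (AlgHom.id k _))).mem_suppIn hf (U := fun _ => False)
    (fun d hd => by
      simp only [LinearMap.sub_apply, AlgHom.toLinearMap_apply, algHom_monomial, AlgHom.id_apply]
      rw [monomial_eq]
      simp [hd, h0, h1])
  rw [← sub_eq_zero]
  ext n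
  by_contra hne
  exact this n hne

section Frobenius
variable (p : ℕ) [Fact p.Prime] [CharP k p]

theorem pNZ (e : ℕ) : p ^ e ≠ 0 := pow_ne_zero e (Fact.out : p.Prime).ne_zero

theorem coeff_pow_q_smul (e : ℕ) (f : PS k) (n : Fin 3 →₀ ℕ) :
    coeff (p ^ e • n) (f ^ p ^ e) = coeff n f ^ p ^ e := by
  rw [← map_iterateFrobenius_expand p (Fact.out : p.Prime).ne_zero f e, coeff_map,
    coeff_expand_smul, iterateFrobenius_def]

theorem coeff_pow_q_of_not_dvd (e : ℕ) (f : PS k) {n : Fin 3 →₀ ℕ} {i : Fin 3}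
    (h : ¬ p ^ e ∣ n i) : coeff n (f ^ p ^ e) = 0 := by
  rw [← map_iterateFrobenius_expand p (Fact.out : p.Prime).ne_zero f e, coeff_map,
    coeff_expand_of_not_dvd _ _ _ h, map_zero]

theorem exists_smul_of_dvd {q : ℕ} {n : Fin 3 →₀ ℕ} (h : ∀ i, q ∣ n i) :
    ∃ m : Fin 3 →₀ ℕ, n = q • m := by
  refine ⟨n.mapRange (fun a => a / q) (by simp), ?_⟩
  ext i
  simp [Nat.mul_div_cancel' (h i)]

instance charP_PS : CharP (PS k) p := charP_of_injective_algebraMap (algebraMap k (PS k)).injective p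

theorem add_pow_q (e : ℕ) (f g : PS k) : (f + g) ^ p ^ e = f ^ p ^ e + g ^ p ^ e :=
  add_pow_char_pow f g p e

theorem sub_pow_q (e : ℕ) (f g : PS k) : (f - g) ^ p ^ e = f ^ p ^ e - g ^ p ^ e :=
  sub_pow_char_pow f g e

/-- A power series all of whose exponents are divisible by `q` is a `q`-th power. -/
theorem exists_pow_q_eq [IsAlgClosed k] (e : ℕ) (f : PS k)
    (h : ∀ n, coeff n f ≠ 0 → ∀ i, p ^ e ∣ n i) : ∃ w : PS k, w ^ p ^ e = f := by
  have hr : ∀ c : k, ∃ r : k, r ^ p ^ e = c := fun c =>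
    IsAlgClosed.exists_pow_nat_eq c (Nat.pos_of_ne_zero (pNZ p e))
  choose r hr using hr
  refine ⟨mkPS fun n => r (coeff (p ^ e • n) f), ?_⟩
  ext n
  by_cases hn : ∀ i, p ^ e ∣ n i
  · obtain ⟨m, rfl⟩ := exists_smul_of_dvd hn
    rw [coeff_pow_q_smul]
    exact hr _
  · push Not at hn
    obtain ⟨i, hi⟩ := hn
    rw [coeff_pow_q_of_not_dvd p e _ hi]
    by_contra hne
    exact hi (h n (Ne.symm hne) i)

end Frobenius

end Basics

/-! ### Differential operators and their effect on orders. -/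

section DiffOps
variable {k : Type u} [Field k] {A : Type v} [CommRing A] [Algebra k A]

theorem isDiffOp_zero (n : ℕ) : IsDiffOp k n (0 : A →ₗ[k] A) := by
  induction n with
  | zero => intro b c; simp
  | succ n ih => intro b; simpa using ih

theorem IsDiffOp.add {n : ℕ} {δ ε : A →ₗ[k] A} (h : IsDiffOp k n δ) (h' : IsDiffOp k n ε) :
    IsDiffOp k n (δ + ε) := by
  induction n generalizing δ ε with
  | zero => intro b c; simp [h b c, h' b c, mul_add]
  | succ n ih =>
    intro b
    convert ih (h b) (h' b) using 1
    ext c; simp; ring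

theorem isDiffOp_sum {ι : Type*} {n : ℕ} (s : Finset ι) (δ : ι → A →ₗ[k] A)
    (h : ∀ i ∈ s, IsDiffOp k n (δ i)) : IsDiffOp k n (∑ i ∈ s, δ i) := by
  classical
  induction s using Finset.induction_on with
  | empty => simpa using isDiffOp_zero n
  | insert a s ha ih =>
    rw [Finset.sum_insert ha]
    exact (h a (Finset.mem_insert_self _ _)).add (ih fun i hi => h i (Finset.mem_insert_of_mem hi))

theorem IsDiffOp.mulLeft {n : ℕ} {δ : A →ₗ[k] A} (h : IsDiffOp k n δ) (a : A) :
    IsDiffOp k n (LinearMap.mulLeft k a ∘ₗ δ) := by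
  induction n generalizing δ with
  | zero => intro b c; simp [h b c]; ring
  | succ n ih =>
    intro b
    convert ih (h b) using 1
    ext c; simp; ring

theorem IsDiffOp.succ {n : ℕ} {δ : A →ₗ[k] A} (h : IsDiffOp k n δ) : IsDiffOp k (n + 1) δ := by
  induction n generalizing δ with
  | zero =>
    intro b
    convert isDiffOp_zero (k := k) (A := A) 0 using 1
    ext c; simp [h b c]
  | succ n ih => intro b; exact ih (h b)

theorem IsDiffOp.mono {m n : ℕ} {δ : A →ₗ[k] A} (h : IsDiffOp k m δ) (hmn : m ≤ n) :
    IsDiffOp k n δ := by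
  induction hmn with
  | refl => exact h
  | step _ ih => exact ih.succ

/-- The commutator of a composite with `b` is `δ[ε, b] + [δ, b]ε`, in each term of which one factor
has lost a degree; hence a double induction. -/
theorem IsDiffOp.comp {m n : ℕ} {δ ε : A →ₗ[k] A} (h : IsDiffOp k m δ) (h' : IsDiffOp k n ε) :
    IsDiffOp k (m + n) (δ ∘ₗ ε) := by
  induction m generalizing n δ ε with
  | zero =>
    induction n generalizing ε with
    | zero => intro b c; simp [h' b c, h b]
    | succ n ih =>
      intro b
      have h2 : (δ ∘ₗ ε) ∘ₗ LinearMap.mulLeft k b - LinearMap.mulLeft k b ∘ₗ (δ ∘ₗ ε) =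
          δ ∘ₗ (ε ∘ₗ LinearMap.mulLeft k b - LinearMap.mulLeft k b ∘ₗ ε) := by
        ext c; simp [h b]
      rw [h2]
      exact ih (h' b)
  | succ m ih =>
    induction n generalizing ε with
    | zero =>
      intro b
      have h2 : (δ ∘ₗ ε) ∘ₗ LinearMap.mulLeft k b - LinearMap.mulLeft k b ∘ₗ (δ ∘ₗ ε) =
          (δ ∘ₗ LinearMap.mulLeft k b - LinearMap.mulLeft k b ∘ₗ δ) ∘ₗ ε := by
        ext c; simp [h' b c]
      rw [h2]
      exact ih (h b) h'
    | succ n ih' =>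
      have key : ∀ b, (δ ∘ₗ ε) ∘ₗ LinearMap.mulLeft k b - LinearMap.mulLeft k b ∘ₗ (δ ∘ₗ ε) =
          δ ∘ₗ (ε ∘ₗ LinearMap.mulLeft k b - LinearMap.mulLeft k b ∘ₗ ε) +
          (δ ∘ₗ LinearMap.mulLeft k b - LinearMap.mulLeft k b ∘ₗ δ) ∘ₗ ε := by
        intro b; ext c; simp
      intro b
      rw [key]
      refine IsDiffOp.add (ih' (h' b)) ?_
      have := ih (h b) h'
      exact this.mono (le_of_eq (by simp; ring))

/-- In a product `b g` with `b ∈ I`, moving `δ` past `b` either keeps the factor `b` in front or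
replaces `δ` by an operator of smaller degree. -/
theorem IsDiffOp.mem_pow {n : ℕ} {δ : A →ₗ[k] A} (h : IsDiffOp k n δ) (I : Ideal A) {a : ℕ} {f : A}
    (hf : f ∈ I ^ a) : δ f ∈ I ^ (a - n) := by
  induction n generalizing δ a f with
  | zero =>
    have := h f 1
    rw [mul_one] at this
    rw [this]
    exact Ideal.mul_mem_right _ _ hf
  | succ n ih =>
    induction a generalizing f with
    | zero => simp
    | succ a iha =>
      rw [pow_succ'] at hf
      refine Submodule.mul_induction_on hf (fun b hb g hg => ?_) (fun x y hx hy => ?_)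
      · have h1 : δ (b * g) = b * δ g +
            (δ ∘ₗ LinearMap.mulLeft k b - LinearMap.mulLeft k b ∘ₗ δ) g := by simp
        rw [h1]
        refine Ideal.add_mem _ ?_ ?_
        · have := Ideal.mul_mem_mul hb (iha hg)
          rw [← pow_succ'] at this
          exact Ideal.pow_le_pow_right (by omega) this
        · have := ih (h b) hg
          exact Ideal.pow_le_pow_right (by omega) this
      · rw [map_add]; exact Ideal.add_mem _ hx hy

/-- Differential operators lower the order along a prime by at most their degree. -/
theorem IsDiffOp.mem_symbolic {n : ℕ} {δ : A →ₗ[k] A} (h : IsDiffOp k n δ) (Q : Ideal A)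
    [Q.IsPrime] {a : ℕ} {f : A} (hf : ∃ s ∉ Q, s * f ∈ Q ^ a) : ∃ s ∉ Q, s * δ f ∈ Q ^ (a - n) := by
  induction n generalizing δ with
  | zero =>
    obtain ⟨s, hs, hsf⟩ := hf
    refine ⟨s, hs, ?_⟩
    rw [← h s f]
    exact h.mem_pow Q hsf
  | succ n ih =>
    obtain ⟨s, hs, hsf⟩ := hf
    obtain ⟨s', hs', h'⟩ := ih (h s)
    -- The factor `s` clears the denominator of `f`, and `s'` that of the commutator `[δ, s] f`,
    -- which has smaller degree.
    refine ⟨s' * s, fun hmem => (Ideal.IsPrime.mem_or_mem ‹_› hmem).elim hs' hs, ?_⟩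
    have h1 : s' * s * δ f = s' * δ (s * f) -
        s' * (δ ∘ₗ LinearMap.mulLeft k s - LinearMap.mulLeft k s ∘ₗ δ) f := by
      simp; ring
    rw [h1]
    exact Ideal.sub_mem _ (Ideal.mul_mem_left _ _ (h.mem_pow Q hsf))
      (Ideal.pow_le_pow_right (by omega) h')

end DiffOps

/-! ### Hasse derivatives: Leibniz rule, degree, chain rule. -/

section Hasse
variable {k : Type u} [Field k]

/-- The Hasse derivative of order `n` with respect to the variable `X i`. -/
def hasse (i : Fin 3) (n : ℕ) : PS k →ₗ[k] PS k where
  toFun f := mkPS fun m => ((m i + n).choose n : k) * coeff (m + Finsupp.single i n) f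
  map_add' f g := by ext m; simp [mul_add]
  map_smul' c f := by ext m; simp; ring

@[simp] theorem coeff_hasse (i : Fin 3) (n : ℕ) (f : PS k) (m : Fin 3 →₀ ℕ) :
    coeff m (hasse i n f) = ((m i + n).choose n : k) * coeff (m + Finsupp.single i n) f := rfl

theorem hasse_zero (i : Fin 3) : hasse (k := k) i 0 = LinearMap.id := by
  ext f m; simp

theorem hasse_monomial (i : Fin 3) (n : ℕ) (d : Fin 3 →₀ ℕ) (c : k) :
    hasse i n (monomial d c) = monomial (d - Finsupp.single i n) (((d i).choose n : k) * c) := by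
  classical
  ext m
  rw [coeff_hasse, coeff_monomial, coeff_monomial]
  by_cases h : n ≤ d i
  · have h1 : m + Finsupp.single i n = d ↔ m = d - Finsupp.single i n := by
      constructor
      · rintro rfl; simp
      · rintro rfl
        exact tsub_add_cancel_of_le (by rwa [Finsupp.single_le_iff])
    by_cases h2 : m = d - Finsupp.single i n
    · rw [if_pos (h1.2 h2), if_pos h2, ← h1.2 h2]
      simp
    · rw [if_neg (fun h' => h2 (h1.1 h')), if_neg h2, mul_zero]
  · rw [Nat.choose_eq_zero_of_lt (not_le.1 h), if_neg, mul_zero]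
    · simp
    · rintro rfl
      simp at h

theorem deg_add (m n : Fin 3 →₀ ℕ) : deg (m + n) = deg m + deg n := by simp [deg]; ring

theorem deg_single (i : Fin 3) (n : ℕ) : deg (Finsupp.single i n) = n := by
  fin_cases i <;> simp [deg]

theorem hasse_mem_mm_pow (i : Fin 3) (n : ℕ) {f : PS k} {N : ℕ} (hf : f ∈ mm k ^ N) :
    hasse i n f ∈ mm k ^ (N - n) := by
  rw [mem_mm_pow] at hf ⊢
  intro m hm
  rw [coeff_hasse] at hm
  have := hf _ (right_ne_zero_of_mul hm)
  rw [deg_add, deg_single] at this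
  omega

theorem cont_hasse (i : Fin 3) (n : ℕ) : Cont (hasse (k := k) i n) := fun N =>
  ⟨N + n, fun f hf => by simpa using hasse_mem_mm_pow i n hf⟩

/-- The identity of binomial coefficients behind it is Vandermonde's. -/
theorem hasse_monomial_mul_monomial (i : Fin 3) (n : ℕ) (a b : Fin 3 →₀ ℕ) :
    hasse i n ((monomial a 1 : PS k) * monomial b 1) =
      ∑ c ∈ Finset.HasAntidiagonal.antidiagonal n, hasse i c.1 (monomial a 1) * hasse i c.2 (monomial b 1) := by
  have hterm : ∀ c ∈ Finset.HasAntidiagonal.antidiagonal n,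
      hasse i c.1 (monomial a 1 : PS k) * hasse i c.2 (monomial b 1) =
        monomial (a + b - Finsupp.single i n) (((a i).choose c.1 * (b i).choose c.2 : ℕ) : k) := by
    intro c hc
    rw [Finset.HasAntidiagonal.mem_antidiagonal] at hc
    rw [hasse_monomial, hasse_monomial, monomial_mul_monomial]
    by_cases h1 : c.1 ≤ a i
    · by_cases h2 : c.2 ≤ b i
      · congr 1
        · congr 1
          ext j
          by_cases hj : i = j
          · subst hj; simp; omega
          · simp [Finsupp.single_eq_of_ne (Ne.symm hj)]
        · push_cast; ring
      · simp [Nat.choose_eq_zero_of_lt (not_le.1 h2)]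
    · simp [Nat.choose_eq_zero_of_lt (not_le.1 h1)]
  rw [Finset.sum_congr rfl hterm, monomial_mul_monomial, hasse_monomial, ← map_sum]
  congr 1
  rw [Finsupp.add_apply, Nat.add_choose_eq]
  push_cast
  simp

/-- Both sides are linear and continuous in each factor, so the rule extends from monomials in one
factor at a time. -/
theorem hasse_mul (i : Fin 3) (n : ℕ) (f g : PS k) :
    hasse i n (f * g) = ∑ c ∈ Finset.HasAntidiagonal.antidiagonal n, hasse i c.1 f * hasse i c.2 g := by
  have step1 : ∀ a : Fin 3 →₀ ℕ, ∀ g : PS k, hasse i n (monomial a 1 * g) =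
      ∑ c ∈ Finset.HasAntidiagonal.antidiagonal n, hasse i c.1 (monomial a 1) * hasse i c.2 g := by
    intro a g
    have : hasse (k := k) i n ∘ₗ LinearMap.mulLeft k (monomial a 1) =
        ∑ c ∈ Finset.HasAntidiagonal.antidiagonal n,
          LinearMap.mulLeft k (hasse i c.1 (monomial a 1)) ∘ₗ hasse i c.2 := by
      refine ((cont_hasse i n).comp (cont_mulLeft _)).ext
        (cont_sum _ _ fun c _ => (cont_mulLeft _).comp (cont_hasse i c.2)) fun b => ?_
      simp [LinearMap.sum_apply, hasse_monomial_mul_monomial]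
    simpa [LinearMap.sum_apply] using congrArg (fun L => L g) this
  have : hasse (k := k) i n ∘ₗ LinearMap.mulLeft k g =
      ∑ c ∈ Finset.HasAntidiagonal.antidiagonal n, LinearMap.mulLeft k (hasse i c.2 g) ∘ₗ hasse i c.1 := by
    refine ((cont_hasse i n).comp (cont_mulLeft _)).ext
      (cont_sum _ _ fun c _ => (cont_mulLeft _).comp (cont_hasse i c.1)) fun b => ?_
    simp only [LinearMap.comp_apply, LinearMap.mulLeft_apply, LinearMap.sum_apply]
    rw [mul_comm, step1]
    exact Finset.sum_congr rfl fun c _ => mul_comm _ _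
  have := congrArg (fun L => L f) this
  simp only [LinearMap.comp_apply, LinearMap.mulLeft_apply, LinearMap.sum_apply] at this
  rw [mul_comm, this]
  exact Finset.sum_congr rfl fun c _ => mul_comm _ _

/-- By the Leibniz rule the commutator with `b` is a combination of Hasse derivatives of strictly
smaller order. -/
theorem isDiffOp_hasse (i : Fin 3) (n : ℕ) : IsDiffOp k n (hasse (k := k) i n) := by
  induction n using Nat.strong_induction_on with
  | _ n ih =>
    cases n with
    | zero => intro b c; simp [hasse_zero]
    | succ n =>
      intro b
      have : hasse i (n + 1) ∘ₗ LinearMap.mulLeft k b - LinearMap.mulLeft k b ∘ₗ hasse i (n + 1) =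
          ∑ c ∈ (Finset.HasAntidiagonal.antidiagonal (n + 1)).erase (0, n + 1),
            LinearMap.mulLeft k (hasse i c.1 b) ∘ₗ hasse i c.2 := by
        ext1 f
        simp only [LinearMap.sub_apply, LinearMap.comp_apply, LinearMap.mulLeft_apply,
          LinearMap.sum_apply]
        rw [hasse_mul, ← Finset.add_sum_erase (a := (0, n + 1)) _ _ (by simp)]
        simp [hasse_zero]
      rw [this]
      refine isDiffOp_sum _ _ fun c hc => ?_
      rw [Finset.mem_erase, Finset.HasAntidiagonal.mem_antidiagonal] at hc
      have hlt : c.2 < n + 1 := by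
        by_contra hge
        exact hc.1 (Prod.ext (by omega) (by omega))
      exact ((ih c.2 hlt).mulLeft _).mono (by omega)

theorem hasse_of_suppIn {f : PS k} (hf : f ∈ suppIn fun n => n 2 = 0) {n : ℕ} (hn : n ≠ 0) :
    hasse 2 n f = 0 := by
  ext m
  rw [coeff_hasse]
  by_contra hne
  have := hf _ (right_ne_zero_of_mul hne)
  simp at this
  exact hn this.2

theorem hasse_mul_of_suppIn {f : PS k} (hf : f ∈ suppIn fun n => n 2 = 0) (n : ℕ) (g : PS k) :
    hasse 2 n (f * g) = f * hasse 2 n g := by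
  rw [hasse_mul, ← Finset.add_sum_erase (a := (0, n)) _ _ (by simp), Finset.sum_eq_zero]
  · simp [hasse_zero]
  · intro c hc
    rw [Finset.mem_erase, Finset.HasAntidiagonal.mem_antidiagonal] at hc
    rw [hasse_of_suppIn hf, zero_mul]
    rintro h
    exact hc.1 (Prod.ext h (by omega))

theorem one_mem_suppIn : (1 : PS k) ∈ suppIn fun n => n 2 = 0 :=
  monomial_mem_suppIn (U := fun n => n 2 = 0) (n := 0) rfl 1

theorem mul_mem_suppInZ {f g : PS k} (hf : f ∈ suppIn fun n => n 2 = 0)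
    (hg : g ∈ suppIn fun n => n 2 = 0) : f * g ∈ suppIn fun n => n 2 = 0 :=
  mul_mem_suppIn hf hg fun a ha b hb => by simp [ha, hb]

theorem pow_mem_suppInZ {f : PS k} (hf : f ∈ suppIn fun n => n 2 = 0) (n : ℕ) :
    f ^ n ∈ suppIn fun n => n 2 = 0 := by
  induction n with
  | zero => exact one_mem_suppIn
  | succ n ih => rw [pow_succ]; exact mul_mem_suppInZ ih hf

theorem hasse_X (n : ℕ) : hasse 2 n (X 2 : PS k) = if n = 0 then X 2 else if n = 1 then 1 else 0 := by
  rw [X, hasse_monomial]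
  rcases n with _ | _ | n
  · simp
  · simp
  · simp [Nat.choose_eq_zero_of_lt]

theorem hasse_linear_mul {r w : PS k} (hr : r ∈ suppIn fun n => n 2 = 0)
    (hw : w ∈ suppIn fun n => n 2 = 0) (n : ℕ) (g : PS k) :
    hasse 2 (n + 1) ((r * X 2 + w) * g) = (r * X 2 + w) * hasse 2 (n + 1) g + r * hasse 2 n g := by
  have h0 : ∀ m, hasse 2 (m + 2) (r * X 2 + w) = 0 := by
    intro m
    rw [map_add, hasse_mul_of_suppIn hr, hasse_of_suppIn hw (by omega), hasse_X]
    simp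
  have h1 : hasse 2 1 (r * X 2 + w) = r := by
    rw [map_add, hasse_mul_of_suppIn hr, hasse_of_suppIn hw (by omega), hasse_X]
    simp
  rw [hasse_mul, Finset.Nat.sum_antidiagonal_succ, hasse_zero, LinearMap.id_apply]
  congr 1
  cases n with
  | zero => simp [-map_add, h1, hasse_zero]
  | succ n =>
    rw [Finset.Nat.sum_antidiagonal_succ, zero_add, h1, Finset.sum_eq_zero, add_zero]
    intro c _
    rw [h0, zero_mul]

theorem hasse_linear_pow {r w : PS k} (hr : r ∈ suppIn fun n => n 2 = 0)
    (hw : w ∈ suppIn fun n => n 2 = 0) (n c : ℕ) :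
    hasse 2 n ((r * X 2 + w) ^ c) = (c.choose n : PS k) * r ^ n * (r * X 2 + w) ^ (c - n) := by
  induction c generalizing n with
  | zero =>
    cases n with
    | zero => simp [hasse_zero]
    | succ n =>
      rw [pow_zero, hasse_of_suppIn one_mem_suppIn (by omega)]
      simp
  | succ c ih =>
    cases n with
    | zero => simp [hasse_zero]
    | succ n =>
      rw [pow_succ', hasse_linear_mul hr hw, ih, ih, Nat.choose_succ_succ]
      rcases lt_or_ge n c with h | h
      · rw [show c + 1 - (n + 1) = c - (n + 1) + 1 by omega,
          show c - n = c - (n + 1) + 1 by omega]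
        push_cast
        ring
      · rw [Nat.choose_eq_zero_of_lt (show c < n + 1 by omega),
          show c + 1 - (n + 1) = c - n by omega]
        push_cast
        ring

/-- The chain rule for Hasse derivatives with respect to `z`. -/
theorem hasse_algHom (θ : PS k →ₐ[k] PS k) {r w : PS k} (hr : r ∈ suppIn fun n => n 2 = 0)
    (hw : w ∈ suppIn fun n => n 2 = 0) (h0 : θ (X 0) ∈ suppIn fun n => n 2 = 0)
    (h1 : θ (X 1) ∈ suppIn fun n => n 2 = 0) (h2 : θ (X 2) = r * X 2 + w) (n : ℕ) (f : PS k) :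
    hasse 2 n (θ f) = r ^ n * θ (hasse 2 n f) := by
  have : hasse 2 n ∘ₗ θ.toLinearMap =
      LinearMap.mulLeft k (r ^ n) ∘ₗ θ.toLinearMap ∘ₗ hasse 2 n := by
    refine ((cont_hasse 2 n).comp (cont_algHom θ)).ext
      ((cont_mulLeft _).comp ((cont_algHom θ).comp (cont_hasse 2 n))) fun d => ?_
    simp only [LinearMap.comp_apply, AlgHom.toLinearMap_apply, LinearMap.mulLeft_apply]
    have hmon : (monomial (d - Finsupp.single 2 n) (((d 2).choose n : k) * 1) : PS k) =
        ((d 2).choose n : k) • monomial (d - Finsupp.single 2 n) 1 := by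
      rw [← map_smul, smul_eq_mul]
    rw [hasse_monomial, hmon, map_smul, algHom_monomial, algHom_monomial, h2,
      hasse_mul_of_suppIn (mul_mem_suppInZ (pow_mem_suppInZ h0 _) (pow_mem_suppInZ h1 _)),
      hasse_linear_pow hr hw]
    simp [Algebra.smul_def]
    ring
  exact congrArg (fun L => L f) this

end Hasse

/-- By Lucas the binomial coefficient is, modulo `p`, the digit of `d` at `p ^ n`. It tells which
Hasse derivative detects an exponent that is not sufficiently divisible by `p`. -/
theorem not_dvd_choose_prime_pow {p : ℕ} [Fact p.Prime] {n d : ℕ} (h : p ^ n ∣ d)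
    (h' : ¬ p ^ (n + 1) ∣ d) : ¬ p ∣ d.choose (p ^ n) := by
  induction n generalizing d with
  | zero => simpa using h'
  | succ n ih =>
    obtain ⟨c, rfl⟩ : p ∣ d := (dvd_pow_self p (Nat.succ_ne_zero n)).trans h
    have hp : 0 < p := (Fact.out : p.Prime).pos
    have h1 : p ^ n ∣ c := by
      rw [pow_succ'] at h
      exact Nat.dvd_of_mul_dvd_mul_left hp h
    have h2 : ¬ p ^ (n + 1) ∣ c := by
      intro hc
      apply h'
      rw [pow_succ']
      exact Nat.mul_dvd_mul_left p hc
    have h3 := Choose.choose_modEq_choose_mod_mul_choose_div_nat (n := p * c) (k := p ^ (n + 1)) (p := p)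
    rw [Nat.mul_mod_right, pow_succ', Nat.mul_mod_right, Nat.mul_div_cancel_left _ hp,
      Nat.mul_div_cancel_left _ hp, Nat.choose_self, one_mul] at h3
    rw [pow_succ']
    intro hd
    exact ih h1 h2 ((h3.dvd_iff dvd_rfl).1 hd)

/-! ### Identifications of the completion with `k[[x, y, z]]`. -/

section Completion
variable {k : Type u} [Field k] {A : Type v} [CommRing A] [Algebra k A]

/-- Elements of an extended ideal are approximated by elements of the ideal. -/
theorem exists_approx (ι : A →ₐ[k] PS k) (n : ℕ) (hd : ∀ f : PS k, ∃ a : A, f - ι a ∈ mm k ^ n)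
    (I : Ideal A) {f : PS k} (hf : f ∈ I.map ι.toRingHom) :
    ∃ a ∈ I, f - ι a ∈ mm k ^ n * I.map ι.toRingHom := by
  refine Submodule.span_induction (p := fun f _ => ∃ a ∈ I, f - ι a ∈ mm k ^ n * I.map ι.toRingHom)
    ?_ ?_ ?_ ?_ hf
  · rintro _ ⟨a, ha, rfl⟩
    exact ⟨a, ha, by simp⟩
  · exact ⟨0, I.zero_mem, by simp⟩
  · rintro x y _ _ ⟨a, ha, ha'⟩ ⟨b, hb, hb'⟩
    refine ⟨a + b, I.add_mem ha hb, ?_⟩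
    have : x + y - ι (a + b) = (x - ι a) + (y - ι b) := by rw [map_add]; ring
    rw [this]
    exact Ideal.add_mem _ ha' hb'
  · rintro c x _ ⟨a, ha, ha'⟩
    obtain ⟨b, hb⟩ := hd c
    refine ⟨b * a, I.mul_mem_left _ ha, ?_⟩
    have : c • x - ι (b * a) = c * (x - ι a) + (c - ι b) * ι a := by
      rw [map_mul, smul_eq_mul]; ring
    rw [this]
    exact Ideal.add_mem _ (Ideal.mul_mem_left _ _ ha')
      (Ideal.mul_mem_mul hb (Ideal.mem_map_of_mem ι.toRingHom ha))

variable [IsLocalRing A]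

theorem IsCompletion.mem_maximalIdeal {ι : A →ₐ[k] PS k} (h : IsCompletion ι) {a : A} :
    ι a ∈ mm k ↔ a ∈ maximalIdeal A := by simpa using h.1 1 a

theorem IsCompletion.map_maximalIdeal {ι : A →ₐ[k] PS k} (h : IsCompletion ι) :
    (maximalIdeal A).map ι.toRingHom ≤ mm k :=
  Ideal.map_le_iff_le_comap.2 fun _ ha => Ideal.mem_comap.2 (h.mem_maximalIdeal.2 ha)

/-- This is Krull's intersection theorem in the local ring `A ⧸ I`. -/
theorem mem_of_forall_mem_sup [IsNoetherianRing A] (I : Ideal A) (a : A)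
    (h : ∀ n, ∃ b ∈ I, a - b ∈ maximalIdeal A ^ n) : a ∈ I := by
  by_cases hI : I = ⊤
  · rw [hI]; trivial
  have : Nontrivial (A ⧸ I) := Ideal.Quotient.nontrivial_iff.2 hI
  have : IsLocalRing (A ⧸ I) :=
    IsLocalRing.of_surjective' (Ideal.Quotient.mk I) Ideal.Quotient.mk_surjective
  have hle : (maximalIdeal A).map (Ideal.Quotient.mk I) ≠ ⊤ := by
    intro htop
    have h1 : (maximalIdeal A).map (Ideal.Quotient.mk I) ≤ maximalIdeal (A ⧸ I) := by
      rw [Ideal.map_le_iff_le_comap]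
      have := IsLocalRing.of_surjective' (Ideal.Quotient.mk I) Ideal.Quotient.mk_surjective
      have : ((maximalIdeal (A ⧸ I)).comap (Ideal.Quotient.mk I)) ≤ maximalIdeal A :=
        IsLocalRing.le_maximalIdeal (Ideal.comap_ne_top _ (maximalIdeal.isMaximal _).ne_top)
      have hmax : ((maximalIdeal (A ⧸ I)).comap (Ideal.Quotient.mk I)).IsMaximal :=
        Ideal.comap_isMaximal_of_surjective _ Ideal.Quotient.mk_surjective
      rw [eq_maximalIdeal hmax]
    rw [htop, top_le_iff] at h1
    exact (maximalIdeal.isMaximal _).ne_top h1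
  have := Ideal.iInf_pow_eq_bot_of_isLocalRing _ hle
  rw [← Ideal.Quotient.eq_zero_iff_mem]
  rw [← Ideal.mem_bot, ← this, Ideal.mem_iInf]
  intro n
  obtain ⟨b, hb, hab⟩ := h n
  rw [← Ideal.map_pow]
  have h2 := Ideal.mem_map_of_mem (Ideal.Quotient.mk I) hab
  rwa [map_sub, Ideal.Quotient.eq_zero_iff_mem.2 hb, sub_zero] at h2

/-- An ideal is the contraction of its extension to the completion: an element of the extension is
approximated by elements of `I`, and `I` is closed. -/
theorem IsCompletion.mem_of_mem_map [IsNoetherianRing A] {ι : A →ₐ[k] PS k} (h : IsCompletion ι)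
    {I : Ideal A} {a : A} (ha : ι a ∈ I.map ι.toRingHom) : a ∈ I := by
  refine mem_of_forall_mem_sup I a fun n => ?_
  obtain ⟨b, hb, hab⟩ := exists_approx ι n (h.2 n) I ha
  have h1 : ι (a - b) ∈ mm k ^ n := by
    rw [map_sub]
    exact Ideal.mul_le_left (I := mm k ^ n) (J := I.map ι.toRingHom) hab
  exact ⟨b, hb, (h.1 n (a - b)).1 h1⟩

theorem IsCompletion.le_of_map_le [IsNoetherianRing A] {ι : A →ₐ[k] PS k} (h : IsCompletion ι)
    {I J : Ideal A} (hIJ : I.map ι.toRingHom ≤ J.map ι.toRingHom) : I ≤ J := fun _ ha =>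
  h.mem_of_mem_map (hIJ (Ideal.mem_map_of_mem ι.toRingHom ha))

theorem IsCompletion.injective [IsNoetherianRing A] {ι : A →ₐ[k] PS k} (h : IsCompletion ι) :
    Function.Injective ι := by
  rw [injective_iff_map_eq_zero]
  intro a ha
  have : a ∈ (⊥ : Ideal A) := h.mem_of_mem_map (by rw [ha]; exact Ideal.zero_mem _)
  simpa using this

/-- The coefficient of `θ f` at `d` is read off from `ψ` at an approximation of `f` of order
exceeding `deg d`. That the choice of the approximation is irrelevant makes `θ` multiplicative and
additive. -/
theorem IsCompletion.exists_extend {ι : A →ₐ[k] PS k} (h : IsCompletion ι) (ψ : A →ₐ[k] PS k)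
    (hψ : ∀ n, ∀ a ∈ maximalIdeal A ^ n, ψ a ∈ mm k ^ n) :
    ∃ θ : PS k →ₐ[k] PS k, ∀ a, θ (ι a) = ψ a := by
  have h2 := h.2
  choose b hb using fun (f : PS k) (n : ℕ) => h2 n f
  let θ : PS k → PS k := fun f => mkPS fun d => coeff d (ψ (b f (deg d + 1)))
  have key : ∀ f n a, f - ι a ∈ mm k ^ n → θ f - ψ a ∈ mm k ^ n := by
    intro f n a hfa
    rw [mem_mm_pow]
    intro d hd
    by_contra hlt
    push Not at hlt
    apply hd
    rw [map_sub, coeff_mkPS, ← map_sub, ← map_sub]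
    refine coeff_eq_zero_of_mem_mm_pow (hψ (deg d + 1) _ ?_) (Nat.lt_succ_self _)
    rw [← h.1, map_sub]
    have := Ideal.sub_mem _ (Ideal.pow_le_pow_right hlt hfa) (hb f (deg d + 1))
    simpa using this
  have hι : ∀ a, θ (ι a) = ψ a := fun a => eq_of_forall_sub_mem fun n => key _ n a (by simp)
  refine ⟨⟨⟨⟨⟨θ, ?_⟩, ?_⟩, ?_, ?_⟩, ?_⟩, hι⟩
  · have := hι 1
    rwa [map_one, map_one] at this
  · intro f g
    refine eq_of_forall_sub_mem fun n => ?_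
    have h1 := key f n _ (hb f n)
    have h2 := key g n _ (hb g n)
    have h3 := key (f * g) n (b f n * b g n) (by
      have : f * g - ι (b f n * b g n) = f * (g - ι (b g n)) + (f - ι (b f n)) * ι (b g n) := by
        rw [map_mul]; ring
      rw [this]
      exact Ideal.add_mem _ (Ideal.mul_mem_left _ _ (hb g n)) (Ideal.mul_mem_right _ _ (hb f n)))
    have : θ (f * g) - θ f * θ g = (θ (f * g) - ψ (b f n * b g n)) - θ f * (θ g - ψ (b g n))
        - (θ f - ψ (b f n)) * ψ (b g n) := by
      rw [map_mul]; ring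
    simp only
    rw [this]
    exact Ideal.sub_mem _ (Ideal.sub_mem _ h3 (Ideal.mul_mem_left _ _ h2))
      (Ideal.mul_mem_right _ _ h1)
  · simpa using hι 0
  · intro f g
    refine eq_of_forall_sub_mem fun n => ?_
    have h1 := key f n _ (hb f n)
    have h2 := key g n _ (hb g n)
    have h3 := key (f + g) n (b f n + b g n) (by
      have : f + g - ι (b f n + b g n) = (f - ι (b f n)) + (g - ι (b g n)) := by
        rw [map_add]; ring
      rw [this]
      exact Ideal.add_mem _ (hb f n) (hb g n))
    have : θ (f + g) - (θ f + θ g) = (θ (f + g) - ψ (b f n + b g n)) - (θ f - ψ (b f n))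
        - (θ g - ψ (b g n)) := by
      rw [map_add]; ring
    simp only
    rw [this]
    exact Ideal.sub_mem _ (Ideal.sub_mem _ h3 h1) h2
  · intro c
    have := hι (algebraMap k A c)
    rw [ι.commutes, ψ.commutes] at this
    exact this

theorem IsCompletion.algHom_ext {ι : A →ₐ[k] PS k} (h : IsCompletion ι) {θ θ' : PS k →ₐ[k] PS k}
    (heq : ∀ a, θ (ι a) = θ' (ι a)) : θ = θ' := by
  ext1 f
  refine eq_of_forall_sub_mem fun n => ?_
  obtain ⟨a, ha⟩ := h.2 n f
  have : θ f - θ' f = θ (f - ι a) - θ' (f - ι a) := by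
    rw [map_sub, map_sub, heq]; ring
  rw [this]
  exact Ideal.sub_mem _ (algHom_mem_mm_pow θ ha) (algHom_mem_mm_pow θ' ha)

/-- Two identifications of the completion differ by an automorphism. -/
theorem IsCompletion.exists_equiv {ι ι' : A →ₐ[k] PS k} (h : IsCompletion ι)
    (h' : IsCompletion ι') : ∃ τ : PS k ≃ₐ[k] PS k, ∀ a, τ (ι a) = ι' a := by
  obtain ⟨θ, hθ⟩ := h.exists_extend ι' fun n a ha => (h'.1 n a).2 ha
  obtain ⟨θ', hθ'⟩ := h'.exists_extend ι fun n a ha => (h.1 n a).2 ha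
  refine ⟨AlgEquiv.ofAlgHom θ θ' ?_ ?_, hθ⟩
  · exact h'.algHom_ext fun a => by simp [hθ, hθ']
  · exact h.algHom_ext fun a => by simp [hθ, hθ']

theorem algEquiv_mem_mm_pow (τ : PS k ≃ₐ[k] PS k) {f : PS k} {n : ℕ} :
    τ f ∈ mm k ^ n ↔ f ∈ mm k ^ n := by
  constructor
  · intro h
    have := algHom_mem_mm_pow τ.symm.toAlgHom h
    simpa using this
  · exact fun h => algHom_mem_mm_pow τ.toAlgHom h

theorem IsCompletion.comp {ι : A →ₐ[k] PS k} (h : IsCompletion ι) (τ : PS k ≃ₐ[k] PS k) :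
    IsCompletion (τ.toAlgHom.comp ι) := by
  refine ⟨fun n a => ?_, fun n f => ?_⟩
  · rw [← h.1 n a]
    exact algEquiv_mem_mm_pow τ
  · obtain ⟨a, ha⟩ := h.2 n (τ.symm f)
    refine ⟨a, ?_⟩
    rw [← algEquiv_mem_mm_pow τ] at ha
    simpa using ha

/-- An endomorphism acting trivially on the cotangent space acts trivially on the associated graded
ring. -/
theorem algHom_sub_self_mem (θ : PS k →ₐ[k] PS k) (h : ∀ i, θ (X i) - X i ∈ mm k ^ 2) {n : ℕ}
    {f : PS k} (hf : f ∈ mm k ^ n) : θ f - f ∈ mm k ^ (n + 1) := by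
  have h0 : ∀ f, θ f - f ∈ mm k := fun f => mem_mm.2 (by simp [constantCoeff_algHom])
  have h1 : ∀ f ∈ mm k, θ f - f ∈ mm k ^ 2 := by
    intro f hf
    rw [mm_eq_varIdeal] at hf
    refine Submodule.span_induction (p := fun f _ => θ f - f ∈ mm k ^ 2) ?_ ?_ ?_ ?_ hf
    · rintro _ ⟨i, _, rfl⟩; exact h i
    · simp
    · intro x y _ _ hx hy
      have : θ (x + y) - (x + y) = (θ x - x) + (θ y - y) := by rw [map_add]; ring
      rw [this]; exact Ideal.add_mem _ hx hy
    · intro c x hx' hx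
      have hx'' : x ∈ mm k := by rw [mm_eq_varIdeal]; exact hx'
      have : θ (c • x) - c • x = θ c * (θ x - x) + (θ c - c) * x := by
        rw [smul_eq_mul, map_mul]; ring
      rw [this]
      refine Ideal.add_mem _ (Ideal.mul_mem_left _ _ hx) ?_
      rw [pow_two]
      exact Ideal.mul_mem_mul (h0 c) hx''
  induction n generalizing f with
  | zero => simpa using h0 f
  | succ n ih =>
    rw [pow_succ] at hf
    refine Submodule.mul_induction_on hf (fun g hg x hx => ?_) (fun x y hx hy => ?_)
    · have : θ (g * x) - g * x = θ x * (θ g - g) + (θ x - x) * g := by rw [map_mul]; ring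
      rw [this]
      refine Ideal.add_mem _ ?_ ?_
      · rw [pow_succ']
        exact Ideal.mul_mem_mul (algHom_mem_mm θ hx) (ih hg)
      · have := Ideal.mul_mem_mul (h1 x hx) hg
        rw [← pow_add] at this
        exact Ideal.pow_le_pow_right (by omega) this
    · have : θ (x + y) - (x + y) = (θ x - x) + (θ y - y) := by rw [map_add]; ring
      rw [this]; exact Ideal.add_mem _ hx hy

/-- A local homomorphism sending generators of the maximal ideal to coordinates identifies the
completion. -/
theorem isCompletion_of_generators (ψ : A →ₐ[k] PS k) (b : Fin 3 → A)
    (hres : ∀ c : A, ∃ r : k, c - algebraMap k A r ∈ maximalIdeal A)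
    (hb : maximalIdeal A = Ideal.span (Set.range b)) (hψ : ∀ i, ψ (b i) - X i ∈ mm k ^ 2) :
    IsCompletion ψ := by
  have hbm : ∀ i, ψ (b i) ∈ mm k := fun i => by
    have := Ideal.add_mem _ (Ideal.pow_le_self two_ne_zero (hψ i)) (X_mem_mm i)
    simpa using this
  let θ := sub3 (fun i => ψ (b i)) hbm
  have hθ : ∀ P : MvPolynomial (Fin 3) k, θ (P : PS k) = ψ (MvPolynomial.aeval b P) := by
    intro P
    have : θ.comp (MvPolynomial.coeToMvPowerSeries.algHom k) = ψ.comp (MvPolynomial.aeval b) := by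
      apply MvPolynomial.algHom_ext
      intro i
      simp [θ]
    have := congrArg (fun L => L P) this
    simpa using this
  have hθ1 : ∀ {n : ℕ} {f : PS k}, f ∈ mm k ^ n → θ f - f ∈ mm k ^ (n + 1) := fun hf =>
    algHom_sub_self_mem θ (fun i => by simpa [θ] using hψ i) hf
  have hmap : (maximalIdeal A).map ψ.toRingHom ≤ mm k := by
    rw [hb, Ideal.map_span, Ideal.span_le]
    rintro _ ⟨_, ⟨i, rfl⟩, rfl⟩
    exact hbm i
  have hmap' : ∀ n, ∀ a ∈ maximalIdeal A ^ n, ψ a ∈ mm k ^ n := by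
    intro n a ha
    have := Ideal.mem_map_of_mem ψ.toRingHom ha
    rw [Ideal.map_pow] at this
    exact Ideal.pow_right_mono hmap n this
  -- Every element of `A` of order at least `n` has an initial form which is a polynomial in the
  -- generators `b`, because the residue field is `k`.
  have hpoly : ∀ n, ∀ a ∈ maximalIdeal A ^ n, ∃ P : MvPolynomial (Fin 3) k, P.IsHomogeneous n ∧
      a - MvPolynomial.aeval b P ∈ maximalIdeal A ^ (n + 1) := by
    intro n
    induction n with
    | zero =>
      intro a _
      obtain ⟨r, hr⟩ := hres a
      exact ⟨MvPolynomial.C r, MvPolynomial.isHomogeneous_C _ _, by simpa using hr⟩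
    | succ n ih =>
      intro a ha
      rw [pow_succ'] at ha
      refine Submodule.mul_induction_on ha (fun x hx y hy => ?_) ?_
      · rw [hb] at hx
        obtain ⟨c, rfl⟩ := (Ideal.mem_span_range_iff_exists_fun).1 hx
        choose P hP hP' using fun i => ih (c i * y) (Ideal.mul_mem_left _ _ hy)
        refine ⟨∑ i, MvPolynomial.X i * P i, ?_, ?_⟩
        · refine MvPolynomial.IsHomogeneous.sum _ _ _ fun i _ => ?_
          rw [add_comm n 1]
          exact (MvPolynomial.isHomogeneous_X k i).mul (hP i)
        · rw [map_sum, Finset.sum_mul, ← Finset.sum_sub_distrib]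
          refine Ideal.sum_mem _ fun i _ => ?_
          have : c i * b i * y - MvPolynomial.aeval b (MvPolynomial.X i * P i) =
              b i * (c i * y - MvPolynomial.aeval b (P i)) := by
            rw [map_mul, MvPolynomial.aeval_X]; ring
          rw [this, pow_succ']
          refine Ideal.mul_mem_mul ?_ (hP' i)
          rw [hb]
          exact Ideal.subset_span ⟨i, rfl⟩
      · rintro x y ⟨P, hP, hP'⟩ ⟨P', h2, h2'⟩
        refine ⟨P + P', hP.add h2, ?_⟩
        have : x + y - MvPolynomial.aeval b (P + P') = (x - MvPolynomial.aeval b P) +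
            (y - MvPolynomial.aeval b P') := by rw [map_add]; ring
        rw [this]
        exact Ideal.add_mem _ hP' h2'
  refine ⟨fun n a => ⟨?_, hmap' n a⟩, ?_⟩
  · induction n with
    | zero => simp
    | succ n ih =>
      intro ha
      obtain ⟨P, hP, hP'⟩ := hpoly n a (ih (Ideal.pow_le_pow_right (Nat.le_succ n) ha))
      have h1 := hmap' _ _ hP'
      rw [map_sub, ← hθ] at h1
      have h2 : (P : PS k) ∈ mm k ^ n := by
        rw [mem_mm_pow]
        intro d hd
        rw [MvPolynomial.coeff_coe] at hd
        have := hP hd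
        rw [show (1 : Fin 3 → ℕ) = fun _ => 1 from rfl, wt_eq_weight] at this
        simp [wt, deg] at this ⊢
        omega
      have h3 := hθ1 h2
      -- Since `θ` is trivial on the graded ring, the order of `ψ a` bounds that of `P` itself; a
      -- form of degree `n` and order above `n` vanishes.
      have h4 : (P : PS k) ∈ mm k ^ (n + 1) := by
        have := Ideal.sub_mem _ (Ideal.sub_mem _ ha h1) h3
        simpa using this
      have h5 : P = 0 := by
        ext d
        by_contra hd
        have h6 := hP hd
        have h7 := mem_mm_pow.1 h4 d (by rwa [MvPolynomial.coeff_coe])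
        rw [show (1 : Fin 3 → ℕ) = fun _ => 1 from rfl, wt_eq_weight] at h6
        simp [wt, deg] at h6 h7
        omega
      simpa [h5] using hP'
  · intro n f
    induction n with
    | zero => exact ⟨0, by simp⟩
    | succ n ih =>
      obtain ⟨a, ha⟩ := ih
      obtain ⟨s, hs, _⟩ := exists_trunc (f - ψ a) (n + 1)
      let P : MvPolynomial (Fin 3) k := ∑ d ∈ s, MvPolynomial.monomial d (coeff d (f - ψ a))
      have hP : (P : PS k) = ∑ d ∈ s, monomial d (coeff d (f - ψ a)) := by
        have : (P : PS k) = MvPolynomial.coeToMvPowerSeries.ringHom P := rfl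
        rw [this, map_sum]
        exact Finset.sum_congr rfl fun d _ => MvPolynomial.coe_monomial _ _
      rw [← hP] at hs
      have h1 : (P : PS k) ∈ mm k ^ n := by
        have := Ideal.sub_mem _ ha (Ideal.pow_le_pow_right (Nat.le_succ n) hs)
        simpa using this
      refine ⟨a + MvPolynomial.aeval b P, ?_⟩
      rw [map_add, ← hθ]
      have : f - (ψ a + θ P) = (f - ψ a - P) - (θ P - P) := by ring
      rw [this]
      exact Ideal.sub_mem _ hs (hθ1 h1)

end Completion

/-! ### Generated filtrations, images and inverse images. -/

namespace IdealisticFiltration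
variable {A : Type v} [CommRing A]

theorem mem_generate {S : Set (A × ℕ)} {f : A} {n : ℕ} (h : (f, n) ∈ S) :
    f ∈ (generate S).level n := by
  change f ∈ ⨅ T : {T : IdealisticFiltration A // ∀ s ∈ S, s.1 ∈ T.level s.2}, T.1.level n
  rw [Ideal.mem_iInf]
  exact fun T => T.2 _ h

theorem generate_le {S : Set (A × ℕ)} {T : IdealisticFiltration A}
    (h : ∀ f n, (f, n) ∈ S → f ∈ T.level n) (n : ℕ) : (generate S).level n ≤ T.level n :=
  iInf_le (fun T : {T : IdealisticFiltration A // ∀ s ∈ S, s.1 ∈ T.level s.2} => T.1.level n)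
    ⟨T, fun s hs => h s.1 s.2 hs⟩

theorem level_anti (R : IdealisticFiltration A) {m n : ℕ} (h : m ≤ n) : R.level n ≤ R.level m :=
  antitone_nat_of_succ_le R.level_succ_le h

theorem mul_mem (R : IdealisticFiltration A) {m n : ℕ} {f g : A} (hf : f ∈ R.level m)
    (hg : g ∈ R.level n) : f * g ∈ R.level (m + n) := R.mul_le m n (Ideal.mul_mem_mul hf hg)

theorem pow_mem (R : IdealisticFiltration A) {m : ℕ} {f : A} (hf : f ∈ R.level m) (n : ℕ) :
    f ^ n ∈ R.level (n * m) := by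
  induction n with
  | zero => rw [zero_mul, R.level_zero]; trivial
  | succ n ih => rw [pow_succ, Nat.succ_mul]; exact R.mul_mem ih hf

/-- The inverse image of a filtration. -/
def comap {B : Type*} [CommRing B] (φ : A →+* B) (T : IdealisticFiltration B) :
    IdealisticFiltration A where
  level n := (T.level n).comap φ
  level_zero := by rw [T.level_zero, Ideal.comap_top]
  level_succ_le n := Ideal.comap_mono (T.level_succ_le n)
  mul_le m n := Ideal.mul_le.2 fun f hf g hg => by
    rw [Ideal.mem_comap, map_mul]
    exact T.mul_mem hf hg

theorem mem_map {B : Type*} [CommRing B] (φ : A →+* B) (R : IdealisticFiltration A) {f : A} {n : ℕ}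
    (h : f ∈ R.level n) : φ f ∈ (R.map φ).level n := Ideal.mem_map_of_mem φ h

theorem map_map {B C : Type*} [CommRing B] [CommRing C] (φ : A →+* B) (ψ : B →+* C)
    (R : IdealisticFiltration A) : (R.map φ).map ψ = R.map (ψ.comp φ) := by
  ext1; funext n
  exact Ideal.map_map φ ψ

theorem mem_map_equiv {B : Type*} [CommRing B] (φ : A ≃+* B) (R : IdealisticFiltration A) {f : B}
    {n : ℕ} : f ∈ (R.map (φ : A →+* B)).level n ↔ φ.symm f ∈ R.level n := by
  change f ∈ (R.level n).map (φ : A →+* B) ↔ _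
  constructor
  · intro h
    obtain ⟨g, hg, rfl⟩ := (Ideal.mem_map_iff_of_surjective _ φ.surjective).1 h
    simpa using hg
  · intro h
    have := Ideal.mem_map_of_mem (φ : A →+* B) h
    simpa using this

end IdealisticFiltration

/-! ### Functoriality of the differential saturation under automorphisms. -/

section DiffSat
variable {k : Type u} [Field k] {A : Type v} [CommRing A] [Algebra k A]

theorem mem_diffSat {R : IdealisticFiltration A} {f : A} {a n : ℕ} {δ : A →ₗ[k] A}
    (hf : f ∈ R.level a) (hδ : IsDiffOp k n δ) : δ f ∈ (diffSat k R).level (a - n) :=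
  IdealisticFiltration.mem_generate ⟨f, a, n, δ, hf, hδ, rfl⟩

theorem le_diffSat {R : IdealisticFiltration A} {f : A} {a : ℕ} (hf : f ∈ R.level a) :
    f ∈ (diffSat k R).level a :=
  mem_diffSat (n := 0) (δ := LinearMap.id) hf fun b c => by simp

theorem IsDiffOp.conj {n : ℕ} {δ : A →ₗ[k] A} (h : IsDiffOp k n δ) (τ : A ≃ₐ[k] A) :
    IsDiffOp k n (τ.toLinearMap ∘ₗ δ ∘ₗ τ.symm.toLinearMap) := by
  induction n generalizing δ with
  | zero => intro b c; simp [h _ _]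
  | succ n ih =>
    intro b
    have := ih (h (τ.symm b))
    convert this using 1
    ext c; simp

theorem diffSat_map (R : IdealisticFiltration A) (τ : A ≃ₐ[k] A) {f : A} {n : ℕ}
    (hf : f ∈ (diffSat k R).level n) :
    τ f ∈ (diffSat k (R.map τ.toAlgHom.toRingHom)).level n := by
  have := IdealisticFiltration.generate_le (T := IdealisticFiltration.comap τ.toAlgHom.toRingHom
    (diffSat k (R.map τ.toAlgHom.toRingHom))) ?_ n hf
  · exact this
  · rintro _ _ ⟨f, a, n, δ, hf, hδ, h⟩
    obtain ⟨rfl, rfl⟩ := Prod.mk.inj h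
    change τ (δ f) ∈ (diffSat k (R.map τ.toAlgHom.toRingHom)).level (a - n)
    have h1 := mem_diffSat (IdealisticFiltration.mem_map τ.toAlgHom.toRingHom R hf) (hδ.conj τ)
    convert h1 using 1
    simp

end DiffSat

/-! ### The invariant `σ`: independence of coordinates and the dichotomy. -/

section Sigma
variable {k : Type u} [Field k]

/-- The linear form with given coefficients. -/
def lform (c : Fin 3 → k) : PS k := ∑ i, C (c i) * X i

theorem lform_mem (c : Fin 3 → k) : lform c ∈ mm k :=
  Ideal.sum_mem _ fun i _ => Ideal.mul_mem_left _ _ (X_mem_mm i)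

theorem coeff_lform (c : Fin 3 → k) (i : Fin 3) : coeff (Finsupp.single i 1) (lform c) = c i := by
  classical
  simp only [lform, map_sum, coeff_C_mul, coeff_X]
  rw [Finset.sum_eq_single i] <;> simp +contextual [Finsupp.single_left_inj, eq_comm]

theorem eq_single_of_deg_one {d : Fin 3 →₀ ℕ} (h : deg d = 1) :
    ∃ i, d = Finsupp.single i 1 := by
  simp only [deg] at h
  by_cases h0 : d 0 = 1
  · exact ⟨0, exp_ext (by simp; omega) (by simp; omega) (by simp; omega)⟩
  by_cases h1 : d 1 = 1
  · exact ⟨1, exp_ext (by simp; omega) (by simp; omega) (by simp; omega)⟩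
  · exact ⟨2, exp_ext (by simp; omega) (by simp; omega) (by simp; omega)⟩

theorem sub_lform_mem {f : PS k} (hf : f ∈ mm k) :
    f - lform (fun i => coeff (Finsupp.single i 1) f) ∈ mm k ^ 2 := by
  rw [mem_mm_pow]
  intro n hn
  by_contra hlt
  apply hn
  by_cases h0 : deg n = 0
  · have : n = 0 := by
      simp only [deg] at h0
      exact exp_ext (by simp; omega) (by simp; omega) (by simp; omega)
    subst this
    have := mem_mm.1 (Ideal.sub_mem _ hf (lform_mem fun i => coeff (Finsupp.single i 1) f))
    simpa using this
  · obtain ⟨i, rfl⟩ := eq_single_of_deg_one (show deg n = 1 by omega)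
    rw [map_sub, coeff_lform, sub_self]

theorem lform_eq_zero_of_mem {c : Fin 3 → k} (h : lform c ∈ mm k ^ 2) : c = 0 := by
  funext i
  rw [← coeff_lform c i]
  exact coeff_eq_zero_of_mem_mm_pow h (by rw [deg_single]; norm_num)

variable (p : ℕ)

/-- The linear forms whose `p ^ n`-th power is the initial form of an element of level `p ^ n`. -/
def leadForms (R : IdealisticFiltration (PS k)) (n : ℕ) : Set (Fin 3 → k) :=
  {c | ∃ f ∈ (diffSat k R).level (p ^ n), f - lform c ^ p ^ n ∈ mm k ^ (p ^ n + 1)}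

theorem sigma_eq_leadForms (R : IdealisticFiltration (PS k)) (n : ℕ) :
    sigma p R n = 3 - Module.finrank k (Submodule.span k (leadForms p R n)) := rfl

variable [Fact p.Prime] [CharP k p]

theorem pow_q_sub_mem {f g : PS k} {a : ℕ} (h : f - g ∈ mm k ^ a) (n : ℕ) :
    f ^ p ^ n - g ^ p ^ n ∈ mm k ^ (a * p ^ n) := by
  rw [← sub_pow_q, pow_mul]
  exact Ideal.pow_mem_pow h _

/-- Automorphisms act on leading forms through their linear part: replacing the image of a linear
form by its linear part changes the `p ^ n`-th power only in order `2 * p ^ n`, which is at least `p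
^ n + 1`. -/
theorem leadForms_map (R : IdealisticFiltration (PS k)) (τ : PS k ≃ₐ[k] PS k) {n : ℕ}
    {c : Fin 3 → k} (hc : c ∈ leadForms p R n) :
    (fun i => coeff (Finsupp.single i 1) (τ (lform c))) ∈
      leadForms p (R.map τ.toAlgHom.toRingHom) n := by
  obtain ⟨f, hf, hfc⟩ := hc
  refine ⟨τ f, diffSat_map R τ hf, ?_⟩
  have h1 := algHom_mem_mm_pow τ.toAlgHom hfc
  have h2 := sub_lform_mem (algHom_mem_mm τ.toAlgHom (lform_mem c))
  have h3 := pow_q_sub_mem p h2 n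
  have hp : 1 ≤ p ^ n := Nat.one_le_pow _ _ (Fact.out : p.Prime).pos
  have h4 := Ideal.add_mem _ h1 (Ideal.pow_le_pow_right (show p ^ n + 1 ≤ 2 * p ^ n by omega) h3)
  have h5 : τ.toAlgHom (f - lform c ^ p ^ n) = τ f - τ (lform c) ^ p ^ n := by simp
  rw [h5] at h4
  have h6 : ∀ x, τ.toAlgHom x = τ x := fun _ => rfl
  simp only [h6] at h4
  rw [sub_add_sub_cancel] at h4
  exact h4

/-- The inequality suffices for the invariance of `σ`, since it may also be applied to the inverse
automorphism. -/
theorem finrank_leadForms_le (R : IdealisticFiltration (PS k)) (τ : PS k ≃ₐ[k] PS k) (n : ℕ) :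
    Module.finrank k (Submodule.span k (leadForms p R n)) ≤
      Module.finrank k (Submodule.span k (leadForms p (R.map τ.toAlgHom.toRingHom) n)) := by
  let L : (Fin 3 → k) →ₗ[k] (Fin 3 → k) :=
    { toFun := fun c i => coeff (Finsupp.single i 1) (τ (lform c))
      map_add' := by
        intro c d
        funext i
        have : lform (c + d) = lform c + lform d := by
          simp [lform, add_mul, Finset.sum_add_distrib]
        simp [this]
      map_smul' := by
        intro r c
        funext i
        have : lform (r • c) = r • lform c := by
          simp only [lform, Pi.smul_apply, smul_eq_mul, map_mul, Finset.smul_sum]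
          refine Finset.sum_congr rfl fun i _ => ?_
          rw [mul_assoc, MvPowerSeries.smul_eq_C_mul]
        simp [this] }
  have hL : Function.Injective L := by
    rw [injective_iff_map_eq_zero]
    intro c hc
    apply lform_eq_zero_of_mem
    rw [← algEquiv_mem_mm_pow τ]
    have h1 := sub_lform_mem (algHom_mem_mm τ.toAlgHom (lform_mem c))
    have h2 : (fun i => coeff (Finsupp.single i 1) (τ.toAlgHom (lform c))) = 0 := hc
    rw [h2] at h1
    have h3 : lform (0 : Fin 3 → k) = 0 := by simp [lform]
    rw [h3, sub_zero] at h1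
    exact h1
  rw [(Submodule.equivMapOfInjective L hL (Submodule.span k (leadForms p R n))).finrank_eq]
  refine Submodule.finrank_mono ?_
  rw [Submodule.map_span]
  refine Submodule.span_mono ?_
  rintro _ ⟨c, hc, rfl⟩
  exact leadForms_map p R τ hc

theorem sigma_map (R : IdealisticFiltration (PS k)) (τ : PS k ≃ₐ[k] PS k) :
    sigma p (R.map τ.toAlgHom.toRingHom) = sigma p R := by
  funext n
  rw [sigma_eq_leadForms, sigma_eq_leadForms]
  have h1 := finrank_leadForms_le p R τ n
  have h2 := finrank_leadForms_le p (R.map τ.toAlgHom.toRingHom) τ.symm n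
  have h3 : (R.map τ.toAlgHom.toRingHom).map τ.symm.toAlgHom.toRingHom = R := by
    rw [IdealisticFiltration.map_map]
    have : τ.symm.toAlgHom.toRingHom.comp τ.toAlgHom.toRingHom = RingHom.id _ := by
      ext1 f
      simp
    rw [this]
    ext1; funext n
    exact Ideal.map_id _
  rw [h3] at h2
  omega

omit [Fact (Nat.Prime p)] [CharP k p] in
theorem eq_zero_of_sigma_eq_three {R : IdealisticFiltration (PS k)} {n : ℕ} (h : sigma p R n = 3)
    {c : Fin 3 → k} (hc : c ∈ leadForms p R n) : c = 0 := by
  rw [sigma_eq_leadForms] at h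
  have h0 : Module.finrank k (Submodule.span k (leadForms p R n)) = 0 := by omega
  rw [Submodule.finrank_eq_zero] at h0
  have := Submodule.subset_span (R := k) hc
  rwa [h0] at this

omit [Fact (Nat.Prime p)] [CharP k p] in
theorem sigma_le_two {R : IdealisticFiltration (PS k)} {n : ℕ} {c : Fin 3 → k}
    (hc : c ∈ leadForms p R n) (hne : c ≠ 0) : sigma p R n ≤ 2 := by
  by_contra hlt
  apply hne
  apply eq_zero_of_sigma_eq_three p _ hc
  rw [sigma_eq_leadForms] at hlt ⊢
  omega

omit [Fact (Nat.Prime p)] [CharP k p] in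
theorem exists_smul_of_sigma_eq_two {R : IdealisticFiltration (PS k)} {n : ℕ}
    (h : sigma p R n = 2) {c d : Fin 3 → k} (hc : c ∈ leadForms p R n) (hne : c ≠ 0)
    (hd : d ∈ leadForms p R n) : ∃ r : k, d = r • c := by
  rw [sigma_eq_leadForms] at h
  have h1 : Module.finrank k (Submodule.span k (leadForms p R n)) = 1 := by omega
  rw [finrank_eq_one_iff_of_nonzero' ⟨c, Submodule.subset_span hc⟩ (by
    simpa [Subtype.ext_iff] using hne)] at h1
  obtain ⟨r, hr⟩ := h1 ⟨d, Submodule.subset_span hd⟩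
  exact ⟨r, by simpa [Subtype.ext_iff] using hr.symm⟩

variable [IsAlgClosed k]

/-- A form of degree `p ^ n` whose exponents are all divisible by `p ^ n` is a combination of
`x^(p^n)`, `y^(p^n)`, `z^(p^n)`, hence the `p ^ n`-th power of a linear form once roots of the
coefficients are taken in `k`. -/
theorem exists_leadForm {f : PS k} {n : ℕ} {R : IdealisticFiltration (PS k)}
    (hf : f ∈ (diffSat k R).level (p ^ n)) (hord : f ∈ mm k ^ p ^ n)
    (hq : ∀ d, deg d = p ^ n → coeff d f ≠ 0 → ∀ i, p ^ n ∣ d i) :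
    ∃ c ∈ leadForms p R n, ∀ i, c i ^ p ^ n = coeff (Finsupp.single i (p ^ n)) f := by
  choose c hc using fun i => IsAlgClosed.exists_pow_nat_eq
    (coeff (Finsupp.single i (p ^ n)) f) (Nat.pos_of_ne_zero (pNZ p n))
  refine ⟨c, ⟨f, hf, ?_⟩, hc⟩
  rw [mem_mm_pow]
  intro d hd
  by_contra hlt
  apply hd
  rw [map_sub, sub_eq_zero]
  have hl : lform c ^ p ^ n ∈ mm k ^ p ^ n := Ideal.pow_mem_pow (lform_mem c) _
  rcases lt_or_eq_of_le (show deg d ≤ p ^ n by omega) with h | h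
  · rw [coeff_eq_zero_of_mem_mm_pow hord h, coeff_eq_zero_of_mem_mm_pow hl h]
  · by_cases hdiv : ∀ i, p ^ n ∣ d i
    · obtain ⟨m, rfl⟩ := exists_smul_of_dvd hdiv
      have hm : deg m = 1 := by
        have h1 : deg (p ^ n • m) = p ^ n * deg m := by simp [deg]; ring
        rw [h1] at h
        exact Nat.eq_of_mul_eq_mul_left (Nat.pos_of_ne_zero (pNZ p n)) (by rw [h, mul_one])
      obtain ⟨i, rfl⟩ := eq_single_of_deg_one hm
      rw [coeff_pow_q_smul, coeff_lform, hc, Finsupp.smul_single, smul_eq_mul, mul_one]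
    · have h1 : coeff d f = 0 := by
        by_contra hne
        exact hdiv (hq d h hne)
      push Not at hdiv
      obtain ⟨i, hi⟩ := hdiv
      rw [h1, coeff_pow_q_of_not_dvd p n _ hi]

/-- The value of `σ` in the monomial case with `τ = 1`. -/
abbrev sigmaMon (e : ℕ) : ℕ → ℕ := fun n => if n < e then 3 else 2

/-- If the initial form of `h` were not a `q`-th power, a suitable Hasse derivative of `h` would
have an initial form which is the `p ^ n`-th power of a nonzero linear form for some `n < e`; but
`σ` equal to 3 at `n` excludes all such forms. -/
theorem dvd_of_sigma_eq_three {R : IdealisticFiltration (PS k)} {e : ℕ} {h : PS k}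
    (hh : h ∈ R.level (p ^ e)) (hord : h ∈ mm k ^ p ^ e) (hs : ∀ n < e, sigma p R n = 3)
    {d : Fin 3 →₀ ℕ} (hd : deg d = p ^ e) (hne : coeff d h ≠ 0) (i : Fin 3) : p ^ e ∣ d i := by
  classical
  by_contra hcon
  have hp := (Fact.out : p.Prime)
  have hex : ∃ n, ∃ d : Fin 3 →₀ ℕ, ∃ i, deg d = p ^ e ∧ coeff d h ≠ 0 ∧ ¬ p ^ (n + 1) ∣ d i := by
    refine ⟨e, d, i, hd, hne, fun h' => hcon ((pow_dvd_pow p (Nat.le_succ e)).trans h')⟩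
  -- By minimality all exponents of the initial form are divisible by `p ^ n`, and the exponent `b
  -- j` is not divisible by `p ^ (n + 1)`.
  set n := Nat.find hex with hn
  obtain ⟨b, j, hb, hbne, hbj⟩ := Nat.find_spec hex
  rw [← hn] at hbj
  have hmin : ∀ d : Fin 3 →₀ ℕ, deg d = p ^ e → coeff d h ≠ 0 → ∀ i, p ^ n ∣ d i := by
    intro d hd hne i
    by_contra hnd
    cases hcase : n with
    | zero => rw [hcase] at hnd; simp at hnd
    | succ m =>
      rw [hcase] at hnd
      exact Nat.find_min hex (show m < Nat.find hex by omega) ⟨d, i, hd, hne, hnd⟩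
  have hne' : n < e := by
    by_contra hge
    have : n ≠ e ∨ n = e := ne_or_eq _ _
    apply hcon
    exact (pow_dvd_pow p (not_lt.1 hge)).trans (hmin d hd hne i)
  have hbj0 : p ^ n ≤ b j := by
    apply Nat.le_of_dvd _ (hmin b hb hbne j)
    apply Nat.pos_of_ne_zero
    intro h0
    rw [h0] at hbj
    exact hbj (dvd_zero _)
  let m := b - Finsupp.single j (p ^ n)
  have hm : m + Finsupp.single j (p ^ n) = b :=
    tsub_add_cancel_of_le (by rwa [Finsupp.single_le_iff])
  have hmi : ∀ i, p ^ n ∣ m i := by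
    intro i
    have h1 := hmin b hb hbne i
    rw [← hm, Finsupp.add_apply] at h1
    refine (Nat.dvd_add_left ?_).1 h1
    by_cases hij : j = i
    · subst hij; simp
    · rw [Finsupp.single_eq_of_ne (Ne.symm hij)]; exact dvd_zero _
  have hdm : deg m + p ^ n = p ^ e := by
    rw [← hb, ← hm, deg_add, deg_single]
  -- The derivative of multi-order `m` takes `b` to `p ^ n` times the `j`-th unit vector and lowers
  -- the level from `p ^ e` to exactly `p ^ n`.
  let D : PS k →ₗ[k] PS k := hasse 0 (m 0) ∘ₗ (hasse 1 (m 1) ∘ₗ hasse 2 (m 2))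
  have hD : IsDiffOp k (m 0 + (m 1 + m 2)) D :=
    (isDiffOp_hasse 0 _).comp ((isDiffOp_hasse 1 _).comp (isDiffOp_hasse 2 _))
  have hcD : ∀ a, coeff a (D h) = ((a 0 + m 0).choose (m 0) : k) * ((a 1 + m 1).choose (m 1) : k) *
      ((a 2 + m 2).choose (m 2) : k) * coeff (a + m) h := by
    intro a
    have : a + Finsupp.single 0 (m 0) + Finsupp.single 1 (m 1) + Finsupp.single 2 (m 2) = a + m := by
      refine exp_ext ?_ ?_ ?_ <;> simp
    simp only [D, LinearMap.comp_apply, coeff_hasse, this]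
    simp
    ring
  have hlev : D h ∈ (diffSat k R).level (p ^ n) := by
    have := mem_diffSat hh hD
    rwa [show p ^ e - (m 0 + (m 1 + m 2)) = p ^ n by simp only [deg] at hdm; omega] at this
  have hordD : D h ∈ mm k ^ p ^ n := by
    rw [mem_mm_pow]
    intro a ha
    rw [hcD] at ha
    have := mem_mm_pow.1 hord _ (right_ne_zero_of_mul ha)
    rw [deg_add] at this
    omega
  obtain ⟨c, hc, hcc⟩ := exists_leadForm p hlev hordD (by
    intro a hda ha i
    rw [hcD] at ha
    have := hmin (a + m) (by rw [deg_add]; omega) (right_ne_zero_of_mul ha) i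
    rw [Finsupp.add_apply] at this
    exact (Nat.dvd_add_left (hmi i)).1 this)
  have hc0 := eq_zero_of_sigma_eq_three p (hs n hne') hc
  have h1 := hcc j
  rw [hc0, Pi.zero_apply, zero_pow (pNZ p n), hcD, add_comm _ m, hm] at h1
  have hch : ∀ x : ℕ, ¬ p ∣ x → (x : k) ≠ 0 := fun x hx => by
    rwa [Ne, CharP.cast_eq_zero_iff k p]
  have hbm : b j = m j + p ^ n := by rw [← hm]; simp
  -- The coefficient surviving at the `j`-th pure power contains a binomial coefficient of `b j`
  -- over `p ^ n`, which is nonzero in `k` by Lucas.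
  have hchj : (((m j + p ^ n).choose (m j) : ℕ) : k) ≠ 0 := by
    rw [← Nat.choose_symm (Nat.le_add_right _ _), Nat.add_sub_cancel_left]
    apply hch
    rw [← hbm]
    exact not_dvd_choose_prime_pow (hmin b hb hbne j) hbj
  rw [add_comm (m j)] at hchj
  refine absurd h1.symm (mul_ne_zero (mul_ne_zero (mul_ne_zero ?_ ?_) ?_) hbne)
  all_goals
    fin_cases j <;> simp at hchj ⊢ <;> exact hchj

/-- At a point of the support where an element of level `q = p ^ e` has `z ^ q` in its initial form,
either `σ` is smaller than in the monomial case, or it takes the same value and the initial form is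
a `q`-th power. -/
theorem sigma_dichotomy (R : IdealisticFiltration (PS k)) {e : ℕ} {h : PS k}
    (hh : h ∈ R.level (p ^ e)) (hord : h ∈ mm k ^ p ^ e)
    (htop : coeff (Finsupp.single 2 (p ^ e)) h ≠ 0) :
    (∃ n, (∀ m < n, sigma p R m = sigmaMon e m) ∧ sigma p R n < sigmaMon e n) ∨
      (sigma p R = sigmaMon e ∧
        ∀ d, deg d = p ^ e → coeff d h ≠ 0 → ∀ i, p ^ e ∣ d i) := by
  by_cases hex : ∃ n, (∀ m < n, sigma p R m = sigmaMon e m) ∧ sigma p R n < sigmaMon e n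
  · exact Or.inl hex
  right
  have hle3 : ∀ n, sigma p R n ≤ 3 := fun n => Nat.sub_le _ _
  -- Since `σ` never exceeds 3, the first index below `e` where it differs from 3 would be a drop.
  have h3 : ∀ n < e, sigma p R n = 3 := by
    intro n
    induction n using Nat.strong_induction_on with
    | _ n ih =>
      intro hn
      by_contra hne
      refine hex ⟨n, fun m hm => ?_, ?_⟩
      · rw [ih m hm (hm.trans hn), sigmaMon, if_pos (hm.trans hn)]
      · rw [sigmaMon, if_pos hn]
        have := hle3 n
        omega
  have hdvd : ∀ d, deg d = p ^ e → coeff d h ≠ 0 → ∀ i, p ^ e ∣ d i :=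
    fun d hd hne i => dvd_of_sigma_eq_three p hh hord h3 hd hne i
  obtain ⟨c, hc, hcc⟩ := exists_leadForm p (le_diffSat hh) hord hdvd
  have hc0 : c ≠ 0 := by
    rintro rfl
    apply htop
    rw [← hcc 2, Pi.zero_apply, zero_pow (pNZ p e)]
  -- The `p ^ (n - e)`-th power of an element with leading form `c` at level `p ^ e` has leading
  -- form `c` at level `p ^ n`.
  have h2 : ∀ n, e ≤ n → sigma p R n ≤ 2 := by
    intro n hn
    refine sigma_le_two p (c := c) ?_ hc0
    obtain ⟨f, hf, hfc⟩ := hc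
    refine ⟨f ^ p ^ (n - e), ?_, ?_⟩
    · have := (diffSat k R).pow_mem hf (p ^ (n - e))
      rwa [← pow_add, Nat.sub_add_cancel hn] at this
    · have := pow_q_sub_mem p hfc (n - e)
      rw [← pow_mul, ← pow_add, Nat.add_sub_cancel' hn, add_mul, ← pow_add,
        Nat.add_sub_cancel' hn, one_mul] at this
      exact Ideal.pow_le_pow_right (Nat.add_le_add_left (Nat.one_le_pow _ _
        (Fact.out : p.Prime).pos) _) this
  refine ⟨?_, hdvd⟩
  have heq : ∀ n, sigma p R n = sigmaMon e n := by
    intro n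
    induction n using Nat.strong_induction_on with
    | _ n ih =>
      by_cases hn : n < e
      · rw [h3 n hn, sigmaMon, if_pos hn]
      · by_contra hne
        refine hex ⟨n, ih, ?_⟩
        rw [sigmaMon, if_neg hn] at hne ⊢
        have := h2 n (not_lt.1 hn)
        omega
  exact funext heq

end Sigma

/-! ### Weierstrass division by a monic polynomial in `z`. -/

section Weierstrass
variable {k : Type u} [Field k]

theorem coeff_mul_of_unique {f g : PS k} {a b : Fin 3 →₀ ℕ}
    (h : ∀ a' b', a' + b' = a + b → coeff a' f ≠ 0 → coeff b' g ≠ 0 → a' = a) :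
    coeff (a + b) (f * g) = coeff a f * coeff b g := by
  classical
  rw [coeff_mul, Finset.sum_eq_single (a, b)]
  · rintro ⟨a', b'⟩ hc hne
    rw [Finset.HasAntidiagonal.mem_antidiagonal] at hc
    by_contra h0
    have ha := h a' b' hc (left_ne_zero_of_mul h0) (right_ne_zero_of_mul h0)
    subst ha
    exact hne (Prod.ext rfl (add_left_cancel hc))
  · intro hc
    rw [Finset.HasAntidiagonal.mem_antidiagonal] at hc
    exact absurd rfl hc

theorem coeff_X_pow_mul_add (i : Fin 3) (n : ℕ) (f : PS k) (m : Fin 3 →₀ ℕ) :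
    coeff (m + Finsupp.single i n) (X i ^ n * f) = coeff m f := by
  rw [X_pow_eq, add_comm, coeff_add_monomial_mul, one_mul]

theorem coeff_X_pow_mul_eq_zero (i : Fin 3) (n : ℕ) (f : PS k) {m : Fin 3 →₀ ℕ} (h : m i < n) :
    coeff m (X i ^ n * f) = 0 := by
  rw [X_pow_eq, coeff_monomial_mul, if_neg]
  rw [Finsupp.single_le_iff]
  omega

theorem X_pow_dvd_iff {i : Fin 3} {n : ℕ} {f : PS k} :
    X i ^ n ∣ f ↔ ∀ m, coeff m f ≠ 0 → n ≤ m i := by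
  constructor
  · rintro ⟨g, rfl⟩ m hm
    by_contra hlt
    exact hm (coeff_X_pow_mul_eq_zero i n g (not_le.1 hlt))
  · intro h
    refine ⟨mkPS fun m => coeff (m + Finsupp.single i n) f, ?_⟩
    ext m
    by_cases hm : n ≤ m i
    · obtain ⟨m', rfl⟩ : ∃ m', m = m' + Finsupp.single i n :=
        ⟨m - Finsupp.single i n, (tsub_add_cancel_of_le (by rwa [Finsupp.single_le_iff])).symm⟩
      rw [coeff_X_pow_mul_add, coeff_mkPS]
    · rw [coeff_X_pow_mul_eq_zero i n _ (not_le.1 hm)]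
      by_contra h0
      exact hm (h m h0)

theorem exists_factor {i j : ℕ} {f : PS k} (h : ∀ m, coeff m f ≠ 0 → i ≤ m 0 ∧ j ≤ m 1) :
    ∃ g, f = X 0 ^ i * X 1 ^ j * g := by
  obtain ⟨g, rfl⟩ := X_pow_dvd_iff.2 fun m hm => (h m hm).1
  obtain ⟨g', rfl⟩ : X 1 ^ j ∣ g := X_pow_dvd_iff.2 fun m hm => by
    have := (h (m + Finsupp.single 0 i) (by rwa [coeff_X_pow_mul_add])).2
    simpa using this
  exact ⟨g', by ring⟩

/-- `h` is a Weierstrass polynomial of degree `q` in `z`. -/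
structure ZMonic (q : ℕ) (h : PS k) : Prop where
  top : coeff (Finsupp.single 2 q) h = 1
  low : ∀ n, coeff n h ≠ 0 → n ≠ Finsupp.single 2 q → n 2 < q ∧ 0 < n 0 + n 1

theorem ZMonic.wt_zero {q : ℕ} {h : PS k} (hh : ZMonic q h) {n : Fin 3 →₀ ℕ} (hn : coeff n h ≠ 0)
    (h0 : n 0 + n 1 = 0) : n = Finsupp.single 2 q := by
  by_contra hne
  have := (hh.low n hn hne).2
  omega

theorem ZMonic.sub_mem {q : ℕ} {h : PS k} (hh : ZMonic q h) :
    h - X 2 ^ q ∈ suppIn fun n => n 2 < q ∧ 0 < n 0 + n 1 := by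
  classical
  intro n hn
  rw [map_sub, X_pow_eq, coeff_monomial] at hn
  by_cases h1 : n = Finsupp.single 2 q
  · rw [if_pos h1, h1, hh.top, sub_self] at hn
    exact absurd rfl hn
  · rw [if_neg h1, sub_zero] at hn
    exact hh.low n hn h1

theorem zMonic_of_sub_mem {q : ℕ} {h : PS k}
    (hh : h - X 2 ^ q ∈ suppIn fun n => n 2 < q ∧ 0 < n 0 + n 1) : ZMonic q h := by
  classical
  have key : ∀ n, coeff n (h - X 2 ^ q) = coeff n h - if n = Finsupp.single 2 q then 1 else 0 := by
    intro n
    rw [map_sub, X_pow_eq, coeff_monomial]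
  constructor
  · by_contra hne
    have := (hh (Finsupp.single 2 q) (by rw [key, if_pos rfl]; exact sub_ne_zero.2 hne)).2
    simp at this
  · intro n hn hne
    exact hh n (by rw [key, if_neg hne, sub_zero]; exact hn)

/-- Give `x` and `y` weight 1 and `z` weight 0. The lowest part of `h` is `z ^ q`, so a lowest
monomial of the quotient, multiplied by `z ^ q`, survives in the product, and its exponent of `z` is
at least `q`. -/
theorem weierstrass_unique {q : ℕ} {h : PS k} (hh : ZMonic q h) {c : PS k} (hd : h ∣ c)
    (hc : c ∈ suppIn fun n => n 2 < q) : c = 0 := by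
  obtain ⟨w, rfl⟩ := hd
  by_cases hw : w = 0
  · rw [hw, mul_zero]
  exfalso
  obtain ⟨u, hu, hu'⟩ := exists_exact_weight (w := ![1, 1, 0]) hw
  rw [mem_wIdeal] at hu hu'
  push Not at hu'
  obtain ⟨b, hb, hbu⟩ := hu'
  have hwt : ∀ n, wt ![1, 1, 0] n = n 0 + n 1 := fun n => by simp [wt]
  simp only [hwt] at hu hbu
  have hbu' := hu b hb
  have h1 : coeff (Finsupp.single 2 q + b) (h * w) = coeff (Finsupp.single 2 q) h * coeff b w := by
    refine coeff_mul_of_unique fun a' b' hab ha' hb' => hh.wt_zero ha' ?_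
    have h2 := hu b' hb'
    have h3 := congrArg (fun m => m 0) hab
    have h4 := congrArg (fun m => m 1) hab
    simp at h3 h4
    omega
  have := hc (Finsupp.single 2 q + b) (by rw [h1, hh.top, one_mul]; exact hb)
  simp at this

/-- Let `T` discard the terms of `z`-degree below `q` and divide the rest by `z ^ q`. With `B = z ^
q - h`, which has positive weight in `x` and `y`, the series `G = g + B * T G` is obtained by
iteration; the quotient is `T G` and the remainder is the part of `G` of `z`-degree below `q`. -/
theorem weierstrass_exists {q : ℕ} {h : PS k} (hh : ZMonic q h) (g : PS k) :
    ∃ w c, g = h * w + c ∧ c ∈ suppIn fun n => n 2 < q := by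
  let B : PS k := X 2 ^ q - h
  have hwt : ∀ n, wt ![1, 1, 0] n = n 0 + n 1 := fun n => by simp [wt]
  have hB : B ∈ wIdeal ![1, 1, 0] 1 := by
    have : B = -(h - X 2 ^ q) := by simp [B]
    rw [this]
    refine Ideal.neg_mem_iff _ |>.2 ?_
    intro n hn
    rw [hwt]
    exact (hh.sub_mem n hn).2
  let T : PS k → PS k := fun g => mkPS fun m => coeff (m + Finsupp.single 2 q) g
  have hTsub : ∀ f g, T (f - g) = T f - T g := fun f g => by ext m; simp [T]
  have hTadd : ∀ f g, T (f + g) = T f + T g := fun f g => by ext m; simp [T]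
  have hT : ∀ N f, f ∈ wIdeal ![1, 1, 0] N → T f ∈ wIdeal ![1, 1, 0] N := by
    intro N f hf n hn
    have := hf (n + Finsupp.single 2 q) hn
    rw [hwt] at this ⊢
    simpa using this
  let L : PS k → PS k := fun g => B * T g
  have hL : ∀ N f, f ∈ wIdeal ![1, 1, 0] N → L f ∈ wIdeal ![1, 1, 0] (N + 1) := fun N f hf => by
    rw [add_comm]; exact mul_mem_wIdeal hB (hT N f hf)
  have hit : ∀ i, L^[i] g ∈ wIdeal ![1, 1, 0] i := by
    intro i
    induction i with
    | zero => exact mem_wIdeal_zero _ _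
    | succ i ih => rw [Function.iterate_succ_apply']; exact hL _ _ ih
  let G : PS k := mkPS fun n => ∑ i ∈ Finset.range (n 0 + n 1 + 1), coeff n (L^[i] g)
  have hG : ∀ N, G - ∑ i ∈ Finset.range N, L^[i] g ∈ wIdeal ![1, 1, 0] N := by
    intro N n hn
    rw [hwt]
    by_contra hlt
    apply hn
    rw [map_sub, map_sum, coeff_mkPS, sub_eq_zero]
    refine Finset.sum_subset (Finset.range_mono (by omega)) fun i _ hi => ?_
    by_contra hne
    have := hit i n hne
    rw [hwt] at this
    simp at hi
    omega
  have hLsum : ∀ N, L (∑ i ∈ Finset.range N, L^[i] g) = ∑ i ∈ Finset.range N, L^[i + 1] g := by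
    intro N
    induction N with
    | zero =>
      have hT0 : T 0 = 0 := by simpa using hTsub 0 0
      simp [L, hT0]
    | succ N ih =>
      rw [Finset.sum_range_succ, Finset.sum_range_succ, ← ih, Function.iterate_succ_apply']
      simp only [L, hTadd, mul_add]
  have hfix : G = g + L G := by
    rw [← sub_eq_zero]
    have hall : ∀ N, G - (g + L G) ∈ wIdeal ![1, 1, 0] N := by
      intro N
      have h1 := hG (N + 1)
      have h2 := hL N _ (hG N)
      have h3 : L (G - ∑ i ∈ Finset.range N, L^[i] g) = L G - ∑ i ∈ Finset.range N, L^[i + 1] g := by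
        rw [← hLsum]; simp only [L, hTsub, mul_sub]
      rw [h3] at h2
      rw [Finset.sum_range_succ'] at h1
      have h4 := Ideal.sub_mem _ h1 h2
      refine wIdeal_anti _ (Nat.le_succ N) ?_
      convert h4 using 1
      simp only [Function.iterate_zero, id]
      ring
    ext n
    by_contra hne
    have := hall (n 0 + n 1 + 1) n hne
    rw [hwt] at this
    omega
  obtain ⟨c0, hc0⟩ : ∃ c0 : PS k, ∀ n, coeff n c0 = if n 2 < q then coeff n G else 0 :=
    ⟨mkPS fun n => if n 2 < q then coeff n G else 0, fun n => rfl⟩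
  refine ⟨T G, c0, ?_, ?_⟩
  · have hsplit : G = X 2 ^ q * T G + c0 := by
      ext n
      rw [map_add, hc0]
      by_cases hn : n 2 < q
      · rw [if_pos hn, coeff_X_pow_mul_eq_zero _ _ _ hn, zero_add]
      · obtain ⟨m', rfl⟩ : ∃ m', n = m' + Finsupp.single 2 q :=
          ⟨n - Finsupp.single 2 q, (tsub_add_cancel_of_le (by
            rw [Finsupp.single_le_iff]; omega)).symm⟩
        rw [if_neg hn, coeff_X_pow_mul_add, add_zero]
        rfl
    have h5 : g = G - B * T G := eq_sub_of_add_eq hfix.symm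
    rw [h5]
    nth_rewrite 1 [hsplit]
    simp only [B]
    ring
  · intro n hn
    rw [hc0] at hn
    by_contra hlt
    exact hn (if_neg hlt)

end Weierstrass

/-! ### The algebraic data of the monomial case and the intermediate coefficients of `h`. -/

section Frame
variable {k : Type u} [Field k]

/-- The conditions on coordinates, monomial and leading generator in the monomial case, without
the boundary and the value of `σ`. -/
structure Frame (p e a α β : ℕ) (R : IdealisticFiltration (PS k)) (h : PS k) : Prop where
  a_pos : 0 < a
  h_mem : h ∈ R.level (p ^ e)
  monic : ZMonic (p ^ e) h
  mono_mem : X 0 ^ α * X 1 ^ β ∈ R.level a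
  sat : ∀ l n f, f ∈ R.level l → hasse 2 n f ∈ R.level (l - n)
  const : ∀ l f, f ∈ R.level l → ∃ w g, f = h * w + g ∧
    g ∈ suppIn fun n => α * l ≤ a * n 0 ∧ β * l ≤ a * n 1

/-- `(A + a - 1) / a` is the ceiling of `A / a`; it replaces fractional exponents by divisibility by
a genuine monomial. -/
theorem ceil_le_iff {a A n : ℕ} (ha : 0 < a) : (A + a - 1) / a ≤ n ↔ A ≤ a * n := by
  rw [Nat.div_le_iff_le_mul_add_pred ha]
  constructor <;> intro h <;> omega

/-- The remainder of the Weierstrass division satisfies the same divisibility. -/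
theorem exists_rem {q a A B : ℕ} (ha : 0 < a) {h f : PS k} (hh : ZMonic q h)
    (hf : ∃ w g, f = h * w + g ∧ g ∈ suppIn fun n => A ≤ a * n 0 ∧ B ≤ a * n 1) :
    ∃ c, h ∣ f - c ∧ c ∈ suppIn fun n => n 2 < q ∧ A ≤ a * n 0 ∧ B ≤ a * n 1 := by
  obtain ⟨w, g, rfl, hg⟩ := hf
  obtain ⟨g', rfl⟩ := exists_factor (i := (A + a - 1) / a) (j := (B + a - 1) / a) (f := g)
    fun m hm => ⟨(ceil_le_iff ha).2 (hg m hm).1, (ceil_le_iff ha).2 (hg m hm).2⟩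
  obtain ⟨w', c, rfl, hc⟩ := weierstrass_exists hh g'
  refine ⟨X 0 ^ ((A + a - 1) / a) * X 1 ^ ((B + a - 1) / a) * c,
    ⟨w + X 0 ^ ((A + a - 1) / a) * X 1 ^ ((B + a - 1) / a) * w', by ring⟩, ?_⟩
  intro n hn
  have h0 : X 0 ^ ((A + a - 1) / a) ∣ X 0 ^ ((A + a - 1) / a) * X 1 ^ ((B + a - 1) / a) * c :=
    Dvd.intro _ (mul_assoc _ _ _).symm
  have h1 : X 1 ^ ((B + a - 1) / a) ∣ X 0 ^ ((A + a - 1) / a) * X 1 ^ ((B + a - 1) / a) * c :=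
    ⟨X 0 ^ ((A + a - 1) / a) * c, by ring⟩
  refine ⟨?_, (ceil_le_iff ha).1 (X_pow_dvd_iff.1 h0 n hn), (ceil_le_iff ha).1
    (X_pow_dvd_iff.1 h1 n hn)⟩
  obtain ⟨a', b', rfl, ha', hb'⟩ := exists_of_coeff_mul_ne_zero hn
  have h2 : a' 2 = 0 := by
    have : (X 0 ^ ((A + a - 1) / a) * X 1 ^ ((B + a - 1) / a) : PS k) ∈ suppIn fun n => n 2 = 0 :=
      mul_mem_suppInZ (pow_mem_suppInZ (X_mem_suppIn (by simp)) _)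
        (pow_mem_suppInZ (X_mem_suppIn (by simp)) _)
    exact this a' ha'
  have h3 := hc b' hb'
  simpa [h2] using h3

theorem zdeg_add {f g : PS k} {q : ℕ} (hf : f ∈ suppIn fun n => n 2 < q)
    (hg : g ∈ suppIn fun n => n 2 < q) : f - g ∈ suppIn fun n => n 2 < q :=
  Submodule.sub_mem _ hf hg

variable {p e a α β : ℕ} [Fact p.Prime] [CharP k p] {R : IdealisticFiltration (PS k)} {h : PS k}

omit [Fact p.Prime] [CharP k p] in
theorem Frame.rem (F : Frame p e a α β R h) {l : ℕ} {f : PS k} (hf : f ∈ R.level l) :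
    ∃ c, h ∣ f - c ∧ c ∈ suppIn fun n => n 2 < p ^ e ∧ α * l ≤ a * n 0 ∧ β * l ≤ a * n 1 :=
  exists_rem F.a_pos F.monic (F.const l f hf)

/-- Divisibility of the intermediate coefficients of `h`. -/
theorem Frame.mid (F : Frame p e a α β R h) {n : Fin 3 →₀ ℕ} (hn : coeff n h ≠ 0) (h0 : 0 < n 2)
    (hq : n 2 < p ^ e) : α * (p ^ e - n 2) ≤ a * n 0 ∧ β * (p ^ e - n 2) ≤ a * n 1 := by
  -- The derivative of order `n 2` has level `q - n 2`, and its remainder carries the desired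
  -- divisibility. It has `z`-degree below `q`, because `p` divides the binomial coefficient of `q`
  -- over `n 2`; so it equals its remainder.
  obtain ⟨c, hc, hc'⟩ := F.rem (F.sat _ (n 2) _ F.h_mem)
  have hD : hasse 2 (n 2) h ∈ suppIn fun n => n 2 < p ^ e := by
    intro m hm
    rw [coeff_hasse] at hm
    by_cases htop : m + Finsupp.single 2 (n 2) = Finsupp.single 2 (p ^ e)
    · have h1 := congrArg (fun m => m 2) htop
      simp at h1
      exfalso
      apply left_ne_zero_of_mul hm
      rw [h1, CharP.cast_eq_zero_iff k p]
      exact (Fact.out : p.Prime).dvd_choose_pow (by omega) (by omega)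
    · have := (F.monic.low _ (right_ne_zero_of_mul hm) htop).1
      simp at this
      omega
  have hEq : hasse 2 (n 2) h - c = 0 := weierstrass_unique F.monic hc
    (zdeg_add hD (suppIn_mono (fun n hn => hn.1) hc'))
  have hcoef : coeff (n - Finsupp.single 2 (n 2)) (hasse 2 (n 2) h) ≠ 0 := by
    have h1 : n - Finsupp.single 2 (n 2) + Finsupp.single 2 (n 2) = n :=
      tsub_add_cancel_of_le (by rw [Finsupp.single_le_iff])
    rw [coeff_hasse, h1]
    simpa using hn
  rw [sub_eq_zero.1 hEq] at hcoef
  have := (hc' _ hcoef).2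
  simpa using this

end Frame

/-! ### Translations of `z` and the exchange of `x` and `y`. -/

section Shift
variable {k : Type u} [Field k]

theorem exists_shift {w : PS k} (hw : w ∈ suppIn fun n => n 2 = 0) (hm : w ∈ mm k) :
    ∃ τ : PS k ≃ₐ[k] PS k, τ (X 0) = X 0 ∧ τ (X 1) = X 1 ∧ τ (X 2) = X 2 + w := by
  have h1 : ∀ v ∈ mm k, ∀ i, (![X 0, X 1, X 2 + v] : Fin 3 → PS k) i ∈ mm k := by
    intro v hv i
    fin_cases i
    · exact X_mem_mm 0
    · exact X_mem_mm 1
    · exact Ideal.add_mem _ (X_mem_mm 2) hv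
  have hm' : -w ∈ mm k := Ideal.neg_mem_iff _ |>.2 hm
  have hfix : ∀ v (hv : ∀ i, (![X 0, X 1, X 2 + v] : Fin 3 → PS k) i ∈ mm k), sub3 _ hv w = w :=
    fun v hv => algHom_eq_self _ (by simp) (by simp) hw
  refine ⟨AlgEquiv.ofAlgHom (sub3 _ (h1 w hm)) (sub3 _ (h1 (-w) hm')) ?_ ?_, ?_, ?_, ?_⟩
  · refine algHom_ext fun i => ?_
    fin_cases i
    · simp
    · simp
    · simp; rw [hfix]; ring
  · refine algHom_ext fun i => ?_
    fin_cases i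
    · simp
    · simp
    · simp; rw [hfix]; ring
  all_goals simp

/-- The exponent with `x` and `y` exchanged. -/
def swapExp (n : Fin 3 →₀ ℕ) : Fin 3 →₀ ℕ := n.mapDomain (Equiv.swap 0 1)

theorem swapExp_apply (n : Fin 3 →₀ ℕ) (i : Fin 3) : swapExp n i = n (Equiv.swap 0 1 i) := by
  have : swapExp n (Equiv.swap 0 1 (Equiv.swap 0 1 i)) = n (Equiv.swap 0 1 i) :=
    Finsupp.mapDomain_apply (Equiv.swap (0 : Fin 3) 1).injective _ _
  rwa [Equiv.swap_apply_self] at this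

@[simp] theorem swapExp_zero (n : Fin 3 →₀ ℕ) : swapExp n 0 = n 1 := by simp [swapExp_apply]
@[simp] theorem swapExp_one (n : Fin 3 →₀ ℕ) : swapExp n 1 = n 0 := by simp [swapExp_apply]
@[simp] theorem swapExp_two (n : Fin 3 →₀ ℕ) : swapExp n 2 = n 2 := by
  rw [swapExp_apply, Equiv.swap_apply_of_ne_of_ne] <;> decide

theorem swapExp_swapExp (n : Fin 3 →₀ ℕ) : swapExp (swapExp n) = n :=
  exp_ext (by simp) (by simp) (by simp)

variable (k) in
theorem exists_swap : ∃ τ : PS k ≃ₐ[k] PS k, τ (X 0) = X 1 ∧ τ (X 1) = X 0 ∧ τ (X 2) = X 2 := by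
  have h1 : ∀ i, (![X 1, X 0, X 2] : Fin 3 → PS k) i ∈ mm k := by
    intro i
    fin_cases i
    · exact X_mem_mm 1
    · exact X_mem_mm 0
    · exact X_mem_mm 2
  refine ⟨AlgEquiv.ofAlgHom (sub3 _ h1) (sub3 _ h1) ?_ ?_, ?_, ?_, ?_⟩
  · refine algHom_ext fun i => ?_
    fin_cases i <;> simp
  · refine algHom_ext fun i => ?_
    fin_cases i <;> simp
  all_goals simp

variable (k) in
/-- The automorphism exchanging `x` and `y`. -/
def swapEquiv : PS k ≃ₐ[k] PS k := (exists_swap k).choose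

@[simp] theorem swapEquiv_X0 : swapEquiv k (X 0) = X 1 := (exists_swap k).choose_spec.1
@[simp] theorem swapEquiv_X1 : swapEquiv k (X 1) = X 0 := (exists_swap k).choose_spec.2.1
@[simp] theorem swapEquiv_X2 : swapEquiv k (X 2) = X 2 := (exists_swap k).choose_spec.2.2

theorem coeff_swapEquiv (f : PS k) (n : Fin 3 →₀ ℕ) :
    coeff n (swapEquiv k f) = coeff (swapExp n) f := by
  classical
  let L : PS k →ₗ[k] PS k :=
    { toFun := fun f => mkPS fun n => coeff (swapExp n) f
      map_add' := fun f g => by ext n; simp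
      map_smul' := fun c f => by ext n; simp }
  have hLa : ∀ f n, coeff n (L f) = coeff (swapExp n) f := fun f n => rfl
  have hL : Cont L := by
    intro N
    refine ⟨N, fun f hf => ?_⟩
    rw [mem_mm_pow] at hf ⊢
    intro n hn
    have := hf (swapExp n) hn
    simp only [deg, swapExp_zero, swapExp_one, swapExp_two] at this ⊢
    omega
  have : (swapEquiv k).toAlgHom.toLinearMap = L := by
    refine (cont_algHom _).ext hL fun d => ?_
    have h1 : (swapEquiv k).toAlgHom.toLinearMap (monomial d 1) = monomial (swapExp d) 1 := by
      have a0 : (swapEquiv k).toAlgHom (X 0) = X 1 := swapEquiv_X0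
      have a1 : (swapEquiv k).toAlgHom (X 1) = X 0 := swapEquiv_X1
      have a2 : (swapEquiv k).toAlgHom (X 2) = X 2 := swapEquiv_X2
      rw [AlgHom.toLinearMap_apply, algHom_monomial, monomial_eq, a0, a1, a2, swapExp_zero,
        swapExp_one, swapExp_two]
      ring
    rw [h1]
    ext n
    rw [hLa, coeff_monomial, coeff_monomial]
    have : n = swapExp d ↔ swapExp n = d := by
      constructor
      · rintro rfl; exact swapExp_swapExp d
      · rintro rfl; exact (swapExp_swapExp n).symm
    simp only [this]
  have h2 := congrArg (fun L => coeff n (L f)) this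
  exact h2

theorem map_equiv_symm_mem {R : IdealisticFiltration (PS k)} (τ : PS k ≃ₐ[k] PS k) {f : PS k}
    {n : ℕ} : f ∈ (R.map τ.toAlgHom.toRingHom).level n ↔ ∃ g ∈ R.level n, τ g = f := by
  have : f ∈ (R.map τ.toAlgHom.toRingHom).level n ↔ τ.symm f ∈ R.level n :=
    IdealisticFiltration.mem_map_equiv τ.toRingEquiv R
  rw [this]
  constructor
  · intro h
    exact ⟨_, h, by simp⟩
  · rintro ⟨g, hg, rfl⟩
    simpa using hg

theorem mul_pow_mem_suppIn {U : (Fin 3 →₀ ℕ) → Prop} {i j c : ℕ} {Y : PS k}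
    (hY : Y ∈ suppIn fun n => n 2 ≤ 1) (h : ∀ n, i ≤ n 0 → j ≤ n 1 → n 2 ≤ c → U n) :
    X 0 ^ i * X 1 ^ j * Y ^ c ∈ suppIn U := by
  have hpow : Y ^ c ∈ suppIn fun n => n 2 ≤ c := by
    induction c generalizing U with
    | zero =>
      rw [pow_zero]
      exact suppIn_mono (fun n hn => hn.le) one_mem_suppIn
    | succ c ih =>
      rw [pow_succ]
      refine mul_mem_suppIn (ih (U := fun n => n 2 ≤ c) (fun n _ _ h => h)) hY fun a ha b hb => ?_
      simp; omega
  intro n hn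
  refine h n ?_ ?_ ?_
  · exact X_pow_dvd_iff.1 (⟨X 1 ^ j * Y ^ c, by ring⟩ : X 0 ^ i ∣ X 0 ^ i * X 1 ^ j * Y ^ c) n hn
  · exact X_pow_dvd_iff.1 (⟨X 0 ^ i * Y ^ c, by ring⟩ : X 1 ^ j ∣ X 0 ^ i * X 1 ^ j * Y ^ c) n hn
  · obtain ⟨a', b', rfl, ha', hb'⟩ := exists_of_coeff_mul_ne_zero hn
    have : (X 0 ^ i * X 1 ^ j : PS k) ∈ suppIn fun n => n 2 = 0 :=
      mul_mem_suppInZ (pow_mem_suppInZ (X_mem_suppIn (by simp)) _)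
        (pow_mem_suppInZ (X_mem_suppIn (by simp)) _)
    have h2 := this a' ha'
    have h3 := hpow b' hb'
    simp [h2]
    exact h3

variable {p e a α β : ℕ} [Fact p.Prime] [CharP k p] {R : IdealisticFiltration (PS k)} {h : PS k}

theorem ZMonic.shift (hh : ZMonic (p ^ e) h) {w : PS k} (hw : w ∈ suppIn fun n => n 2 = 0)
    (hm : w ∈ mm k) {τ : PS k ≃ₐ[k] PS k} (h0 : τ (X 0) = X 0) (h1 : τ (X 1) = X 1)
    (h2 : τ (X 2) = X 2 + w) : ZMonic (p ^ e) (τ h) := by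
  have hX2 : (X 2 + w : PS k) ∈ suppIn fun n => n 2 ≤ 1 :=
    Submodule.add_mem _ (X_mem_suppIn (by simp)) (suppIn_mono (fun n hn => by simp [hn]) hw)
  have hq : 0 < p ^ e := Nat.pos_of_ne_zero (pNZ p e)
  refine zMonic_of_sub_mem ?_
  have : τ h - X 2 ^ p ^ e = τ.toAlgHom (h - X 2 ^ p ^ e) + w ^ p ^ e := by
    have h3 : τ.toAlgHom (h - X 2 ^ p ^ e) = τ h - τ (X 2) ^ p ^ e := by simp
    rw [h3, h2, add_pow_q]; ring
  rw [this]
  refine Submodule.add_mem _ ?_ ?_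
  · refine algHom_mem_suppIn _ hh.sub_mem fun d hd => ?_
    have h3 : τ.toAlgHom (monomial d 1) = X 0 ^ d 0 * X 1 ^ d 1 * (X 2 + w) ^ d 2 := by
      rw [algHom_monomial]; simp [h0, h1, h2]
    rw [h3]
    exact mul_pow_mem_suppIn hX2 fun n h0 h1 h2 => by omega
  · intro n hn
    have hz := pow_mem_suppInZ hw (p ^ e) n hn
    refine ⟨by simp [hz, hq], ?_⟩
    have h4 := mem_mm_pow.1 (Ideal.pow_mem_pow hm (p ^ e)) n hn
    simp only [deg, hz] at h4
    omega

theorem Frame.shift (F : Frame p e a α β R h) {w : PS k} (hw : w ∈ suppIn fun n => n 2 = 0)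
    (hm : w ∈ mm k) {τ : PS k ≃ₐ[k] PS k} (h0 : τ (X 0) = X 0) (h1 : τ (X 1) = X 1)
    (h2 : τ (X 2) = X 2 + w) : Frame p e a α β (R.map τ.toAlgHom.toRingHom) (τ h) := by
  have hX2 : (X 2 + w : PS k) ∈ suppIn fun n => n 2 ≤ 1 :=
    Submodule.add_mem _ (X_mem_suppIn (by simp)) (suppIn_mono (fun n hn => by simp [hn]) hw)
  refine ⟨F.a_pos, map_equiv_symm_mem τ |>.2 ⟨h, F.h_mem, rfl⟩, F.monic.shift hw hm h0 h1 h2,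
    map_equiv_symm_mem τ |>.2 ⟨_, F.mono_mem, by simp [h0, h1]⟩, ?_, ?_⟩
  · intro l n f hf
    obtain ⟨g, hg, rfl⟩ := (map_equiv_symm_mem τ).1 hf
    refine (map_equiv_symm_mem τ).2 ⟨_, F.sat l n g hg, ?_⟩
    have := hasse_algHom τ.toAlgHom one_mem_suppIn hw (h0.symm ▸ X_mem_suppIn (by simp))
      (h1.symm ▸ X_mem_suppIn (by simp)) (by rw [one_mul]; exact h2) n g
    rw [one_pow, one_mul] at this
    exact this.symm
  · intro l f hf
    obtain ⟨g, hg, rfl⟩ := (map_equiv_symm_mem τ).1 hf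
    obtain ⟨v, g', rfl, hg'⟩ := F.const l g hg
    refine ⟨τ v, τ g', by simp, ?_⟩
    refine algHom_mem_suppIn τ.toAlgHom hg' fun d hd => ?_
    have h3 : τ.toAlgHom (monomial d 1) = X 0 ^ d 0 * X 1 ^ d 1 * (X 2 + w) ^ d 2 := by
      rw [algHom_monomial]; simp [h0, h1, h2]
    rw [h3]
    exact mul_pow_mem_suppIn hX2 fun n h0 h1 h2 =>
      ⟨hd.1.trans (Nat.mul_le_mul_left _ h0), hd.2.trans (Nat.mul_le_mul_left _ h1)⟩

omit [Fact p.Prime] [CharP k p] in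
theorem Frame.swap (F : Frame p e a α β R h) :
    Frame p e a β α (R.map (swapEquiv k).toAlgHom.toRingHom) (swapEquiv k h) := by
  have hsupp : ∀ {U V : (Fin 3 →₀ ℕ) → Prop} {f : PS k}, f ∈ suppIn U → (∀ n, U (swapExp n) → V n) →
      swapEquiv k f ∈ suppIn V := by
    intro U V f hf hUV n hn
    rw [coeff_swapEquiv] at hn
    exact hUV n (hf _ hn)
  refine ⟨F.a_pos, map_equiv_symm_mem _ |>.2 ⟨h, F.h_mem, rfl⟩, ?_,
    map_equiv_symm_mem _ |>.2 ⟨_, F.mono_mem, by simp [mul_comm]⟩, ?_, ?_⟩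
  · refine zMonic_of_sub_mem ?_
    have : swapEquiv k h - X 2 ^ p ^ e = swapEquiv k (h - X 2 ^ p ^ e) := by simp
    rw [this]
    refine hsupp F.monic.sub_mem fun n hn => ?_
    simp at hn
    omega
  · intro l n f hf
    obtain ⟨g, hg, rfl⟩ := (map_equiv_symm_mem _).1 hf
    refine (map_equiv_symm_mem _).2 ⟨_, F.sat l n g hg, ?_⟩
    have := hasse_algHom (swapEquiv k).toAlgHom one_mem_suppIn (zero_mem _)
      (by simpa using X_mem_suppIn (by simp)) (by simpa using X_mem_suppIn (by simp))
      (by simp) n g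
    rw [one_pow, one_mul] at this
    exact this.symm
  · intro l f hf
    obtain ⟨g, hg, rfl⟩ := (map_equiv_symm_mem _).1 hf
    obtain ⟨v, g', rfl, hg'⟩ := F.const l g hg
    refine ⟨_, _, map_add (swapEquiv k) _ _ |>.trans (by rw [map_mul]), ?_⟩
    refine hsupp hg' fun n hn => ?_
    simp at hn
    exact ⟨hn.2, hn.1⟩

end Shift

/-! ### Cleaning of the constant term of `h` with respect to a weight. -/

section Adapt
variable {k : Type u} [Field k]

/-- All monomials of `h` other than `z ^ q` are of degree greater than `q`. -/
def Strong (q : ℕ) (h : PS k) : Prop := h - X 2 ^ q ∈ mm k ^ (q + 1)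

theorem Strong.mem {q : ℕ} {h : PS k} (S : Strong q h) : h ∈ mm k ^ q := by
  have h1 := Ideal.add_mem _ (Ideal.pow_le_pow_right (Nat.le_succ q) S)
    (Ideal.pow_mem_pow (X_mem_mm (k := k) 2) q)
  simpa using h1

theorem Strong.deg_lt {q : ℕ} {h : PS k} (S : Strong q h) {n : Fin 3 →₀ ℕ} (hn : coeff n h ≠ 0)
    (hne : n ≠ Finsupp.single 2 q) : q < deg n := by
  classical
  refine mem_mm_pow.1 S n ?_
  rwa [map_sub, X_pow_eq, coeff_monomial, if_neg hne, sub_zero]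

theorem Strong.deg_lt_of_zero {q : ℕ} {h : PS k} (S : Strong q h) {n : Fin 3 →₀ ℕ}
    (hn : coeff n h ≠ 0) (h2 : n 2 = 0) (hq : 0 < q) : q < n 0 + n 1 := by
  have := S.deg_lt hn (by rintro rfl; simp at h2; omega)
  simp only [deg, h2] at this
  omega

/-- The part of `h` which is not a constant, nor the leading term, with respect to `z`. -/
theorem exists_mid {q : ℕ} (hq : 0 < q) {h : PS k} (hh : ZMonic q h) :
    ∃ m c : PS k, h = X 2 ^ q + m + c ∧ (∀ n, coeff n m = if 0 < n 2 ∧ n 2 < q then coeff n h else 0) ∧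
      (∀ n, coeff n c = if n 2 = 0 then coeff n h else 0) := by
  classical
  obtain ⟨m, hm⟩ : ∃ m : PS k, ∀ n, coeff n m = if 0 < n 2 ∧ n 2 < q then coeff n h else 0 :=
    ⟨mkPS fun n => if 0 < n 2 ∧ n 2 < q then coeff n h else 0, fun n => rfl⟩
  obtain ⟨c, hc⟩ : ∃ c : PS k, ∀ n, coeff n c = if n 2 = 0 then coeff n h else 0 :=
    ⟨mkPS fun n => if n 2 = 0 then coeff n h else 0, fun n => rfl⟩
  refine ⟨m, c, ?_, hm, hc⟩
  ext n
  rw [map_add, map_add, hm, hc, X_pow_eq, coeff_monomial]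
  by_cases h1 : n = Finsupp.single 2 q
  · subst h1
    simp [hh.top, hq.ne']
  · rw [if_neg h1]
    by_cases h0 : coeff n h = 0
    · simp [h0]
    · have := (hh.low n h0 h1).1
      by_cases h2 : n 2 = 0
      · simp [h2]
      · simp [h2, Nat.pos_of_ne_zero h2, this]

variable {p e a α β : ℕ} [Fact p.Prime] [CharP k p] {R : IdealisticFiltration (PS k)} {h : PS k}

theorem exists_of_coeff_pow_q_ne_zero {e : ℕ} {w : PS k} {n : Fin 3 →₀ ℕ}
    (hn : coeff n (w ^ p ^ e) ≠ 0) : ∃ m, n = p ^ e • m ∧ coeff m w ≠ 0 := by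
  obtain ⟨m, rfl⟩ := exists_smul_of_dvd (q := p ^ e) (n := n) fun i => by
    by_contra hi
    exact hn (coeff_pow_q_of_not_dvd p e w hi)
  refine ⟨m, rfl, fun h0 => hn ?_⟩
  rw [coeff_pow_q_smul, h0, zero_pow (pNZ p e)]

/-- With `x`, `y`, `z` of weights `q ω0`, `q ω1`, `r`, the term `z ^ q` has weight `q r`. If `r / q`
does not exceed the weight of `x^(α/a) y^(β/a)`, the intermediate terms of `h` are at least as
heavy. The parameter `s` is 1 when the inequality is strict, and then they are strictly heavier. -/
theorem Frame.mem_mid (F : Frame p e a α β R h) {ω0 ω1 r s : ℕ} (hs : s ≤ 1)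
    (hr : a * r + s ≤ p ^ e * (ω0 * α + ω1 * β)) {m : PS k}
    (hm : ∀ n, coeff n m = if 0 < n 2 ∧ n 2 < p ^ e then coeff n h else 0) :
    m ∈ wIdeal ![p ^ e * ω0, p ^ e * ω1, r] (p ^ e * r + s) := by
  intro n hn
  rw [hm] at hn
  by_cases hc : 0 < n 2 ∧ n 2 < p ^ e
  swap
  · exact absurd (if_neg hc) hn
  rw [if_pos hc] at hn
  obtain ⟨h0, h1⟩ := F.mid hn hc.1 hc.2
  simp only [wt, Matrix.cons_val_zero, Matrix.cons_val_one, Matrix.cons_val]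
  obtain ⟨l, hl⟩ : ∃ l, p ^ e = l + n 2 := ⟨p ^ e - n 2, by omega⟩
  have hl' : p ^ e - n 2 = l := by omega
  have hl0 : 1 ≤ l := by omega
  rw [hl'] at h0 h1
  generalize p ^ e = q at *
  have h2 : ω0 * (α * l) + ω1 * (β * l) ≤ ω0 * (a * n 0) + ω1 * (a * n 1) :=
    Nat.add_le_add (Nat.mul_le_mul_left _ h0) (Nat.mul_le_mul_left _ h1)
  have h3 : (a * r + s) * l ≤ q * (ω0 * α + ω1 * β) * l := Nat.mul_le_mul_right _ hr
  have h4 : q * (ω0 * (α * l) + ω1 * (β * l)) ≤ q * (ω0 * (a * n 0) + ω1 * (a * n 1)) :=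
    Nat.mul_le_mul_left _ h2
  have h5 : a * (q * r) + s ≤ a * (q * ω0 * n 0 + q * ω1 * n 1 + r * n 2) := by
    have e1 : a * (q * r) = a * r * l + a * r * n 2 := by rw [hl]; ring
    have : s ≤ s * l := Nat.le_mul_of_pos_right _ hl0
    rw [e1]
    nlinarith
  by_contra hlt
  push Not at hlt
  rcases Nat.le_one_iff_eq_zero_or_eq_one.1 hs with rfl | rfl
  · have := Nat.mul_lt_mul_of_pos_left hlt F.a_pos
    simp at this h5
    omega
  · have := Nat.mul_le_mul_left a (Nat.le_of_lt_succ hlt)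
    omega

/-- The effect of a shift of `z` on the coefficients of small weight. -/
theorem Frame.coeff_shift (F : Frame p e a α β R h) {w : PS k} {τ : PS k ≃ₐ[k] PS k} (h0 : τ (X 0) = X 0) (h1 : τ (X 1) = X 1)
    (h2 : τ (X 2) = X 2 + w) {ω0 ω1 r s : ℕ} (hs : s ≤ 1)
    (hr : a * r + s ≤ p ^ e * (ω0 * α + ω1 * β))
    (hw : ∀ m, coeff m w ≠ 0 → r ≤ p ^ e * (ω0 * m 0 + ω1 * m 1)) {n : Fin 3 →₀ ℕ}
    (hn2 : n 2 = 0) (hn : ω0 * n 0 + ω1 * n 1 < r + s) :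
    coeff n (τ h) = coeff n h + coeff n (w ^ p ^ e) := by
  classical
  have hq : 0 < p ^ e := Nat.pos_of_ne_zero (pNZ p e)
  obtain ⟨m, c, hh, hm, hc⟩ := exists_mid hq F.monic
  have hc2 : c ∈ suppIn fun n => n 2 = 0 := by
    intro n hn
    rw [hc] at hn
    by_contra h0
    exact hn (if_neg h0)
  have hm' := F.mem_mid hs hr hm
  -- As `w` is of weight at least `r`, the translation does not lower weights. Hence the
  -- intermediate terms contribute nothing at `n`, and only `z ^ q ↦ z ^ q + w ^ q` matters.
  have hτ : ∀ i, τ.toAlgHom (X i) ∈ wIdeal (k := k) ![p ^ e * ω0, p ^ e * ω1, r]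
      ((![p ^ e * ω0, p ^ e * ω1, r] : Fin 3 → ℕ) i) := by
    intro i
    fin_cases i
    · have := X_mem_wIdeal (k := k) ![p ^ e * ω0, p ^ e * ω1, r] 0
      rw [← h0] at this
      exact this
    · have := X_mem_wIdeal (k := k) ![p ^ e * ω0, p ^ e * ω1, r] 1
      rw [← h1] at this
      exact this
    · have h3 : w ∈ wIdeal ![p ^ e * ω0, p ^ e * ω1, r] r := by
        intro l hl
        have := hw l hl
        simp only [wt, Matrix.cons_val_zero, Matrix.cons_val_one, Matrix.cons_val]
        nlinarith
      have h4 := Ideal.add_mem _ (X_mem_wIdeal ![p ^ e * ω0, p ^ e * ω1, r] 2) h3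
      rw [← h2] at h4
      exact h4
  have hτm := algHom_mem_wIdeal τ.toAlgHom hτ hm'
  have hcm : coeff n (τ m) = 0 := by
    by_contra hne
    have h5 := hτm n hne
    simp only [wt, Matrix.cons_val_zero, Matrix.cons_val_one, Matrix.cons_val, hn2] at h5
    have h6 : p ^ e * r + s ≤ p ^ e * (ω0 * n 0 + ω1 * n 1) := by nlinarith
    rcases Nat.le_one_iff_eq_zero_or_eq_one.1 hs with rfl | rfl
    · have := Nat.le_of_mul_le_mul_left h6 hq
      omega
    · have := lt_of_mul_lt_mul_left (lt_of_lt_of_le (Nat.lt_succ_self _) h6) (Nat.zero_le _)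
      omega
  have hτc : τ c = c := algHom_eq_self τ.toAlgHom h0 h1 hc2
  have hz : coeff n (X 2 ^ p ^ e : PS k) = 0 := by
    rw [X_pow_eq, coeff_monomial, if_neg]
    rintro rfl
    exact hq.ne' (by simpa using hn2)
  have hmn : coeff n m = 0 := by rw [hm, if_neg]; omega
  rw [hh]
  simp only [map_add, map_pow, h2, hτc, add_pow_q, hcm, hz, hmn]
  ring

variable (q a α β) in
/-- `h` is adapted with respect to a weight of `x` and `y`: the monomials of minimal weight of its
constant term cannot be removed by a shift of `z`. -/
def Adapted (q a α β : ℕ) (h : PS k) (ω0 ω1 : ℕ) : Prop :=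
  (∀ n, n 2 = 0 → coeff n h ≠ 0 → q * (ω0 * α + ω1 * β) ≤ a * (ω0 * n 0 + ω1 * n 1)) ∨
  ∃ n, n 2 = 0 ∧ coeff n h ≠ 0 ∧ a * (ω0 * n 0 + ω1 * n 1) < q * (ω0 * α + ω1 * β) ∧
    (¬ ∀ i, q ∣ n i) ∧ ∀ m, m 2 = 0 → coeff m h ≠ 0 → ω0 * n 0 + ω1 * n 1 ≤ ω0 * m 0 + ω1 * m 1

/-- `τ` is a coordinate change, changing `z` only, which preserves the properties of `h`. -/
structure Adjust (p e a α β : ℕ) (R : IdealisticFiltration (PS k)) (h : PS k)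
    (τ : PS k ≃ₐ[k] PS k) : Prop where
  X0 : τ (X 0) = X 0
  X1 : τ (X 1) = X 1
  frame : Frame p e a α β (R.map τ.toAlgHom.toRingHom) (τ h)
  strong : Strong (p ^ e) (τ h)
  adapted : ∀ ω0 ω1, Adapted (p ^ e) a α β h ω0 ω1 → Adapted (p ^ e) a α β (τ h) ω0 ω1

theorem map_trans (R : IdealisticFiltration (PS k)) (τ τ' : PS k ≃ₐ[k] PS k) :
    (R.map τ.toAlgHom.toRingHom).map τ'.toAlgHom.toRingHom =
      R.map (τ.trans τ').toAlgHom.toRingHom :=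
  IdealisticFiltration.map_map _ _ _

theorem map_refl (R : IdealisticFiltration (PS k)) :
    R.map (AlgEquiv.refl : PS k ≃ₐ[k] PS k).toAlgHom.toRingHom = R := by
  ext n f
  rw [map_equiv_symm_mem]
  simp

omit [Fact p.Prime] [CharP k p] in
theorem Adjust.refl (F : Frame p e a α β R h) (S : Strong (p ^ e) h) :
    Adjust p e a α β R h AlgEquiv.refl :=
  ⟨rfl, rfl, by rw [map_refl]; exact F, S, fun _ _ h => h⟩

omit [Fact p.Prime] [CharP k p] in
theorem Adjust.trans {τ τ' : PS k ≃ₐ[k] PS k} (A : Adjust p e a α β R h τ)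
    (A' : Adjust p e a α β (R.map τ.toAlgHom.toRingHom) (τ h) τ') :
    Adjust p e a α β R h (τ.trans τ') := by
  refine ⟨?_, ?_, ?_, A'.strong, fun _ _ h => A'.adapted _ _ (A.adapted _ _ h)⟩
  · rw [AlgEquiv.trans_apply, A.X0, A'.X0]
  · rw [AlgEquiv.trans_apply, A.X1, A'.X1]
  · have := A'.frame
    rwa [map_trans] at this

/-- A shift of `z` by a series whose `q`-th power is supported in the support of `h`. -/
theorem Frame.exists_adjust (F : Frame p e a α β R h) (S : Strong (p ^ e) h) {w : PS k}
    (hw2 : w ∈ suppIn fun n => n 2 = 0) (hw : ∀ m, coeff m w ≠ 0 → coeff (p ^ e • m) h ≠ 0) :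
    ∃ τ, Adjust p e a α β R h τ ∧ τ (X 2) = X 2 + w := by
  have hq : 0 < p ^ e := Nat.pos_of_ne_zero (pNZ p e)
  -- If `m` occurs in `w`, then `q • m` occurs in `h`, so its degree exceeds `q` and `m` has degree
  -- at least 2. This keeps `h` strong.
  have hwm : w ∈ mm k ^ 2 := by
    rw [mem_mm_pow]
    intro n hn
    have h2 := hw2 n hn
    have := S.deg_lt_of_zero (hw n hn) (by simp [h2]) hq
    simp only [Finsupp.smul_apply, smul_eq_mul, ← mul_add] at this
    simp only [deg]
    by_contra hlt
    have : p ^ e * (n 0 + n 1) ≤ p ^ e * 1 := Nat.mul_le_mul_left _ (by omega)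
    omega
  have hwm1 : w ∈ mm k := Ideal.pow_le_self two_ne_zero hwm
  obtain ⟨τ, h0, h1, h2⟩ := exists_shift hw2 hwm1
  refine ⟨τ, ⟨h0, h1, F.shift hw2 hwm1 h0 h1 h2, ?_, ?_⟩, h2⟩
  · have : τ h - X 2 ^ p ^ e = τ.toAlgHom (h - X 2 ^ p ^ e) + w ^ p ^ e := by
      have h3 : τ.toAlgHom (h - X 2 ^ p ^ e) = τ h - τ (X 2) ^ p ^ e := by simp
      rw [h3, h2, add_pow_q]; ring
    rw [Strong, this]
    refine Ideal.add_mem _ (algHom_mem_mm_pow _ S) ?_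
    have := Ideal.pow_mem_pow hwm (p ^ e)
    rw [← pow_mul] at this
    exact Ideal.pow_le_pow_right (by omega) this
  -- Since `w ^ q` is supported in the support of `h`, no monomial appears below the existing ones,
  -- and exponents not divisible by `q` keep their coefficients. Hence adaptedness for one weight
  -- survives cleaning for another.
  · have hwq : ∀ n, coeff n (w ^ p ^ e) ≠ 0 → coeff n h ≠ 0 := by
      intro n hn
      obtain ⟨m, rfl, hm⟩ := exists_of_coeff_pow_q_ne_zero hn
      exact hw m hm
    rintro ω0 ω1 (hgood | ⟨n, hn2, hn, hlt, hnd, hmin⟩)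
    · refine Or.inl fun n hn2 hn => ?_
      by_contra hlt
      push Not at hlt
      rw [F.coeff_shift h0 h1 h2 le_rfl (Nat.succ_le_of_lt hlt) ?_ hn2 (Nat.lt_succ_self _)] at hn
      · have hnh : coeff n h = 0 := by
          by_contra hne
          exact absurd (hgood n hn2 hne) (not_le.2 hlt)
        rw [hnh, zero_add] at hn
        exact hwq n hn hnh
      · intro m hm
        have h3 := hgood _ (by simp [hw2 m hm]) (hw m hm)
        have h4 := lt_of_mul_lt_mul_left (lt_of_lt_of_le hlt h3) (Nat.zero_le _)
        simp only [Finsupp.smul_apply, smul_eq_mul] at h4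
        nlinarith
    · have hsh : ∀ m, m 2 = 0 → ω0 * m 0 + ω1 * m 1 ≤ ω0 * n 0 + ω1 * n 1 →
          coeff m (τ h) = coeff m h + coeff m (w ^ p ^ e) := by
        intro m hm2 hm
        refine F.coeff_shift h0 h1 h2 le_rfl (Nat.succ_le_of_lt hlt) ?_ hm2
          (Nat.lt_succ_of_le hm)
        intro m hm
        have h3 := hmin _ (by simp [hw2 m hm]) (hw m hm)
        simp only [Finsupp.smul_apply, smul_eq_mul] at h3
        nlinarith
      refine Or.inr ⟨n, hn2, ?_, hlt, hnd, fun m hm2 hm => ?_⟩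
      · rw [hsh n hn2 le_rfl]
        have : coeff n (w ^ p ^ e) = 0 := by
          by_contra hne
          obtain ⟨m, rfl, -⟩ := exists_of_coeff_pow_q_ne_zero hne
          exact hnd fun i => by simp
        rwa [this, add_zero]
      · by_contra hlt'
        push Not at hlt'
        rw [hsh m hm2 hlt'.le] at hm
        have hmh : coeff m h = 0 := by
          by_contra hne
          exact absurd (hmin m hm2 hne) (not_le.2 hlt')
        rw [hmh, zero_add] at hm
        exact hwq m hm hmh

/-- Removal of a set of `q`-th powers of monomials by a shift. -/
theorem Frame.exists_remove [IsAlgClosed k] (F : Frame p e a α β R h) (S : Strong (p ^ e) h)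
    (U : (Fin 3 →₀ ℕ) → Prop) (hU2 : ∀ n, U n → n 2 = 0)
    (hU : ∀ n, U n → coeff n h ≠ 0 → ∀ i, p ^ e ∣ n i) {ω0 ω1 r : ℕ}
    (hr : a * r < p ^ e * (ω0 * α + ω1 * β))
    (hUr : ∀ n, U n → coeff n h ≠ 0 → r ≤ ω0 * n 0 + ω1 * n 1) :
    ∃ τ, Adjust p e a α β R h τ ∧ ∀ n, n 2 = 0 → ω0 * n 0 + ω1 * n 1 ≤ r →
      (U n → coeff n (τ h) = 0) ∧ (¬ U n → coeff n (τ h) = coeff n h) := by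
  classical
  obtain ⟨g, hg⟩ : ∃ g : PS k, ∀ n, coeff n g = if U n then - coeff n h else 0 :=
    ⟨mkPS fun n => if U n then - coeff n h else 0, fun n => rfl⟩
  have hgU : ∀ n, coeff n g ≠ 0 → U n ∧ coeff n h ≠ 0 := by
    intro n hn
    rw [hg] at hn
    by_cases hUn : U n
    · rw [if_pos hUn] at hn
      exact ⟨hUn, fun h0 => hn (by rw [h0, neg_zero])⟩
    · exact absurd (if_neg hUn) hn
  obtain ⟨w, hw⟩ := exists_pow_q_eq p e g fun n hn => hU n (hgU n hn).1 (hgU n hn).2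
  have hwm : ∀ m, coeff m w ≠ 0 → U (p ^ e • m) ∧ coeff (p ^ e • m) h ≠ 0 := by
    intro m hm
    refine hgU _ ?_
    rw [← hw, coeff_pow_q_smul]
    exact pow_ne_zero _ hm
  have hw2 : w ∈ suppIn fun n => n 2 = 0 := by
    intro m hm
    have := hU2 _ (hwm m hm).1
    simpa [pNZ p e, (Fact.out : p.Prime).ne_zero] using this
  obtain ⟨τ, A, h2⟩ := F.exists_adjust S hw2 fun m hm => (hwm m hm).2
  refine ⟨τ, A, fun n hn2 hn => ?_⟩
  rw [F.coeff_shift A.X0 A.X1 h2 le_rfl (Nat.succ_le_of_lt hr) ?_ hn2 (Nat.lt_succ_of_le hn),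
    hw, hg]
  · constructor
    · intro hUn
      rw [if_pos hUn, add_neg_cancel]
    · intro hUn
      rw [if_neg hUn, add_zero]
  · intro m hm
    have := hUr _ (hwm m hm).1 (hwm m hm).2
    simp only [Finsupp.smul_apply, smul_eq_mul] at this
    nlinarith

/-- Let `r` bound the weights of the constant term from below. If `h` is not adapted, all monomials
of weight `r` are `q`-th powers and a translation removes them, so `r` increases. Since `a ≥ 1`, the
process has stopped when `r` reaches `q (ω0 α + ω1 β)`. -/
theorem Frame.exists_adapted [IsAlgClosed k] (ω0 ω1 : ℕ) (F : Frame p e a α β R h)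
    (S : Strong (p ^ e) h) :
    ∃ τ, Adjust p e a α β R h τ ∧ Adapted (p ^ e) a α β (τ h) ω0 ω1 := by
  have main : ∀ N r : ℕ, p ^ e * (ω0 * α + ω1 * β) ≤ r + N →
      ∀ (R : IdealisticFiltration (PS k)) (h : PS k), Frame p e a α β R h → Strong (p ^ e) h →
      (∀ n, n 2 = 0 → coeff n h ≠ 0 → r ≤ ω0 * n 0 + ω1 * n 1) →
      ∃ τ, Adjust p e a α β R h τ ∧ Adapted (p ^ e) a α β (τ h) ω0 ω1 := by
    intro N
    induction N with
    | zero =>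
      intro r hr R h F S hmin
      refine ⟨_, Adjust.refl F S, Or.inl fun n hn2 hn => ?_⟩
      have := hmin n hn2 hn
      exact hr.trans (this.trans (Nat.le_mul_of_pos_left _ F.a_pos))
    | succ N ih =>
      intro r hr R h F S hmin
      by_cases hA : Adapted (p ^ e) a α β h ω0 ω1
      · exact ⟨_, Adjust.refl F S, hA⟩
      by_cases hrr : a * r < p ^ e * (ω0 * α + ω1 * β)
      swap
      · exact absurd (Or.inl fun n hn2 hn => (not_lt.1 hrr).trans
          (Nat.mul_le_mul_left _ (hmin n hn2 hn))) hA
      have hdiv : ∀ n, n 2 = 0 ∧ ω0 * n 0 + ω1 * n 1 = r → coeff n h ≠ 0 → ∀ i, p ^ e ∣ n i := by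
        intro n hn hne
        by_contra hnd
        exact hA (Or.inr ⟨n, hn.1, hne, by rw [hn.2]; exact hrr, hnd, fun m hm2 hm => by
          rw [hn.2]; exact hmin m hm2 hm⟩)
      obtain ⟨τ, A, hτ⟩ := F.exists_remove S (fun n => n 2 = 0 ∧ ω0 * n 0 + ω1 * n 1 = r)
        (fun n hn => hn.1) hdiv hrr (fun n hn _ => hn.2.ge)
      have hmin' : ∀ n, n 2 = 0 → coeff n (τ h) ≠ 0 → r + 1 ≤ ω0 * n 0 + ω1 * n 1 := by
        intro n hn2 hn
        by_contra hlt
        obtain ⟨hz, hnz⟩ := hτ n hn2 (by omega)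
        by_cases hnr : ω0 * n 0 + ω1 * n 1 = r
        · exact hn (hz ⟨hn2, hnr⟩)
        · rw [hnz fun h => hnr h.2] at hn
          have := hmin n hn2 hn
          omega
      obtain ⟨τ', A', hA'⟩ := ih (r + 1) (by omega) _ _ A.frame A.strong hmin'
      exact ⟨_, A.trans A', hA'⟩
  exact main (p ^ e * (ω0 * α + ω1 * β)) 0 (by omega) R h F S fun _ _ _ => Nat.zero_le _

end Adapt

/-! ### Good and bad divisors, and their behaviour under automorphisms. -/

section GoodBad
variable {k : Type u} [Field k]

/-- The divisor `X i = 0` is good. -/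
def Good (q a α : ℕ) (i : Fin 3) (h : PS k) : Prop :=
  ∀ n, n 2 = 0 → coeff n h ≠ 0 → q * α ≤ a * n i

/-- The divisor `X i = 0` is bad: `r` is the order of the constant term of `h` and `r + δ` the
smallest degree of a monomial of its initial form which is not a `q`-th power. -/
structure Bad (q a α : ℕ) (i j : Fin 3) (h : PS k) (r δ : ℕ) : Prop where
  lt : a * r < q * α
  min : ∀ n, n 2 = 0 → coeff n h ≠ 0 → r ≤ n i
  lead : ∃ n, n 2 = 0 ∧ n i = r ∧ n j = δ ∧ coeff n h ≠ 0 ∧ ¬ ∀ i, q ∣ n i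
  low : ∀ n, n 2 = 0 → coeff n h ≠ 0 → n i = r → n j < δ → ∀ i, q ∣ n i

theorem good_or_bad {q a α : ℕ} {i j : Fin 3} {h : PS k}
    (H : Good q a α i h ∨ ∃ n, n 2 = 0 ∧ coeff n h ≠ 0 ∧ a * n i < q * α ∧ (¬ ∀ i, q ∣ n i) ∧
      ∀ m, m 2 = 0 → coeff m h ≠ 0 → n i ≤ m i) :
    Good q a α i h ∨ ∃ r δ, Bad q a α i j h r δ := by
  classical
  rcases H with H | ⟨n, hn2, hn, hlt, hnd, hmin⟩
  · exact Or.inl H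
  right
  have hex : ∃ δ, ∃ m, m 2 = 0 ∧ m i = n i ∧ m j = δ ∧ coeff m h ≠ 0 ∧ ¬ ∀ i, q ∣ m i :=
    ⟨_, n, hn2, rfl, rfl, hn, hnd⟩
  refine ⟨n i, Nat.find hex, hlt, hmin, Nat.find_spec hex, fun m hm2 hm hmi hmj => ?_⟩
  by_contra hmd
  exact Nat.find_min hex hmj ⟨m, hm2, hmi, rfl, hm, hmd⟩

theorem Adapted.good_or_bad_x {q a α β : ℕ} {h : PS k} (H : Adapted q a α β h 1 0) :
    Good q a α 0 h ∨ ∃ r δ, Bad q a α 0 1 h r δ := by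
  refine good_or_bad ?_
  simpa [Adapted, Good] using H

theorem Adapted.good_or_bad_y {q a α β : ℕ} {h : PS k} (H : Adapted q a α β h 0 1) :
    Good q a β 1 h ∨ ∃ r δ, Bad q a β 1 0 h r δ := by
  refine good_or_bad ?_
  simpa [Adapted, Good] using H

theorem Good.swap {q a α : ℕ} {i j : Fin 3} {h : PS k} (hij : ∀ n, swapExp n i = n j)
    (H : Good q a α i h) : Good q a α j (swapEquiv k h) := by
  intro n hn2 hn
  rw [coeff_swapEquiv] at hn
  have := H _ (by simpa using hn2) hn
  rwa [hij] at this

theorem swapExp_dvd {q : ℕ} {n : Fin 3 →₀ ℕ} : (∀ i, q ∣ swapExp n i) ↔ ∀ i, q ∣ n i := by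
  simp only [Fin.forall_fin_succ]
  simp
  tauto

theorem Bad.swap {q a α : ℕ} {i j i' j' : Fin 3} {h : PS k} {r δ : ℕ}
    (hi : ∀ n, swapExp n i = n i') (hj : ∀ n, swapExp n j = n j') (B : Bad q a α i j h r δ) :
    Bad q a α i' j' (swapEquiv k h) r δ := by
  refine ⟨B.lt, ?_, ?_, ?_⟩
  · intro n hn2 hn
    rw [coeff_swapEquiv] at hn
    have := B.min _ (by simpa using hn2) hn
    rwa [hi] at this
  · obtain ⟨n, hn2, hni, hnj, hn, hnd⟩ := B.lead
    refine ⟨swapExp n, by simpa using hn2, by rw [← hi, swapExp_swapExp, hni],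
      by rw [← hj, swapExp_swapExp, hnj], by rwa [coeff_swapEquiv, swapExp_swapExp], ?_⟩
    rwa [swapExp_dvd]
  · intro n hn2 hn hni hnj
    rw [coeff_swapEquiv] at hn
    rw [← swapExp_dvd]
    exact B.low _ (by simpa using hn2) hn (by rwa [hi]) (by rwa [hj])

theorem Bad.not_good {q a α : ℕ} {i j : Fin 3} {h : PS k} {r δ : ℕ} (B : Bad q a α i j h r δ) :
    ¬ Good q a α i h := by
  intro H
  obtain ⟨n, hn2, hni, -, hn, -⟩ := B.lead
  have := H n hn2 hn
  have := B.lt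
  rw [hni] at *
  omega

variable {p e a α β : ℕ} [Fact p.Prime] [CharP k p] {R : IdealisticFiltration (PS k)} {h : PS k}

/-- Coordinates in which the lower part of the initial form along a bad divisor vanishes. -/
theorem Frame.exists_normal [IsAlgClosed k] (F : Frame p e a α β R h) (S : Strong (p ^ e) h)
    {r δ : ℕ} (B : Bad (p ^ e) a α 0 1 h r δ) :
    ∃ τ, Adjust p e a α β R h τ ∧
      (∃ n, n 2 = 0 ∧ n 0 = r ∧ n 1 = δ ∧ coeff n (τ h) ≠ 0 ∧ ¬ ∀ i, p ^ e ∣ n i) ∧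
      ∀ n, n 2 = 0 → coeff n (τ h) ≠ 0 → r < n 0 ∨ (n 0 = r ∧ δ ≤ n 1) := by
  obtain ⟨τ, A, hτ⟩ := F.exists_remove S (fun n => n 2 = 0 ∧ n 0 = r ∧ n 1 < δ) (fun n hn => hn.1)
    (fun n hn hne => B.low n hn.1 hne hn.2.1 hn.2.2) (ω0 := 1) (ω1 := 0) (r := r)
    (by simpa using B.lt) (fun n hn hne => by simpa using hn.2.1.ge)
  simp only [one_mul, zero_mul, add_zero] at hτ
  refine ⟨τ, A, ?_, ?_⟩
  · obtain ⟨n, hn2, hn0, hn1, hn, hnd⟩ := B.lead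
    refine ⟨n, hn2, hn0, hn1, ?_, hnd⟩
    rwa [(hτ n hn2 hn0.le).2 (by omega)]
  · intro n hn2 hn
    by_contra hlt
    push Not at hlt
    obtain ⟨hlt, hlt'⟩ := hlt
    obtain ⟨h1, h2⟩ := hτ n hn2 hlt
    by_cases hU : n 2 = 0 ∧ n 0 = r ∧ n 1 < δ
    · exact hn (h1 hU)
    · rw [h2 hU] at hn
      have := B.min n hn2 hn
      have h3 : n 0 = r := le_antisymm hlt this
      have := hlt' h3
      exact hU ⟨hn2, h3, this⟩

/-- The linear part of the image of `z` is a multiple of `z`. -/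
theorem coeff_top_ne_zero {τ : PS k ≃ₐ[k] PS k} {h' : PS k} (hR : h ∈ R.level (p ^ e))
    (hM : ZMonic (p ^ e) h) (S : Strong (p ^ e) h)
    (hR' : h' ∈ (R.map τ.toAlgHom.toRingHom).level (p ^ e)) (S' : Strong (p ^ e) h')
    (hσ : sigma p (R.map τ.toAlgHom.toRingHom) e = 2) :
    coeff (Finsupp.single 2 (p ^ e)) (τ h) ≠ 0 := by
  classical
  set c : Fin 3 → k := fun i => coeff (Finsupp.single i 1) (τ (X 2)) with hc
  have h1 : τ (X 2) - lform c ∈ mm k ^ 2 := sub_lform_mem (algHom_mem_mm τ.toAlgHom (X_mem_mm 2))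
  have h2 : τ h - lform c ^ p ^ e ∈ mm k ^ (p ^ e + 1) := by
    have h3 : τ h - τ (X 2) ^ p ^ e ∈ mm k ^ (p ^ e + 1) := by
      have := algHom_mem_mm_pow τ.toAlgHom S
      simpa using this
    have h4 := pow_q_sub_mem p h1 e
    have h5 := Ideal.add_mem _ h3 (Ideal.pow_le_pow_right (n := 2 * p ^ e) (m := p ^ e + 1) ?_ h4)
    · simpa using h5
    · have := Nat.pos_of_ne_zero (pNZ p e)
      omega
  have h3 : c ∈ leadForms p (R.map τ.toAlgHom.toRingHom) e :=
    ⟨τ h, le_diffSat ((map_equiv_symm_mem τ).2 ⟨h, hR, rfl⟩), h2⟩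
  have hl : lform (Pi.single 2 1 : Fin 3 → k) = X 2 := by
    simp [lform, Fin.sum_univ_three]
  have h4 : (Pi.single 2 1 : Fin 3 → k) ∈ leadForms p (R.map τ.toAlgHom.toRingHom) e := by
    refine ⟨h', le_diffSat hR', ?_⟩
    have := S'
    rw [Strong, ← hl] at this
    exact this
  -- The value 2 of `σ` leaves a line of leading forms. It contains `z`, coming from `h'`, and the
  -- linear part of `τ (X 2)`, coming from `τ h`; the latter is nonzero because `τ` preserves orders
  -- and `h` has order exactly `q`.
  obtain ⟨r, hr⟩ := exists_smul_of_sigma_eq_two p hσ h4 (by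
    intro h0
    have := congrFun h0 2
    simp at this) h3
  have hr0 : r ≠ 0 := by
    rintro rfl
    rw [zero_smul] at hr
    have h5 : lform c = 0 := by rw [hr]; simp [lform]
    rw [h5, zero_pow (pNZ p e), sub_zero, algEquiv_mem_mm_pow] at h2
    have := mem_mm_pow.1 h2 (Finsupp.single 2 (p ^ e)) (by rw [hM.top]; exact one_ne_zero)
    rw [deg_single] at this
    omega
  have h6 : coeff (Finsupp.single 2 (p ^ e)) (τ h - lform c ^ p ^ e) = 0 :=
    coeff_eq_zero_of_mem_mm_pow h2 (by rw [deg_single]; exact Nat.lt_succ_self _)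
  rw [map_sub, sub_eq_zero] at h6
  have h7 : (Finsupp.single 2 (p ^ e) : Fin 3 →₀ ℕ) = p ^ e • Finsupp.single 2 1 := by simp
  rw [h6, h7, coeff_pow_q_smul, coeff_lform, hr]
  simpa using fun h => absurd h hr0

/-- The monomials of lowest weight of a Weierstrass remainder. -/
theorem coeff_eq_zero_of_eq_mul_add {q : ℕ} {h f w g : PS k} (hM : ZMonic q h)
    (hf : f = h * w + g) {v0 v1 M : ℕ} (hv0 : 0 < v0) (hv1 : 0 < v1)
    (hfM : f ∈ wIdeal ![v0, v1, 0] M) (hgM : g ∈ wIdeal ![v0, v1, 0] (M + 1)) {n : Fin 3 →₀ ℕ}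
    (hn : v0 * n 0 + v1 * n 1 = M) (hn2 : n 2 < q) : coeff n f = 0 := by
  have hwt : ∀ n, wt ![v0, v1, 0] n = v0 * n 0 + v1 * n 1 := fun n => by simp [wt]
  by_contra hne
  have hgn : coeff n g = 0 := by
    by_contra h0
    have := hgM n h0
    rw [hwt] at this
    omega
  have h1 : h * w ∈ wIdeal ![v0, v1, 0] M := by
    have := Ideal.sub_mem _ hfM (wIdeal_anti _ (Nat.le_succ M) hgM)
    rwa [hf, add_sub_cancel_right] at this
  have h2 : h ∉ wIdeal ![v0, v1, 0] (0 + 1) := by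
    intro h0
    have := h0 (Finsupp.single 2 q) (by rw [hM.top]; exact one_ne_zero)
    simp [hwt] at this
  have h3 := mem_wIdeal_of_mul_mem h2 h1
  rw [hf, map_add, hgn, add_zero] at hne
  obtain ⟨a', b', rfl, ha', hb'⟩ := exists_of_coeff_mul_ne_zero hne
  have h4 := h3 b' hb'
  rw [hwt] at h4
  simp only [Finsupp.add_apply] at hn hn2
  have h5 : v0 * a' 0 + v1 * a' 1 = 0 := by
    rw [mul_add, mul_add] at hn
    omega
  have h6 : a' 0 = 0 ∧ a' 1 = 0 := by
    constructor
    · by_contra h7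
      have := Nat.mul_pos hv0 (Nat.pos_of_ne_zero h7)
      omega
    · by_contra h7
      have := Nat.mul_pos hv1 (Nat.pos_of_ne_zero h7)
      omega
  have h7 := hM.wt_zero ha' (by omega)
  subst h7
  simp at hn2

omit [Fact p.Prime] [CharP k p] in
/-- The exponent of a monomial of the filtration is bounded below by the monomial of a frame. -/
theorem Frame.mul_le (F : Frame p e a α β R h) {V : PS k} (hV : V ∉ mm k) {l i j : ℕ}
    (hq : 0 < p ^ e) (hf : V * (X 0 ^ i * X 1 ^ j) ∈ R.level l) : α * l ≤ a * i := by
  obtain ⟨w, g, hwg, hg⟩ := F.const l _ hf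
  by_contra hlt
  push Not at hlt
  -- The weight `j + 1` of `x` is so steep that every monomial with exponent of `x` above `i` is
  -- heavier than `x ^ i y ^ j`. If the bound failed, the whole remainder `g` would be heavier, and
  -- `x ^ i y ^ j`, having no `z`, could not come from a multiple of `h`.
  have hwt : ∀ n, wt ![j + 1, 1, 0] n = (j + 1) * n 0 + n 1 := fun n => by simp [wt]
  set n : Fin 3 →₀ ℕ := Finsupp.single 0 i + Finsupp.single 1 j with hn
  have hmon : (X 0 ^ i * X 1 ^ j : PS k) = monomial n 1 := by rw [monomial_eq]; simp [hn]
  have h1 : coeff n (V * (X 0 ^ i * X 1 ^ j)) ≠ 0 := by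
    have := coeff_add_mul_monomial (R := k) 0 n V 1
    rw [zero_add] at this
    rw [hmon, this, mul_one]
    rwa [mem_mm] at hV
  refine h1 (coeff_eq_zero_of_eq_mul_add F.monic hwg (v0 := j + 1) (v1 := 1)
    (M := (j + 1) * i + j) (by omega) (by omega) ?_ ?_ (by simp [hn]) (by simpa [hn] using hq))
  · refine Ideal.mul_mem_left _ _ ?_
    rw [hmon]
    exact monomial_mem_wIdeal (by rw [hwt]; simp [hn]) 1
  · intro m hm
    have h2 := hg m hm
    have h3 : i < m 0 := lt_of_mul_lt_mul_left (lt_of_lt_of_le hlt h2.1) (Nat.zero_le _)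
    rw [hwt]
    have : (j + 1) * (i + 1) ≤ (j + 1) * m 0 := Nat.mul_le_mul_left _ h3
    rw [mul_add, mul_one] at this
    omega

/-- The initial forms along a bad divisor of two leading generators agree in the decisive
exponents. -/
theorem Frame.not_bad_of_higher {a' α' β' : ℕ} {h' : PS k} {τ : PS k ≃ₐ[k] PS k}
    (F : Frame p e a α β R h) (S : Strong (p ^ e) h)
    (F' : Frame p e a' α' β' (R.map τ.toAlgHom.toRingHom) h') (S' : Strong (p ^ e) h')
    (hμ : α * a' = α' * a) (hσ : sigma p (R.map τ.toAlgHom.toRingHom) e = 2)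
    (hX0 : X 0 ∣ τ (X 0)) {n' : Fin 3 →₀ ℕ} (hlt : a' * n' 0 < p ^ e * α') (hn2 : n' 2 = 0)
    (hn : coeff n' h' ≠ 0) (hnd : ¬ ∀ i, p ^ e ∣ n' i)
    (hlow : ∀ n, n 2 = 0 → coeff n h' ≠ 0 → n' 0 < n 0 ∨ (n 0 = n' 0 ∧ n' 1 ≤ n 1))
    (hhigh : ∀ n, n 2 = 0 → coeff n h ≠ 0 →
      p ^ e * α ≤ a * n 0 ∨ n' 0 < n 0 ∨ (n 0 = n' 0 ∧ n' 1 < n 1)) : False := by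
  classical
  have hq : 0 < p ^ e := Nat.pos_of_ne_zero (pNZ p e)
  have htop := coeff_top_ne_zero F.h_mem F.monic S F'.h_mem S' hσ
  obtain ⟨m, c, hh, hm, hc⟩ := exists_mid hq F.monic
  obtain ⟨m', c', hh', hm', hc'⟩ := exists_mid hq F'.monic
  have hdeg := S'.deg_lt_of_zero hn hn2 hq
  have ha := F.a_pos
  have ha' := F'.a_pos
  obtain ⟨w, g, hwg, hg⟩ := F'.const (p ^ e) (τ h) ((map_equiv_symm_mem τ).2 ⟨h, F.h_mem, rfl⟩)
  have hmem_mid : ∀ r, a * r + 1 ≤ p ^ e * ((a' * (n' 1 + 1) + p ^ e) * α + 0 * β) →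
    m ∈ wIdeal ![p ^ e * (a' * (n' 1 + 1) + p ^ e), p ^ e * 0, r] (p ^ e * r + 1) :=
    fun r hr => F.mem_mid le_rfl hr hm
  have hmem_mid' : ∀ r, a' * r + 1 ≤ p ^ e * ((a' * (n' 1 + 1) + p ^ e) * α' + 0 * β') →
    m' ∈ wIdeal ![p ^ e * (a' * (n' 1 + 1) + p ^ e), p ^ e * 0, r] (p ^ e * r + 1) :=
    fun r hr => F'.mem_mid le_rfl hr hm'
  -- `N` makes the pair of exponents of `x` and `y`, compared lexicographically, a linear weight
  -- near `n'`, whose weight is `M`. It exceeds `n' 1`; the term `a' (n' 1 + 1)` puts everything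
  -- divisible by the `q / a'`-th power of the monomial beyond `M`; and `N ≥ q` gives `M ≥ q`.
  generalize hN : a' * (n' 1 + 1) + p ^ e = N at *
  obtain ⟨M, hM⟩ : ∃ M, M = N * n' 0 + n' 1 := ⟨_, rfl⟩
  have hNq : p ^ e ≤ N := by omega
  have hN0 : 0 < N := by omega
  have hN1 : n' 1 < N := by
    have : n' 1 + 1 ≤ a' * (n' 1 + 1) := Nat.le_mul_of_pos_left _ ha'
    omega
  have hMq : p ^ e ≤ M := by
    rcases Nat.eq_zero_or_pos (n' 0) with h0 | h0
    · rw [h0] at hdeg; omega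
    · have : N ≤ N * n' 0 := Nat.le_mul_of_pos_right _ h0
      omega
  have hA' : a' * (M + 1) ≤ N * (p ^ e * α') := by
    have h1 : N * (a' * n' 0 + 1) ≤ N * (p ^ e * α') := Nat.mul_le_mul_left _ hlt
    have h2 : a' * (M + 1) = N * (a' * n' 0) + a' * (n' 1 + 1) := by rw [hM]; ring
    rw [mul_add, mul_one] at h1
    omega
  have hA : a * (M + 1) ≤ N * (p ^ e * α) := by
    have h1 := Nat.mul_le_mul_left a hA'
    have h2 : a * (N * (p ^ e * α')) = a' * (N * (p ^ e * α)) := by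
      calc a * (N * (p ^ e * α')) = N * p ^ e * (α' * a) := by ring
        _ = N * p ^ e * (α * a') := by rw [hμ]
        _ = _ := by ring
    rw [h2] at h1
    refine Nat.le_of_mul_le_mul_left ?_ ha'
    calc a' * (a * (M + 1)) = a * (a' * (M + 1)) := by ring
      _ ≤ _ := h1
  -- For these weights `z ^ q` and the monomial `n'` both have weight `q M`, the least weight
  -- occurring in `h'`. The factor `q` and the bound `M ≥ q` ensure that every non-unit, in
  -- particular the uncontrolled series `τ (X 1)`, is at least as heavy as `y`.
  set v : Fin 3 → ℕ := ![p ^ e * N, p ^ e, M] with hv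
  have hwt : ∀ n, wt v n = p ^ e * N * n 0 + p ^ e * n 1 + M * n 2 := fun n => by simp [wt, hv]
  have hmmv : ∀ f ∈ mm k, f ∈ wIdeal v (p ^ e) := by
    intro f hf n hnf
    rw [← pow_one (mm k)] at hf
    have h1 := mem_mm_pow.1 hf n hnf
    rw [hwt]
    simp only [deg] at h1
    have hNN : p ^ e ≤ p ^ e * N := Nat.le_mul_of_pos_right _ hN0
    rcases Nat.eq_zero_or_pos (n 0) with h0 | h0
    · rcases Nat.eq_zero_or_pos (n 1) with h1 | h1
      · have : M ≤ M * n 2 := Nat.le_mul_of_pos_right _ (by omega)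
        omega
      · have : p ^ e ≤ p ^ e * n 1 := Nat.le_mul_of_pos_right _ h1
        omega
    · have : p ^ e * N ≤ p ^ e * N * n 0 := Nat.le_mul_of_pos_right _ h0
      omega
  have hτ0 : τ (X 0) ∈ wIdeal v (p ^ e * N) := by
    obtain ⟨u, hu⟩ := hX0
    rw [hu]
    exact Ideal.mul_mem_right _ _ (by simpa [hv] using X_mem_wIdeal v 0)
  have hτ1 : τ (X 1) ∈ wIdeal v (p ^ e) := hmmv _ (algHom_mem_mm τ.toAlgHom (X_mem_mm 1))
  have hx : ∀ n : Fin 3 →₀ ℕ, n' 0 < n 0 ∨ (n 0 = n' 0 ∧ n' 1 < n 1) →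
      p ^ e * M + 1 ≤ p ^ e * N * n 0 + p ^ e * n 1 := by
    intro n hnn
    have h1 : M + 1 ≤ N * n 0 + n 1 := by
      rcases hnn with h0 | ⟨h0, h1⟩
      · have := Nat.mul_le_mul_left N h0
        rw [Nat.succ_eq_add_one, mul_add, mul_one] at this
        omega
      · rw [hM, h0]; omega
    have h2 := Nat.mul_le_mul_left (p ^ e) h1
    rw [mul_add, mul_add, mul_one, ← mul_assoc] at h2
    omega
  have hcw : c ∈ wIdeal ![p ^ e * N, p ^ e, 0] (p ^ e * M + 1) := by
    intro n hnc
    rw [hc] at hnc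
    by_cases h2 : n 2 = 0
    swap
    · exact absurd (if_neg h2) hnc
    rw [if_pos h2] at hnc
    simp only [wt, Matrix.cons_val_zero, Matrix.cons_val_one, Matrix.cons_val]
    rcases hhigh n h2 hnc with h3 | h3
    · have h4 : N * (p ^ e * α) ≤ N * (a * n 0) := Nat.mul_le_mul_left _ h3
      have h5 : a * (M + 1) ≤ a * (N * n 0) := by
        refine hA.trans (h4.trans (le_of_eq ?_)); ring
      have h6 := Nat.mul_le_mul_left (p ^ e) (Nat.le_of_mul_le_mul_left h5 ha)
      rw [mul_add, mul_one, ← mul_assoc] at h6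
      omega
    · have := hx n h3
      omega
  have hτc : τ c ∈ wIdeal v (p ^ e * M + 1) := by
    refine algHom_mem_wIdeal τ.toAlgHom (fun i => ?_) hcw
    fin_cases i
    · exact hτ0
    · exact hτ1
    · exact mem_wIdeal_zero _ _
  have hgv : g ∈ wIdeal v (p ^ e * M + 1) := by
    intro n hng
    have h3 := (hg n hng).1
    have h4 : a' * (M + 1) ≤ a' * (N * n 0) := by
      calc a' * (M + 1) ≤ N * (p ^ e * α') := hA'
        _ = N * (α' * p ^ e) := by ring
        _ ≤ N * (a' * n 0) := Nat.mul_le_mul_left _ h3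
        _ = _ := by ring
    have h6 := Nat.mul_le_mul_left (p ^ e) (Nat.le_of_mul_le_mul_left h4 ha')
    rw [mul_add, mul_one, ← mul_assoc] at h6
    rw [hwt]
    omega
  have hτm : ∀ M1 ≤ M, τ (X 2) ∈ wIdeal v M1 → τ m ∈ wIdeal v (p ^ e * M1 + 1) := by
    intro M1 hM1 hz
    have h1 : a * M1 + 1 ≤ p ^ e * (N * α + 0 * β) := by
      have h2 : a * M1 + a ≤ N * (p ^ e * α) :=
        le_trans (by rw [← Nat.mul_succ]; exact Nat.mul_le_mul_left _ (Nat.succ_le_succ hM1)) hA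
      have h3 : p ^ e * (N * α + 0 * β) = N * (p ^ e * α) := by ring
      omega
    refine algHom_mem_wIdeal τ.toAlgHom (fun i => ?_) (hmem_mid M1 h1)
    fin_cases i
    · exact hτ0
    · exact mem_wIdeal_zero _ _
    · exact hz
  have hh'v : h' ∈ wIdeal v (p ^ e * M) := by
    rw [hh']
    refine Ideal.add_mem _ (Ideal.add_mem _ ?_ ?_) ?_
    · exact pow_mem_wIdeal (by simpa [hv] using X_mem_wIdeal v 2) _
    · have h1 : a' * M + 1 ≤ p ^ e * (N * α' + 0 * β') := by
        have h3 : p ^ e * (N * α' + 0 * β') = N * (p ^ e * α') := by ring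
        rw [mul_add, mul_one] at hA'
        omega
      intro n hnm
      have := hmem_mid' M h1 n hnm
      simp only [wt, Matrix.cons_val_zero, Matrix.cons_val_one, Matrix.cons_val] at this
      rw [hwt]
      omega
    · intro n hnc
      rw [hc'] at hnc
      by_cases h2 : n 2 = 0
      swap
      · exact absurd (if_neg h2) hnc
      rw [if_pos h2] at hnc
      rw [hwt]
      have h3 : M ≤ N * n 0 + n 1 := by
        rcases hlow n h2 hnc with h3 | ⟨h3, h4⟩
        · have := Nat.mul_le_mul_left N h3
          rw [Nat.succ_eq_add_one, mul_add, mul_one] at this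
          omega
        · rw [h3, hM]; omega
      have h4 := Nat.mul_le_mul_left (p ^ e) h3
      rw [mul_add, ← mul_assoc] at h4
      omega
  have hid : τ (X 2) ^ p ^ e = h' * w + g - τ m - τ c := by
    rw [← hwg]
    nth_rewrite 1 [hh]
    simp only [map_add, map_pow]
    ring
  -- If `τ (X 2)` had weight `M1 < M`, every term on the right of `hid` would be heavier than `q
  -- M1`, whereas the `q`-th power on the left has weight exactly `q M1`.
  have hzM : τ (X 2) ∈ wIdeal v M := by
    have hz0 : τ (X 2) ≠ 0 := by
      intro h0
      have : (X 2 : PS k) = 0 := τ.injective (by rw [h0, map_zero])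
      have h1 := congrArg (coeff (Finsupp.single 2 1)) this
      simp at h1
    obtain ⟨M1, h1, h2⟩ := exists_exact_weight (w := v) hz0
    by_cases hMM : M ≤ M1
    · exact wIdeal_anti _ hMM h1
    push Not at hMM
    exfalso
    have h3 : p ^ e * M1 + 1 ≤ p ^ e * M := by
      have := Nat.mul_le_mul_left (p ^ e) hMM
      rw [Nat.succ_eq_add_one, mul_add, mul_one] at this
      omega
    refine pow_notMem_wIdeal h2 (p ^ e) ?_
    rw [hid]
    refine Ideal.sub_mem _ (Ideal.sub_mem _ (Ideal.add_mem _ ?_ ?_) (hτm M1 hMM.le h1)) ?_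
    · exact Ideal.mul_mem_right _ _ (wIdeal_anti _ h3 hh'v)
    · exact wIdeal_anti _ (by omega) hgv
    · exact wIdeal_anti _ (by omega) hτc
  -- The monomial `z ^ q` occurs in `τ h`, and not in `g`, each of whose monomials has a positive
  -- exponent of `x`; so it comes from `h' * w`, and `w` is a unit.
  have hw0 : coeff 0 w ≠ 0 := by
    have h1 : coeff (Finsupp.single 2 (p ^ e) + 0) (h' * w) =
        coeff (Finsupp.single 2 (p ^ e)) h' * coeff 0 w := by
      refine coeff_mul_of_unique fun a b hab ha _ => F'.monic.wt_zero ha ?_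
      have h3 := congrArg (fun m => m 0) hab
      have h4 := congrArg (fun m => m 1) hab
      simp at h3 h4
      omega
    rw [add_zero, F'.monic.top, one_mul] at h1
    have h2 : coeff (Finsupp.single 2 (p ^ e)) g = 0 := by
      by_contra h0
      have := (hg _ h0).1
      simp only [Finsupp.single_apply] at this
      rw [mul_comm α'] at this
      simp at this
      rcases this with this | this
      · exact pNZ p e (by simp [this])
      · rw [this] at hlt
        omega
    rw [hwg, map_add, h1, h2, add_zero] at htop
    exact htop
  have hwn : wt v n' = p ^ e * M := by rw [hwt, hn2, hM]; ring
  have hkey : coeff (n' + 0) (h' * w) = coeff n' h' * coeff 0 w := by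
    refine coeff_mul_of_unique fun a b hab ha _ => ?_
    have h1 := hh'v a ha
    have h2 := congrArg (wt v) hab
    rw [wt_add, add_zero, hwn] at h2
    have h3 : wt v b = 0 := by omega
    rw [hwt] at h3
    have hb : b = 0 := by
      have hMp : 0 < M := by omega
      have hqN : 0 < p ^ e * N := Nat.mul_pos hq hN0
      refine exp_ext ?_ ?_ ?_
      · by_contra h0
        have := Nat.mul_pos hqN (Nat.pos_of_ne_zero h0)
        omega
      · by_contra h0
        have := Nat.mul_pos hq (Nat.pos_of_ne_zero h0)
        omega
      · by_contra h0
        have := Nat.mul_pos hMp (Nat.pos_of_ne_zero h0)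
        omega
    rw [hb] at hab
    simpa using hab
  have hz : ∀ f ∈ wIdeal (k := k) v (p ^ e * M + 1), coeff n' f = 0 := by
    intro f hf
    by_contra h0
    have := hf n' h0
    omega
  -- A `q`-th power contains no monomial outside the `q`-multiples, but on the right of `hid` only
  -- `h' * w` reaches weight `q M`, with the nonzero coefficient of `hkey` at `n'`.
  have h1 : coeff n' (τ (X 2) ^ p ^ e) = 0 := by
    by_contra h0
    obtain ⟨m, rfl, -⟩ := exists_of_coeff_pow_q_ne_zero h0
    exact hnd fun i => by simp
  rw [hid, map_sub, map_sub, map_add, hz g hgv, hz _ (hτm M le_rfl hzM), hz _ hτc] at h1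
  rw [add_zero] at hkey
  rw [hkey] at h1
  simp only [add_zero, sub_zero] at h1
  exact mul_ne_zero hn hw0 h1

end GoodBad

/-! ### Translation between presentations and frames. -/

section Presentations
variable {k : Type u} [Field k] {p : ℕ} {G : TripletGerm.{u, v} k}

theorem span_X_ne {i j : Fin 3} (hij : i ≠ j) :
    Ideal.span {(X i : PS k)} ≠ Ideal.span {(X j : PS k)} := by
  classical
  intro h
  have h1 : (X i : PS k) ∈ Ideal.span {(X j : PS k)} := h ▸ Ideal.mem_span_singleton_self _
  rw [Ideal.mem_span_singleton, ← pow_one (X j)] at h1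
  have := X_pow_dvd_iff.1 h1 (Finsupp.single i 1) (by simp)
  simp [hij] at this

/-- The filtration of the germ in the coordinates of the presentation. -/
abbrev Presentation.filt (P : Presentation p G) : IdealisticFiltration (PS k) :=
  G.R.map P.chart.toRingHom

theorem Presentation.strong (P : Presentation p G) : Strong (p ^ P.e) P.h := by
  classical
  rw [Strong, mem_mm_pow]
  intro n hn
  rw [map_sub, X_pow_eq, coeff_monomial] at hn
  by_cases h1 : n = Finsupp.single 2 (p ^ P.e)
  · rw [if_pos h1, h1, P.h_coeff_top, sub_self] at hn
    exact absurd rfl hn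
  · rw [if_neg h1, sub_zero] at hn
    exact (P.h_coeff n hn h1).2

theorem Presentation.frame (P : Presentation p G) : Frame p P.e P.a P.α P.β P.filt P.h where
  a_pos := P.a_pos
  h_mem := P.h_mem
  monic := ⟨P.h_coeff_top, fun n hn hne => by have := P.h_coeff n hn hne; omega⟩
  mono_mem := P.monomial_mem
  sat l n f hf := P.saturated l n f hf
  const l f hf := by
    obtain ⟨c, ⟨w, hw⟩, hc⟩ := P.const_dvd l f hf
    exact ⟨w, c, by rw [← hw]; ring, fun n hn => (hc n hn).2⟩

/-- The boundary of the germ has the equations `x` and possibly `y`. -/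
def IsBoundary (G : TripletGerm.{u, v} k) (chart : G.ring →ₐ[k] PS k) (β : ℕ) (Hx : Ideal G.ring) :
    Prop :=
  (G.E = [Hx] ∧ β = 0) ∨
    ∃ Hy : Ideal G.ring, Hy.map chart.toRingHom = Ideal.span {MvPowerSeries.X 1} ∧
      (G.E = [Hx, Hy] ∨ G.E = [Hy, Hx])

/-- The presentation defined by a frame. -/
def presentationOfFrame {e a α β : ℕ} {h : PS k} {chart : G.ring →ₐ[k] PS k}
    (hι : IsCompletion chart) (F : Frame p e a α β (G.R.map chart.toRingHom) h)
    (S : Strong (p ^ e) h) (hσ : sigma p (G.R.map chart.toRingHom) = sigmaMon e)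
    {Hx : Ideal G.ring} (hx : Hx.map chart.toRingHom = Ideal.span {MvPowerSeries.X 0})
    (hb : IsBoundary G chart β Hx) : Presentation p G where
  chart := chart
  isCompletion := hι
  e := e
  h := h
  α := α
  β := β
  a := a
  a_pos := F.a_pos
  Hx := Hx
  Hx_eq := hx
  boundary := hb
  sigma_eq := hσ
  h_mem := F.h_mem
  h_coeff_top := F.monic.top
  h_coeff n hn hne := ⟨(F.monic.low n hn hne).1, S.deg_lt hn hne⟩
  monomial_mem := F.mono_mem
  saturated := F.sat
  const_dvd l f hf := by
    obtain ⟨c, hc, hc'⟩ := F.rem hf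
    exact ⟨c, hc, hc'⟩

theorem map_comp_equiv (ι : G.ring →ₐ[k] PS k) (τ : PS k ≃ₐ[k] PS k) (I : Ideal G.ring) :
    I.map (τ.toAlgHom.comp ι).toRingHom = (I.map ι.toRingHom).map τ.toAlgHom.toRingHom :=
  (Ideal.map_map _ _).symm

theorem filt_comp_equiv (ι : G.ring →ₐ[k] PS k) (τ : PS k ≃ₐ[k] PS k) :
    G.R.map (τ.toAlgHom.comp ι).toRingHom =
      (G.R.map ι.toRingHom).map τ.toAlgHom.toRingHom :=
  (IdealisticFiltration.map_map _ _ _).symm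

theorem map_span_X (τ : PS k ≃ₐ[k] PS k) (f : PS k) :
    (Ideal.span {f}).map τ.toAlgHom.toRingHom = Ideal.span {τ f} := by
  rw [Ideal.map_span, Set.image_singleton]
  rfl

variable [Fact p.Prime] [CharP k p]

/-- The presentation after a change of the coordinate `z`. -/
def Presentation.adjust (P : Presentation p G) {τ : PS k ≃ₐ[k] PS k}
    (A : Adjust p P.e P.a P.α P.β P.filt P.h τ) : Presentation p G :=
  presentationOfFrame (p := p) (G := G) (P.isCompletion.comp τ)
    (by rw [filt_comp_equiv]; exact A.frame)
    A.strong (by rw [filt_comp_equiv, sigma_map]; exact P.sigma_eq) (Hx := P.Hx)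
    (by rw [map_comp_equiv, P.Hx_eq, map_span_X, A.X0])
    (by
      rcases P.boundary with h | ⟨Hy, hy, h⟩
      · exact Or.inl h
      · exact Or.inr ⟨Hy, by rw [map_comp_equiv, hy, map_span_X, A.X1], h⟩)

/-- The presentation with the roles of `x` and `y` exchanged. -/
def Presentation.swap (P : Presentation p G) {Hy : Ideal G.ring}
    (hy : Hy.map P.chart.toRingHom = Ideal.span {X 1})
    (hE : G.E = [P.Hx, Hy] ∨ G.E = [Hy, P.Hx]) : Presentation p G :=
  presentationOfFrame (p := p) (G := G) (P.isCompletion.comp (swapEquiv k))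
    (by rw [filt_comp_equiv]; exact P.frame.swap)
    (h := swapEquiv k P.h)
    (by
      have := algHom_mem_mm_pow (swapEquiv k).toAlgHom P.strong
      rw [Strong]
      simpa using this)
    (by rw [filt_comp_equiv, sigma_map]; exact P.sigma_eq) (Hx := Hy)
    (by rw [map_comp_equiv, hy, map_span_X, swapEquiv_X1])
    (Or.inr ⟨P.Hx, by rw [map_comp_equiv, P.Hx_eq, map_span_X, swapEquiv_X0], hE.symm⟩)

/-- Every presentation can be changed to one which is adapted along both divisors and for the
total degree. -/
theorem Presentation.exists_adapted [IsAlgClosed k] (P : Presentation p G) :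
    ∃ τ, Adjust p P.e P.a P.α P.β P.filt P.h τ ∧
      Adapted (p ^ P.e) P.a P.α P.β (τ P.h) 1 0 ∧ Adapted (p ^ P.e) P.a P.α P.β (τ P.h) 0 1 ∧
      Adapted (p ^ P.e) P.a P.α P.β (τ P.h) 1 1 := by
  obtain ⟨τ, A, h1⟩ := P.frame.exists_adapted 1 0 P.strong
  obtain ⟨τ', A', h2⟩ := A.frame.exists_adapted 0 1 A.strong
  obtain ⟨τ'', A'', h3⟩ := A'.frame.exists_adapted 1 1 A'.strong
  refine ⟨(τ.trans τ').trans τ'', (A.trans A').trans ?_, A''.adapted _ _ (A'.adapted _ _ h1),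
    A''.adapted _ _ h2, h3⟩
  have : (P.filt.map τ.toAlgHom.toRingHom).map τ'.toAlgHom.toRingHom =
    P.filt.map (τ.trans τ').toAlgHom.toRingHom := map_trans _ _ _
  rw [this] at A''
  exact A''

omit [CharP k p] in
theorem q_pos (P : Presentation p G) : (0 : ℚ) < (p : ℚ) ^ P.e :=
  pow_pos (Nat.cast_pos.2 (Fact.out : p.Prime).pos) _

omit [Fact p.Prime] [CharP k p] in
theorem Presentation.ordX_le (P : Presentation p G) {n : Fin 3 →₀ ℕ} (hn : n ∈ P.constSupport) :
    P.ordX ≤ n 0 := Nat.sInf_le ⟨n, hn, rfl⟩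

omit [Fact p.Prime] [CharP k p] in
theorem Presentation.exists_ordX (P : Presentation p G) (h : P.constSupport ≠ ∅) :
    ∃ n ∈ P.constSupport, n 0 = P.ordX := by
  obtain ⟨m, hm⟩ := Set.nonempty_iff_ne_empty.2 h
  exact Nat.sInf_mem (s := {r | ∃ n ∈ P.constSupport, n 0 = r}) ⟨m 0, m, hm, rfl⟩

omit [CharP k p] in
theorem Presentation.mu_le_iff (P : Presentation p G) (r : ℕ) :
    P.mu ≤ (r : ℚ) / (p : ℚ) ^ P.e ↔ p ^ P.e * P.α ≤ P.a * r := by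
  rw [Presentation.mu, div_le_div_iff₀ (Nat.cast_pos.2 P.a_pos) (q_pos P)]
  rw [mul_comm (P.α : ℚ), mul_comm (r : ℚ)]
  exact_mod_cast Iff.rfl

omit [CharP k p] in
theorem Presentation.slope_eq_iff (P : Presentation p G) :
    P.slope = P.mu ↔ Good (p ^ P.e) P.a P.α 0 P.h := by
  by_cases h : P.constSupport = ∅
  · rw [Presentation.slope, if_pos h]
    refine iff_of_true rfl fun n hn2 hn => ?_
    have : n ∈ P.constSupport := ⟨hn2, hn⟩
    rw [h] at this
    exact absurd this (Set.notMem_empty _)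
  · rw [Presentation.slope, if_neg h, min_eq_right_iff, P.mu_le_iff]
    constructor
    · intro h1 n hn2 hn
      exact h1.trans (Nat.mul_le_mul_left _ (P.ordX_le ⟨hn2, hn⟩))
    · intro h1
      obtain ⟨n, hn, hno⟩ := P.exists_ordX h
      rw [← hno]
      exact h1 n hn.1 hn.2

omit [CharP k p] in
theorem Presentation.slope_lt_iff (P : Presentation p G) :
    P.slope < P.mu ↔ ¬ Good (p ^ P.e) P.a P.α 0 P.h := by
  rw [← P.slope_eq_iff]
  have : P.slope ≤ P.mu := by
    rw [Presentation.slope]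
    split_ifs
    · exact le_rfl
    · exact min_le_right _ _
  exact ⟨fun h => h.ne, fun h => lt_of_le_of_ne this h⟩

omit [Fact p.Prime] [CharP k p] in
theorem Presentation.coeff_initial (P : Presentation p G) (n : Fin 3 →₀ ℕ) :
    coeff n P.initial ≠ 0 ↔ n 2 = 0 ∧ coeff n P.h ≠ 0 ∧ n 0 = P.ordX := by
  classical
  have : coeff n P.initial =
      if n ∈ P.constSupport ∧ n 0 = P.ordX then coeff n P.h else 0 := by
    unfold Presentation.initial
    rw [coeff_apply]
    congr 1
  rw [this]
  by_cases h : n ∈ P.constSupport ∧ n 0 = P.ordX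
  · rw [if_pos h]
    exact ⟨fun h' => ⟨h.1.1, h', h.2⟩, fun h' => h'.2.1⟩
  · rw [if_neg h]
    simp only [ne_eq, not_true_eq_false, false_iff]
    exact fun h' => h ⟨⟨h'.1, h'.2.1⟩, h'.2.2⟩

omit [Fact p.Prime] [CharP k p] in
theorem Presentation.ordX_eq (P : Presentation p G) {r δ : ℕ}
    (B : Bad (p ^ P.e) P.a P.α 0 1 P.h r δ) : P.ordX = r := by
  obtain ⟨n, hn2, hn0, -, hn, -⟩ := B.lead
  have hmem : n ∈ P.constSupport := ⟨hn2, hn⟩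
  obtain ⟨m, hm, hm'⟩ := P.exists_ordX (Set.nonempty_iff_ne_empty.1 ⟨n, hmem⟩)
  have := B.min m hm.1 hm.2
  have := P.ordX_le hmem
  omega

omit [CharP k p] [Fact (Nat.Prime p)] in
theorem Presentation.rho_eq (P : Presentation p G) {r δ : ℕ}
    (B : Bad (p ^ P.e) P.a P.α 0 1 P.h r δ) : P.rho = (δ : ℚ) / (p : ℚ) ^ P.e := by
  have hr := P.ordX_eq B
  have : P.resOrd = r + δ := by
    refine le_antisymm ?_ ?_
    · obtain ⟨n, hn2, hn0, hn1, hn, hnd⟩ := B.lead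
      refine Nat.sInf_le ⟨n, (P.coeff_initial n).2 ⟨hn2, hn, hn0.trans hr.symm⟩, hnd, ?_⟩
      omega
    · obtain ⟨n, hn2, hn0, hn1, hn, hnd⟩ := B.lead
      refine le_csInf ⟨_, n, (P.coeff_initial n).2 ⟨hn2, hn, hn0.trans hr.symm⟩, hnd, rfl⟩ ?_
      rintro d ⟨m, hm, hmd, rfl⟩
      obtain ⟨hm2, hm, hm0⟩ := (P.coeff_initial m).1 hm
      by_contra hlt
      exact hmd (B.low m hm2 hm (hm0.trans hr) (by omega))
  rw [Presentation.rho, this, hr]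
  push_cast
  rw [add_sub_cancel_left]

omit [CharP k p] in
theorem Presentation.isGood (P : Presentation p G) (H : Good (p ^ P.e) P.a P.α 0 P.h) :
    IsGood p G P.Hx P.mu :=
  ⟨P, rfl, Or.inl (P.slope_eq_iff.2 H), P.slope_eq_iff.2 H, rfl⟩

theorem Presentation.isBad (P : Presentation p G) {r δ : ℕ}
    (B : Bad (p ^ P.e) P.a P.α 0 1 P.h r δ) :
    IsBad p G P.Hx P.mu ((δ : ℚ) / (p : ℚ) ^ P.e) := by
  have hs := P.slope_lt_iff.2 B.not_good
  have hr := P.ordX_eq B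
  obtain ⟨n, hn2, hn0, hn1, hn, hnd⟩ := B.lead
  refine ⟨P, rfl, Or.inr ⟨?_, hs, ?_⟩, hs, rfl, P.rho_eq B⟩
  · have hne : P.constSupport ≠ ∅ := Set.nonempty_iff_ne_empty.1 ⟨n, hn2, hn⟩
    rw [Presentation.slope, if_neg hne] at hs ⊢
    exact min_eq_left (not_le.1 fun h => (not_le.2 hs) (by rw [min_eq_right h])).le
  · rintro ⟨w, hw⟩
    have h1 := (P.coeff_initial n).2 ⟨hn2, hn, hn0.trans hr.symm⟩
    rw [← hw] at h1
    obtain ⟨m, rfl, -⟩ := exists_of_coeff_pow_q_ne_zero h1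
    exact hnd fun i => by simp

/-- A series all of whose exponents are divisible by `q` is a `q`-th power over `k`, so being
well-adapted provides a monomial of the initial form that is not one. -/
theorem Presentation.exists_bad [IsAlgClosed k] (P : Presentation p G) (hw : P.WellAdapted)
    (hs : P.slope < P.mu) : ∃ r δ, Bad (p ^ P.e) P.a P.α 0 1 P.h r δ := by
  rcases hw with hw | ⟨-, -, hw⟩
  · exact absurd hw hs.ne
  have hng := P.slope_lt_iff.1 hs
  refine (good_or_bad (Or.inr ?_)).resolve_left hng
  by_contra hno
  have hne : P.constSupport ≠ ∅ := by
    intro h0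
    rw [Presentation.slope, if_pos h0] at hs
    exact lt_irrefl _ hs
  have hlt : P.a * P.ordX < p ^ P.e * P.α := by
    rw [← not_le, ← P.mu_le_iff]
    intro h1
    rw [Presentation.slope, if_neg hne, min_eq_right h1] at hs
    exact lt_irrefl _ hs
  refine hw (exists_pow_q_eq p _ _ fun n hn => ?_)
  obtain ⟨hn2, hn, hn0⟩ := (P.coeff_initial n).1 hn
  by_contra hnd
  exact hno ⟨n, hn2, hn, by rw [hn0]; exact hlt, hnd, fun m hm2 hm => by
    rw [hn0]; exact P.ordX_le ⟨hm2, hm⟩⟩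

end Presentations

/-! ### Independence of the presentation. -/

section Uniqueness
variable {k : Type u} [Field k] {p : ℕ} {G : TripletGerm.{u, v} k}

instance isDomain_PS : IsDomain (PS k) := NoZeroDivisors.to_isDomain _

theorem Presentation.exists_trans (P P' : Presentation p G) :
    ∃ τ : PS k ≃ₐ[k] PS k, P'.chart = τ.toAlgHom.comp P.chart := by
  obtain ⟨τ, hτ⟩ := P.isCompletion.exists_equiv P'.isCompletion
  exact ⟨τ, AlgHom.ext fun a => (hτ a).symm⟩

theorem associated_of_map {ι : G.ring →ₐ[k] PS k} {τ : PS k ≃ₐ[k] PS k} {D : Ideal G.ring}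
    {f g : PS k} (h : D.map ι.toRingHom = Ideal.span {f})
    (h' : D.map (τ.toAlgHom.comp ι).toRingHom = Ideal.span {g}) : Associated (τ f) g := by
  rw [map_comp_equiv, h, map_span_X] at h'
  exact Ideal.span_singleton_eq_span_singleton.1 h'

theorem Presentation.not_X01 (P : Presentation p G) {D : Ideal G.ring}
    (h : D.map P.chart.toRingHom = Ideal.span {X 0})
    (h' : D.map P.chart.toRingHom = Ideal.span {X 1}) : False :=
  span_X_ne (k := k) (i := 0) (j := 1) (by decide) (h ▸ h')

variable [Fact p.Prime] [CharP k p]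

/-- The exponent `e` is the first index at which `σ` takes the value 2, and `σ` does not depend on
the coordinates. -/
theorem Presentation.e_eq (P P' : Presentation p G) : P.e = P'.e := by
  obtain ⟨τ, hτ⟩ := P.exists_trans P'
  have h1 : sigma p P'.filt = sigma p P.filt := by
    rw [Presentation.filt, hτ, filt_comp_equiv, sigma_map]
  have h2 : (fun n => if n < P'.e then 3 else 2) = fun n => if n < P.e then 3 else 2 := by
    rw [← P'.sigma_eq, ← P.sigma_eq]
    exact h1
  have h3 := congrFun h2 P.e
  have h4 := congrFun h2 P'.e
  by_contra hne
  rcases lt_or_gt_of_ne hne with h | h <;> simp [h, h.not_gt] at h3 h4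

omit [Fact p.Prime] [CharP k p] in
/-- The monomials of two presentations with the same `H_x` agree up to a unit. -/
theorem Presentation.exists_unit_mul (P P' : Presentation p G) (h : P.Hx = P'.Hx)
    {τ : PS k ≃ₐ[k] PS k} (hτ : P'.chart = τ.toAlgHom.comp P.chart) :
    ∃ V : PS k, V ∉ mm k ∧ τ (X 0 ^ P.α * X 1 ^ P.β) = V * (X 0 ^ P.α * X 1 ^ P.β) := by
  have hunit : ∀ u : (PS k)ˣ, (u : PS k) ∉ mm k := fun u hu =>
    (IsLocalRing.mem_maximalIdeal _).1 hu u.isUnit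
  have hx := associated_of_map (τ := τ) P.Hx_eq (by rw [← hτ, h, P'.Hx_eq])
  obtain ⟨u, hu⟩ := hx.symm
  rcases P.boundary with ⟨-, hb⟩ | ⟨Hy, hy, hE⟩
  · refine ⟨((u ^ P.α : (PS k)ˣ) : PS k), hunit _, ?_⟩
    rw [map_mul, map_pow, ← hu, hb, pow_zero, map_one]
    push_cast
    ring
  · have hy' : Hy.map P'.chart.toRingHom = Ideal.span {X 1} := by
      rcases P'.boundary with ⟨hE', -⟩ | ⟨Hy', hy', hE'⟩
      · rcases hE with hE | hE <;> rw [hE'] at hE <;> simp at hE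
      · have hne : Hy ≠ P.Hx := by
          rintro rfl
          exact P.not_X01 P.Hx_eq hy
        rw [← h] at hE'
        rcases hE with hE | hE <;> rcases hE' with hE' | hE' <;> rw [hE] at hE' <;>
          simp at hE'
        · rw [hE']; exact hy'
        · exact absurd hE'.2 hne
        · exact absurd hE'.1 hne
        · rw [hE']; exact hy'
    obtain ⟨u', hu'⟩ := (associated_of_map (τ := τ) hy (by rw [← hτ, hy'])).symm
    refine ⟨((u ^ P.α * u' ^ P.β : (PS k)ˣ) : PS k), hunit _, ?_⟩
    rw [map_mul, map_pow, map_pow, ← hu, ← hu']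
    push_cast
    ring

omit [CharP k p] in
-- Up to a unit, the monomial of `P` is an element of level `P.a` in the coordinates of `P'`, and is
-- bound by the divisibility imposed there. Exchanging the presentations gives equality of the
-- ratios.
theorem Presentation.mul_le (P P' : Presentation p G) (h : P.Hx = P'.Hx) :
    P'.α * P.a ≤ P'.a * P.α := by
  obtain ⟨τ, hτ⟩ := P.exists_trans P'
  obtain ⟨V, hV, hτV⟩ := P.exists_unit_mul P' h hτ
  refine P'.frame.mul_le (i := P.α) (j := P.β) hV (Nat.pos_of_ne_zero (pNZ p _)) ?_
  rw [← hτV, Presentation.filt, hτ, filt_comp_equiv]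
  exact (map_equiv_symm_mem τ).2 ⟨_, P.monomial_mem, rfl⟩

omit [CharP k p] in
theorem Presentation.alpha_mul_eq (P P' : Presentation p G) (h : P.Hx = P'.Hx) :
    P.α * P'.a = P'.α * P.a := by
  have h1 := P.mul_le P' h
  have h2 := P'.mul_le P h.symm
  rw [mul_comm P'.a] at h1
  rw [mul_comm P.a] at h2
  exact le_antisymm h2 h1

omit [CharP k p] in
theorem Presentation.mu_eq (P P' : Presentation p G) (h : P.Hx = P'.Hx) : P.mu = P'.mu := by
  rw [Presentation.mu, Presentation.mu, div_eq_div_iff (Nat.cast_pos.2 P.a_pos).ne'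
    (Nat.cast_pos.2 P'.a_pos).ne']
  exact_mod_cast P.alpha_mul_eq P' h

/-- A bad divisor is not of higher type for another presentation. -/
theorem Presentation.not_higher (P P' : Presentation p G) (h : P.Hx = P'.Hx) {n' : Fin 3 →₀ ℕ}
    (hlt : P'.a * n' 0 < p ^ P'.e * P'.α) (hn2 : n' 2 = 0)
    (hn : coeff n' P'.h ≠ 0) (hnd : ¬ ∀ i, p ^ P'.e ∣ n' i)
    (hlow : ∀ n, n 2 = 0 → coeff n P'.h ≠ 0 → n' 0 < n 0 ∨ (n 0 = n' 0 ∧ n' 1 ≤ n 1))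
    (hhigh : ∀ n, n 2 = 0 → coeff n P.h ≠ 0 →
      p ^ P.e * P.α ≤ P.a * n 0 ∨ n' 0 < n 0 ∨ (n 0 = n' 0 ∧ n' 1 < n 1)) : False := by
  obtain ⟨τ, hτ⟩ := P.exists_trans P'
  have he := P.e_eq P'
  have F' := P'.frame
  have S' := P'.strong
  have hσ : sigma p P'.filt P'.e = 2 := by
    have := congrFun P'.sigma_eq P'.e
    rwa [if_neg (lt_irrefl _)] at this
  rw [← he] at F' S' hlt hnd hσ
  have hf : P'.filt = P.filt.map τ.toAlgHom.toRingHom := by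
    rw [Presentation.filt, hτ, filt_comp_equiv]
  rw [hf] at F' hσ
  have hx := associated_of_map (τ := τ) P.Hx_eq (by rw [← hτ, h, P'.Hx_eq])
  exact P.frame.not_bad_of_higher P.strong F' S' (P.alpha_mul_eq P' h) hσ hx.symm.dvd hlt hn2 hn hnd
    hlow hhigh

/-- A bad divisor has a presentation whose initial form has no lower terms. -/
theorem Presentation.exists_normal [IsAlgClosed k] (P : Presentation p G) {r δ : ℕ}
    (B : Bad (p ^ P.e) P.a P.α 0 1 P.h r δ) :
    ∃ P' : Presentation p G, P'.Hx = P.Hx ∧ ∃ n, P'.a * n 0 < p ^ P'.e * P'.α ∧ n 2 = 0 ∧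
      n 0 = r ∧ n 1 = δ ∧ coeff n P'.h ≠ 0 ∧ (¬ ∀ i, p ^ P'.e ∣ n i) ∧
      ∀ m, m 2 = 0 → coeff m P'.h ≠ 0 → r < m 0 ∨ (m 0 = r ∧ δ ≤ m 1) := by
  obtain ⟨τ, A, ⟨n, hn2, hn0, hn1, hn, hnd⟩, hlow⟩ := P.frame.exists_normal P.strong B
  refine ⟨P.adjust A, rfl, n, ?_, hn2, hn0, hn1, hn, hnd, hlow⟩
  rw [hn0]
  exact B.lt

variable [IsAlgClosed k]

/-- For the good presentation every monomial of the constant term lies beyond the bound given by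
`μ`, hence it cannot account for the decisive monomial of the bad one. -/
theorem Presentation.not_good_bad (P P' : Presentation p G) (h : P.Hx = P'.Hx)
    (H : Good (p ^ P.e) P.a P.α 0 P.h) {r δ : ℕ} (B : Bad (p ^ P'.e) P'.a P'.α 0 1 P'.h r δ) :
    False := by
  obtain ⟨P1, h1, n, hlt, hn2, rfl, rfl, hn, hnd, hlow⟩ := P'.exists_normal B
  exact P.not_higher P1 (h.trans h1.symm) hlt hn2 hn hnd hlow fun m hm2 hm => Or.inl (H m hm2 hm)

/-- In normal coordinates the pair `(r, δ)` is the lexicographic minimum of the constant term. If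
two such pairs differed, the presentation with the larger one would have only monomials above the
smaller one. -/
theorem Presentation.bad_eq (P P' : Presentation p G) (h : P.Hx = P'.Hx) {r δ r' δ' : ℕ}
    (B : Bad (p ^ P.e) P.a P.α 0 1 P.h r δ) (B' : Bad (p ^ P'.e) P'.a P'.α 0 1 P'.h r' δ') :
    r = r' ∧ δ = δ' := by
  obtain ⟨P0, h0, n, hlt, hn2, rfl, rfl, hn, hnd, hlow⟩ := P.exists_normal B
  obtain ⟨P1, h1, n', hlt', hn2', rfl, rfl, hn', hnd', hlow'⟩ := P'.exists_normal B'
  have h2 : P0.Hx = P1.Hx := h0.trans (h.trans h1.symm)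
  by_contra hne
  by_cases hlex : n' 0 < n 0 ∨ (n 0 = n' 0 ∧ n' 1 < n 1)
  · refine P0.not_higher P1 h2 hlt' hn2' hn' hnd' hlow' fun m hm2 hm => ?_
    have := hlow m hm2 hm
    omega
  · refine P1.not_higher P0 h2.symm hlt hn2 hn hnd hlow fun m hm2 hm => ?_
    have := hlow' m hm2 hm
    omega

omit [IsAlgClosed k] [CharP k p] in
theorem IsGood.mu_eq {D : Ideal G.ring} {μ μ' : ℚ} (h : IsGood p G D μ) (h' : IsGood p G D μ') :
    μ = μ' := by
  obtain ⟨P, hx, -, -, rfl⟩ := h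
  obtain ⟨P', hx', -, -, rfl⟩ := h'
  exact P.mu_eq P' (hx.trans hx'.symm)

theorem IsGood.not_isBad {D : Ideal G.ring} {μ μ' ρ : ℚ} (h : IsGood p G D μ)
    (h' : IsBad p G D μ' ρ) : False := by
  obtain ⟨P, hx, -, hs, -⟩ := h
  obtain ⟨P', hx', hw, hs', -, -⟩ := h'
  obtain ⟨r, δ, B⟩ := P'.exists_bad hw hs'
  exact P.not_good_bad P' (hx.trans hx'.symm) (P.slope_eq_iff.1 hs) B

theorem IsBad.eq {D : Ideal G.ring} {μ μ' ρ ρ' : ℚ} (h : IsBad p G D μ ρ)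
    (h' : IsBad p G D μ' ρ') : μ = μ' ∧ ρ = ρ' := by
  obtain ⟨P, hx, hw, hs, rfl, rfl⟩ := h
  obtain ⟨P', hx', hw', hs', rfl, rfl⟩ := h'
  obtain ⟨r, δ, B⟩ := P.exists_bad hw hs
  obtain ⟨r', δ', B'⟩ := P'.exists_bad hw' hs'
  have hh := hx.trans hx'.symm
  refine ⟨P.mu_eq P' hh, ?_⟩
  rw [P.rho_eq B, P'.rho_eq B', P.e_eq P', (P.bad_eq P' hh B B').2]

/-- The constructors do not fix which of two components is named first; this is harmless because
type, `μ` and `ρ` are intrinsic to a component and the values are symmetric in the two. -/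
theorem IsInvMON.unique {w w' : List ℚ} (h : IsInvMON p G w) (h' : IsInvMON p G w') : w = w' := by
  have key : ∀ {D D' D1 D1' : Ideal G.ring}, (G.E = [D, D'] ∨ G.E = [D', D]) →
      (G.E = [D1, D1'] ∨ G.E = [D1', D1]) → (D = D1 ∧ D' = D1') ∨ (D = D1' ∧ D' = D1) := by
    rintro D D' D1 D1' (h | h) (h' | h') <;> rw [h] at h' <;> simp at h' <;>
      obtain ⟨rfl, rfl⟩ := h' <;> simp
  have key1 : ∀ {D D' D1 : Ideal G.ring}, G.E = [D1] → (G.E = [D, D'] ∨ G.E = [D', D]) → False := by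
    rintro D D' D1 h (h' | h') <;> rw [h] at h' <;> simp at h'
  rcases h with ⟨D, μ, hE, hD⟩ | ⟨D, D', μ, μ', hE, hD, hD'⟩ | ⟨D, μ, ρ, hE, hD⟩ |
      ⟨D, D', μ, ρ, μ', hE, hD, hD'⟩ | ⟨D, D', μ, ρ, μ', ρ', hE, hD, hD'⟩ <;>
    rcases h' with ⟨D1, μ1, hE1, hD1⟩ | ⟨D1, D1', μ1, μ1', hE1, hD1, hD1'⟩ | ⟨D1, μ1, ρ1, hE1, hD1⟩ |
      ⟨D1, D1', μ1, ρ1, μ1', hE1, hD1, hD1'⟩ | ⟨D1, D1', μ1, ρ1, μ1', ρ1', hE1, hD1, hD1'⟩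
  · rw [hE] at hE1; simp at hE1; subst hE1; rw [hD.mu_eq hD1]
  · exact (key1 hE (Or.inl hE1)).elim
  · rw [hE] at hE1; simp at hE1; subst hE1; exact (hD.not_isBad hD1).elim
  · exact (key1 hE hE1).elim
  · exact (key1 hE (Or.inl hE1)).elim
  · exact (key1 hE1 (Or.inl hE)).elim
  · rcases key (Or.inl hE) (Or.inl hE1) with ⟨rfl, rfl⟩ | ⟨rfl, rfl⟩
    · rw [hD.mu_eq hD1, hD'.mu_eq hD1']
    · rw [hD.mu_eq hD1', hD'.mu_eq hD1, min_comm, max_comm]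
  · exact (key1 hE1 (Or.inl hE)).elim
  · rcases key (Or.inl hE) hE1 with ⟨rfl, rfl⟩ | ⟨rfl, rfl⟩
    · exact (hD.not_isBad hD1).elim
    · exact (hD'.not_isBad hD1).elim
  · rcases key (Or.inl hE) (Or.inl hE1) with ⟨rfl, rfl⟩ | ⟨rfl, rfl⟩
    · exact (hD.not_isBad hD1).elim
    · exact (hD.not_isBad hD1').elim
  · rw [hE] at hE1; simp at hE1; subst hE1; exact (hD1.not_isBad hD).elim
  · exact (key1 hE (Or.inl hE1)).elim
  · rw [hE] at hE1; simp at hE1; subst hE1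
    obtain ⟨rfl, rfl⟩ := hD.eq hD1
    rfl
  · exact (key1 hE hE1).elim
  · exact (key1 hE (Or.inl hE1)).elim
  · exact (key1 hE1 hE).elim
  · rcases key hE (Or.inl hE1) with ⟨rfl, rfl⟩ | ⟨rfl, rfl⟩
    · exact (hD1.not_isBad hD).elim
    · exact (hD1'.not_isBad hD).elim
  · exact (key1 hE1 hE).elim
  · rcases key hE hE1 with ⟨rfl, rfl⟩ | ⟨rfl, rfl⟩
    · obtain ⟨rfl, rfl⟩ := hD.eq hD1
      rfl
    · exact (hD1'.not_isBad hD).elim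
  · rcases key hE (Or.inl hE1) with ⟨rfl, rfl⟩ | ⟨rfl, rfl⟩
    · exact (hD'.not_isBad hD1').elim
    · exact (hD'.not_isBad hD1).elim
  · exact (key1 hE1 (Or.inl hE)).elim
  · rcases key (Or.inl hE) (Or.inl hE1) with ⟨rfl, rfl⟩ | ⟨rfl, rfl⟩
    · exact (hD1.not_isBad hD).elim
    · exact (hD1'.not_isBad hD).elim
  · exact (key1 hE1 (Or.inl hE)).elim
  · rcases key (Or.inl hE) hE1 with ⟨rfl, rfl⟩ | ⟨rfl, rfl⟩
    · exact (hD1'.not_isBad hD').elim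
    · exact (hD1'.not_isBad hD).elim
  · rcases key (Or.inl hE) (Or.inl hE1) with ⟨rfl, rfl⟩ | ⟨rfl, rfl⟩
    · rw [(hD.eq hD1).2, (hD'.eq hD1').2]
    · rw [(hD.eq hD1').2, (hD'.eq hD1).2, min_comm, max_comm]

omit [Fact p.Prime] [CharP k p] [IsAlgClosed k] in
theorem Presentation.exists_Hy_of_ne (P : Presentation p G) (h : G.E ≠ [P.Hx]) :
    ∃ Hy : Ideal G.ring, Hy.map P.chart.toRingHom = Ideal.span {X 1} ∧
      (G.E = [P.Hx, Hy] ∨ G.E = [Hy, P.Hx]) := by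
  rcases P.boundary with h' | h'
  · exact absurd h'.1 h
  · exact h'

end Uniqueness

/-! ### Singular curves lie in a coordinate plane and are graphs over its axis. -/

section SingularCurves
variable {k : Type u} [Field k]

theorem IsSingCurve.mem {R : IdealisticFiltration (PS k)} {Q : Ideal (PS k)}
    (hQ : IsSingCurve R Q) {f : PS k} {l : ℕ} (hl : 0 < l) (hf : f ∈ R.level l) : f ∈ Q := by
  obtain ⟨s, hs, hsf⟩ := hQ.2.2 l f hf
  exact (hQ.1.mem_or_mem (Ideal.pow_le_self hl.ne' hsf)).resolve_left hs

theorem IsSingCurve.ne_mm {R : IdealisticFiltration (PS k)} {Q : Ideal (PS k)}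
    (hQ : IsSingCurve R Q) : Q ≠ mm k := by
  rintro rfl
  have h1 := hQ.2.1
  let _ := Ideal.Quotient.field (mm k)
  rw [ringKrullDim_eq_zero_of_field] at h1
  exact zero_ne_one h1

/-- A series whose restriction to the plane `x = 0` is a nonzero series in `y` is contained in a
prime ideal with `x` only if `y` is. -/
theorem X1_mem_of_mem {Q : Ideal (PS k)} (hQ : Q.IsPrime) (h0 : X 0 ∈ Q) {f : PS k} (hf : f ∈ Q)
    (h2 : ∀ n, n 0 = 0 → coeff n f ≠ 0 → n 2 = 0) {n : Fin 3 →₀ ℕ} (hn0 : n 0 = 0)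
    (hn : coeff n f ≠ 0) : X 1 ∈ Q := by
  classical
  obtain ⟨g, hg⟩ : ∃ g : PS k, ∀ n, coeff n g = if n 0 = 0 then coeff n f else 0 :=
    ⟨mkPS fun n => if n 0 = 0 then coeff n f else 0, fun n => rfl⟩
  have hgn : ∀ n, coeff n g ≠ 0 ↔ n 0 = 0 ∧ coeff n f ≠ 0 := by
    intro n
    rw [hg]
    by_cases h : n 0 = 0 <;> simp [h]
  have hgQ : g ∈ Q := by
    have hd : X 0 ^ 1 ∣ f - g := X_pow_dvd_iff.2 fun n hn => by
      by_contra h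
      have h' : n 0 = 0 := by omega
      rw [map_sub, hg, if_pos h', sub_self] at hn
      exact hn rfl
    obtain ⟨w, hw⟩ := hd
    have : g = f - X 0 * w := by rw [pow_one] at hw; rw [← hw]; ring
    rw [this]
    exact Ideal.sub_mem _ hf (Ideal.mul_mem_right _ _ h0)
  have hex : ∃ m, ∃ n, coeff n g ≠ 0 ∧ n 1 = m := ⟨_, n, (hgn n).2 ⟨hn0, hn⟩, rfl⟩
  obtain ⟨n, hn, hnm⟩ := Nat.find_spec hex
  obtain ⟨w, hw⟩ : X 1 ^ Nat.find hex ∣ g :=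
    X_pow_dvd_iff.2 fun n hn => Nat.find_min' hex ⟨n, hn, rfl⟩
  have hn' : n = 0 + Finsupp.single 1 (Nat.find hex) := by
    have h3 := (hgn n).1 hn
    refine exp_ext ?_ ?_ ?_
    · simp [h3.1]
    · simp [hnm]
    · simp [h2 n h3.1 h3.2]
  have hu : IsUnit w := by
    rw [hw, hn', coeff_X_pow_mul_add] at hn
    rw [MvPowerSeries.isUnit_iff_constantCoeff, isUnit_iff_ne_zero]
    simpa using hn
  rw [hw] at hgQ
  rcases hQ.mem_or_mem hgQ with h | h
  · exact hQ.mem_of_pow_mem _ h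
  · exact absurd (Ideal.eq_top_of_isUnit_mem _ h hu) hQ.ne_top

variable {p e a α β : ℕ} [Fact p.Prime] [CharP k p] {R : IdealisticFiltration (PS k)} {h : PS k}
  {Q : Ideal (PS k)}

omit [CharP k p] in
-- Modulo `x` and `y` the element `h` is `z ^ q`; a curve containing both would contain `z` and be
-- the point.
theorem IsSingCurve.not_X1_mem (hQ : IsSingCurve R Q) (F : Frame p e a α β R h) (h0 : X 0 ∈ Q) :
    X 1 ∉ Q := by
  intro h1
  have hh := hQ.mem (Nat.pos_of_ne_zero (pNZ p e)) F.h_mem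
  have hz : X 2 ^ p ^ e ∈ Q := by
    have hd : h - X 2 ^ p ^ e ∈ varIdeal {0, 1} := by
      rw [varIdeal_eq]
      intro n hn
      have := (F.monic.sub_mem n hn).2
      simp [wt, ind]
      omega
    have hle : varIdeal {0, 1} ≤ Q := by
      rw [varIdeal, Ideal.span_le]
      rintro _ ⟨s, hs, rfl⟩
      simp at hs
      rcases hs with rfl | rfl
      · exact h0
      · exact h1
    have := Ideal.sub_mem _ hh (hle hd)
    simpa using this
  have h2 := hQ.1.mem_of_pow_mem _ hz
  refine hQ.ne_mm (le_antisymm (IsLocalRing.le_maximalIdeal hQ.1.ne_top) ?_)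
  rw [mm_eq_varIdeal, varIdeal, Ideal.span_le]
  rintro _ ⟨s, hs, rfl⟩
  fin_cases s
  · exact h0
  · exact h1
  · exact h2

omit [Fact p.Prime] [CharP k p] in
theorem IsSingCurve.X0_or_X1 (hQ : IsSingCurve R Q) (F : Frame p e a α β R h) :
    (0 < α ∧ X 0 ∈ Q) ∨ (0 < β ∧ X 1 ∈ Q) := by
  rcases hQ.1.mem_or_mem (hQ.mem F.a_pos F.mono_mem) with h1 | h1
  · left
    rcases Nat.eq_zero_or_pos α with rfl | h
    · rw [pow_zero] at h1
      exact absurd ((Ideal.eq_top_iff_one _).2 h1) hQ.1.ne_top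
    · exact ⟨h, hQ.1.mem_of_pow_mem _ h1⟩
  · right
    rcases Nat.eq_zero_or_pos β with rfl | h
    · rw [pow_zero] at h1
      exact absurd ((Ideal.eq_top_iff_one _).2 h1) hQ.1.ne_top
    · exact ⟨h, hQ.1.mem_of_pow_mem _ h1⟩

omit [CharP k p] in
theorem IsSingCurve.alpha_pos (hQ : IsSingCurve R Q) (F : Frame p e a α β R h) (h0 : X 0 ∈ Q) :
    0 < α := by
  rcases hQ.X0_or_X1 F with h1 | h1
  · exact h1.1
  · exact absurd h1.2 (hQ.not_X1_mem F h0)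

/-- The exponents of `h` in the plane `x = 0`. -/
theorem Frame.n2_of_n0 (F : Frame p e a α β R h) (hα : 0 < α)
    {n : Fin 3 →₀ ℕ} (hn : coeff n h ≠ 0)
    (hn0 : n 0 = 0) (hne : n ≠ Finsupp.single 2 (p ^ e)) : n 2 = 0 := by
  by_contra h2
  have hlt := (F.monic.low n hn hne).1
  have := (F.mid hn (Nat.pos_of_ne_zero h2) hlt).1
  rw [hn0, mul_zero] at this
  have := Nat.mul_pos hα (Nat.sub_pos_of_lt hlt)
  omega

/-- The restriction to `x = 0` of the constant term of `h` is a `q`-th power if there is a singular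
curve in that plane. -/
theorem IsSingCurve.dvd_of_coeff_ne_zero (hQ : IsSingCurve R Q) (F : Frame p e a α β R h)
    (h0 : X 0 ∈ Q) {n : Fin 3 →₀ ℕ} (hn : coeff n h ≠ 0) (hn0 : n 0 = 0) : ∀ i, p ^ e ∣ n i := by
  have hα := hQ.alpha_pos F h0
  by_cases hne : n = Finsupp.single 2 (p ^ e)
  · subst hne
    intro i
    fin_cases i <;> simp
  have hn2 := F.n2_of_n0 hα hn hn0 hne
  by_contra hnd
  have hnd1 : ¬ p ^ e ∣ n 1 := by
    intro h1
    refine hnd fun i => ?_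
    fin_cases i
    · simp [hn0]
    · exact h1
    · simp [hn2]
  have hn1 : n 1 ≠ 0 := by
    intro h1
    rw [h1] at hnd1
    exact hnd1 (dvd_zero _)
  have hfin : FiniteMultiplicity p (n 1) :=
    Nat.finiteMultiplicity_iff.2 ⟨(Fact.out : p.Prime).ne_one, Nat.pos_of_ne_zero hn1⟩
  obtain ⟨i, hi⟩ : ∃ i, i = multiplicity p (n 1) := ⟨_, rfl⟩
  have hi1 : p ^ i ∣ n 1 := by rw [hi]; exact pow_multiplicity_dvd _ _
  have hi2 : ¬ p ^ (i + 1) ∣ n 1 := hfin.not_pow_dvd_of_multiplicity_lt (by omega)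
  have hie : i < e := by
    by_contra hlt
    exact hnd1 ((pow_dvd_pow p (not_lt.1 hlt)).trans hi1)
  have hilt : p ^ i < p ^ e := Nat.pow_lt_pow_right (Fact.out : p.Prime).one_lt hie
  have hch := not_dvd_choose_prime_pow hi1 hi2
  have := hQ.1
  -- The derivative of order `p ^ i` in `y` has order at least `q - p ^ i > 0` along the curve. On
  -- `x = 0` it is a nonzero series in `y` alone, as `p ^ i` is the exact power of `p` dividing `n
  -- 1`, so `y` would belong to `Q`.
  obtain ⟨s, hs, hsD⟩ := (isDiffOp_hasse (k := k) 1 (p ^ i)).mem_symbolic Q (hQ.2.2 _ _ F.h_mem)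
  have hDQ : hasse 1 (p ^ i) h ∈ Q :=
    (hQ.1.mem_or_mem (Ideal.pow_le_self (by omega) hsD)).resolve_left hs
  refine hQ.not_X1_mem F h0 (X1_mem_of_mem hQ.1 h0 hDQ ?_ (n := n - Finsupp.single 1 (p ^ i))
    (by simp [hn0]) ?_)
  · intro m hm0 hm
    rw [coeff_hasse] at hm
    have h1 := right_ne_zero_of_mul hm
    by_cases hne' : m + Finsupp.single 1 (p ^ i) = Finsupp.single 2 (p ^ e)
    · have := congrArg (fun m => m 1) hne'
      simp [(Fact.out : p.Prime).ne_zero] at this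
    · have := F.n2_of_n0 hα h1 (by simp [hm0]) hne'
      simpa using this
  · have h1 : n - Finsupp.single 1 (p ^ i) + Finsupp.single 1 (p ^ i) = n :=
      tsub_add_cancel_of_le (by
        rw [Finsupp.single_le_iff]; exact Nat.le_of_dvd (Nat.pos_of_ne_zero hn1) hi1)
    have h2 : (n - Finsupp.single 1 (p ^ i) : Fin 3 →₀ ℕ) 1 + p ^ i = n 1 := by
      have := congrArg (fun m => m 1) h1
      simpa using this
    rw [coeff_hasse, h1, h2]
    refine mul_ne_zero ?_ hn
    rwa [ne_eq, CharP.cast_eq_zero_iff k p]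

/-- In suitable coordinates a singular curve in the plane `x = 0` is defined by `x = z = 0`. -/
theorem IsSingCurve.exists_root [IsAlgClosed k] (hQ : IsSingCurve R Q) (F : Frame p e a α β R h)
    (h0 : X 0 ∈ Q) : ∃ s : PS k, (s ∈ suppIn fun n => n 0 = 0 ∧ n 2 = 0) ∧
      (∀ m, coeff m s ≠ 0 → coeff (p ^ e • m) h ≠ 0) ∧ X 2 - s ∈ Q ∧
      ∀ n, n 0 = 0 → n 2 = 0 → coeff n (s ^ p ^ e) = - coeff n h := by
  classical
  have hq := Nat.pos_of_ne_zero (pNZ p e)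
  have hα := hQ.alpha_pos F h0
  obtain ⟨g, hg⟩ : ∃ g : PS k, ∀ n, coeff n g = if n 0 = 0 ∧ n 2 = 0 then - coeff n h else 0 :=
    ⟨mkPS fun n => if n 0 = 0 ∧ n 2 = 0 then - coeff n h else 0, fun n => rfl⟩
  have hgn : ∀ n, coeff n g ≠ 0 → (n 0 = 0 ∧ n 2 = 0) ∧ coeff n h ≠ 0 := by
    intro n hn
    rw [hg] at hn
    by_cases h : n 0 = 0 ∧ n 2 = 0
    · rw [if_pos h] at hn
      exact ⟨h, fun h0 => hn (by rw [h0, neg_zero])⟩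
    · exact absurd (if_neg h) hn
  obtain ⟨s, hs⟩ := exists_pow_q_eq p e g fun n hn =>
    hQ.dvd_of_coeff_ne_zero F h0 (hgn n hn).2 (hgn n hn).1.1
  have hsm : ∀ m, coeff m s ≠ 0 → coeff (p ^ e • m) g ≠ 0 := by
    intro m hm
    rw [← hs, coeff_pow_q_smul]
    exact pow_ne_zero _ hm
  refine ⟨s, fun m hm => ?_, fun m hm => (hgn _ (hsm m hm)).2, ?_, fun n hn0 hn2 => by
    rw [hs, hg, if_pos ⟨hn0, hn2⟩]⟩
  · have := (hgn _ (hsm m hm)).1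
    simpa [pNZ p e, (Fact.out : p.Prime).ne_zero] using this
  -- By additivity of the `q`-th power, `(z - s) ^ q = z ^ q - g`, and this agrees with `h` on the
  -- plane `x = 0`, where `h` has no intermediate terms.
  · refine hQ.1.mem_of_pow_mem (p ^ e) ?_
    rw [sub_pow_q, hs]
    have hd : X 0 ^ 1 ∣ h - (X 2 ^ p ^ e - g) := X_pow_dvd_iff.2 fun n hn => by
      by_contra hlt
      have hn0 : n 0 = 0 := by omega
      apply hn
      rw [map_sub, map_sub, hg, X_pow_eq, coeff_monomial]
      by_cases h1 : n = Finsupp.single 2 (p ^ e)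
      · subst h1
        simp [F.monic.top, (Fact.out : p.Prime).ne_zero]
      · rw [if_neg h1]
        by_cases h2 : n 2 = 0
        · rw [if_pos ⟨hn0, h2⟩]; ring
        · rw [if_neg fun h => h2 h.2]
          have : coeff n h = 0 := by
            by_contra h3
            exact h2 (F.n2_of_n0 hα h3 hn0 h1)
          rw [this]; ring
    obtain ⟨w, hw⟩ := hd
    rw [pow_one] at hw
    have h1 : X 2 ^ p ^ e - g = h - X 0 * w := by rw [← hw]; ring
    rw [h1]
    exact Ideal.sub_mem _ (hQ.mem hq F.h_mem) (Ideal.mul_mem_right _ _ h0)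

/-- A prime ideal containing `x` and `z - s(y)` but not `y` is generated by these elements. -/
theorem le_of_X2_sub_mem {Q Q' : Ideal (PS k)} (hQ : Q.IsPrime) (h0 : X 0 ∈ Q) (h1 : X 1 ∉ Q)
    {s : PS k} (hs : s ∈ suppIn fun n => n 0 = 0 ∧ n 2 = 0) (hsm : s ∈ mm k) (h2 : X 2 - s ∈ Q)
    (h0' : X 0 ∈ Q') (h2' : X 2 - s ∈ Q') : Q ≤ Q' := by
  intro f hf
  have hM : ZMonic 1 (X 2 - s) := by
    refine zMonic_of_sub_mem ?_
    rw [pow_one, sub_sub_cancel_left]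
    refine Submodule.neg_mem _ fun n hn => ?_
    have h3 := hs n hn
    rw [← pow_one (mm k)] at hsm
    have h4 := mem_mm_pow.1 hsm n hn
    simp only [deg] at h4
    omega
  obtain ⟨w, c, rfl, hc⟩ := weierstrass_exists hM f
  refine Ideal.add_mem _ (Ideal.mul_mem_right _ _ h2') ?_
  have hcQ : c ∈ Q := by
    have := Ideal.sub_mem _ hf (Ideal.mul_mem_right w _ h2)
    simpa using this
  by_cases hcn : ∃ n, n 0 = 0 ∧ coeff n c ≠ 0
  · obtain ⟨n, hn0, hn⟩ := hcn
    exact absurd (X1_mem_of_mem hQ h0 hcQ (fun n _ hn => by have := hc n hn; omega) hn0 hn) h1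
  · push Not at hcn
    obtain ⟨w', rfl⟩ : X 0 ^ 1 ∣ c := X_pow_dvd_iff.2 fun n hn => by
      by_contra hlt
      exact hn (hcn n (by omega))
    rw [pow_one]
    exact Ideal.mul_mem_right _ _ h0'

omit [CharP k p] in
theorem root_mem_mm {s : PS k} (S : Strong (p ^ e) h)
    (hsh : ∀ m, coeff m s ≠ 0 → coeff (p ^ e • m) h ≠ 0) : s ∈ mm k := by
  rw [mem_mm]
  by_contra hne
  rw [← coeff_zero_eq_constantCoeff_apply] at hne
  have h1 := hsh 0 hne
  rw [smul_zero] at h1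
  have := S.deg_lt_of_zero h1 rfl (Nat.pos_of_ne_zero (pNZ p e))
  simp at this

/-- There is at most one singular curve in the plane `x = 0`. -/
theorem IsSingCurve.unique [IsAlgClosed k] {Q' : Ideal (PS k)} (hQ : IsSingCurve R Q)
    (hQ' : IsSingCurve R Q') (F : Frame p e a α β R h) (S : Strong (p ^ e) h) (h0 : X 0 ∈ Q)
    (h0' : X 0 ∈ Q') : Q = Q' := by
  obtain ⟨s, hs, hsh, hsQ, hsc⟩ := hQ.exists_root F h0
  obtain ⟨s', hs', hsh', hsQ', hsc'⟩ := hQ'.exists_root F h0'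
  -- Both `q`-th powers are prescribed by `h`, and the Frobenius map is injective.
  have hss : s = s' := by
    have h1 : s ^ p ^ e = s' ^ p ^ e := by
      have hz : ∀ {s : PS k}, (s ∈ suppIn fun n => n 0 = 0 ∧ n 2 = 0) → ∀ n,
          ¬ (n 0 = 0 ∧ n 2 = 0) → coeff n (s ^ p ^ e) = 0 := by
        intro s hs n hn
        by_contra h1
        obtain ⟨m, rfl, hm⟩ := exists_of_coeff_pow_q_ne_zero h1
        have := hs m hm
        exact hn (by simp [this])
      ext n
      by_cases hn : n 0 = 0 ∧ n 2 = 0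
      · rw [hsc n hn.1 hn.2, hsc' n hn.1 hn.2]
      · rw [hz hs n hn, hz hs' n hn]
    have h2 : (s - s') ^ p ^ e = 0 := by rw [sub_pow_q, h1, sub_self]
    exact sub_eq_zero.1 (pow_eq_zero_iff (pNZ p e) |>.1 h2)
  subst hss
  have hsm := root_mem_mm S hsh
  exact le_antisymm
    (le_of_X2_sub_mem hQ.1 h0 (hQ.not_X1_mem F h0) hs hsm hsQ h0' hsQ')
    (le_of_X2_sub_mem hQ'.1 h0' (hQ'.not_X1_mem F h0') hs hsm hsQ' h0 hsQ)

/-- The translation by the root `s` straightens the curve to `x = z = 0`. It is an admissible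
adjustment because `s ^ q` is supported in the support of `h`. -/
theorem IsSingCurve.exists_adjust [IsAlgClosed k] (hQ : IsSingCurve R Q) (F : Frame p e a α β R h)
    (S : Strong (p ^ e) h) (h0 : X 0 ∈ Q) :
    ∃ τ, Adjust p e a α β R h τ ∧ Q.map τ.toAlgHom.toRingHom = varIdeal {0, 2} := by
  obtain ⟨s, hs, hsh, hsQ, -⟩ := hQ.exists_root F h0
  have hsm := root_mem_mm S hsh
  have hs2 : s ∈ suppIn fun n => n 2 = 0 := suppIn_mono (fun n hn => hn.2) hs
  obtain ⟨τ, A, h2⟩ := F.exists_adjust S hs2 hsh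
  have hτs : τ s = s := algHom_eq_self τ.toAlgHom A.X0 A.X1 hs2
  have hQs : Q = Ideal.span {X 0, X 2 - s} := by
    refine le_antisymm (le_of_X2_sub_mem hQ.1 h0 (hQ.not_X1_mem F h0) hs hsm hsQ
      (Ideal.subset_span (by simp)) (Ideal.subset_span (by simp))) ?_
    rw [Ideal.span_le]
    rintro _ (rfl | rfl)
    · exact h0
    · exact hsQ
  refine ⟨τ, A, ?_⟩
  rw [hQs, Ideal.map_span, varIdeal]
  congr 1
  have e0 : τ.toAlgHom.toRingHom (X 0) = X 0 := A.X0
  have e2 : τ.toAlgHom.toRingHom (X 2 - s) = X 2 := by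
    change τ (X 2 - s) = X 2
    rw [map_sub, h2, hτs, add_sub_cancel_right]
  rw [Set.image_pair, e0, e2]
  simp [Set.image_pair]

end SingularCurves

/-! ### A criterion for a coordinate curve to be singular. -/

section CurveExists
variable {k : Type u} [Field k]

theorem X_mem_varIdeal_iff {S : Finset (Fin 3)} {i : Fin 3} : (X i : PS k) ∈ varIdeal S ↔ i ∈ S := by
  refine ⟨fun h => ?_, X_mem_varIdeal⟩
  rw [varIdeal_eq] at h
  have := h (Finsupp.single i 1) (by simp)
  rw [wt_single, mul_one, ind] at this
  by_contra hi
  rw [if_neg hi] at this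
  omega

theorem notMem_varIdeal_iff {S : Finset (Fin 3)} {f : PS k} : f ∉ varIdeal S ↔
    f ∉ wIdeal (ind S) (0 + 1) := by
  rw [varIdeal_eq]

theorem varIdeal_isPrime (S : Finset (Fin 3)) : (varIdeal (k := k) S).IsPrime := by
  refine ⟨?_, fun {f g} h => ?_⟩
  · rw [Ideal.ne_top_iff_one, varIdeal_eq]
    intro h
    have := h 0 (by simp)
    simp [wt] at this
  · by_contra hne
    push Not at hne
    rw [notMem_varIdeal_iff, notMem_varIdeal_iff] at hne
    rw [varIdeal_eq] at h
    exact mul_notMem_wIdeal hne.1 hne.2 h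

/-- Symbolic powers of the ideals generated by variables are the powers. -/
theorem mem_pow_of_symbolic {S : Finset (Fin 3)} {f s : PS k} {n : ℕ} (hs : s ∉ varIdeal S)
    (h : s * f ∈ varIdeal S ^ n) : f ∈ varIdeal S ^ n := by
  rw [varIdeal_pow] at h ⊢
  rw [notMem_varIdeal_iff] at hs
  exact mem_wIdeal_of_mul_mem hs h

theorem IsSingCurve.level_le {R : IdealisticFiltration (PS k)} {S : Finset (Fin 3)}
    (hQ : IsSingCurve R (varIdeal S)) (l : ℕ) : R.level l ≤ varIdeal S ^ l := by
  intro f hf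
  obtain ⟨s, hs, hsf⟩ := hQ.2.2 l f hf
  exact mem_pow_of_symbolic hs hsf

/-- The quotient is not a field since `y` is not invertible in it. A prime containing `x`, `z` and
some element nonzero in the quotient must contain `y`, so it is the maximal ideal. -/
theorem ringKrullDim_quotient_varIdeal :
    ringKrullDim (PS k ⧸ varIdeal (k := k) {0, 2}) = 1 := by
  have := varIdeal_isPrime (k := k) {0, 2}
  have hloc : IsLocalRing (PS k ⧸ varIdeal (k := k) {0, 2}) :=
    IsLocalRing.of_surjective' (Ideal.Quotient.mk _) Ideal.Quotient.mk_surjective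
  rw [ringKrullDim_eq_one_iff_of_isLocalRing_isDomain]
  have h1 : ∀ f : PS k, IsUnit (Ideal.Quotient.mk (varIdeal (k := k) {0, 2}) f) → IsUnit f := by
    intro f hf
    by_contra hne
    have hfm : f ∈ mm k := hne
    obtain ⟨g, hg⟩ := Ideal.Quotient.mk_surjective (I := varIdeal (k := k) {0, 2}) hf.unit⁻¹.1
    have h2 : Ideal.Quotient.mk (varIdeal (k := k) {0, 2}) (f * g - 1) = 0 := by
      rw [map_sub, map_mul, hg, map_one, sub_eq_zero]
      exact hf.mul_val_inv
    rw [Ideal.Quotient.eq_zero_iff_mem] at h2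
    have h3 := Ideal.sub_mem _ (Ideal.mul_mem_right g _ hfm)
      (IsLocalRing.le_maximalIdeal this.ne_top h2)
    rw [sub_sub_cancel] at h3
    exact (Ideal.ne_top_iff_one _).1 (maximalIdeal.isMaximal (PS k)).ne_top h3
  constructor
  · intro hF
    have h2 : Ideal.Quotient.mk (varIdeal (k := k) {0, 2}) (X 1) ≠ 0 := by
      rw [ne_eq, Ideal.Quotient.eq_zero_iff_mem, X_mem_varIdeal_iff]
      decide
    obtain ⟨b, hb⟩ := hF.mul_inv_cancel h2
    exact (IsLocalRing.mem_maximalIdeal _).1 (X_mem_mm (k := k) 1) (h1 _ (IsUnit.of_mul_eq_one _ hb))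
  · intro x hx y hy
    obtain ⟨f, rfl⟩ := Ideal.Quotient.mk_surjective x
    obtain ⟨g, rfl⟩ := Ideal.Quotient.mk_surjective y
    rw [Ideal.radical_eq_sInf, Ideal.mem_sInf]
    rintro P ⟨hP, hPp⟩
    have hPc := hPp.comap (Ideal.Quotient.mk (varIdeal (k := k) {0, 2}))
    have hle : varIdeal {0, 2} ≤ P.comap (Ideal.Quotient.mk (varIdeal (k := k) {0, 2})) := by
      intro a ha
      rw [Ideal.mem_comap, Ideal.Quotient.eq_zero_iff_mem.2 ha]
      exact zero_mem _
    have h0 : (X 0 : PS k) ∈ P.comap (Ideal.Quotient.mk (varIdeal (k := k) {0, 2})) :=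
      hle (X_mem_varIdeal (by simp))
    have h2 : (X 2 : PS k) ∈ P.comap (Ideal.Quotient.mk (varIdeal (k := k) {0, 2})) :=
      hle (X_mem_varIdeal (by simp))
    have hX1 : (X 1 : PS k) ∈ P.comap (Ideal.Quotient.mk (varIdeal (k := k) {0, 2})) := by
      by_contra hX1
      refine hx ?_
      rw [Ideal.Quotient.eq_zero_iff_mem]
      refine le_of_X2_sub_mem (Q' := varIdeal {0, 2}) hPc h0 hX1 (s := 0) (zero_mem _) (zero_mem _)
        (by rwa [sub_zero]) (X_mem_varIdeal (by simp)) (by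
          rw [sub_zero]; exact X_mem_varIdeal (by simp)) ?_
      rw [Ideal.mem_comap]
      exact hP (Ideal.mem_span_singleton_self _)
    have hg : g ∈ mm k := by
      by_contra hg
      have : IsUnit g := by
        by_contra h
        exact hg h
      exact (IsLocalRing.mem_maximalIdeal _).1 hy (this.map _)
    have : mm k ≤ P.comap (Ideal.Quotient.mk (varIdeal (k := k) {0, 2})) := by
      rw [mm_eq_varIdeal, varIdeal, Ideal.span_le]
      rintro _ ⟨s, -, rfl⟩
      fin_cases s
      · exact h0
      · exact hX1
      · exact h2
    exact this hg

variable {p e a α β : ℕ} [Fact p.Prime] [CharP k p] {R : IdealisticFiltration (PS k)} {h : PS k}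

omit [CharP k p] in
/-- A curve along which the monomial and `h` have the maximal order is singular. -/
theorem Frame.isSingCurve (F : Frame p e a α β R h) (hα : a ≤ α)
    (hr : ∀ n, n 2 = 0 → coeff n h ≠ 0 → p ^ e ≤ n 0) : IsSingCurve R (varIdeal {0, 2}) := by
  classical
  refine ⟨varIdeal_isPrime _, ringKrullDim_quotient_varIdeal, fun l f hf => ⟨1, ?_, ?_⟩⟩
  · exact (Ideal.ne_top_iff_one _).1 (varIdeal_isPrime _).ne_top
  rw [one_mul, varIdeal_pow]
  by_contra hnot
  have hwt : ∀ n, wt (ind {0, 2}) n = n 0 + n 2 := fun n => by simp [wt, ind]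
  have hf0 : f ≠ 0 := by
    rintro rfl
    exact hnot (zero_mem _)
  obtain ⟨d, hd, hd'⟩ := exists_exact_weight (w := ind {0, 2}) hf0
  have hdl : d < l := by
    by_contra hlt
    exact hnot (wIdeal_anti _ (not_lt.1 hlt) hd)
  -- Among the monomials of lowest order `d` along the curve, take one with least exponent of `x`.
  -- Differentiating `n 2` times in `z` makes it a series in `x` and `y` only, with `x`-exponent
  -- below the new level `l - n 2`.
  have hex : ∃ i, ∃ n, coeff n f ≠ 0 ∧ n 0 = i ∧ n 0 + n 2 = d := by
    rw [mem_wIdeal] at hd'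
    push Not at hd'
    obtain ⟨n, hn, hlt⟩ := hd'
    have := hd n hn
    rw [hwt] at hlt this
    exact ⟨_, n, hn, rfl, by omega⟩
  obtain ⟨n, hn, hni, hnd⟩ := Nat.find_spec hex
  have hmin : ∀ m, coeff m f ≠ 0 → m 0 + m 2 = d → n 0 ≤ m 0 := fun m hm hmd => by
    rw [hni]; exact Nat.find_min' hex ⟨m, hm, rfl, hmd⟩
  have hmd : ∀ m, coeff m f ≠ 0 → d ≤ m 0 + m 2 := fun m hm => by
    have := hd m hm
    rwa [hwt] at this
  obtain ⟨w, g, hwg, hg⟩ := F.const _ _ (F.sat l (n 2) f hf)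
  -- The variable `x` is made slightly heavier than `z`. The chosen monomial remains of least weight
  -- in the derivative and the remainder is heavier. In `h` the lightest power is `z ^ q`, of weight
  -- `(d + 1) q`, whereas the terms without `z` weigh at least `(d + 2) q`; so a product with `h`
  -- cannot give a monomial without `z` of that least weight.
  have hv : ∀ m, wt ![d + 2, 0, d + 1] m = (d + 2) * m 0 + (d + 1) * m 2 := fun m => by simp [wt]
  have hDf : hasse 2 (n 2) f ∈ wIdeal ![d + 2, 0, d + 1] ((d + 2) * n 0) := by
    intro m hm
    rw [coeff_hasse] at hm
    have hm' := right_ne_zero_of_mul hm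
    have h1 := hmd _ hm'
    have h2 := hmin _ hm'
    simp only [Finsupp.add_apply, Finsupp.single_apply] at h1 h2
    simp at h1 h2
    rw [hv]
    by_cases h3 : m 0 + (m 2 + n 2) = d
    · exact (Nat.mul_le_mul_left _ (h2 h3)).trans (Nat.le_add_right _ _)
    · have h4 : n 0 + 1 ≤ m 0 + m 2 := by omega
      have h5 := Nat.mul_le_mul_left (d + 1) h4
      nlinarith
  have hgw : g ∈ wIdeal ![d + 2, 0, d + 1] ((d + 2) * n 0 + 1) := by
    intro m hm
    have h1 := (hg m hm).1
    have h2 : a * (l - n 2) ≤ a * m 0 := (Nat.mul_le_mul_right _ hα).trans h1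
    have h3 := Nat.le_of_mul_le_mul_left h2 F.a_pos
    rw [hv]
    have h4 : n 0 + 1 ≤ m 0 := by omega
    have := Nat.mul_le_mul_left (d + 2) h4
    rw [mul_add] at this
    omega
  have hhw : h ∉ wIdeal ![d + 2, 0, d + 1] ((d + 1) * p ^ e + 1) := by
    intro h1
    have := h1 (Finsupp.single 2 (p ^ e)) (by rw [F.monic.top]; exact one_ne_zero)
    rw [wt_single] at this
    simp at this
  have h1 : h * w ∈ wIdeal ![d + 2, 0, d + 1] ((d + 2) * n 0) := by
    have := Ideal.sub_mem _ hDf (wIdeal_anti _ (Nat.le_succ _) hgw)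
    rwa [hwg, add_sub_cancel_right] at this
  have hww := mem_wIdeal_of_mul_mem hhw h1
  set m : Fin 3 →₀ ℕ := n - Finsupp.single 2 (n 2) with hm
  have hmn : m + Finsupp.single 2 (n 2) = n :=
    tsub_add_cancel_of_le (by rw [Finsupp.single_le_iff])
  have hm2 : m 2 = 0 := by simp [hm]
  have hm0 : m 0 = n 0 := by simp [hm]
  have hDm : coeff m (hasse 2 (n 2) f) ≠ 0 := by
    rw [coeff_hasse, hmn, hm2]
    simpa using hn
  have hgm : coeff m g = 0 := by
    by_contra h2
    have := hgw m h2
    rw [hv, hm2, hm0] at this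
    omega
  rw [hwg, map_add, hgm, add_zero] at hDm
  obtain ⟨a', b', hab, ha', hb'⟩ := exists_of_coeff_mul_ne_zero hDm
  have h2 := congrArg (fun m => m 2) hab
  have h0 := congrArg (fun m => m 0) hab
  simp only [Finsupp.add_apply] at h0 h2
  have h3 := hr a' (by omega) ha'
  have h4 := hww b' hb'
  rw [hv] at h4
  have hq := Nat.pos_of_ne_zero (pNZ p e)
  have h5 : b' 2 = 0 := by omega
  rw [h5] at h4
  have h6 : (d + 2) * n 0 = (d + 2) * a' 0 + (d + 2) * b' 0 := by
    rw [← mul_add, h0, hm0]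
  have h7 : (d + 2) * p ^ e ≤ (d + 2) * a' 0 := Nat.mul_le_mul_left _ h3
  have h8 : (d + 2) * p ^ e = (d + 1) * p ^ e + p ^ e := by ring
  omega

end CurveExists

/-! ### Existence of a prescribed centre. -/

section Procedure
variable {k : Type u} [Field k]

theorem InSing.map {R : IdealisticFiltration (PS k)} {Q : Ideal (PS k)} (h : InSing R Q)
    (τ : PS k ≃ₐ[k] PS k) :
    InSing (R.map τ.toAlgHom.toRingHom) (Q.map τ.toAlgHom.toRingHom) := by
  intro l f hf
  obtain ⟨g, hg, rfl⟩ := (map_equiv_symm_mem τ).1 hf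
  obtain ⟨s, hs, hsg⟩ := h l g hg
  refine ⟨τ s, fun h => hs ?_, ?_⟩
  · have h' : τ s ∈ Q.map (τ.toRingEquiv : PS k →+* PS k) := h
    rw [Ideal.map_comap_of_equiv, Ideal.mem_comap] at h'
    simpa using h'
  · rw [← map_mul, ← Ideal.map_pow]
    exact Ideal.mem_map_of_mem τ.toAlgHom.toRingHom hsg

theorem IsSingCurve.map {R : IdealisticFiltration (PS k)} {Q : Ideal (PS k)} (h : IsSingCurve R Q)
    (τ : PS k ≃ₐ[k] PS k) :
    IsSingCurve (R.map τ.toAlgHom.toRingHom) (Q.map τ.toAlgHom.toRingHom) := by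
  have hp := h.1
  refine ⟨Ideal.map_isPrime_of_equiv τ.toRingEquiv, ?_, h.2.2.map τ⟩
  rw [← h.2.1]
  exact (ringKrullDim_eq_of_ringEquiv
    (Ideal.quotientEquiv Q (Q.map τ.toAlgHom.toRingHom) τ.toRingEquiv rfl)).symm

theorem filt_map_symm (R : IdealisticFiltration (PS k)) (τ : PS k ≃ₐ[k] PS k) :
    (R.map τ.toAlgHom.toRingHom).map τ.symm.toAlgHom.toRingHom = R := by
  rw [map_trans]
  have : τ.trans τ.symm = AlgEquiv.refl := by ext1 x; simp
  rw [this, map_refl]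

variable {p : ℕ} {G : TripletGerm.{u, v} k} [Fact p.Prime] [CharP k p] [IsAlgClosed k]

/-- A singular curve in the plane `x = 0` is prescribed if no other curve has precedence. -/
theorem Presentation.prescribes_of_curve (P : Presentation p G) {Q : Ideal (PS k)}
    (hQ : IsSingCurve P.filt Q) (h0 : X 0 ∈ Q)
    (h : (∃ Q', IsSingCurve P.filt Q' ∧ X 1 ∈ Q') → P.β < P.α ∨ P.β = P.α ∧ G.E.head? = some P.Hx) :
    P.Prescribes Q := by
  refine Or.inl ⟨hQ, ?_, fun Q' hQ' hne => ?_⟩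
  · rw [P.Hx_eq, Ideal.span_singleton_le_iff_mem]
    exact h0
  · rcases hQ'.X0_or_X1 P.frame with h1 | h1
    · exact absurd (hQ'.unique hQ P.frame P.strong h1.2 h0) hne
    · exact h ⟨Q', hQ', h1.2⟩

/-- A singular curve contains the monomial, so it lies in `x = 0` or in `y = 0`, and in the second
case `β > 0` forces a second boundary component. Exchanging `x` and `y` when necessary gives the
name `H_x` to the component with precedence. -/
theorem Presentation.exists_prescribes (P : Presentation p G) :
    ∃ (P : Presentation p G) (Q : Ideal (PS k)), P.Prescribes Q := by
  by_cases hno : ∃ Q, IsSingCurve P.filt Q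
  swap
  · exact ⟨P, _, Or.inr ⟨fun Q hQ => hno ⟨Q, hQ⟩, rfl⟩⟩
  have hswap : ∀ {Hy : Ideal G.ring} (hy : Hy.map P.chart.toRingHom = Ideal.span {X 1})
      (hE : G.E = [P.Hx, Hy] ∨ G.E = [Hy, P.Hx]) {Q : Ideal (PS k)} (i j : Fin 3),
      swapEquiv k (X i) = X j → IsSingCurve P.filt Q → X i ∈ Q →
      IsSingCurve (P.swap hy hE).filt (Q.map (swapEquiv k).toAlgHom.toRingHom) ∧
        X j ∈ Q.map (swapEquiv k).toAlgHom.toRingHom := by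
    intro Hy hy hE Q i j hij hQ h1
    refine ⟨?_, ?_⟩
    · have := hQ.map (swapEquiv k)
      rwa [← filt_comp_equiv] at this
    · rw [← hij]
      exact Ideal.mem_map_of_mem (swapEquiv k).toAlgHom.toRingHom h1
  have hswap' : ∀ {Hy : Ideal G.ring} (hy : Hy.map P.chart.toRingHom = Ideal.span {X 1})
      (hE : G.E = [P.Hx, Hy] ∨ G.E = [Hy, P.Hx]),
      (∃ Q', IsSingCurve (P.swap hy hE).filt Q' ∧ X 1 ∈ Q') → ∃ Q', IsSingCurve P.filt Q' ∧ X 0 ∈ Q' := by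
    rintro Hy hy hE ⟨Q', hQ', h1⟩
    refine ⟨Q'.map (swapEquiv k).symm.toAlgHom.toRingHom, ?_, ?_⟩
    · have h2 := hQ'.map (swapEquiv k).symm
      have h3 : (P.swap hy hE).filt = P.filt.map (swapEquiv k).toAlgHom.toRingHom :=
        filt_comp_equiv _ _
      rwa [h3, filt_map_symm] at h2
    · have h2 : (swapEquiv k).symm (X 1) = X 0 := by
        rw [AlgEquiv.symm_apply_eq, swapEquiv_X0]
      rw [← h2]
      exact Ideal.mem_map_of_mem (swapEquiv k).symm.toAlgHom.toRingHom h1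
  by_cases hx : ∃ Q, IsSingCurve P.filt Q ∧ X 0 ∈ Q
  · by_cases hy : ∃ Q, IsSingCurve P.filt Q ∧ X 1 ∈ Q
    swap
    · obtain ⟨Q, hQ, h0⟩ := hx
      exact ⟨P, Q, P.prescribes_of_curve hQ h0 fun h => absurd h hy⟩
    obtain ⟨Q, hQ, h0⟩ := hx
    obtain ⟨Q', hQ', h1⟩ := hy
    by_cases hE1 : G.E = [P.Hx]
    · rcases P.boundary with ⟨-, hβ⟩ | ⟨Hy, -, hE | hE⟩
      · rcases hQ'.X0_or_X1 P.frame with h2 | h2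
        · exact absurd h1 (hQ'.not_X1_mem P.frame h2.2)
        · omega
      · rw [hE] at hE1; simp at hE1
      · rw [hE] at hE1; simp at hE1
    · obtain ⟨Hy, hy, hE⟩ := P.exists_Hy_of_ne hE1
      obtain ⟨hs1, hs2⟩ := hswap hy hE 1 0 swapEquiv_X1 hQ' h1
      by_cases hlt : P.β < P.α
      · exact ⟨P, Q, P.prescribes_of_curve hQ h0 fun _ => Or.inl hlt⟩
      by_cases hgt : P.α < P.β
      · exact ⟨_, _, (P.swap hy hE).prescribes_of_curve hs1 hs2 fun _ => Or.inl hgt⟩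
      have heq : P.β = P.α := by omega
      rcases id hE with hE' | hE'
      · exact ⟨P, Q, P.prescribes_of_curve hQ h0 fun _ => Or.inr ⟨heq, by rw [hE']; rfl⟩⟩
      · exact ⟨_, _, (P.swap hy hE).prescribes_of_curve hs1 hs2 fun _ =>
          Or.inr ⟨heq.symm, by rw [hE']; rfl⟩⟩
  · obtain ⟨Q, hQ⟩ := hno
    rcases hQ.X0_or_X1 P.frame with h1 | h1
    · exact absurd ⟨Q, hQ, h1.2⟩ hx
    · by_cases hE1 : G.E = [P.Hx]
      · rcases P.boundary with ⟨-, hβ⟩ | ⟨Hy, -, hE | hE⟩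
        · omega
        · rw [hE] at hE1; simp at hE1
        · rw [hE] at hE1; simp at hE1
      · obtain ⟨Hy, hy, hE⟩ := P.exists_Hy_of_ne hE1
        obtain ⟨hs1, hs2⟩ := hswap hy hE 1 0 swapEquiv_X1 hQ h1.2
        exact ⟨_, _, (P.swap hy hE).prescribes_of_curve hs1 hs2 fun h =>
          absurd (hswap' hy hE h) hx⟩

end Procedure

/-! ### Generators of the centre and of the maximal ideal close to the coordinates. -/

section Generators
variable {k : Type u} [Field k] {A : Type v} [CommRing A] [IsLocalRing A] [IsNoetherianRing A]
  [Algebra k A]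

/-- This is Nakayama's lemma for the ideal generated by the variables of `S`. -/
theorem le_of_le_sup_mm_mul {N : Ideal (PS k)} (S : Finset (Fin 3))
    (h : ∀ s ∈ S, ∃ f ∈ N, X s - f ∈ mm k * varIdeal S) : varIdeal (k := k) S ≤ N := by
  refine Submodule.le_of_le_smul_of_le_jacobson_bot (I := mm k) ?_
    (IsLocalRing.maximalIdeal_le_jacobson _) ?_
  · exact Submodule.fg_span (S.finite_toSet.image _)
  · nth_rewrite 1 [varIdeal]
    rw [Ideal.span_le]
    rintro _ ⟨s, hs, rfl⟩
    obtain ⟨f, hf, hsf⟩ := h s hs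
    have : (X s : PS k) = f + (X s - f) := by ring
    change (X s : PS k) ∈ _
    rw [this]
    exact Submodule.add_mem_sup hf hsf

/-- Elements of the ring approximating the coordinates. -/
structure IsGens (ι : A →ₐ[k] PS k) (S : Finset (Fin 3)) (J : Ideal A) (j : Fin 3 → A) : Prop where
  mem : ∀ s ∈ S, j s ∈ J
  sub : ∀ s ∈ S, X s - ι (j s) ∈ mm k ^ 2 * varIdeal S
  sub_sq : ∀ s, X s - ι (j s) ∈ mm k ^ 2
  span : J = Ideal.span (j '' S)
  max : maximalIdeal A = Ideal.span (Set.range j)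
  map_max : (maximalIdeal A).map ι.toRingHom = mm k

/-- Coordinates need not come from `A`. Approximating them to second order, inside `J` for those in
`S`, is enough for generation by Nakayama, and the errors remain of second order after division by
`x`. -/
theorem IsCompletion.exists_isGens {ι : A →ₐ[k] PS k} (hι : IsCompletion ι) {S : Finset (Fin 3)}
    {J : Ideal A} (hJ : J.map ι.toRingHom = varIdeal S) : ∃ j, IsGens ι S J j := by
  have h1 : ∀ s, ∃ a : A, (s ∈ S → a ∈ J ∧ X s - ι a ∈ mm k ^ 2 * varIdeal S) ∧
      X s - ι a ∈ mm k ^ 2 := by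
    intro s
    by_cases hs : s ∈ S
    · have hX : (X s : PS k) ∈ J.map ι.toRingHom := by
        rw [hJ]
        exact X_mem_varIdeal hs
      obtain ⟨a, ha, has⟩ := exists_approx ι 2 (hι.2 2) J hX
      have has' := Ideal.mul_le_left (I := mm k ^ 2) (J := J.map ι.toRingHom) has
      rw [hJ] at has
      exact ⟨a, fun _ => ⟨ha, has⟩, has'⟩
    · obtain ⟨a, ha⟩ := hι.2 2 (X s)
      exact ⟨a, fun h => absurd h hs, ha⟩
  choose j hj hj2 using h1
  have hmm : mm k ≤ (Ideal.span (Set.range j)).map ι.toRingHom := by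
    rw [mm_eq_varIdeal]
    refine le_of_le_sup_mm_mul _ fun s _ => ⟨ι (j s), ?_, ?_⟩
    · exact Ideal.mem_map_of_mem ι.toRingHom (Ideal.subset_span ⟨s, rfl⟩)
    · rw [← mm_eq_varIdeal, ← pow_two]
      exact hj2 s
  have hjm : Ideal.span (Set.range j) ≤ maximalIdeal A := by
    rw [Ideal.span_le]
    rintro _ ⟨s, rfl⟩
    refine hι.mem_maximalIdeal.1 ?_
    have := Ideal.sub_mem _ (X_mem_mm s) (Ideal.pow_le_self two_ne_zero (hj2 s))
    rwa [sub_sub_cancel] at this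
  refine ⟨j, fun s hs => (hj s hs).1, fun s hs => (hj s hs).2, hj2, ?_, ?_, ?_⟩
  · refine le_antisymm (hι.le_of_map_le ?_) ?_
    · rw [hJ]
      refine le_of_le_sup_mm_mul S fun s hs => ⟨ι (j s), ?_, ?_⟩
      · exact Ideal.mem_map_of_mem ι.toRingHom (Ideal.subset_span ⟨s, hs, rfl⟩)
      · exact Ideal.mul_mono_left (Ideal.pow_le_self two_ne_zero) (hj s hs).2
    · rw [Ideal.span_le]
      rintro _ ⟨s, hs, rfl⟩
      exact (hj s hs).1
  · exact le_antisymm (hι.le_of_map_le (hι.map_maximalIdeal.trans hmm)) hjm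
  · exact le_antisymm hι.map_maximalIdeal (hmm.trans (Ideal.map_mono hjm))

end Generators

/-! ### Extension of a homomorphism to fractions in the blown up ring. -/

section Lift
variable {k : Type u} [Field k] {A B : Type v} [CommRing A] [IsDomain A] [IsLocalRing A] [Algebra k A]
  [CommRing B] [IsDomain B] [IsLocalRing B] [Algebra k B]

/-- `g` is the value at `c` of the extension of `Θ` along `φ`. -/
def LiftRel (φ : A →ₐ[k] B) (Θ : A →ₐ[k] PS k) (c : B) (g : PS k) : Prop :=
  (∃ d n, d ≠ 0 ∧ φ d * c = φ n ∧ Θ d * g = Θ n) ∧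
    c - algebraMap k B (constantCoeff g) ∈ maximalIdeal B

variable {φ : A →ₐ[k] B} {Θ : A →ₐ[k] PS k}

omit [IsLocalRing A] [IsDomain B] in
theorem LiftRel.unique (hφ : Function.Injective φ) (hΘ : Function.Injective Θ) {c : B} {g g' : PS k}
    (h : LiftRel φ Θ c g) (h' : LiftRel φ Θ c g') : g = g' := by
  obtain ⟨⟨d, n, hd, h1, h2⟩, -⟩ := h
  obtain ⟨⟨d', n', hd', h1', h2'⟩, -⟩ := h'
  have h3 : d' * n = d * n' := by
    apply hφ
    rw [map_mul, map_mul, ← h1, ← h1']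
    ring
  have h4 : Θ (d * d') ≠ 0 := fun h0 => mul_ne_zero hd hd' (hΘ (by rw [h0, map_zero]))
  refine mul_left_cancel₀ h4 ?_
  have h5 := congrArg Θ h3
  rw [map_mul, map_mul, ← h2, ← h2'] at h5
  rw [map_mul]
  linear_combination h5

omit [IsLocalRing A] [IsDomain B] in
theorem LiftRel.add {c c' : B} {g g' : PS k} (h : LiftRel φ Θ c g) (h' : LiftRel φ Θ c' g') :
    LiftRel φ Θ (c + c') (g + g') := by
  obtain ⟨⟨d, n, hd, h1, h2⟩, h3⟩ := h
  obtain ⟨⟨d', n', hd', h1', h2'⟩, h3'⟩ := h'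
  refine ⟨⟨d * d', d' * n + d * n', mul_ne_zero hd hd', ?_, ?_⟩, ?_⟩
  · simp only [map_mul, map_add, ← h1, ← h1']; ring
  · simp only [map_mul, map_add, ← h2, ← h2']; ring
  · have := Ideal.add_mem _ h3 h3'
    rw [map_add, map_add]
    convert this using 1
    ring

omit [IsLocalRing A] [IsDomain B] in
theorem LiftRel.mul {c c' : B} {g g' : PS k} (h : LiftRel φ Θ c g) (h' : LiftRel φ Θ c' g') :
    LiftRel φ Θ (c * c') (g * g') := by
  obtain ⟨⟨d, n, hd, h1, h2⟩, h3⟩ := h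
  obtain ⟨⟨d', n', hd', h1', h2'⟩, h3'⟩ := h'
  refine ⟨⟨d * d', n * n', mul_ne_zero hd hd', ?_, ?_⟩, ?_⟩
  · simp only [map_mul, ← h1, ← h1']; ring
  · simp only [map_mul, ← h2, ← h2']; ring
  · have := Ideal.add_mem _ (Ideal.mul_mem_right c' _ h3)
      (Ideal.mul_mem_left _ (algebraMap k B (constantCoeff g)) h3')
    rw [map_mul, map_mul]
    convert this using 1
    ring

omit [IsDomain A] [IsDomain B] in
theorem liftRel_map (hm : ∀ a ∈ maximalIdeal A, φ a ∈ maximalIdeal B)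
    (hΘm : ∀ a, constantCoeff (Θ a) = 0 → a ∈ maximalIdeal A) (a : A) : LiftRel φ Θ (φ a) (Θ a) := by
  refine ⟨⟨1, a, one_ne_zero, by simp, by simp⟩, ?_⟩
  have h1 : a - algebraMap k A (constantCoeff (Θ a)) ∈ maximalIdeal A := by
    apply hΘm
    rw [map_sub, map_sub, AlgHom.commutes, MvPowerSeries.algebraMap_apply]
    simp
  have := hm _ h1
  rwa [map_sub, AlgHom.commutes] at this

omit [IsDomain A] [IsLocalRing A] in
-- This is what the condition on constant terms in `LiftRel` is for: a unit `c` has a residue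
-- different from 0, so `g` is invertible.
theorem LiftRel.inv (hφ : Function.Injective φ) {c c' : B} {g : PS k} (h : LiftRel φ Θ c g)
    (hc : c * c' = 1) : ∃ g', g * g' = 1 ∧ LiftRel φ Θ c' g' := by
  obtain ⟨⟨d, n, hd, h1, h2⟩, h3⟩ := h
  have hcu : IsUnit c := IsUnit.of_mul_eq_one _ hc
  have hg0 : constantCoeff g ≠ 0 := by
    intro h0
    rw [h0, map_zero, sub_zero] at h3
    exact (IsLocalRing.mem_maximalIdeal _).1 h3 hcu
  have hg : IsUnit g := by
    rwa [MvPowerSeries.isUnit_iff_constantCoeff, isUnit_iff_ne_zero]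
  obtain ⟨g', hg'⟩ := hg.exists_right_inv
  refine ⟨g', hg', ⟨n, d, ?_, ?_, ?_⟩, ?_⟩
  · rintro rfl
    rw [map_zero] at h1
    rcases mul_eq_zero.1 h1 with h | h
    · exact hd (hφ (by rw [h, map_zero]))
    · exact hcu.ne_zero h
  · rw [← h1, mul_assoc, hc, mul_one]
  · rw [← h2, mul_assoc, hg', mul_one]
  · have hgg : constantCoeff g * constantCoeff g' = 1 := by rw [← map_mul, hg', map_one]
    have h4 : c' - algebraMap k B (constantCoeff g') =
        -(c' * algebraMap k B (constantCoeff g')) * (c - algebraMap k B (constantCoeff g)) := by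
      have h5 : algebraMap k B (constantCoeff g) * algebraMap k B (constantCoeff g') = 1 := by
        rw [← map_mul, hgg, map_one]
      linear_combination algebraMap k B (constantCoeff g') * hc - c' * h5
    rw [h4]
    exact Ideal.mul_mem_left _ _ h3

end Lift

/-! ### The blow up in coordinates. -/

section BlowMap
variable {k : Type u} [Field k]

/-- An endomorphism is continuous, so a coefficient of the image which is fed by one monomial only
can be computed from that monomial, although `f` has infinitely many. -/
theorem coeff_algHom_of_unique (θ : PS k →ₐ[k] PS k) {f : PS k} {m N : Fin 3 →₀ ℕ}
    (h : ∀ n, n ≠ m → coeff n f ≠ 0 → coeff N (θ (monomial n 1)) = 0) :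
    coeff N (θ f) = coeff m f * coeff N (θ (monomial m 1)) := by
  have h1 : f - coeff m f • monomial m (1 : k) ∈ suppIn fun n => n ≠ m ∧ coeff n f ≠ 0 := by
    rw [mem_suppIn]
    intro n hn
    rw [map_sub, coeff_smul, coeff_monomial] at hn
    by_cases hnm : n = m
    · subst hnm
      simp at hn
    · rw [if_neg hnm, mul_zero, sub_zero] at hn
      exact ⟨hnm, hn⟩
  have h2 : θ (f - coeff m f • monomial m (1 : k)) ∈ suppIn fun n => n ≠ N := by
    refine algHom_mem_suppIn θ h1 (fun n hn => ?_)
    rw [mem_suppIn]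
    rintro n' hn' rfl
    exact hn' (h n hn.1 hn.2)
  by_contra h3
  have h4 : coeff N (θ (f - coeff m f • monomial m (1 : k))) ≠ 0 := by
    rw [map_sub, map_smul, map_sub, coeff_smul]
    exact sub_ne_zero.2 h3
  exact (mem_suppIn.1 h2) N h4 rfl

theorem coeff_X1_add_C_pow (c : k) (m : ℕ) (n : Fin 3 →₀ ℕ) :
    coeff n ((X 1 + C c : PS k) ^ m) =
      if n 0 = 0 ∧ n 2 = 0 then (m.choose (n 1) : k) * c ^ (m - n 1) else 0 := by
  rw [add_pow, map_sum]
  have h1 : ∀ i, coeff n ((X 1 : PS k) ^ i * C c ^ (m - i) * (m.choose i : PS k)) =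
      if n = Finsupp.single 1 i then (m.choose i : k) * c ^ (m - i) else 0 := by
    intro i
    have : (X 1 : PS k) ^ i * C c ^ (m - i) * (m.choose i : PS k) =
        C ((m.choose i : k) * c ^ (m - i)) * X 1 ^ i := by
      rw [map_mul, map_pow, map_natCast]
      ring
    rw [this, coeff_C_mul, coeff_X_pow]
    split_ifs <;> simp
  rw [Finset.sum_congr rfl fun i _ => h1 i]
  by_cases hn : n 0 = 0 ∧ n 2 = 0
  · have hn1 : n = Finsupp.single 1 (n 1) := exp_ext (by simp [hn.1]) (by simp) (by simp [hn.2])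
    rw [if_pos hn]
    by_cases hm : n 1 ≤ m
    · rw [Finset.sum_eq_single (n 1)]
      · rw [if_pos hn1]
      · intro b _ hb
        rw [if_neg]
        intro h
        apply hb
        rw [h]
        simp
      · intro h
        simp at h
        omega
    · rw [Nat.choose_eq_zero_of_lt (by omega), Nat.cast_zero, zero_mul]
      refine Finset.sum_eq_zero fun i hi => ?_
      rw [if_neg]
      intro h
      have : n 1 = i := by rw [h]; simp
      simp at hi
      omega
  · rw [if_neg hn]
    refine Finset.sum_eq_zero fun i _ => ?_
    rw [if_neg]
    rintro rfl
    simp at hn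

/-- The images of the coordinates under the blow up, divided by the equation `x` of the
exceptional divisor. -/
def blowQuot (c : k) (s : Fin 3) : PS k := ![1, X 1 + C c, X 2] s

theorem blowMap_aux (S : Finset (Fin 3)) (c : k) (s : Fin 3) :
    (if s ∈ S then X 0 * blowQuot c s else X s : PS k) ∈ mm k := by
  split_ifs
  · exact Ideal.mul_mem_right _ _ (X_mem_mm 0)
  · exact X_mem_mm s

/-- The blow up of the centre defined by `X s`, `s ∈ S`, at the point `(0, c, 0)` of the chart
defined by `X 0`. -/
def blowMap (S : Finset (Fin 3)) (c : k) : PS k →ₐ[k] PS k := sub3 _ (blowMap_aux S c)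

theorem blowMap_X (S : Finset (Fin 3)) (c : k) (s : Fin 3) :
    blowMap S c (X s) = if s ∈ S then X 0 * blowQuot c s else X s := sub3_X _ _ s

theorem blowMap_X_mem {S : Finset (Fin 3)} {s : Fin 3} (h : s ∈ S) (c : k) :
    blowMap S c (X s) = X 0 * blowQuot c s := by rw [blowMap_X, if_pos h]

/-- The first two coordinates of a curve or the three coordinates. -/
def IsCenter (S : Finset (Fin 3)) : Prop := 0 ∈ S ∧ 2 ∈ S

theorem blowMap_monomial {S : Finset (Fin 3)} (hS : IsCenter S) (c : k) (n : Fin 3 →₀ ℕ) :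
    blowMap S c (monomial n 1) = X 0 ^ wt (ind S) n * X 2 ^ n 2 *
      (if 1 ∈ S then X 1 + C c else X 1) ^ n 1 := by
  rw [algHom_monomial, blowMap_X_mem hS.1, blowMap_X_mem hS.2, blowMap_X]
  have h0 : blowQuot c 0 = 1 := rfl
  have h1 : blowQuot c 1 = X 1 + C c := rfl
  have h2 : blowQuot c 2 = X 2 := rfl
  rw [h0, h1, h2]
  generalize (X 1 + C c : PS k) = Y
  simp only [wt, ind, hS.1, hS.2, if_true]
  split_ifs <;> ring

theorem coeff_blowMap_monomial {S : Finset (Fin 3)} (hS : IsCenter S) (c : k)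
    (n N : Fin 3 →₀ ℕ) : coeff N (blowMap S c (monomial n 1)) =
      if N 0 = wt (ind S) n ∧ N 2 = n 2 then
        ((n 1).choose (N 1) : k) * (if 1 ∈ S then c else 0) ^ (n 1 - N 1) else 0 := by
  have h1 : (if 1 ∈ S then X 1 + C c else X 1 : PS k) = X 1 + C (if 1 ∈ S then c else 0) := by
    split_ifs <;> simp
  rw [blowMap_monomial hS, h1]
  by_cases hN : wt (ind S) n ≤ N 0 ∧ n 2 ≤ N 2
  · obtain ⟨N', rfl⟩ : ∃ N' : Fin 3 →₀ ℕ,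
        N = N' + Finsupp.single 2 (n 2) + Finsupp.single 0 (wt (ind S) n) :=
      ⟨N - (Finsupp.single 0 (wt (ind S) n) + Finsupp.single 2 (n 2)), by
        obtain ⟨h2, h3⟩ := hN
        refine exp_ext ?_ ?_ ?_
        · simp
          omega
        · simp
        · simp
          omega⟩
    rw [mul_assoc, coeff_X_pow_mul_add, coeff_X_pow_mul_add, coeff_X1_add_C_pow]
    simp
  · have hne : ¬(N 0 = wt (ind S) n ∧ N 2 = n 2) := by omega
    rw [if_neg hne]
    rcases not_and_or.1 hN with h | h
    · rw [mul_assoc]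
      exact coeff_X_pow_mul_eq_zero 0 _ _ (not_le.1 h)
    · rw [mul_comm (X 0 ^ _), mul_assoc]
      exact coeff_X_pow_mul_eq_zero 2 _ _ (not_le.1 h)

/-- When `y` belongs to the centre, consider the monomials with a given order along the centre and a
given exponent of `z`: they are finitely many, and the one with the largest exponent of `y` alone
produces the corresponding power of `y` after `y ↦ x (y + c)`. When it does not, distinct monomials
have distinct images. -/
theorem blowMap_injective {S : Finset (Fin 3)} (hS : IsCenter S) (c : k) :
    Function.Injective (blowMap S c) := by
  rw [injective_iff_map_eq_zero]
  intro f hf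
  by_contra h0
  obtain ⟨m, hm⟩ : ∃ m, coeff m f ≠ 0 := by
    by_contra! h
    exact h0 (MvPowerSeries.ext h)
  let T : Set ℕ := {j | ∃ n, coeff n f ≠ 0 ∧ wt (ind S) n = wt (ind S) m ∧ n 2 = m 2 ∧ n 1 = j}
  by_cases h1 : 1 ∈ S
  · have hfin : T.Finite := by
      refine (Set.finite_Iic (wt (ind S) m)).subset ?_
      rintro j ⟨n, -, hn, -, rfl⟩
      rw [← hn]
      simp [wt, ind, h1]
      omega
    obtain ⟨j, ⟨n, hn, hn1, hn2, hn3⟩, hj⟩ := hfin.exists_maximal ⟨_, m, hm, rfl, rfl, rfl⟩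
    let N : Fin 3 →₀ ℕ := Finsupp.single 0 (wt (ind S) m) + Finsupp.single 1 j +
      Finsupp.single 2 (m 2)
    have h2 := coeff_algHom_of_unique (blowMap S c) (f := f) (m := n) (N := N) ?_
    · rw [hf, map_zero, coeff_blowMap_monomial hS] at h2
      simp [N, hn1, hn2, hn3] at h2
      exact hn h2.symm
    · intro n' hn' hn0
      rw [coeff_blowMap_monomial hS, ite_eq_right_iff]
      rintro ⟨h3, h4⟩
      have hN0 : N 0 = wt (ind S) m := by simp [N]
      have hN1 : N 1 = j := by simp [N]
      have hN2 : N 2 = m 2 := by simp [N]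
      rw [hN0] at h3
      rw [hN2] at h4
      rw [hN1]
      have h5 : n' 1 ≤ j := by
        by_contra h6
        exact h6 (hj ⟨n', hn0, h3.symm, h4.symm, rfl⟩ (by omega))
      rcases h5.lt_or_eq with h6 | h6
      · rw [Nat.choose_eq_zero_of_lt h6, Nat.cast_zero, zero_mul]
      · refine absurd ?_ hn'
        have h7 := h3.symm.trans hn1.symm
        simp only [wt, ind, hS.1, hS.2, h1, if_true] at h7
        exact exp_ext (by omega) (by omega) (by omega)
  · let N : Fin 3 →₀ ℕ := Finsupp.single 0 (wt (ind S) m) + Finsupp.single 1 (m 1) +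
      Finsupp.single 2 (m 2)
    have h2 := coeff_algHom_of_unique (blowMap S c) (f := f) (m := m) (N := N) ?_
    · rw [hf, map_zero, coeff_blowMap_monomial hS] at h2
      simp [N] at h2
      exact hm h2.symm
    · intro n' hn' hn0
      rw [coeff_blowMap_monomial hS, ite_eq_right_iff]
      rintro ⟨h3, h4⟩
      have hN0 : N 0 = wt (ind S) m := by simp [N]
      have hN1 : N 1 = m 1 := by simp [N]
      have hN2 : N 2 = m 2 := by simp [N]
      rw [hN0] at h3
      rw [hN2] at h4
      rw [hN1, if_neg h1]
      rcases lt_trichotomy (n' 1) (m 1) with h6 | h6 | h6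
      · rw [Nat.choose_eq_zero_of_lt h6, Nat.cast_zero, zero_mul]
      · refine absurd ?_ hn'
        simp only [wt, ind, hS.1, hS.2, h1, if_true, if_false] at h3
        exact exp_ext (by omega) (by omega) (by omega)
      · rw [zero_pow (by omega), mul_zero]

/-- Elements of the `n`-th power of the ideal of the centre become divisible by `x ^ n`. -/
theorem exists_blowMap_eq {S : Finset (Fin 3)} (c : k) (I : Ideal (PS k)) {f : PS k}
    (hI : I.map (blowMap S c).toRingHom ≤ I) (n : ℕ) (hf : f ∈ I * varIdeal S ^ n) :
    ∃ g ∈ I, blowMap S c f = X 0 ^ n * g := by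
  have h1 : (varIdeal S ^ n).map (blowMap S c).toRingHom ≤ Ideal.span {X 0 ^ n} := by
    rw [Ideal.map_pow, ← Ideal.span_singleton_pow]
    refine Ideal.pow_right_mono ?_ n
    rw [varIdeal, Ideal.map_span, Ideal.span_le]
    rintro _ ⟨_, ⟨s, hs, rfl⟩, rfl⟩
    change blowMap S c (X s) ∈ _
    rw [blowMap_X_mem hs]
    exact Ideal.mul_mem_right _ _ (Ideal.mem_span_singleton_self _)
  have h2 := Ideal.mem_map_of_mem (blowMap S c).toRingHom hf
  rw [Ideal.map_mul] at h2
  have h3 := Ideal.mul_mono hI h1 h2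
  rw [mul_comm, Ideal.mem_span_singleton_mul] at h3
  obtain ⟨g, hg, hg'⟩ := h3
  exact ⟨g, hg, hg'.symm⟩

/-- A monomial of order above `q` along the centre has a factor from the centre to spare. One of
order exactly `q` but of larger degree exists only for a curve, and is then divisible by `y`. -/
theorem mem_mm_mul_varIdeal_pow {S : Finset (Fin 3)} (hS : IsCenter S) {q : ℕ} {f : PS k}
    (hf : ∀ n, coeff n f ≠ 0 → q ≤ wt (ind S) n ∧ q < deg n) : f ∈ mm k * varIdeal S ^ q := by
  classical
  have hle : varIdeal (k := k) S ≤ mm k := by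
    rw [varIdeal, Ideal.span_le]
    rintro _ ⟨s, -, rfl⟩
    exact X_mem_mm s
  let f1 : PS k := mkPS fun n => if q < wt (ind S) n then coeff n f else 0
  have h1 : f1 ∈ mm k * varIdeal S ^ q := by
    have : f1 ∈ varIdeal S ^ (q + 1) := by
      rw [varIdeal_pow, mem_wIdeal_iff]
      intro n hn
      simp only [f1, coeff_mkPS] at hn
      by_contra h
      exact hn (if_neg (by omega))
    rw [pow_succ'] at this
    exact Ideal.mul_mono_left hle this
  have h2 : ∀ n, coeff n (f - f1) ≠ 0 → coeff n f ≠ 0 ∧ wt (ind S) n ≤ q := by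
    intro n hn
    simp only [f1, map_sub, coeff_mkPS] at hn
    split_ifs at hn with h
    · simp at hn
    · exact ⟨by simpa using hn, by omega⟩
  have h3 : ∀ n, coeff n (f - f1) ≠ 0 → 1 ≤ n 1 ∧ 1 ∉ S := by
    intro n hn
    obtain ⟨h4, h5⟩ := h2 n hn
    have h6 := hf n h4
    by_cases h1 : 1 ∈ S
    · simp only [wt, ind, hS.1, hS.2, h1, if_true, deg] at h5 h6
      omega
    · simp only [wt, ind, hS.1, hS.2, h1, if_true, if_false, deg] at h5 h6
      exact ⟨by omega, h1⟩
  have h4 : f - f1 ∈ mm k * varIdeal S ^ q := by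
    obtain ⟨g, hg⟩ : (X 1 : PS k) ^ 1 ∣ f - f1 := X_pow_dvd_iff.2 fun n hn => by
      have := (h3 n hn).1
      omega
    rw [hg, pow_one]
    refine Ideal.mul_mem_mul (X_mem_mm 1) ?_
    rw [varIdeal_pow, mem_wIdeal_iff]
    intro n hn
    rw [← coeff_X_pow_mul_add 1 1, ← hg] at hn
    have h5 := (hf _ (h2 _ hn).1).1
    rw [wt_add, wt_single, ind, if_neg (h3 _ hn).2] at h5
    simpa using h5
  rw [← sub_add_cancel f f1]
  exact Ideal.add_mem _ h4 h1

end BlowMap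

/-! ### The local ring of the blow up. -/

section BlowUp
variable {k : Type u} [Field k] {A B : Type v} [CommRing A] [IsDomain A] [IsLocalRing A]
  [IsNoetherianRing A] [Algebra k A] [CommRing B] [IsDomain B] [IsLocalRing B] [IsNoetherianRing B]
  [Algebra k B]

/-- `B` is the local ring of the blow up of the ideal `J` of `A` at a closed point lying over the
closed point, and `t` generates `J B`. -/
structure IsBlowUp (φ : A →ₐ[k] B) (J : Ideal A) (t : A) : Prop where
  inj : Function.Injective φ
  mem : t ∈ J
  ne_zero : t ≠ 0
  comap : (maximalIdeal B).comap φ.toRingHom = maximalIdeal A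
  res : ∀ c : B, ∃ r : k, c - algebraMap k B r ∈ maximalIdeal B
  map_eq : J.map φ.toRingHom = Ideal.span {φ t}
  gen : ∀ c : B, ∃ b ∈ Algebra.adjoin k (Set.range φ ∪ {b : B | ∃ j ∈ J, φ t * b = φ j}),
    ∃ s ∈ Algebra.adjoin k (Set.range φ ∪ {b : B | ∃ j ∈ J, φ t * b = φ j}), IsUnit s ∧ s * c = b

variable {φ : A →ₐ[k] B} {J : Ideal A} {t : A} {ι : A →ₐ[k] PS k} {S : Finset (Fin 3)}
  {j : Fin 3 → A}

omit [IsDomain A] [IsNoetherianRing A] [IsDomain B] [IsNoetherianRing B] in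
theorem IsBlowUp.phi_ne_zero (hφ : IsBlowUp φ J t) : φ t ≠ 0 := fun h =>
  hφ.ne_zero (hφ.inj (by rw [h, map_zero]))

omit [IsDomain A] [IsNoetherianRing A] [IsDomain B] [IsNoetherianRing B] in
theorem IsBlowUp.phi_mem (hφ : IsBlowUp φ J t) {a : A} (ha : a ∈ maximalIdeal A) :
    φ a ∈ maximalIdeal B := by
  rw [← hφ.comap] at ha
  exact ha

omit [IsDomain A] [IsNoetherianRing A] [IsDomain B] [IsNoetherianRing B] in
theorem IsBlowUp.exists_eq (hφ : IsBlowUp φ J t) {n : ℕ} {I : Ideal A} {a : A} (ha : a ∈ I * J ^ n) :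
    ∃ b ∈ I.map φ.toRingHom, φ a = φ t ^ n * b := by
  have h1 := Ideal.mem_map_of_mem φ.toRingHom ha
  rw [Ideal.map_mul, Ideal.map_pow, hφ.map_eq, Ideal.span_singleton_pow, mul_comm,
    Ideal.mem_span_singleton_mul] at h1
  obtain ⟨b, hb, h⟩ := h1
  exact ⟨b, hb, h.symm⟩

omit [IsDomain A] [IsNoetherianRing A] [IsNoetherianRing B] in
theorem IsBlowUp.exists_units (hφ : IsBlowUp φ J t) (hj : IsGens ι S J j) :
    ∃ u : Fin 3 → B, (∀ s ∈ S, φ (j s) = φ t * u s) ∧ ∃ s ∈ S, IsUnit (u s) := by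
  have h1 : ∀ s, ∃ b : B, s ∈ S → φ (j s) = φ t * b := by
    intro s
    by_cases hs : s ∈ S
    · obtain ⟨b, -, hb⟩ := hφ.exists_eq (n := 1) (I := ⊤) (a := j s) (by simpa using hj.mem s hs)
      exact ⟨b, fun _ => by simpa using hb⟩
    · exact ⟨0, fun h => absurd h hs⟩
  choose u hu using h1
  refine ⟨u, hu, ?_⟩
  by_contra! h2
  -- If all quotients were non-units, `J B` would lie in `t` times the maximal ideal, and so would
  -- `t` itself.
  have h3 : J ≤ (Ideal.span {φ t} * maximalIdeal B).comap φ.toRingHom := by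
    nth_rewrite 1 [hj.span]
    rw [Ideal.span_le]
    rintro _ ⟨s, hs, rfl⟩
    change φ (j s) ∈ Ideal.span {φ t} * maximalIdeal B
    rw [hu s hs]
    exact Ideal.mul_mem_mul (Ideal.mem_span_singleton_self _)
      ((IsLocalRing.mem_maximalIdeal _).2 (h2 s hs))
  have h4 : φ t ∈ Ideal.span {φ t} * maximalIdeal B := h3 hφ.mem
  rw [Ideal.mem_span_singleton_mul] at h4
  obtain ⟨m, hm, hmt⟩ := h4
  have h5 : m = 1 := mul_left_cancel₀ hφ.phi_ne_zero (by rw [hmt, mul_one])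
  rw [h5] at hm
  exact (IsLocalRing.mem_maximalIdeal _).1 hm isUnit_one

omit [IsDomain A] [IsNoetherianRing A] [IsNoetherianRing B] in
/-- Subalgebras of the blow up containing a set of generators and inverses are everything. -/
theorem IsBlowUp.eq_top (hφ : IsBlowUp φ J t) (hj : IsGens ι S J j) {u0 : B}
    (hu0 : φ (j 0) = φ t * u0) {w : Fin 3 → B} (hw : ∀ s ∈ S, φ (j s) = φ (j 0) * w s)
    {T : Subalgebra k B} (hA : ∀ a, φ a ∈ T) (hinv : ∀ c c', c ∈ T → c * c' = 1 → c' ∈ T)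
    (hwT : ∀ s ∈ S, w s ∈ T) (c : B) : c ∈ T := by
  have h1 : ∀ x ∈ J, ∃ y ∈ T, φ x = φ (j 0) * y := by
    intro x hx
    rw [hj.span] at hx
    refine Submodule.span_induction ?_ ?_ ?_ ?_ hx
    · rintro _ ⟨s, hs, rfl⟩
      exact ⟨w s, hwT s hs, hw s hs⟩
    · exact ⟨0, T.zero_mem, by simp⟩
    · rintro x y - - ⟨a, ha, hax⟩ ⟨b, hb, hby⟩
      exact ⟨a + b, T.add_mem ha hb, by rw [map_add, hax, hby, mul_add]⟩
    · rintro r x - ⟨a, ha, hax⟩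
      exact ⟨φ r * a, T.mul_mem (hA r) ha, by rw [smul_eq_mul, map_mul, hax]; ring⟩
  -- Since `t ∈ J`, it is `j 0` times an element `y` of `T`; then `u0` is the inverse of `y`, so it
  -- lies in `T`. Fractions over `t` thus become fractions over `j 0`.
  obtain ⟨y, hy, hty⟩ := h1 t hφ.mem
  have hyu : y * u0 = 1 := by
    refine mul_left_cancel₀ hφ.phi_ne_zero ?_
    rw [mul_one]
    nth_rewrite 2 [hty]
    rw [hu0]
    ring
  have hu : u0 ∈ T := hinv _ _ hy hyu
  have h2 : Algebra.adjoin k (Set.range φ ∪ {b : B | ∃ j ∈ J, φ t * b = φ j}) ≤ T := by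
    rw [Algebra.adjoin_le_iff]
    rintro b (⟨a, rfl⟩ | ⟨x, hx, hb⟩)
    · exact hA a
    · obtain ⟨y, hy, hxy⟩ := h1 x hx
      have : b = u0 * y := mul_left_cancel₀ hφ.phi_ne_zero (by rw [hb, hxy, hu0]; ring)
      rw [this]
      exact T.mul_mem hu hy
  obtain ⟨b, hb, s, hs, hsu, hsc⟩ := hφ.gen c
  obtain ⟨s', hs'⟩ := hsu.exists_right_inv
  have h3 : c = s' * b := by rw [← hsc, ← mul_assoc, mul_comm s', hs', one_mul]
  rw [h3]
  exact T.mul_mem (hinv _ _ (h2 hs) hs') (h2 hb)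

end BlowUp

/-- The filtration generated by the pairs `(f', l)` with `x ^ l f' = θ f`, `f` of level `l`. -/
def blowFilt {k : Type u} [Field k] (θ : PS k →ₐ[k] PS k) (R : IdealisticFiltration (PS k)) :
    IdealisticFiltration (PS k) :=
  IdealisticFiltration.generate {s | ∃ f ∈ R.level s.2, X 0 ^ s.2 * s.1 = θ f}

theorem X_ne_zero {k : Type u} [Field k] (i : Fin 3) : (X i : PS k) ≠ 0 := fun h => by
  have := congrArg (coeff (Finsupp.single i 1)) h
  simp at this

/-! ### Lifting of coordinates, filtration and divisors to the blow up. -/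

section BlowUp
variable {k : Type u} [Field k] {A B : Type v} [CommRing A] [IsDomain A] [IsLocalRing A]
  [IsNoetherianRing A] [Algebra k A] [CommRing B] [IsDomain B] [IsLocalRing B] [IsNoetherianRing B]
  [Algebra k B]
variable {φ : A →ₐ[k] B} {J : Ideal A} {t : A} {ι : A →ₐ[k] PS k} {S : Finset (Fin 3)}
  {j : Fin 3 → A} {c : k}

omit [IsDomain A] [IsNoetherianRing A] in
theorem IsCompletion.exists_res (hι : IsCompletion ι) (a : A) :
    ∃ r : k, a - algebraMap k A r ∈ maximalIdeal A := by
  refine ⟨constantCoeff (ι a), hι.mem_maximalIdeal.1 (mem_mm.2 ?_)⟩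
  rw [map_sub, map_sub, AlgHom.commutes, MvPowerSeries.algebraMap_apply]
  simp

theorem blowMap_map_le (S : Finset (Fin 3)) (c : k) (n : ℕ) :
    (mm k ^ n).map (blowMap S c).toRingHom ≤ mm k ^ n := map_mm_le _ n

omit [IsDomain A] [IsNoetherianRing A] in
theorem IsGens.exists_theta (hj : IsGens ι S J j) (c : k) {s : Fin 3} (hs : s ∈ S) :
    ∃ r ∈ mm k ^ 2, blowMap S c (ι (j s)) = X 0 * (blowQuot c s - r) := by
  obtain ⟨r, hr, h⟩ := exists_blowMap_eq c (mm k ^ 2) (blowMap_map_le S c 2) 1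
    (by rw [pow_one]; exact hj.sub s hs)
  refine ⟨r, hr, ?_⟩
  rw [map_sub, blowMap_X_mem hs, pow_one] at h
  linear_combination -h

omit [IsNoetherianRing B] in
/-- The lift of a chart of `A` to a chart of the blow up. -/
theorem IsBlowUp.exists_chart (hφ : IsBlowUp φ J t) (hι : IsCompletion ι) (hS : IsCenter S)
    (hj : IsGens ι S J j) {w : Fin 3 → B} (hw : ∀ s ∈ S, φ (j s) = φ (j 0) * w s)
    {u0 : B} (hu : IsUnit u0) (hu0 : φ (j 0) = φ t * u0)
    (hwc : ∀ s ∈ S, w s - algebraMap k B (constantCoeff (blowQuot c s)) ∈ maximalIdeal B) :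
    ∃ ψ : B →ₐ[k] PS k, IsCompletion ψ ∧ ∀ a, ψ (φ a) = blowMap S c (ι a) := by
  have hjm : ∀ s, j s ∈ maximalIdeal A := fun s => by
    rw [hj.max]
    exact Ideal.subset_span ⟨s, rfl⟩
  set Θ : A →ₐ[k] PS k := (blowMap S c).comp ι with hΘ
  have hΘa : ∀ a, Θ a = blowMap S c (ι a) := fun a => rfl
  have hΘi : Function.Injective Θ := (blowMap_injective hS c).comp hι.injective
  have hΘm : ∀ a, constantCoeff (Θ a) = 0 → a ∈ maximalIdeal A := by
    intro a ha
    rw [hΘa, constantCoeff_algHom] at ha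
    exact hι.mem_maximalIdeal.1 (mem_mm.2 ha)
  have hrel : ∀ a, LiftRel φ Θ (φ a) (Θ a) := liftRel_map (fun a => hφ.phi_mem) hΘm
  have hj0 : j 0 ≠ 0 := by
    intro h
    rw [h, map_zero] at hu0
    exact mul_ne_zero hφ.phi_ne_zero hu.ne_zero hu0.symm
  obtain ⟨r0, hr0, hΘ0⟩ := hj.exists_theta c hS.1
  have hq0 : blowQuot c 0 = 1 := rfl
  rw [hq0] at hΘ0
  have hunit : IsUnit (1 - r0) := by
    rw [MvPowerSeries.isUnit_iff_constantCoeff, map_sub, map_one,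
      mem_mm.1 (Ideal.pow_le_self two_ne_zero hr0), sub_zero]
    exact isUnit_one
  obtain ⟨y, hy⟩ := hunit.exists_right_inv
  -- The quotient `j s / j 0` is sent to `blowQuot c s` up to second order: both images are `x`
  -- times a series known modulo the square of the maximal ideal, and the factor belonging to `j 0`
  -- is a unit.
  have hwrel : ∀ s ∈ S, ∃ g, g - blowQuot c s ∈ mm k ^ 2 ∧ LiftRel φ Θ (w s) g := by
    intro s hs
    obtain ⟨r, hr, h⟩ := hj.exists_theta c hs
    have hg : y * (blowQuot c s - r) - blowQuot c s ∈ mm k ^ 2 := by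
      have : y * (blowQuot c s - r) - blowQuot c s = y * blowQuot c s * r0 - y * r := by
        linear_combination blowQuot c s * hy
      rw [this]
      exact Ideal.sub_mem _ (Ideal.mul_mem_left _ _ hr0) (Ideal.mul_mem_left _ _ hr)
    refine ⟨_, hg, ⟨j 0, j s, hj0, (hw s hs).symm, ?_⟩, ?_⟩
    · rw [hΘa, hΘa, hΘ0, h]
      linear_combination X 0 * (blowQuot c s - r) * hy
    · have h2 := mem_mm.1 (Ideal.pow_le_self two_ne_zero hg)
      rw [map_sub, sub_eq_zero] at h2
      rw [h2]
      exact hwc s hs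
  -- The elements of `B` admitting a value form a subalgebra closed under inverses and containing
  -- the generators, hence all of `B`. Values are unique because `φ` and `Θ` are injective.
  let T : Subalgebra k B :=
    { carrier := {c | ∃ g, LiftRel φ Θ c g}
      mul_mem' := fun ⟨g, hg⟩ ⟨g', hg'⟩ => ⟨_, hg.mul hg'⟩
      add_mem' := fun ⟨g, hg⟩ ⟨g', hg'⟩ => ⟨_, hg.add hg'⟩
      algebraMap_mem' := fun r => ⟨Θ (algebraMap k A r), by
        have := hrel (algebraMap k A r)
        rwa [AlgHom.commutes] at this⟩ }
  have hT : ∀ b : B, ∃ g, LiftRel φ Θ b g := fun b =>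
    hφ.eq_top hj hu0 hw (T := T) (fun a => ⟨_, hrel a⟩)
      (fun b b' ⟨g, hg⟩ hb => by
        obtain ⟨g', -, h⟩ := hg.inv hφ.inj hb
        exact ⟨g', h⟩)
      (fun s hs => by
        obtain ⟨g, -, h⟩ := hwrel s hs
        exact ⟨g, h⟩) b
  choose F hF using hT
  have huniq : ∀ {b g}, LiftRel φ Θ b g → F b = g := fun h => (hF _).unique hφ.inj hΘi h
  let ψ : B →ₐ[k] PS k :=
    { toFun := F
      map_one' := by
        have := hrel 1
        rw [map_one, map_one] at this
        exact huniq this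
      map_mul' := fun a b => huniq ((hF a).mul (hF b))
      map_zero' := by
        have := hrel 0
        rw [map_zero, map_zero] at this
        exact huniq this
      map_add' := fun a b => huniq ((hF a).add (hF b))
      commutes' := fun r => by
        have := hrel (algebraMap k A r)
        rw [AlgHom.commutes, AlgHom.commutes] at this
        exact huniq this }
  have hψ : ∀ {b g}, LiftRel φ Θ b g → ψ b = g := huniq
  have hψφ : ∀ a, ψ (φ a) = Θ a := fun a => hψ (hrel a)
  refine ⟨ψ, ?_, hψφ⟩
  let b : Fin 3 → B := ![φ (j 0), if 1 ∈ S then w 1 - algebraMap k B c else φ (j 1), w 2]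
  have hb0 : b 0 = φ (j 0) := rfl
  have hb1 : b 1 = if 1 ∈ S then w 1 - algebraMap k B c else φ (j 1) := rfl
  have hb2 : b 2 = w 2 := rfl
  have hq1 : blowQuot c 1 = X 1 + C c := rfl
  have hq2 : blowQuot c 2 = X 2 := rfl
  have hbm : ∀ i, b i ∈ maximalIdeal B := by
    intro i
    fin_cases i
    · exact hφ.phi_mem (hjm 0)
    · change b 1 ∈ _
      rw [hb1]
      split_ifs with h
      · have := hwc 1 h
        rw [hq1] at this
        simpa using this
      · exact hφ.phi_mem (hjm 1)
    · have := hwc 2 hS.2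
      rw [hq2, constantCoeff_X, map_zero, sub_zero] at this
      exact this
  set N : Ideal B := Ideal.span (Set.range b) with hN
  have hNm : N ≤ maximalIdeal B := by
    rw [hN, Ideal.span_le]
    rintro _ ⟨i, rfl⟩
    exact hbm i
  have hbN : ∀ i, b i ∈ N := fun i => Ideal.subset_span ⟨i, rfl⟩
  have hwN : ∀ s ∈ S, w s - algebraMap k B (constantCoeff (blowQuot c s)) ∈ N := by
    intro s hs
    fin_cases s
    · have h1 : w 0 = 1 := by
        have h2 := hw 0 hS.1
        refine mul_left_cancel₀ (a := φ (j 0)) (fun h => hj0 (hφ.inj (by rw [h, map_zero]))) ?_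
        rw [← h2, mul_one]
      change w 0 - algebraMap k B (constantCoeff (blowQuot c 0)) ∈ N
      rw [h1, hq0]
      simp
    · have := hbN 1
      rw [hb1, if_pos (show (1 : Fin 3) ∈ S from hs)] at this
      change w 1 - algebraMap k B (constantCoeff (blowQuot c 1)) ∈ N
      rw [hq1]
      simpa using this
    · change w 2 - algebraMap k B (constantCoeff (blowQuot c 2)) ∈ N
      rw [hq2, constantCoeff_X, map_zero, sub_zero]
      exact hbN 2
  have hφN : ∀ a ∈ maximalIdeal A, φ a ∈ N := by
    have : maximalIdeal A ≤ N.comap φ.toRingHom := by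
      rw [hj.max, Ideal.span_le]
      rintro _ ⟨s, rfl⟩
      change φ (j s) ∈ N
      by_cases hs : s ∈ S
      · rw [hw s hs]
        exact Ideal.mul_mem_right _ _ (hbN 0)
      · have : s = 1 := by
          fin_cases s
          · exact absurd hS.1 hs
          · rfl
          · exact absurd hS.2 hs
        subst this
        have := hbN 1
        rwa [hb1, if_neg hs] at this
    exact fun a ha => this ha
  -- Every element of `B` is a constant modulo `N`, by the same generation argument. Therefore `N`
  -- is the whole maximal ideal, and the three elements `b` are generators mapping to coordinates.
  let T' : Subalgebra k B :=
    { carrier := {c | ∃ r, c - algebraMap k B r ∈ N}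
      mul_mem' := fun {a b} ⟨r, hr⟩ ⟨r', hr'⟩ => ⟨r * r', by
        have : a * b - algebraMap k B (r * r') =
            (a - algebraMap k B r) * b + algebraMap k B r * (b - algebraMap k B r') := by
          rw [map_mul]
          ring
        rw [this]
        exact Ideal.add_mem _ (Ideal.mul_mem_right _ _ hr) (Ideal.mul_mem_left _ _ hr')⟩
      add_mem' := fun {a b} ⟨r, hr⟩ ⟨r', hr'⟩ => ⟨r + r', by
        have := Ideal.add_mem _ hr hr'
        rw [map_add]
        convert this using 1
        ring⟩
      algebraMap_mem' := fun r => ⟨r, by simp⟩ }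
  have hT' : ∀ x : B, ∃ r, x - algebraMap k B r ∈ N := fun x =>
    hφ.eq_top hj hu0 hw (T := T')
      (fun a => by
        obtain ⟨r, hr⟩ := hι.exists_res a
        refine ⟨r, ?_⟩
        have := hφN _ hr
        rwa [map_sub, AlgHom.commutes] at this)
      (fun x x' ⟨r, hr⟩ hx => by
        have hr0 : r ≠ 0 := by
          rintro rfl
          rw [map_zero, sub_zero] at hr
          exact (IsLocalRing.mem_maximalIdeal _).1 (hNm hr) (IsUnit.of_mul_eq_one _ hx)
        refine ⟨r⁻¹, ?_⟩
        have h1 : algebraMap k B r * algebraMap k B r⁻¹ = 1 := by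
          rw [← map_mul, mul_inv_cancel₀ hr0, map_one]
        have : x' - algebraMap k B r⁻¹ =
            -(x' * algebraMap k B r⁻¹) * (x - algebraMap k B r) := by
          linear_combination algebraMap k B r⁻¹ * hx - x' * h1
        rw [this]
        exact Ideal.mul_mem_left _ _ hr)
      (fun s hs => ⟨_, hwN s hs⟩) x
  refine isCompletion_of_generators ψ b hφ.res (le_antisymm ?_ hNm) ?_
  · intro x hx
    obtain ⟨r, hr⟩ := hT' x
    have hr0 : r = 0 := by
      by_contra h0
      have h1 := Ideal.sub_mem _ hx (hNm hr)
      rw [sub_sub_cancel] at h1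
      exact (IsLocalRing.mem_maximalIdeal _).1 h1 ((isUnit_iff_ne_zero.2 h0).map _)
    rwa [hr0, map_zero, sub_zero] at hr
  · intro i
    fin_cases i
    · change ψ (b 0) - X 0 ∈ _
      rw [hb0, hψφ, hΘa, hΘ0]
      have : X 0 * (1 - r0) - X 0 = -X 0 * r0 := by ring
      rw [this]
      exact Ideal.mul_mem_left _ _ hr0
    · change ψ (b 1) - X 1 ∈ _
      rw [hb1]
      split_ifs with h
      · obtain ⟨g, hg, hgr⟩ := hwrel 1 h
        rw [map_sub, hψ hgr, AlgHom.commutes, MvPowerSeries.algebraMap_apply]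
        rw [hq1] at hg
        convert hg using 1
        simp
        ring
      · rw [hψφ, hΘa]
        have h1 := algHom_mem_mm_pow (blowMap S c) (hj.sub_sq 1)
        rw [map_sub, blowMap_X, if_neg h] at h1
        rw [← neg_sub]
        exact neg_mem h1
    · change ψ (b 2) - X 2 ∈ _
      obtain ⟨g, hg, hgr⟩ := hwrel 2 hS.2
      rw [hb2, hψ hgr, ← hq2]
      exact hg

omit [IsDomain B] [IsNoetherianRing B] [IsDomain A] [IsNoetherianRing A] [IsLocalRing B] in
theorem IsGens.exists_unit (hj : IsGens ι S J j) (hS : IsCenter S)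
    {u0 : B} (hu : IsUnit u0) (hu0 : φ (j 0) = φ t * u0) {ψ : B →ₐ[k] PS k}
    (hψ : ∀ a, ψ (φ a) = blowMap S c (ι a)) : ∃ U, IsUnit U ∧ ψ (φ t) = X 0 * U := by
  obtain ⟨r0, hr0, h⟩ := hj.exists_theta c hS.1
  have hunit : IsUnit (1 - r0) := by
    rw [MvPowerSeries.isUnit_iff_constantCoeff, map_sub, map_one,
      mem_mm.1 (Ideal.pow_le_self two_ne_zero hr0), sub_zero]
    exact isUnit_one
  obtain ⟨v, hv⟩ := hu.exists_right_inv
  refine ⟨(1 - r0) * ψ v, hunit.mul ((IsUnit.of_mul_eq_one _ (mul_comm u0 v ▸ hv)).map ψ), ?_⟩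
  have h1 : φ t = φ (j 0) * v := by rw [hu0, mul_assoc, hv, mul_one]
  have hq0 : blowQuot c 0 = 1 := rfl
  rw [h1, map_mul, hψ, h, hq0]
  ring

omit [IsDomain A] [IsNoetherianRing A] [IsDomain B] [IsNoetherianRing B] in
/-- The transform of a filtration, in the lifted chart. -/
theorem IsBlowUp.map_generate (hφ : IsBlowUp φ J t) {ψ : B →ₐ[k] PS k}
    {R : IdealisticFiltration A} (hR : ∀ l, R.level l ≤ J ^ l)
    (hψ : ∀ a, ψ (φ a) = blowMap S c (ι a)) {U : PS k} (hU : IsUnit U)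
    (hUt : ψ (φ t) = X 0 * U) :
    (IdealisticFiltration.generate {s : B × ℕ | ∃ (f : A) (a : ℕ), f ∈ R.level a ∧ s.2 = a ∧
      φ f = φ t ^ a * s.1}).map ψ.toRingHom = blowFilt (blowMap S c) (R.map ι.toRingHom) := by
  obtain ⟨V, hV⟩ := hU.exists_right_inv
  have hX0 : ∀ l, (X 0 : PS k) ^ l ≠ 0 := fun l => pow_ne_zero l (X_ne_zero 0)
  ext l : 2
  refine le_antisymm ?_ ?_
  · change Ideal.map _ _ ≤ _
    rw [Ideal.map_le_iff_le_comap]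
    refine IdealisticFiltration.generate_le
      (T := (blowFilt (blowMap S c) (R.map ι.toRingHom)).comap ψ.toRingHom) ?_ l
    rintro b l ⟨f, a, hf, rfl, hb⟩
    change ψ b ∈ (blowFilt _ _).level l
    have h1 : U ^ l * ψ b ∈ (blowFilt (blowMap S c) (R.map ι.toRingHom)).level l := by
      refine IdealisticFiltration.mem_generate ⟨ι f, Ideal.mem_map_of_mem ι.toRingHom hf, ?_⟩
      rw [← hψ, hb, map_mul, map_pow, hUt]
      ring
    have h2 : ψ b = V ^ l * (U ^ l * ψ b) := by
      rw [← mul_assoc, ← mul_pow, mul_comm V, hV, one_pow, one_mul]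
    rw [h2]
    exact Ideal.mul_mem_left _ _ h1
  · refine IdealisticFiltration.generate_le ?_ l
    rintro g l ⟨f, hf, hg⟩
    -- The extended level consists of combinations of images of elements of `A`. Each of these lies
    -- in `J ^ l`, so it can be divided in `B`, and the quotients are combined with the same
    -- coefficients.
    have h1 : ∃ g' ∈ ((IdealisticFiltration.generate {s : B × ℕ | ∃ (f : A) (a : ℕ),
        f ∈ R.level a ∧ s.2 = a ∧ φ f = φ t ^ a * s.1}).map ψ.toRingHom).level l,
        X 0 ^ l * g' = blowMap S c f := by
      refine Submodule.span_induction ?_ ?_ ?_ ?_ (hf : f ∈ Ideal.span _)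
      · rintro _ ⟨a, ha, rfl⟩
        obtain ⟨b, -, hb⟩ := hφ.exists_eq (n := l) (I := ⊤) (a := a) (by simpa using hR l ha)
        refine ⟨U ^ l * ψ b, Ideal.mul_mem_left _ _ (Ideal.mem_map_of_mem ψ.toRingHom
          (IdealisticFiltration.mem_generate ⟨a, l, ha, rfl, hb⟩)), ?_⟩
        change _ = blowMap S c (ι a)
        rw [← hψ, hb, map_mul, map_pow, hUt]
        ring
      · exact ⟨0, Ideal.zero_mem _, by simp⟩
      · rintro x y - - ⟨a, ha, hax⟩ ⟨b, hb, hby⟩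
        exact ⟨a + b, Ideal.add_mem _ ha hb, by rw [mul_add, hax, hby, map_add]⟩
      · rintro r x - ⟨a, ha, hax⟩
        refine ⟨blowMap S c r * a, Ideal.mul_mem_left _ _ ha, ?_⟩
        rw [smul_eq_mul, map_mul, ← hax]
        ring
    obtain ⟨g', hg', h⟩ := h1
    have : g = g' := mul_left_cancel₀ (hX0 l) (hg.trans h.symm)
    rw [this]
    exact hg'

theorem span_mul_unit {U : PS k} (hU : IsUnit U) (f : PS k) :
    Ideal.span {f * U} = Ideal.span {f} := Ideal.span_singleton_mul_right_unit hU f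

omit [IsDomain A] [IsLocalRing A] [IsNoetherianRing A] [IsDomain B] in
/-- The strict transform of the divisor defining the chart is empty. -/
theorem saturation_eq_top {D : Ideal A} (hD : D.map ι.toRingHom = Ideal.span {X 0})
    (hS : IsCenter S) {ψ : B →ₐ[k] PS k} (hψc : IsCompletion ψ)
    (hψ : ∀ a, ψ (φ a) = blowMap S c (ι a)) {U : PS k} (hUt : ψ (φ t) = X 0 * U) :
    saturation (D.map φ.toRingHom) (φ t) = ⊤ := by
  rw [Ideal.eq_top_iff_one]
  refine ⟨1, hψc.mem_of_mem_map ?_⟩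
  have h1 : ψ.toRingHom.comp φ.toRingHom = (blowMap S c).toRingHom.comp ι.toRingHom :=
    RingHom.ext hψ
  rw [Ideal.map_map, h1, ← Ideal.map_map, hD, Ideal.map_span, Set.image_singleton, pow_one, mul_one]
  change ψ (φ t) ∈ Ideal.span {blowMap S c (X 0)}
  rw [hUt, blowMap_X_mem hS.1]
  have hq0 : blowQuot c 0 = 1 := rfl
  rw [hq0, mul_one]
  exact Ideal.mul_mem_right _ _ (Ideal.mem_span_singleton_self _)

omit [IsDomain A] [IsDomain B] [IsNoetherianRing B] in
/-- The strict transform of the divisor `y = 0`. -/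
theorem saturation_map (hφ : IsBlowUp φ J t) (hι : IsCompletion ι)
    {D : Ideal A} (hD : D.map ι.toRingHom = Ideal.span {X 1})
    (hJ : J.map ι.toRingHom = varIdeal S) (hc : 1 ∉ S → c = 0) {ψ : B →ₐ[k] PS k}
    (hψ : ∀ a, ψ (φ a) = blowMap S c (ι a)) {U : PS k} (hU : IsUnit U)
    (hUt : ψ (φ t) = X 0 * U) :
    (saturation (D.map φ.toRingHom) (φ t)).map ψ.toRingHom = Ideal.span {X 1 + C c} := by
  have h1 : ψ.toRingHom.comp φ.toRingHom = (blowMap S c).toRingHom.comp ι.toRingHom :=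
    RingHom.ext hψ
  have hθ : ∃ ε, blowMap S c (X 1) = X 0 ^ ε * (X 1 + C c) ∧ (ε = 0 ∨ ε = 1 ∧ 1 ∈ S) := by
    by_cases h : 1 ∈ S
    · exact ⟨1, by rw [blowMap_X_mem h, pow_one]; rfl, Or.inr ⟨rfl, h⟩⟩
    · exact ⟨0, by rw [blowMap_X, if_neg h, hc h]; simp, Or.inl rfl⟩
  obtain ⟨ε, hε, hε'⟩ := hθ
  have h2 : (D.map φ.toRingHom).map ψ.toRingHom = Ideal.span {X 0 ^ ε * (X 1 + C c)} := by
    rw [Ideal.map_map, h1, ← Ideal.map_map, hD, Ideal.map_span, Set.image_singleton]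
    change Ideal.span {blowMap S c (X 1)} = _
    rw [hε]
  -- Either `c = 0` and the equation is `y`, prime to `x`, or `y + c` is a unit.
  have hX1 : ∀ n (f : PS k), X 1 + C c ∣ X 0 ^ n * f → X 1 + C c ∣ f := by
    intro n f h
    by_cases hc0 : c = 0
    · rw [hc0, map_zero, add_zero, ← pow_one (X 1)] at h ⊢
      rw [X_pow_dvd_iff] at h ⊢
      intro m hm
      rw [← coeff_X_pow_mul_add 0 n] at hm
      simpa using h _ hm
    · have : IsUnit (X 1 + C c : PS k) := by
        rw [MvPowerSeries.isUnit_iff_constantCoeff]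
        simpa using hc0
      exact this.dvd
  refine le_antisymm ?_ ?_
  · rw [Ideal.map_le_iff_le_comap]
    rintro b ⟨n, hn⟩
    change ψ b ∈ Ideal.span {X 1 + C c}
    have h3 := Ideal.mem_map_of_mem ψ.toRingHom hn
    rw [h2, Ideal.mem_span_singleton] at h3
    change _ ∣ ψ (φ t ^ n * b) at h3
    rw [map_mul, map_pow, hUt] at h3
    rw [Ideal.mem_span_singleton]
    have h4 : X 1 + C c ∣ X 0 ^ n * (U ^ n * ψ b) := by
      refine (Dvd.intro_left _ rfl).trans (h3.trans (dvd_of_eq ?_))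
      ring
    exact (hU.pow n).dvd_mul_left.1 (hX1 n _ h4)
  · have hX : (X 1 : PS k) ∈ D.map ι.toRingHom := hD ▸ Ideal.mem_span_singleton_self _
    -- This yields an actual element of `D` whose image is `y` times a unit, so that its transform
    -- can be formed in `B`.
    obtain ⟨a, ha, haX⟩ := exists_approx ι 1 (hι.2 1) D hX
    rw [hD, pow_one, mul_comm, Ideal.mem_span_singleton_mul] at haX
    obtain ⟨m, hm, hma⟩ := haX
    have hunit : IsUnit (1 - m) := by
      rw [MvPowerSeries.isUnit_iff_constantCoeff, map_sub, map_one, mem_mm.1 hm, sub_zero]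
      exact isUnit_one
    have hιa : ι a = X 1 * (1 - m) := by linear_combination hma
    have hΘa : ψ (φ a) = X 0 ^ ε * (X 1 + C c) * blowMap S c (1 - m) := by
      rw [hψ, hιa, map_mul, hε]
    have hu' : IsUnit (blowMap S c (1 - m)) := hunit.map _
    have hfin : ∃ b ∈ saturation (D.map φ.toRingHom) (φ t), ∃ W, IsUnit W ∧ ψ b = (X 1 + C c) * W := by
      rcases hε' with rfl | ⟨rfl, h1S⟩
      · exact ⟨φ a, ⟨0, by simpa using Ideal.mem_map_of_mem φ.toRingHom ha⟩, _, hu', by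
          rw [hΘa, pow_zero, one_mul]⟩
      · have haJ : a ∈ J := by
          refine hι.mem_of_mem_map ?_
          rw [hJ]
          rw [hιa]
          exact Ideal.mul_mem_right _ _ (X_mem_varIdeal h1S)
        obtain ⟨b, -, hb⟩ := hφ.exists_eq (n := 1) (I := ⊤) (a := a) (by simpa using haJ)
        obtain ⟨V, hV⟩ := hU.exists_right_inv
        refine ⟨b, ⟨1, ?_⟩, V * blowMap S c (1 - m),
          (IsUnit.of_mul_eq_one _ (mul_comm U V ▸ hV)).mul hu', ?_⟩
        · rw [← hb]
          exact Ideal.mem_map_of_mem φ.toRingHom ha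
        · rw [pow_one] at hb
          rw [hb, map_mul, hUt, pow_one] at hΘa
          refine mul_left_cancel₀ (X_ne_zero 0) ?_
          linear_combination V * hΘa - X 0 * ψ b * hV
    obtain ⟨b, hb, W, hW, hbW⟩ := hfin
    rw [← span_mul_unit hW, Ideal.span_singleton_le_iff_mem, ← hbW]
    exact Ideal.mem_map_of_mem ψ.toRingHom hb

omit [IsDomain A] [IsDomain B] [IsNoetherianRing B] in
/-- In the support, the blow up has no point in the direction of `z`. -/
theorem IsBlowUp.not_isUnit (hφ : IsBlowUp φ J t) (hι : IsCompletion ι) (hS : IsCenter S)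
    (hj : IsGens ι S J j) (hJ : J.map ι.toRingHom = varIdeal S)
    {u2 : B} (hu : φ (j 2) = φ t * u2) {R : IdealisticFiltration A} {R' : IdealisticFiltration B}
    (hR' : R' = IdealisticFiltration.generate {s : B × ℕ | ∃ (f : A) (a : ℕ), f ∈ R.level a ∧
      s.2 = a ∧ φ f = φ t ^ a * s.1})
    (hsupp : ∀ l, R'.level l ≤ maximalIdeal B ^ l)
    {p : ℕ} [Fact p.Prime] [CharP k p] {e : ℕ} {h : PS k}
    (hR : ∀ l, R.level l ≤ J ^ l) (hh : h ∈ (R.map ι.toRingHom).level (p ^ e))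
    (hhz : h - X 2 ^ p ^ e ∈ mm k * varIdeal S ^ p ^ e) : u2 ∈ maximalIdeal B := by
  have hRS : (R.level (p ^ e)).map ι.toRingHom ≤ varIdeal S ^ p ^ e := by
    refine (Ideal.map_mono (hR _)).trans ?_
    rw [Ideal.map_pow, hJ]
  obtain ⟨h0, hh0, h1⟩ := exists_approx ι 1 (hι.2 1) _ hh
  rw [pow_one] at h1
  have h2 : ι (j 2) ^ p ^ e - X 2 ^ p ^ e ∈ mm k * varIdeal S ^ p ^ e := by
    rw [← sub_pow_q, ← neg_sub, neg_pow]
    refine Ideal.mul_mem_left _ _ ?_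
    have h3 := Ideal.pow_mem_pow (hj.sub 2 hS.2) (p ^ e)
    rw [mul_pow, ← pow_mul] at h3
    exact Ideal.mul_mono_left (Ideal.pow_le_self (mul_ne_zero two_ne_zero (pNZ p e))) h3
  -- The elements of `A` approximating `h` and `z` satisfy `h0 ≡ (j 2) ^ q` modulo the maximal ideal
  -- times `J ^ q`. After division by `t ^ q` the transform of `h0` is `u2 ^ q` modulo the maximal
  -- ideal of `B`, and the support condition kills it.
  have h4 : h0 - j 2 ^ p ^ e ∈ maximalIdeal A * J ^ p ^ e := by
    refine hι.mem_of_mem_map ?_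
    rw [Ideal.map_mul, hj.map_max, Ideal.map_pow, hJ]
    have : ι (h0 - j 2 ^ p ^ e) = -(h - ι h0) + (h - X 2 ^ p ^ e) -
        (ι (j 2) ^ p ^ e - X 2 ^ p ^ e) := by
      rw [map_sub, map_pow]
      ring
    rw [this]
    exact Ideal.sub_mem _ (Ideal.add_mem _ (neg_mem (Ideal.mul_mono_right hRS h1)) hhz) h2
  obtain ⟨b, hb, hbe⟩ := hφ.exists_eq h4
  have hbm : b ∈ maximalIdeal B := by
    have : (maximalIdeal A).map φ.toRingHom ≤ maximalIdeal B := by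
      rw [Ideal.map_le_iff_le_comap, hφ.comap]
    exact this hb
  have h5 : u2 ^ p ^ e + b ∈ R'.level (p ^ e) := by
    rw [hR']
    refine IdealisticFiltration.mem_generate ⟨h0, p ^ e, hh0, rfl, ?_⟩
    rw [map_sub, map_pow, hu] at hbe
    linear_combination hbe
  have h6 := Ideal.pow_le_self (pNZ p e) (hsupp _ h5)
  have h7 : u2 ^ p ^ e ∈ maximalIdeal B := by
    have := Ideal.sub_mem _ h6 hbm
    rwa [add_sub_cancel_right] at this
  exact (maximalIdeal.isMaximal B).isPrime.mem_of_pow_mem _ h7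

end BlowUp

/-! ### Auxiliary filtrations reducing closure properties to generators. -/

namespace IdealisticFiltration
variable {k : Type u} [Field k]

/-- The elements all of whose Hasse derivatives with respect to `z` are in the filtration. -/
def hasseCore (T : IdealisticFiltration (PS k)) : IdealisticFiltration (PS k) where
  level l :=
    { carrier := {f | ∀ n, hasse 2 n f ∈ T.level (l - n)}
      add_mem' := fun hf hg n => by rw [map_add]; exact Ideal.add_mem _ (hf n) (hg n)
      zero_mem' := fun n => by rw [map_zero]; exact Ideal.zero_mem _
      smul_mem' := fun r f hf n => by
        rw [smul_eq_mul, hasse_mul]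
        refine Ideal.sum_mem _ fun c hc => Ideal.mul_mem_left _ _ ?_
        rw [Finset.HasAntidiagonal.mem_antidiagonal] at hc
        exact T.level_anti (by omega) (hf c.2) }
  level_zero := by
    rw [Ideal.eq_top_iff_one]
    intro n
    rw [Nat.zero_sub, T.level_zero]
    trivial
  level_succ_le l := fun f hf n => T.level_anti (by omega) (hf n)
  mul_le l m := by
    rw [Ideal.mul_le]
    intro f hf g hg n
    rw [hasse_mul]
    refine Ideal.sum_mem _ fun c hc => ?_
    rw [Finset.HasAntidiagonal.mem_antidiagonal] at hc
    exact T.level_anti (by omega) (T.mul_mem (hf c.1) (hg c.2))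

/-- The elements whose remainder modulo `h` is divisible by a power of a monomial. -/
def monomialCore (a α β : ℕ) (h : PS k) : IdealisticFiltration (PS k) where
  level l :=
    { carrier := {f | ∃ w g, f = h * w + g ∧ g ∈ suppIn fun n => α * l ≤ a * n 0 ∧ β * l ≤ a * n 1}
      add_mem' := by
        rintro _ _ ⟨w, g, rfl, hg⟩ ⟨w', g', rfl, hg'⟩
        exact ⟨w + w', g + g', by ring, Submodule.add_mem _ hg hg'⟩
      zero_mem' := ⟨0, 0, by simp, Submodule.zero_mem _⟩
      smul_mem' := by
        rintro r _ ⟨w, g, rfl, hg⟩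
        refine ⟨r * w, r * g, by rw [smul_eq_mul]; ring, mul_mem_suppIn (U := fun _ => True)
          (fun _ _ => trivial) hg fun m n _ hn => ?_⟩
        simp only [Finsupp.add_apply, mul_add]
        omega }
  level_zero := by
    rw [Ideal.eq_top_iff_one]
    exact ⟨0, 1, by simp, fun n _ => by simp⟩
  level_succ_le l := by
    rintro _ ⟨w, g, rfl, hg⟩
    refine ⟨w, g, rfl, suppIn_mono (fun n hn => ?_) hg⟩
    simp only [mul_add] at hn
    omega
  mul_le l m := by
    rw [Ideal.mul_le]
    rintro _ ⟨w, g, rfl, hg⟩ _ ⟨w', g', rfl, hg'⟩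
    refine ⟨w * (h * w' + g') + g * w', g * g', by ring, mul_mem_suppIn hg hg' fun m n hm hn => ?_⟩
    simp only [Finsupp.add_apply, mul_add]
    omega

end IdealisticFiltration

/-! ### The transform of a frame under the blow up. -/

section Transform
variable {k : Type u} [Field k] {S : Finset (Fin 3)} {c : k}
  {p e a α β : ℕ} {R : IdealisticFiltration (PS k)} {h h' : PS k}

theorem X_zero_pow_ne_zero (n : ℕ) : (X 0 : PS k) ^ n ≠ 0 := pow_ne_zero n (X_ne_zero 0)

/-- The term `z ^ q` shows that `h` has order 0 along `x = 0`. -/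
theorem ZMonic.dvd_of_dvd_mul {q : ℕ} (hh : ZMonic q h) {n : ℕ} {v : PS k}
    (hd : X 0 ^ n ∣ h * v) : X 0 ^ n ∣ v := by
  have hwt : ∀ n : Fin 3 →₀ ℕ, wt ![1, 0, 0] n = n 0 := fun n => by simp [wt]
  have key : ∀ f : PS k, X 0 ^ n ∣ f ↔ f ∈ wIdeal ![1, 0, 0] (0 + n) := by
    intro f
    rw [X_pow_dvd_iff, mem_wIdeal]
    simp only [hwt, zero_add]
  rw [key] at hd ⊢
  rw [zero_add] at hd ⊢
  refine mem_wIdeal_of_mul_mem (a := 0) (fun hmem => ?_) hd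
  have := hmem (Finsupp.single 2 q) (by rw [hh.top]; exact one_ne_zero)
  rw [hwt] at this
  simp at this

/-- Exponents after the blow up. -/
theorem blowMap_mem_suppIn (hS : IsCenter S) (c : k) {U V : (Fin 3 →₀ ℕ) → Prop} {f : PS k}
    (hf : f ∈ suppIn U) (hUV : ∀ n N, U n → N 0 = wt (ind S) n → N 2 = n 2 → N 1 ≤ n 1 →
      ((1 ∈ S → c = 0) → N 1 = n 1) → V N) : blowMap S c f ∈ suppIn V := by
  refine algHom_mem_suppIn _ hf fun n hn N hN => ?_
  rw [coeff_blowMap_monomial hS] at hN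
  split_ifs at hN with h1 h2
  · refine hUV n N hn h1.1 h1.2 ?_ ?_
    · by_contra hlt
      rw [Nat.choose_eq_zero_of_lt (not_le.1 hlt)] at hN
      simp at hN
    · intro hc
      by_contra hne
      rcases lt_or_gt_of_ne hne with hlt | hlt
      · rw [hc h2, zero_pow (by omega), mul_zero] at hN
        exact hN rfl
      · rw [Nat.choose_eq_zero_of_lt hlt] at hN
        simp at hN
  · refine hUV n N hn h1.1 h1.2 ?_ ?_
    · by_contra hlt
      rw [Nat.choose_eq_zero_of_lt (not_le.1 hlt)] at hN
      simp at hN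
    · intro _
      by_contra hne
      rcases lt_or_gt_of_ne hne with hlt | hlt
      · rw [zero_pow (by omega), mul_zero] at hN
        exact hN rfl
      · rw [Nat.choose_eq_zero_of_lt hlt] at hN
        simp at hN
  · exact absurd rfl hN

theorem coeff_monomial_xy (α β : ℕ) :
    coeff (Finsupp.single 0 α + Finsupp.single 1 β) (X 0 ^ α * X 1 ^ β : PS k) = 1 := by
  rw [add_comm, mul_comm, ← mul_one (X 1 ^ β * X 0 ^ α), mul_comm (X 1 ^ β), mul_assoc,
    coeff_X_pow_mul_add, ← zero_add (Finsupp.single 1 β), coeff_X_pow_mul_add]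
  simp

/-- The monomial has level `a`, so its order along the centre is at least `a`. Hence the new
exponent `α + ind S 1 * β - a` is a true difference. -/
theorem Frame.le_of_center (F : Frame p e a α β R h) (hR : ∀ l, R.level l ≤ varIdeal S ^ l)
    (hS : IsCenter S) : a ≤ α + ind S 1 * β := by
  have h1 := hR a F.mono_mem
  rw [varIdeal_pow] at h1
  have := h1 _ (by rw [coeff_monomial_xy]; exact one_ne_zero)
  rw [wt_add, wt_single, wt_single] at this
  simpa [ind, hS.1] using this

theorem Frame.exists_transform (F : Frame p e a α β R h) (hR : ∀ l, R.level l ≤ varIdeal S ^ l)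
    (c : k) : ∃ h', blowMap S c h = X 0 ^ p ^ e * h' := by
  obtain ⟨g, -, hg⟩ := exists_blowMap_eq (S := S) c ⊤ (f := h) le_top (p ^ e)
    (by rw [Ideal.top_mul]; exact hR _ F.h_mem)
  exact ⟨g, hg⟩

theorem mem_blowFilt {θ : PS k →ₐ[k] PS k} {f g : PS k} {l : ℕ} (hf : f ∈ R.level l)
    (hg : X 0 ^ l * g = θ f) : g ∈ (blowFilt θ R).level l :=
  IdealisticFiltration.mem_generate ⟨f, hf, hg⟩

theorem transform_sub_mem [Fact p.Prime] (F : Frame p e a α β R h) (hS : IsCenter S)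
    (hh' : blowMap S c h = X 0 ^ p ^ e * h') : h' - X 2 ^ p ^ e ∈ suppIn fun n => n 2 < p ^ e := by
  have h1 : X 0 ^ p ^ e * (h' - X 2 ^ p ^ e) = blowMap S c (h - X 2 ^ p ^ e) := by
    have hq2 : blowQuot c 2 = X 2 := rfl
    rw [map_sub, hh', map_pow, blowMap_X_mem hS.2, hq2]
    ring
  have h2 : blowMap S c (h - X 2 ^ p ^ e) ∈ suppIn fun n => n 2 < p ^ e :=
    blowMap_mem_suppIn hS c F.monic.sub_mem fun n N hn _ h2 _ _ => by omega
  intro n hn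
  rw [← coeff_X_pow_mul_add 0 (p ^ e), h1] at hn
  simpa using h2 _ hn

theorem transform_monic [Fact p.Prime] (F : Frame p e a α β R h) (hS : IsCenter S)
    (hh' : blowMap S c h = X 0 ^ p ^ e * h') (hm : h' ∈ mm k ^ p ^ e) : ZMonic (p ^ e) h' := by
  refine zMonic_of_sub_mem fun n hn => ?_
  have h1 := transform_sub_mem F hS hh' n hn
  refine ⟨h1, ?_⟩
  have h2 := mem_mm_pow.1 (Ideal.sub_mem _ hm (Ideal.pow_mem_pow (X_mem_mm (k := k) 2) (p ^ e))) n hn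
  simp only [deg] at h2
  omega

/-- The transform of a frame under blow up. -/
theorem Frame.transform [Fact p.Prime] (F : Frame p e a α β R h) (hS : IsCenter S)
    (hR : ∀ l, R.level l ≤ varIdeal S ^ l)
    (hh' : blowMap S c h = X 0 ^ p ^ e * h') (hm : h' ∈ mm k ^ p ^ e) {β' : ℕ}
    (hβ : c = 0 ∧ β' = β ∨ c ≠ 0 ∧ 1 ∈ S ∧ β' = 0) :
    Frame p e a (α + ind S 1 * β - a) β' (blowFilt (blowMap S c) R) h' := by
  classical
  have hM := transform_monic F hS hh' hm
  have ha := F.le_of_center hR hS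
  have hq0 : blowQuot c 0 = 1 := rfl
  have hq1 : blowQuot c 1 = X 1 + C c := rfl
  have hq2 : blowQuot c 2 = X 2 := rfl
  refine ⟨F.a_pos, mem_blowFilt F.h_mem hh'.symm, hM, ?_, ?_, ?_⟩
  · have hX1 : ∃ U, IsUnit U ∧ blowMap S c (X 0 ^ α * X 1 ^ β) =
        X 0 ^ (α + ind S 1 * β) * X 1 ^ β' * U := by
      rw [map_mul, map_pow, map_pow, blowMap_X_mem hS.1, blowMap_X, hq0, hq1]
      rcases hβ with ⟨rfl, rfl⟩ | ⟨hc, h1, rfl⟩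
      · refine ⟨1, isUnit_one, ?_⟩
        by_cases h1 : 1 ∈ S
        · simp only [ind, h1, if_true, map_zero, add_zero]
          ring
        · simp only [ind, h1, if_false]
          ring
      · refine ⟨(X 1 + C c) ^ β, IsUnit.pow _ ?_, ?_⟩
        · rw [MvPowerSeries.isUnit_iff_constantCoeff]
          simpa using hc
        · have key : ∀ Y : PS k, (X 0 * 1) ^ α * (X 0 * Y) ^ β =
              X 0 ^ (α + 1 * β) * X 1 ^ 0 * Y ^ β := fun Y => by ring
          simp only [ind, h1, if_true]
          exact key _
    obtain ⟨U, hU, hXU⟩ := hX1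
    have h1 : X 0 ^ (α + ind S 1 * β - a) * X 1 ^ β' * U ∈ (blowFilt (blowMap S c) R).level a := by
      refine mem_blowFilt F.mono_mem ?_
      rw [hXU, ← mul_assoc, ← mul_assoc, ← pow_add, Nat.add_sub_cancel' ha]
    obtain ⟨V, hV⟩ := hU.exists_right_inv
    have h2 := Ideal.mul_mem_right V _ h1
    rwa [mul_assoc, hV, mul_one] at h2
  · intro l n f hf
    -- By the Leibniz rule the elements having all their derivatives in the transform form a
    -- filtration, so generators suffice.
    have hle : ∀ l, (blowFilt (blowMap S c) R).level l ≤
        (blowFilt (blowMap S c) R).hasseCore.level l := by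
      refine IdealisticFiltration.generate_le ?_
      rintro g l ⟨f, hf, hg⟩ n
      have hX0z : ∀ m, (X 0 : PS k) ^ m ∈ suppIn fun n => n 2 = 0 := fun m =>
        pow_mem_suppInZ (X_mem_suppIn (by simp)) m
      -- The substitution `z ↦ x z` multiplies the derivative of order `n` by `x ^ n`; after
      -- cancellation `hasse 2 n g` is the transform of `hasse 2 n f`, which has level `l - n`.
      have h1 : X 0 ^ l * hasse 2 n g = X 0 ^ n * blowMap S c (hasse 2 n f) := by
        change X 0 ^ l * g = _ at hg
        rw [← hasse_mul_of_suppIn (hX0z l), hg]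
        refine hasse_algHom (blowMap S c) (r := X 0) (w := 0) (X_mem_suppIn (by simp))
          (zero_mem _) ?_ ?_ ?_ n f
        · rw [blowMap_X_mem hS.1, hq0, mul_one]
          exact X_mem_suppIn (by simp)
        · rw [blowMap_X, hq1]
          split_ifs
          · refine mul_mem_suppInZ (X_mem_suppIn (by simp)) (Submodule.add_mem _
              (X_mem_suppIn (by simp)) ?_)
            rw [← monomial_zero_eq_C_apply]
            exact monomial_mem_suppIn (by simp) _
          · exact X_mem_suppIn (by simp)
        · rw [blowMap_X_mem hS.2, hq2, add_zero]
      by_cases hn : n ≤ l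
      · refine mem_blowFilt (F.sat l n f hf) ?_
        refine mul_left_cancel₀ (X_zero_pow_ne_zero n) ?_
        rw [← h1, ← mul_assoc, ← pow_add, Nat.add_sub_cancel' hn]
      · rw [Nat.sub_eq_zero_of_le (by omega), IdealisticFiltration.level_zero]
        trivial
    exact hle l hf n
  · intro l f hf
    have hle : ∀ l, (blowFilt (blowMap S c) R).level l ≤
        (IdealisticFiltration.monomialCore a (α + ind S 1 * β - a) β' h').level l := by
      refine IdealisticFiltration.generate_le ?_
      rintro g l ⟨f, hf, hg⟩
      change X 0 ^ l * g = _ at hg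
      obtain ⟨w, r, rfl, hr⟩ := F.const l f hf
      have h1 : blowMap S c r ∈ suppIn fun n => (α + ind S 1 * β) * l ≤ a * n 0 ∧
          β' * l ≤ a * n 1 := by
        refine blowMap_mem_suppIn hS c hr fun n N hn h0 h2 h1 h1' => ⟨?_, ?_⟩
        · rw [h0]
          have h3 : wt (ind S) n = n 0 + ind S 1 * n 1 + n 2 := by simp [wt, ind, hS.1, hS.2]
          have h4 : ind S 1 * (β * l) ≤ ind S 1 * (a * n 1) := Nat.mul_le_mul_left _ hn.2
          calc (α + ind S 1 * β) * l = α * l + ind S 1 * (β * l) := by ring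
            _ ≤ a * n 0 + ind S 1 * (a * n 1) + a * n 2 := by omega
            _ = a * wt (ind S) n := by rw [h3]; ring
        · rcases hβ with ⟨hc, rfl⟩ | ⟨_, _, rfl⟩
          · rw [h1' fun _ => hc]
            exact hn.2
          · rw [zero_mul]
            exact Nat.zero_le _
      have h2 : X 0 ^ l ∣ blowMap S c r := by
        rw [X_pow_dvd_iff]
        intro n hn
        have h3 := (h1 n hn).1
        exact Nat.le_of_mul_le_mul_left ((Nat.mul_le_mul_right l ha).trans h3) F.a_pos
      obtain ⟨r', hr'⟩ := h2
      have h4 : X 0 ^ l * (g - r') = X 0 ^ p ^ e * (h' * blowMap S c w) := by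
        rw [mul_sub, hg, map_add, map_mul, hh', hr']
        ring
      -- For `l ≤ q` the surplus power `x ^ (q - l)` goes into the quotient. For `l > q` a power of
      -- `x` must instead be cancelled against the quotient, which is possible because `h'` is prime
      -- to `x`.
      have h5 : h' ∣ g - r' := by
        by_cases hl : l ≤ p ^ e
        · refine ⟨X 0 ^ (p ^ e - l) * blowMap S c w, mul_left_cancel₀ (X_zero_pow_ne_zero l) ?_⟩
          rw [h4]
          nth_rewrite 1 [← Nat.add_sub_cancel' hl]
          rw [pow_add]
          ring
        · obtain ⟨m, rfl⟩ := Nat.exists_eq_add_of_le (not_le.1 hl).le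
          rw [pow_add, mul_assoc] at h4
          have h6 := mul_left_cancel₀ (X_zero_pow_ne_zero _) h4
          obtain ⟨v, hv⟩ := hM.dvd_of_dvd_mul (Dvd.intro _ h6)
          refine ⟨v, mul_left_cancel₀ (X_zero_pow_ne_zero m) ?_⟩
          rw [h6, hv]
          ring
      obtain ⟨v, hv⟩ := h5
      refine ⟨v, r', by rw [← hv]; ring, fun n hn => ?_⟩
      rw [← coeff_X_pow_mul_add 0 l, ← hr'] at hn
      have h6 := h1 _ hn
      simp only [Finsupp.add_apply, Finsupp.single_eq_same, mul_add] at h6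
      have h7 : (α + ind S 1 * β - a) * l + a * l = (α + ind S 1 * β) * l := by
        rw [← add_mul, Nat.sub_add_cancel ha]
      refine ⟨by omega, ?_⟩
      simpa using h6.2
    exact hle l hf

end Transform

/-! ### Restoring the normal form of the initial term of `h`. -/

section Shift
variable {k : Type u} [Field k] {p e a α β : ℕ} [Fact p.Prime] [CharP k p]
  {R : IdealisticFiltration (PS k)} {h : PS k}

/-- `τ` is a change of the coordinate `z` by a series whose `q`-th power is supported in the
support of `h`. -/
structure IsShift (q : ℕ) (h : PS k) (τ : PS k ≃ₐ[k] PS k) (w : PS k) : Prop where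
  X0 : τ (X 0) = X 0
  X1 : τ (X 1) = X 1
  X2 : τ (X 2) = X 2 + w
  supp : w ∈ suppIn fun n => n 2 = 0
  mem : w ∈ mm k
  coeff_ne_zero : ∀ m, coeff m w ≠ 0 → coeff (q • m) h ≠ 0

theorem IsShift.coeff_of_pow {τ : PS k ≃ₐ[k] PS k} {w : PS k} (H : IsShift (p ^ e) h τ w)
    {n : Fin 3 →₀ ℕ} (hn : coeff n (w ^ p ^ e) ≠ 0) : coeff n h ≠ 0 ∧ ∀ i, p ^ e ∣ n i := by
  obtain ⟨m, rfl, hm⟩ := exists_of_coeff_pow_q_ne_zero hn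
  exact ⟨H.coeff_ne_zero m hm, fun i => by simp⟩

/-- The weights `ω0`, `ω1` are those for which the weight of a monomial is its exponent at `i`; this
treats both divisors at once. -/
theorem Good.shift_of {ω0 ω1 A : ℕ} {i : Fin 3} (hi : ∀ n : Fin 3 →₀ ℕ, ω0 * n 0 + ω1 * n 1 = n i)
    (hA : ω0 * α + ω1 * β = A) (F : Frame p e a α β R h) {τ : PS k ≃ₐ[k] PS k} {w : PS k}
    (H : IsShift (p ^ e) h τ w) (hG : Good (p ^ e) a A i h) : Good (p ^ e) a A i (τ h) := by
  intro n hn2 hn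
  by_contra hlt
  push Not at hlt
  rw [F.coeff_shift H.X0 H.X1 H.X2 (ω0 := ω0) (ω1 := ω1) (r := n i) (s := 1) le_rfl
    (by rw [hA]; omega) ?_ hn2 (by rw [hi]; omega)] at hn
  · have hnh : coeff n h = 0 := by
      by_contra hne
      exact absurd (hG n hn2 hne) (not_le.2 hlt)
    rw [hnh, zero_add] at hn
    exact (H.coeff_of_pow hn).1 hnh
  · intro m hm
    have h3 := hG _ (by simp [H.supp m hm]) (H.coeff_ne_zero m hm)
    have h4 := lt_of_mul_lt_mul_left (lt_of_lt_of_le hlt h3) (Nat.zero_le _)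
    rw [hi]
    simpa using h4.le

theorem Good.shift_x (F : Frame p e a α β R h) {τ : PS k ≃ₐ[k] PS k} {w : PS k}
    (H : IsShift (p ^ e) h τ w) (hG : Good (p ^ e) a α 0 h) : Good (p ^ e) a α 0 (τ h) :=
  hG.shift_of (ω0 := 1) (ω1 := 0) (by simp) (by simp) F H

theorem Good.shift_y (F : Frame p e a α β R h) {τ : PS k ≃ₐ[k] PS k} {w : PS k}
    (H : IsShift (p ^ e) h τ w) (hG : Good (p ^ e) a β 1 h) : Good (p ^ e) a β 1 (τ h) :=
  hG.shift_of (ω0 := 0) (ω1 := 1) (by simp) (by simp) F H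

theorem Bad.shift_of {ω0 ω1 A : ℕ} {i j : Fin 3}
    (hi : ∀ n : Fin 3 →₀ ℕ, ω0 * n 0 + ω1 * n 1 = n i)
    (hA : ω0 * α + ω1 * β = A) (F : Frame p e a α β R h) {τ : PS k ≃ₐ[k] PS k} {w : PS k}
    (H : IsShift (p ^ e) h τ w) {r δ : ℕ} (hB : Bad (p ^ e) a A i j h r δ) :
    Bad (p ^ e) a A i j (τ h) r δ := by
  have hlt := hB.lt
  have hsh : ∀ n, n 2 = 0 → n i ≤ r → coeff n (τ h) = coeff n h + coeff n (w ^ p ^ e) := by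
    intro n hn2 hn
    refine F.coeff_shift H.X0 H.X1 H.X2 (ω0 := ω0) (ω1 := ω1) (r := r) (s := 1) le_rfl
      (by rw [hA]; omega) ?_ hn2 (by rw [hi]; omega)
    intro m hm
    have h3 := hB.min _ (by simp [H.supp m hm]) (H.coeff_ne_zero m hm)
    rw [hi]
    simpa using h3
  have hz : ∀ n, (¬ ∀ i, p ^ e ∣ n i) → coeff n (w ^ p ^ e) = 0 := by
    intro n hn
    by_contra hne
    exact hn (H.coeff_of_pow hne).2
  refine ⟨hlt, ?_, ?_, ?_⟩
  · intro n hn2 hn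
    by_contra hni
    rw [hsh n hn2 (by omega)] at hn
    have h0 : coeff n h = 0 := by
      by_contra hne
      exact hni (hB.min n hn2 hne)
    rw [h0, zero_add] at hn
    exact (H.coeff_of_pow hn).1 h0
  · obtain ⟨n, hn2, hni, hnj, hn, hnd⟩ := hB.lead
    refine ⟨n, hn2, hni, hnj, ?_, hnd⟩
    rwa [hsh n hn2 hni.le, hz n hnd, add_zero]
  · intro n hn2 hn hni hnj
    by_contra hnd
    rw [hsh n hn2 hni.le, hz n hnd, add_zero] at hn
    exact hnd (hB.low n hn2 hn hni hnj)

theorem Bad.shift_x (F : Frame p e a α β R h) {τ : PS k ≃ₐ[k] PS k} {w : PS k}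
    (H : IsShift (p ^ e) h τ w) {r δ : ℕ} (hB : Bad (p ^ e) a α 0 1 h r δ) :
    Bad (p ^ e) a α 0 1 (τ h) r δ :=
  hB.shift_of (ω0 := 1) (ω1 := 0) (by simp) (by simp) F H

theorem Bad.shift_y (F : Frame p e a α β R h) {τ : PS k ≃ₐ[k] PS k} {w : PS k}
    (H : IsShift (p ^ e) h τ w) {r δ : ℕ} (hB : Bad (p ^ e) a β 1 0 h r δ) :
    Bad (p ^ e) a β 1 0 (τ h) r δ :=
  hB.shift_of (ω0 := 0) (ω1 := 1) (by simp) (by simp) F H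

/-- A linear change of `z` makes the initial form of `h` equal to `z ^ q`. -/
theorem ZMonic.exists_isShift [IsAlgClosed k] (hM : ZMonic (p ^ e) h) (hm : h ∈ mm k ^ p ^ e)
    (hd : ∀ d, deg d = p ^ e → coeff d h ≠ 0 → ∀ i, p ^ e ∣ d i) :
    ∃ τ w, IsShift (p ^ e) h τ w ∧ Strong (p ^ e) (τ h) := by
  classical
  have hq := Nat.pos_of_ne_zero (pNZ p e)
  -- Minus the part of degree `q` other than `z ^ q`; its `q`-th root is a linear form in `x` and
  -- `y` only, since `h` has no other term of `z`-degree `q`.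
  obtain ⟨g, hg⟩ : ∃ g : PS k, ∀ n, coeff n g =
      if deg n = p ^ e ∧ n ≠ Finsupp.single 2 (p ^ e) then - coeff n h else 0 :=
    ⟨mkPS fun n => if deg n = p ^ e ∧ n ≠ Finsupp.single 2 (p ^ e) then - coeff n h else 0,
      fun n => rfl⟩
  have hgn : ∀ n, coeff n g ≠ 0 → deg n = p ^ e ∧ n ≠ Finsupp.single 2 (p ^ e) ∧ coeff n h ≠ 0 := by
    intro n hn
    rw [hg] at hn
    split_ifs at hn with h1
    · exact ⟨h1.1, h1.2, fun h0 => hn (by rw [h0, neg_zero])⟩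
    · exact absurd rfl hn
  obtain ⟨w, hw⟩ := exists_pow_q_eq p e g fun n hn => hd n (hgn n hn).1 (hgn n hn).2.2
  have hwn : ∀ m, coeff m w ≠ 0 → deg m = 1 ∧ m 2 = 0 ∧ coeff (p ^ e • m) h ≠ 0 := by
    intro m hm
    obtain ⟨h1, h2, h3⟩ := hgn (p ^ e • m) (by
      rw [← hw, coeff_pow_q_smul]
      exact pow_ne_zero _ hm)
    have h4 := (hM.low _ h3 h2).1
    simp only [deg, Finsupp.smul_apply, smul_eq_mul] at h1 h4
    refine ⟨?_, ?_, h3⟩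
    · rw [← mul_add, ← mul_add] at h1
      exact Nat.eq_of_mul_eq_mul_left hq (by rw [mul_one]; exact h1)
    · by_contra h5
      have : p ^ e * 1 ≤ p ^ e * m 2 := Nat.mul_le_mul_left _ (by omega)
      omega
  have hw2 : w ∈ suppIn fun n => n 2 = 0 := fun m hm => (hwn m hm).2.1
  have hwm : w ∈ mm k := by
    have : w ∈ mm k ^ 1 := mem_mm_pow.2 fun m hm => (hwn m hm).1.ge
    rwa [pow_one] at this
  obtain ⟨τ, h0, h1, h2⟩ := exists_shift hw2 hwm
  refine ⟨τ, w, ⟨h0, h1, h2, hw2, hwm, fun m hm => (hwn m hm).2.2⟩, ?_⟩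
  have hτw : τ w = w := algHom_eq_self τ.toAlgHom h0 h1 hw2
  have h3 : τ h - X 2 ^ p ^ e = τ.toAlgHom (h - X 2 ^ p ^ e + w ^ p ^ e) := by
    have : τ.toAlgHom (h - X 2 ^ p ^ e + w ^ p ^ e) = τ h - τ (X 2) ^ p ^ e + τ w ^ p ^ e := by simp
    rw [this, h2, hτw, add_pow_q]
    ring
  rw [Strong, h3]
  refine algHom_mem_mm_pow _ (mem_mm_pow.2 fun n hn => ?_)
  rw [map_add, map_sub, X_pow_eq, coeff_monomial, hw, hg] at hn
  by_cases h4 : n = Finsupp.single 2 (p ^ e)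
  · rw [if_pos h4, if_neg (by tauto), h4, hM.top] at hn
    simp at hn
  · rw [if_neg h4, sub_zero] at hn
    by_cases h5 : deg n = p ^ e
    · rw [if_pos ⟨h5, h4⟩, add_neg_cancel] at hn
      exact absurd rfl hn
    · rw [if_neg (by tauto), add_zero] at hn
      have := mem_mm_pow.1 hm n hn
      omega

end Shift

/-! ### Coefficients before and after the blow up. -/

section Coefficients
variable {k : Type u} [Field k] {S : Finset (Fin 3)} {c : k} {q : ℕ} {h h' : PS k}

theorem exists_coeff_of_transform (hS : IsCenter S) (hh' : blowMap S c h = X 0 ^ q * h')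
    {N : Fin 3 →₀ ℕ} (hN : coeff N h' ≠ 0) : ∃ n, coeff n h ≠ 0 ∧ N 0 + q = wt (ind S) n ∧
      N 1 ≤ n 1 ∧ N 2 = n 2 ∧ ((1 ∈ S → c = 0) → N 1 = n 1) := by
  have h1 : blowMap S c h ∈ suppIn fun N => ∃ n, coeff n h ≠ 0 ∧ N 0 = wt (ind S) n ∧
      N 1 ≤ n 1 ∧ N 2 = n 2 ∧ ((1 ∈ S → c = 0) → N 1 = n 1) :=
    blowMap_mem_suppIn hS c (U := fun n => coeff n h ≠ 0) (fun n hn => hn)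
      fun n N hn h0 h2 h1 h1' => ⟨n, hn, h0, h1, h2, h1'⟩
  rw [hh'] at h1
  obtain ⟨n, hn, h0, h1, h2, h3⟩ := h1 (N + Finsupp.single 0 q) (by rwa [coeff_X_pow_mul_add])
  exact ⟨n, hn, by simpa using h0, by simpa using h1, by simpa using h2, fun h => by simpa using h3 h⟩

/-- At the origin of the chart, or for a curve, monomials have distinct monomial images, so
coefficients are carried over unchanged. -/
theorem coeff_transform (hS : IsCenter S) (hc : 1 ∈ S → c = 0)
    (hh' : blowMap S c h = X 0 ^ q * h') {n N : Fin 3 →₀ ℕ} (h0 : N 0 + q = wt (ind S) n)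
    (h1 : N 1 = n 1) (h2 : N 2 = n 2) : coeff N h' = coeff n h := by
  have h3 := coeff_algHom_of_unique (blowMap S c) (f := h) (m := n)
    (N := N + Finsupp.single 0 q) ?_
  · rw [hh', coeff_X_pow_mul_add] at h3
    rw [h3, coeff_blowMap_monomial hS, if_pos (by simpa using ⟨h0, h2⟩)]
    simp [h1]
  · intro m hm hmn
    by_contra hne
    rw [coeff_blowMap_monomial hS] at hne
    have hcc : (if 1 ∈ S then c else 0) = 0 := by
      split_ifs with h
      · exact hc h
      · rfl
    rw [hcc] at hne
    split_ifs at hne with h4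
    · refine hm ?_
      simp only [Finsupp.add_apply, Finsupp.single_eq_same] at h4
      have h5 : N 1 = m 1 := by
        by_contra hne1
        rcases lt_or_gt_of_ne hne1 with hlt | hlt
        · refine hne ?_
          rw [zero_pow (by simpa using by omega), mul_zero]
        · refine hne ?_
          rw [Nat.choose_eq_zero_of_lt (by simpa using hlt)]
          simp
      have h6 : wt (ind S) m = wt (ind S) n := by omega
      have h7 : N 2 = m 2 := by simpa using h4.2
      have h8 : n 1 = m 1 := by omega
      have h9 : n 2 = m 2 := by omega
      simp only [wt, h8, h9] at h6
      refine exp_ext ?_ h8.symm h9.symm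
      have : ind S 0 = 1 := if_pos hS.1
      rw [this] at h6
      omega
    · exact hne rfl

end Coefficients

/-! ### The transform of a germ in lifted coordinates. -/

section Germ
variable {k : Type u} [Field k] {p : ℕ}

/-- A transform, with its structure morphism and an equation of the exceptional divisor. -/
structure IsTransformAt (G : TripletGerm.{u, v} k) (J : Ideal G.ring) (G' : TripletGerm.{u, v} k)
    (φ : G.ring →ₐ[k] G'.ring) (t : G.ring) : Prop where
  blow : IsBlowUp φ J t
  filt : G'.R = IdealisticFiltration.generate
    {s | ∃ (f : G.ring) (a : ℕ), f ∈ G.R.level a ∧ s.2 = a ∧ φ f = φ t ^ a * s.1}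
  one : ∀ D, G.E = [D] → saturation (D.map φ.toRingHom) (φ t) = ⊤ → G'.E = [Ideal.span {φ t}]
  one' : ∀ D, G.E = [D] → saturation (D.map φ.toRingHom) (φ t) ≠ ⊤ →
    G'.E = [Ideal.span {φ t}, saturation (D.map φ.toRingHom) (φ t)]
  two : ∀ D D', G.E = [D, D'] ∨ G.E = [D', D] → saturation (D.map φ.toRingHom) (φ t) = ⊤ →
    saturation (D'.map φ.toRingHom) (φ t) = ⊤ → G'.E = [Ideal.span {φ t}]
  two' : ∀ D D', G.E = [D, D'] ∨ G.E = [D', D] → saturation (D.map φ.toRingHom) (φ t) = ⊤ →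
    saturation (D'.map φ.toRingHom) (φ t) ≠ ⊤ →
    G'.E = [Ideal.span {φ t}, saturation (D'.map φ.toRingHom) (φ t)]

theorem IsTransform.exists_at {G G' : TripletGerm.{u, v} k} {J : Ideal G.ring}
    (h : IsTransform G J G') : ∃ φ t, IsTransformAt G J G' φ t := by
  classical
  obtain ⟨φ, t, h1, h2, h3, h4, h5, h6, h7, h8, h9⟩ := h
  refine ⟨φ, t, ⟨⟨h1, h2, h3, h4, h5, h6, h7⟩, h8, ?_, ?_, ?_, ?_⟩⟩
  all_goals
    obtain ⟨f, hf⟩ : ∃ f : Ideal G.ring → Ideal G'.ring,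
      ∀ D, saturation (D.map φ.toRingHom) (φ t) = f D := ⟨_, fun _ => rfl⟩
    simp only [hf] at h9 ⊢
  · intro D hD hs
    simp [h9, hD, hs]
  · intro D hD hs
    simp [h9, hD, hs]
  · rintro D D' (hD | hD) hs hs' <;> simp [h9, hD, hs, hs']
  · rintro D D' (hD | hD) hs hs' <;> simp [h9, hD, hs, hs']

/-- Passing from `h` to `h'` preserves the type of the two divisors. -/
structure Preserves (q a α β : ℕ) (h h' : PS k) : Prop where
  good_x : Good q a α 0 h → Good q a α 0 h'
  good_y : Good q a β 1 h → Good q a β 1 h'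
  bad_x : ∀ {r δ}, Bad q a α 0 1 h r δ → Bad q a α 0 1 h' r δ
  bad_y : ∀ {r δ}, Bad q a β 1 0 h r δ → Bad q a β 1 0 h' r δ

variable [Fact p.Prime] [CharP k p] [IsAlgClosed k]

/-- The exponent of `y` after the blow up. -/
def blowBeta (c : k) (β : ℕ) : ℕ := by
  classical exact if c = 0 then β else 0

/-- The transform of a germ with a frame: a drop of `σ`, or a frame of the transform. -/
theorem IsTransformAt.exists_frame {G G' : TripletGerm.{u, v} k} {J : Ideal G.ring}
    {φ : G.ring →ₐ[k] G'.ring} {t : G.ring} (hT : IsTransformAt G J G' φ t)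
    {ι : G.ring →ₐ[k] PS k} (hι : IsCompletion ι) {S : Finset (Fin 3)} (hS : IsCenter S)
    (hJ : J.map ι.toRingHom = varIdeal S) {j : Fin 3 → G.ring} (hj : IsGens ι S J j)
    (hR : ∀ l, (G.R.map ι.toRingHom).level l ≤ varIdeal S ^ l)
    {w : Fin 3 → G'.ring} (hw : ∀ s ∈ S, φ (j s) = φ t * w s) (hw0 : IsUnit (w 0))
    (hw2 : w 2 ∈ maximalIdeal G'.ring)
    (hsupp : InSupport G') {e a α β : ℕ} {h : PS k}
    (F : Frame p e a α β (G.R.map ι.toRingHom) h)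
    (hσ : sigma p (G.R.map ι.toRingHom) = sigmaMon e) :
    SigmaDrops p G G' ∨ ∃ (c : k) (ψ : G'.ring →ₐ[k] PS k) (h' h'' : PS k),
      (1 ∉ S → c = 0) ∧ (1 ∈ S → (c = 0 ↔ ¬ IsUnit (w 1))) ∧
      IsCompletion ψ ∧ blowMap S c h = X 0 ^ p ^ e * h' ∧
      Frame p e a (α + ind S 1 * β - a) (blowBeta c β) (G'.R.map ψ.toRingHom) h'' ∧
      Strong (p ^ e) h'' ∧ sigma p (G'.R.map ψ.toRingHom) = sigmaMon e ∧
      Preserves (p ^ e) a (α + ind S 1 * β - a) (blowBeta c β) h' h'' ∧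
      (Ideal.span {φ t}).map ψ.toRingHom = Ideal.span {X 0} ∧
      (∀ D : Ideal G.ring, D.map ι.toRingHom = Ideal.span {X 0} →
        saturation (D.map φ.toRingHom) (φ t) = ⊤) ∧
      (∀ D : Ideal G.ring, D.map ι.toRingHom = Ideal.span {X 1} → c ≠ 0 →
        saturation (D.map φ.toRingHom) (φ t) = ⊤) ∧
      (∀ D : Ideal G.ring, D.map ι.toRingHom = Ideal.span {X 1} → c = 0 →
        saturation (D.map φ.toRingHom) (φ t) ≠ ⊤ ∧
        (saturation (D.map φ.toRingHom) (φ t)).map ψ.toRingHom = Ideal.span {X 1}) := by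
  obtain ⟨w', hw'⟩ := hw0.exists_right_inv
  have hw'u : IsUnit w' := IsUnit.of_mul_eq_one _ (mul_comm (w 0) w' ▸ hw')
  have hwv : ∀ s ∈ S, φ (j s) = φ (j 0) * (w' * w s) := by
    intro s hs
    rw [hw s hs, hw 0 hS.1]
    linear_combination (-(φ t * w s)) * hw'
  -- After division by the unit `w 0` the chart is that of `x`, and `c` is the value of `y / x` at
  -- the new point; for a curve it is set to 0.
  obtain ⟨c, hc1, hc2⟩ : ∃ c : k, (1 ∉ S → c = 0) ∧
      (1 ∈ S → w' * w 1 - algebraMap k G'.ring c ∈ maximalIdeal G'.ring) := by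
    by_cases h1 : 1 ∈ S
    · obtain ⟨c, hc⟩ := hT.blow.res (w' * w 1)
      exact ⟨c, fun h => absurd h1 h, fun _ => hc⟩
    · exact ⟨0, fun _ => rfl, fun h => absurd h h1⟩
  have hc3 : 1 ∈ S → (c = 0 ↔ ¬ IsUnit (w 1)) := by
    intro h1
    have h2 := hc2 h1
    constructor
    · rintro rfl hu
      rw [map_zero, sub_zero] at h2
      exact (IsLocalRing.mem_maximalIdeal _).1 h2 (hw'u.mul hu)
    · intro hu
      by_contra hc0
      have h3 : w' * w 1 ∈ maximalIdeal G'.ring :=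
        Ideal.mul_mem_left _ _ ((IsLocalRing.mem_maximalIdeal _).2 hu)
      have h4 := Ideal.sub_mem _ h3 h2
      rw [sub_sub_cancel] at h4
      exact (IsLocalRing.mem_maximalIdeal _).1 h4 ((isUnit_iff_ne_zero.2 hc0).map _)
  obtain ⟨ψ, hψ, hψφ⟩ := hT.blow.exists_chart (c := c) hι hS hj hwv hw0 (hw 0 hS.1) (by
    intro s hs
    fin_cases s
    · have : constantCoeff (blowQuot c 0) = (1 : k) := map_one constantCoeff
      change w' * w 0 - algebraMap k G'.ring (constantCoeff (blowQuot c 0)) ∈ _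
      rw [this, map_one, mul_comm, hw', sub_self]
      exact zero_mem _
    · have : constantCoeff (blowQuot c 1) = c := by
        have : blowQuot c 1 = X 1 + C c := rfl
        rw [this]
        simp
      change w' * w 1 - algebraMap k G'.ring (constantCoeff (blowQuot c 1)) ∈ _
      rw [this]
      exact hc2 hs
    · have : constantCoeff (blowQuot c 2) = (0 : k) := by
        have : blowQuot c 2 = X 2 := rfl
        rw [this]
        simp
      change w' * w 2 - algebraMap k G'.ring (constantCoeff (blowQuot c 2)) ∈ _
      rw [this, map_zero, sub_zero]
      exact Ideal.mul_mem_left _ _ hw2)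
  obtain ⟨U, hU, hUt⟩ := hj.exists_unit (c := c) hS hw0 (hw 0 hS.1) hψφ
  have hRJ : ∀ l, G.R.level l ≤ J ^ l := by
    intro l
    refine hι.le_of_map_le ?_
    rw [Ideal.map_pow, hJ]
    exact hR l
  have hfilt : G'.R.map ψ.toRingHom = blowFilt (blowMap S c) (G.R.map ι.toRingHom) := by
    rw [hT.filt]
    exact hT.blow.map_generate hRJ hψφ hU hUt
  obtain ⟨h', hh'⟩ := F.exists_transform hR c
  have hsuppψ : (G'.R.map ψ.toRingHom).level (p ^ e) ≤ mm k ^ p ^ e := by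
    refine (Ideal.map_mono (hsupp _)).trans ?_
    rw [Ideal.map_pow]
    exact Ideal.pow_right_mono hψ.map_maximalIdeal _
  have hlev : h' ∈ (G'.R.map ψ.toRingHom).level (p ^ e) := by
    rw [hfilt]
    exact mem_blowFilt F.h_mem hh'.symm
  have hm := hsuppψ hlev
  have hβ : c = 0 ∧ blowBeta c β = β ∨ c ≠ 0 ∧ 1 ∈ S ∧ blowBeta c β = 0 := by
    by_cases hc : c = 0
    · exact Or.inl ⟨hc, if_pos hc⟩
    · refine Or.inr ⟨hc, ?_, if_neg hc⟩
      by_contra h1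
      exact hc (hc1 h1)
  have F' := F.transform hS hR hh' hm hβ
  rw [← hfilt] at F'
  -- The new `h'` contains `z ^ q`. Unless `σ` drops, its initial form is a `q`-th power, and a
  -- linear translation of `z` turns it into `z ^ q`.
  rcases sigma_dichotomy p (G'.R.map ψ.toRingHom) hlev hm (by rw [F'.monic.top]; exact one_ne_zero)
    with hlt | ⟨hσ', hd⟩
  · left
    refine ⟨_, _, ⟨ι, hι, rfl⟩, ⟨ψ, hψ, rfl⟩, ?_⟩
    rw [hσ]
    exact hlt
  right
  obtain ⟨τ, v, H, hst⟩ := F'.monic.exists_isShift hm hd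
  have hmap : ∀ I : Ideal G'.ring, I.map (τ.toAlgHom.comp ψ).toRingHom =
      (I.map ψ.toRingHom).map τ.toAlgHom.toRingHom := fun I => map_comp_equiv ψ τ I
  have hsat : ∀ D : Ideal G.ring, D.map ι.toRingHom = Ideal.span {X 1} →
      (saturation (D.map φ.toRingHom) (φ t)).map ψ.toRingHom = Ideal.span {X 1 + C c} :=
    fun D hD => saturation_map hT.blow hι hD hJ hc1 hψφ hU hUt
  refine ⟨c, τ.toAlgHom.comp ψ, h', τ h', hc1, hc3, hψ.comp τ, hh', ?_, hst, ?_, ?_, ?_, ?_, ?_, ?_⟩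
  · rw [filt_comp_equiv]
    exact F'.shift H.supp H.mem H.X0 H.X1 H.X2
  · rw [filt_comp_equiv, sigma_map, hσ']
  · exact ⟨fun h => h.shift_x F' H, fun h => h.shift_y F' H, fun h => h.shift_x F' H,
      fun h => h.shift_y F' H⟩
  · have h1 : (Ideal.span {φ t}).map ψ.toRingHom = Ideal.span {X 0} := by
      rw [Ideal.map_span, Set.image_singleton]
      change Ideal.span {ψ (φ t)} = _
      rw [hUt, span_mul_unit hU]
    rw [hmap, h1, map_span_X, H.X0]
  · exact fun D hD => saturation_eq_top hD hS hψ hψφ hUt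
  · intro D hD hc
    refine top_le_iff.1 (hψ.le_of_map_le ?_)
    rw [hsat D hD]
    have : IsUnit (X 1 + C c : PS k) := by
      rw [MvPowerSeries.isUnit_iff_constantCoeff]
      simpa using hc
    rw [Ideal.span_singleton_eq_top.2 this]
    exact le_top
  · rintro D hD rfl
    have h1 := hsat D hD
    rw [map_zero, add_zero] at h1
    refine ⟨fun htop => ?_, by rw [hmap, h1, map_span_X, H.X1]⟩
    rw [htop, Ideal.map_top] at h1
    have h2 := Ideal.span_singleton_eq_top.1 h1.symm
    rw [MvPowerSeries.isUnit_iff_constantCoeff] at h2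
    simp at h2

end Germ

/-! ### Types of the divisors after a monomial transformation of exponents. -/

section Types
variable {k : Type u} [Field k]

/-- The type of the divisor `X i = 0`: good, or bad with `ρ = δ / q`. -/
def DivType (q a α : ℕ) (i j : Fin 3) (h : PS k) : Option ℕ → Prop
  | none => Good q a α i h
  | some δ => ∃ r, Bad q a α i j h r δ

theorem exists_divType {q a α : ℕ} {i j : Fin 3} {h : PS k}
    (H : Good q a α i h ∨ ∃ r δ, Bad q a α i j h r δ) : ∃ t, DivType q a α i j h t := by
  rcases H with H | ⟨r, δ, H⟩
  · exact ⟨none, H⟩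
  · exact ⟨some δ, r, H⟩

theorem forall_dvd_iff {q : ℕ} {n : Fin 3 →₀ ℕ} (h2 : n 2 = 0) :
    (∀ i, q ∣ n i) ↔ q ∣ n 0 ∧ q ∣ n 1 := by
  simp [Fin.forall_fin_succ, h2]

/-- The exponents of the constant terms of `h` and of its transform. -/
structure ExpRel (q ε : ℕ) (h h' : PS k) : Prop where
  fwd : ∀ n, n 2 = 0 → coeff n h ≠ 0 →
    ∃ N, N 2 = 0 ∧ coeff N h' ≠ 0 ∧ N 0 + q = n 0 + ε * n 1 ∧ N 1 = n 1
  bwd : ∀ N, N 2 = 0 → coeff N h' ≠ 0 →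
    ∃ n, n 2 = 0 ∧ coeff n h ≠ 0 ∧ N 0 + q = n 0 + ε * n 1 ∧ N 1 = n 1

theorem wt_ind_of_center {S : Finset (Fin 3)} (hS : IsCenter S) (n : Fin 3 →₀ ℕ) :
    wt (ind S) n = n 0 + ind S 1 * n 1 + n 2 := by
  simp [wt, ind, hS.1, hS.2]

theorem expRel_of_transform {S : Finset (Fin 3)} (hS : IsCenter S) {c : k} {q : ℕ} {h h' : PS k}
    (hc : 1 ∈ S → c = 0) (hh' : blowMap S c h = X 0 ^ q * h') (hq : h ∈ varIdeal S ^ q) :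
    ExpRel q (ind S 1) h h' := by
  constructor
  · intro n hn2 hn
    rw [varIdeal_pow] at hq
    have h1 := hq n hn
    rw [wt_ind_of_center hS, hn2] at h1
    refine ⟨Finsupp.single 0 (n 0 + ind S 1 * n 1 - q) + Finsupp.single 1 (n 1), by simp, ?_, ?_,
      by simp⟩
    · rwa [coeff_transform hS hc hh' (n := n) ?_ (by simp) (by simp [hn2])]
      rw [wt_ind_of_center hS, hn2]
      simp
      omega
    · simp
      omega
  · intro N hN2 hN
    obtain ⟨n, hn, h0, h1, h2, h3⟩ := exists_coeff_of_transform hS hh' hN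
    rw [wt_ind_of_center hS, ← h2, hN2] at h0
    exact ⟨n, by omega, hn, h0, h3 hc⟩

variable {q ε a α β : ℕ} {h h' : PS k}

theorem dvd_add_mul_iff {q ε x y z : ℕ} (h : x + q = z + ε * y) :
    (q ∣ x ∧ q ∣ y) ↔ (q ∣ z ∧ q ∣ y) := by
  refine and_congr_left fun hy => ?_
  rw [← Nat.dvd_add_self_right (n := x), h, Nat.dvd_add_left (hy.mul_left _)]

theorem ExpRel.good_y (E : ExpRel q ε h h') (H : Good q a β 1 h) : Good q a β 1 h' := by
  intro N hN2 hN
  obtain ⟨n, hn2, hn, -, h1⟩ := E.bwd N hN2 hN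
  rw [h1]
  exact H n hn2 hn

/-- The exponent of `y`, hence the order `s` along `H_y`, is unchanged, while the exponent of `x`
changes by `ε s - q` on the initial form; being a `q`-th power is preserved. -/
theorem ExpRel.bad_y (E : ExpRel q ε h h') {s δ : ℕ} (B : Bad q a β 1 0 h s δ) :
    q ≤ δ + ε * s ∧ Bad q a β 1 0 h' s (δ + ε * s - q) := by
  have hdvd : ∀ {n N : Fin 3 →₀ ℕ}, n 2 = 0 → N 2 = 0 → N 0 + q = n 0 + ε * n 1 → N 1 = n 1 →
      ((∀ i, q ∣ N i) ↔ ∀ i, q ∣ n i) := by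
    intro n N hn hN h0 h1
    rw [forall_dvd_iff hn, forall_dvd_iff hN, ← h1]
    rw [← h1] at h0
    exact dvd_add_mul_iff h0
  have hle : q ≤ δ + ε * s := by
    obtain ⟨n, hn2, hn1, hn0, hn, hnd⟩ := B.lead
    obtain ⟨N, hN2, hN, h0, h1⟩ := E.fwd n hn2 hn
    rw [hn0, hn1] at h0
    omega
  refine ⟨hle, B.lt, ?_, ?_, ?_⟩
  · intro N hN2 hN
    obtain ⟨n, hn2, hn, -, h1⟩ := E.bwd N hN2 hN
    rw [h1]
    exact B.min n hn2 hn
  · obtain ⟨n, hn2, hn1, hn0, hn, hnd⟩ := B.lead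
    obtain ⟨N, hN2, hN, h0, h1⟩ := E.fwd n hn2 hn
    refine ⟨N, hN2, h1.trans hn1, ?_, hN, fun hd => hnd ((hdvd hn2 hN2 h0 h1).1 hd)⟩
    rw [hn0, hn1] at h0
    omega
  · intro N hN2 hN hN1 hN0
    obtain ⟨n, hn2, hn, h0, h1⟩ := E.bwd N hN2 hN
    refine (hdvd hn2 hN2 h0 h1).2 (B.low n hn2 hn (h1.symm.trans hN1) ?_)
    rw [← h1, hN1] at h0
    omega

theorem ExpRel.good_x (E : ExpRel q 0 h h') (H : Good q a α 0 h) : Good q a (α - a) 0 h' := by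
  intro N hN2 hN
  obtain ⟨n, hn2, hn, h0, -⟩ := E.bwd N hN2 hN
  have h1 := H n hn2 hn
  rw [zero_mul, add_zero] at h0
  rw [← h0, mul_add, mul_comm a q] at h1
  rw [Nat.mul_sub]
  omega

/-- For a curve all exponents of `x` fall by `q`, and the exponents of `y`, hence `δ`, stay. The
bounds on both sides fall together: `α` by `a` and `r` by `q`. -/
theorem ExpRel.bad_x (E : ExpRel q 0 h h') {r δ : ℕ} (B : Bad q a α 0 1 h r δ) :
    Bad q a (α - a) 0 1 h' (r - q) δ := by
  have hdvd : ∀ {n N : Fin 3 →₀ ℕ}, n 2 = 0 → N 2 = 0 → N 0 + q = n 0 + 0 * n 1 → N 1 = n 1 →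
      ((∀ i, q ∣ N i) ↔ ∀ i, q ∣ n i) := by
    intro n N hn hN h0 h1
    rw [forall_dvd_iff hn, forall_dvd_iff hN, ← h1]
    rw [← h1] at h0
    exact dvd_add_mul_iff h0
  have hle : q ≤ r := by
    obtain ⟨n, hn2, hn0, -, hn, -⟩ := B.lead
    obtain ⟨N, hN2, hN, h0, h1⟩ := E.fwd n hn2 hn
    omega
  refine ⟨?_, ?_, ?_, ?_⟩
  · have h1 := B.lt
    rw [Nat.mul_sub, Nat.mul_sub, mul_comm q a]
    have : a * q ≤ a * r := Nat.mul_le_mul_left _ hle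
    omega
  · intro N hN2 hN
    obtain ⟨n, hn2, hn, h0, -⟩ := E.bwd N hN2 hN
    have := B.min n hn2 hn
    omega
  · obtain ⟨n, hn2, hn0, hn1, hn, hnd⟩ := B.lead
    obtain ⟨N, hN2, hN, h0, h1⟩ := E.fwd n hn2 hn
    exact ⟨N, hN2, by omega, by omega, hN, fun hd => hnd ((hdvd hn2 hN2 h0 h1).1 hd)⟩
  · intro N hN2 hN hN0 hN1
    obtain ⟨n, hn2, hn, h0, h1⟩ := E.bwd N hN2 hN
    exact (hdvd hn2 hN2 h0 h1).2 (B.low n hn2 hn (by omega) (by omega))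

end Types

/-! ### The exceptional divisor of the blow up of a point. -/

section Exceptional
variable {k : Type u} [Field k] {p e a α β : ℕ} [Fact p.Prime] [CharP k p] {h h' : PS k} {c : k}

/-- The expression is a coefficient of `(y + c) ^ m`, which is a `q`-th power when `q` divides `m`.
So `q`-th powers remain such at a point with `c ≠ 0`. -/
theorem choose_mul_pow_eq_zero (c : k) {m j : ℕ} (hm : p ^ e ∣ m) (hj : ¬ p ^ e ∣ j) :
    (m.choose j : k) * c ^ (m - j) = 0 := by
  obtain ⟨i, rfl⟩ := hm
  have h1 := coeff_X1_add_C_pow c (p ^ e * i) (Finsupp.single 1 j)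
  rw [mul_comm (p ^ e) i, pow_mul, coeff_pow_q_of_not_dvd p e _ (i := 1) (by simpa using hj)] at h1
  simpa [mul_comm] using h1.symm

/-- The type of the exceptional divisor of the blow up of the point. -/
theorem exists_exceptional (ha : a ≤ α + β) (hA : Adapted (p ^ e) a α β h 1 1)
    (hq : h ∈ mm k ^ p ^ e) (hh' : blowMap Finset.univ c h = X 0 ^ p ^ e * h') :
    (Good (p ^ e) a (α + β - a) 0 h' ∧
      ∀ n, n 2 = 0 → coeff n h ≠ 0 → p ^ e * (α + β) ≤ a * (n 0 + n 1)) ∨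
    ∃ r δ n, Bad (p ^ e) a (α + β - a) 0 1 h' r δ ∧ n 2 = 0 ∧ coeff n h ≠ 0 ∧
      a * (n 0 + n 1) < p ^ e * (α + β) ∧ δ ≤ n 1 ∧
      ∀ m, m 2 = 0 → coeff m h ≠ 0 → n 0 + n 1 ≤ m 0 + m 1 := by
  have hS : IsCenter Finset.univ := ⟨Finset.mem_univ _, Finset.mem_univ _⟩
  obtain ⟨A, hA'⟩ := Nat.exists_eq_add_of_le ha
  have hAA : α + β - a = A := by omega
  rw [hAA]
  have hbwd : ∀ N, N 2 = 0 → coeff N h' ≠ 0 →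
      ∃ n, n 2 = 0 ∧ coeff n h ≠ 0 ∧ N 0 + p ^ e = n 0 + n 1 := by
    intro N hN2 hN
    obtain ⟨n, hn, h0, -, h2, -⟩ := exists_coeff_of_transform hS hh' hN
    rw [wt_univ, deg, ← h2, hN2] at h0
    exact ⟨n, by omega, hn, h0⟩
  rcases hA with hG | ⟨n, hn2, hn, hlt, hnd, hmin⟩
  · simp only [one_mul] at hG
    refine Or.inl ⟨fun N hN2 hN => ?_, hG⟩
    obtain ⟨n, hn2, hn, h0⟩ := hbwd N hN2 hN
    have h1 := hG n hn2 hn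
    rw [← h0, hA', mul_add, mul_add, mul_comm a (p ^ e)] at h1
    omega
  right
  simp only [one_mul] at hlt hmin
  -- Among the monomials of least degree that are not `q`-th powers, take the one with least
  -- exponent of `x`, that is, with the largest exponent of `y`.
  have hex : ∃ d, ∃ m, m 0 = d ∧ m 2 = 0 ∧ coeff m h ≠ 0 ∧ m 0 + m 1 = n 0 + n 1 ∧
      ¬ ∀ i, p ^ e ∣ m i := ⟨_, n, rfl, hn2, hn, rfl, hnd⟩
  classical
  obtain ⟨m, hm0, hm2, hm, hmn, hmd⟩ := Nat.find_spec hex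
  have htop : ∀ l, l 2 = 0 → coeff l h ≠ 0 → l 0 + l 1 = n 0 + n 1 → m 1 < l 1 →
      ∀ i, p ^ e ∣ l i := by
    intro l hl2 hl hln hlm
    by_contra hld
    exact Nat.find_min hex (m := l 0) (by omega) ⟨l, rfl, hl2, hl, hln, hld⟩
  have hqn : p ^ e ≤ m 0 + m 1 := by
    have := mem_mm_pow.1 hq m hm
    simpa [deg, hm2] using this
  -- The exponent of the image of `m` with its full power of `y`. Monomials of the same degree with
  -- a larger power of `y` are `q`-th powers and contribute 0 there, and those with a smaller power
  -- do not reach it. So the coefficient survives for every `c`.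
  let N : Fin 3 →₀ ℕ := Finsupp.single 0 (m 0 + m 1 - p ^ e) + Finsupp.single 1 (m 1)
  have hN0 : N 0 = m 0 + m 1 - p ^ e := by simp [N]
  have hN1 : N 1 = m 1 := by simp [N]
  have hN2 : N 2 = 0 := by simp [N]
  have hNd : ¬ ∀ i, p ^ e ∣ N i := by
    rw [forall_dvd_iff hN2, hN0, hN1]
    rw [forall_dvd_iff hm2] at hmd
    rintro ⟨h1, h2⟩
    refine hmd ⟨?_, h2⟩
    have h3 : p ^ e ∣ m 0 + m 1 := by
      have := Nat.dvd_add h1 (dvd_refl (p ^ e))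
      rwa [Nat.sub_add_cancel hqn] at this
    exact (Nat.dvd_add_left h2).1 h3
  have hN : coeff N h' ≠ 0 := by
    have h3 := coeff_algHom_of_unique (blowMap Finset.univ c) (f := h) (m := m)
      (N := N + Finsupp.single 0 (p ^ e)) ?_
    · rw [hh', coeff_X_pow_mul_add] at h3
      rw [h3, coeff_blowMap_monomial hS, wt_univ]
      simp [hN0, hN1, hN2, hm2, deg, hqn, hm]
    · intro l hl hlh
      rw [coeff_blowMap_monomial hS, wt_univ, if_pos (Finset.mem_univ _), ite_eq_right_iff]
      simp only [deg, Finsupp.add_apply, Finsupp.single_eq_same, hN0, hN1, hN2,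
        Nat.sub_add_cancel hqn]
      rintro ⟨h4, h5⟩
      have hl2 : l 2 = 0 := by simpa using h5.symm
      have h6 : (Finsupp.single 0 (p ^ e) : Fin 3 →₀ ℕ) 1 = 0 := by simp
      rw [h6, add_zero]
      rcases lt_trichotomy (l 1) (m 1) with h7 | h7 | h7
      · rw [Nat.choose_eq_zero_of_lt h7, Nat.cast_zero, zero_mul]
      · exact absurd (exp_ext (by omega) h7 (by omega)) hl
      · have h8 := htop l hl2 hlh (by omega) h7
        refine choose_mul_pow_eq_zero c (h8 1) fun h9 => hmd ?_
        rw [forall_dvd_iff hm2]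
        refine ⟨?_, h9⟩
        have h10 := Nat.dvd_add (h8 0) (h8 1)
        have h11 : l 0 + l 1 = m 0 + m 1 := by omega
        rw [h11] at h10
        exact (Nat.dvd_add_left h9).1 h10
  have hNlt : a * N 0 < p ^ e * A := by
    rw [hN0, Nat.mul_sub, hmn]
    rw [hA', mul_add (p ^ e), mul_comm (p ^ e) a] at hlt
    have : a * p ^ e ≤ a * (n 0 + n 1) := Nat.mul_le_mul_left _ (by omega)
    omega
  have hNmin : ∀ M, M 2 = 0 → coeff M h' ≠ 0 → N 0 ≤ M 0 := by
    intro M hM2 hM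
    obtain ⟨l, hl2, hl, h0⟩ := hbwd M hM2 hM
    have := hmin l hl2 hl
    omega
  rcases good_or_bad (i := 0) (j := 1) (Or.inr ⟨N, hN2, hN, hNlt, hNd, hNmin⟩) with hG | ⟨r, δ, B⟩
  · exact absurd (hG N hN2 hN) (not_le.2 hNlt)
  refine ⟨r, δ, m, B, hm2, hm, by rw [hmn]; exact hlt, ?_, fun l hl2 hl => by
    rw [hmn]; exact hmin l hl2 hl⟩
  -- If `δ` exceeded `m 1`, the monomial `N` would lie in the low part of the initial form, which
  -- contains only `q`-th powers.
  by_contra hδ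
  obtain ⟨M, hM2, hM0, -, hM, -⟩ := B.lead
  have h1 := hNmin M hM2 hM
  have h2 := B.min N hN2 hN
  exact hNd (B.low N hN2 hN (by omega) (by omega))

/-- The relations between the type of the exceptional divisor of the blow up of the point and
the types of the two old divisors. -/
structure ExcRel (q a β : ℕ) (tx ty t : Option ℕ) : Prop where
  good_good : tx = none → ty = none → t = none
  of_good : ∀ δ', t = some δ' → tx = none → a * δ' < q * β
  of_bad : ∀ δ' δ, t = some δ' → tx = some δ → δ' ≤ δ
  bad_good : ∀ δ, t = none → tx = some δ → q * β < a * δ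

/-- All four relations come from comparing degrees. If the exceptional divisor is good, every
monomial of `a_q` has degree at least `q (α + β) / a`. If it is bad, there is a monomial of least
degree, below that bound, whose exponent of `y` dominates `δ'`. The type of `H_x` bounds the
exponents of `x`. -/
theorem exists_excRel (ha : a ≤ α + β) (hA : Adapted (p ^ e) a α β h 1 1)
    (hq : h ∈ mm k ^ p ^ e) (hh' : blowMap Finset.univ c h = X 0 ^ p ^ e * h')
    {tx ty : Option ℕ} (hx : DivType (p ^ e) a α 0 1 h tx) (hy : DivType (p ^ e) a β 1 0 h ty) :
    ∃ t, DivType (p ^ e) a (α + β - a) 0 1 h' t ∧ ExcRel (p ^ e) a β tx ty t := by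
  rcases exists_exceptional ha hA hq hh' with ⟨hG, hall⟩ | ⟨r', δ', n, B, hn2, hn, hlt, hδ, hmin⟩
  · refine ⟨none, hG, fun _ _ => rfl, nofun, nofun, ?_⟩
    rintro δ - rfl
    obtain ⟨r, Bx⟩ := hx
    obtain ⟨m, hm2, hm0, hm1, hm, -⟩ := Bx.lead
    have h1 := hall m hm2 hm
    have h2 := Bx.lt
    rw [hm0, hm1, mul_add, mul_add] at h1
    omega
  · rw [mul_add, mul_add] at hlt
    refine ⟨some δ', ⟨r', B⟩, ?_, ?_, ?_, nofun⟩
    · rintro rfl rfl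
      have h1 := hx n hn2 hn
      have h2 := hy n hn2 hn
      omega
    · rintro _ ⟨⟩ rfl
      have h1 := hx n hn2 hn
      have h2 : a * δ' ≤ a * n 1 := Nat.mul_le_mul_left _ hδ
      omega
    · rintro _ δ ⟨⟩ rfl
      obtain ⟨r, Bx⟩ := hx
      obtain ⟨m, hm2, hm0, hm1, hm, -⟩ := Bx.lead
      have h1 := hmin m hm2 hm
      have h2 := Bx.min n hn2 hn
      omega

theorem Preserves.divType_x {q a α β : ℕ} {h h' : PS k} (H : Preserves q a α β h h') {t : Option ℕ}
    (ht : DivType q a α 0 1 h t) : DivType q a α 0 1 h' t := by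
  rcases t with _ | δ
  · exact H.good_x ht
  · obtain ⟨r, B⟩ := ht
    exact ⟨r, H.bad_x B⟩

theorem Preserves.divType_y {q a α β : ℕ} {h h' : PS k} (H : Preserves q a α β h h') {t : Option ℕ}
    (ht : DivType q a β 1 0 h t) : DivType q a β 1 0 h' t := by
  rcases t with _ | δ
  · exact H.good_y ht
  · obtain ⟨r, B⟩ := ht
    exact ⟨r, H.bad_y B⟩

theorem DivType.swap_x {q a α : ℕ} {t : Option ℕ} (ht : DivType q a α 0 1 h t) :
    DivType q a α 1 0 (swapEquiv k h) t := by
  rcases t with _ | δ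
  · exact Good.swap swapExp_zero ht
  · obtain ⟨r, B⟩ := ht
    exact ⟨r, B.swap swapExp_zero swapExp_one⟩

theorem DivType.swap_y {q a α : ℕ} {t : Option ℕ} (ht : DivType q a α 1 0 h t) :
    DivType q a α 0 1 (swapEquiv k h) t := by
  rcases t with _ | δ
  · exact Good.swap swapExp_one ht
  · obtain ⟨r, B⟩ := ht
    exact ⟨r, B.swap swapExp_one swapExp_zero⟩

theorem Adapted.swap {q a α β : ℕ} (H : Adapted q a α β h 1 1) :
    Adapted q a β α (swapEquiv k h) 1 1 := by
  rcases H with H | ⟨n, hn2, hn, hlt, hnd, hmin⟩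
  · refine Or.inl fun n hn2 hn => ?_
    rw [coeff_swapEquiv] at hn
    have := H _ (by simpa using hn2) hn
    simp only [swapExp_zero, swapExp_one, one_mul] at this ⊢
    rwa [add_comm β, add_comm (n 0)]
  · refine Or.inr ⟨swapExp n, by simpa using hn2, by rwa [coeff_swapEquiv, swapExp_swapExp], ?_,
      fun h => hnd (swapExp_dvd.1 h), fun m hm2 hm => ?_⟩
    · simp only [swapExp_zero, swapExp_one, one_mul] at hlt ⊢
      rwa [add_comm β, add_comm (n 1)]
    · rw [coeff_swapEquiv] at hm
      have := hmin _ (by simpa using hm2) hm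
      simp only [swapExp_zero, swapExp_one, one_mul] at this ⊢
      omega

end Exceptional

/-! ### Values of the invariant in terms of types. -/

section ChartValues
variable {k : Type u} [Field k] {p : ℕ} {G : TripletGerm.{u, v} k}

/-- Coordinates of the completion of a germ, in which the monomial is `(x ^ α * y ^ β, a)`, together
with the types of the divisors `x = 0` and `y = 0`. -/
structure Chart (p : ℕ) (G : TripletGerm.{u, v} k) (ι : G.ring →ₐ[k] PS k) (e a α β : ℕ) (h : PS k)
    (tx ty : Option ℕ) : Prop where
  comp : IsCompletion ι
  frame : Frame p e a α β (G.R.map ι.toRingHom) h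
  strong : Strong (p ^ e) h
  sigma_eq : sigma p (G.R.map ι.toRingHom) = sigmaMon e
  type_x : DivType (p ^ e) a α 0 1 h tx
  type_y : DivType (p ^ e) a β 1 0 h ty

/-- The value of the invariant at a point of one boundary component. -/
def invOne (q : ℕ) (μ : ℚ) : Option ℕ → List ℚ
  | none => [0, 0, μ]
  | some δ => [(δ : ℚ) / q, 0, μ]

/-- The value of the invariant at a point of two boundary components. -/
def invTwo (q : ℕ) (μ ν : ℚ) : Option ℕ → Option ℕ → List ℚ
  | none, none => [0, 0, min μ ν, max μ ν]
  | some δ, none => [min ((δ : ℚ) / q) μ, max ((δ : ℚ) / q) μ]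
  | none, some δ => [min ((δ : ℚ) / q) ν, max ((δ : ℚ) / q) ν]
  | some δ, some δ' => [min ((δ : ℚ) / q) (δ' / q), max ((δ : ℚ) / q) (δ' / q)]

variable [Fact p.Prime] [CharP k p] {ι ι' : G.ring →ₐ[k] PS k} {e a α β e' a' α' β' : ℕ}
  {h h' : PS k} {tx ty tx' ty' : Option ℕ}

theorem Chart.swap (C : Chart p G ι e a α β h tx ty) :
    Chart p G ((swapEquiv k).toAlgHom.comp ι) e a β α (swapEquiv k h) ty tx where
  comp := C.comp.comp _
  frame := by rw [filt_comp_equiv]; exact C.frame.swap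
  strong := by
    have := algHom_mem_mm_pow (swapEquiv k).toAlgHom C.strong
    rw [Strong]
    simpa using this
  sigma_eq := by rw [filt_comp_equiv, sigma_map]; exact C.sigma_eq
  type_x := C.type_y.swap_y
  type_y := C.type_x.swap_x

theorem map_swap_X0 {D : Ideal G.ring} (hD : D.map ι.toRingHom = Ideal.span {X 0}) :
    D.map ((swapEquiv k).toAlgHom.comp ι).toRingHom = Ideal.span {X 1} := by
  rw [map_comp_equiv, hD, map_span_X, swapEquiv_X0]

theorem map_swap_X1 {D : Ideal G.ring} (hD : D.map ι.toRingHom = Ideal.span {X 1}) :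
    D.map ((swapEquiv k).toAlgHom.comp ι).toRingHom = Ideal.span {X 0} := by
  rw [map_comp_equiv, hD, map_span_X, swapEquiv_X1]

/-- The presentation defined by a chart. -/
def Chart.presentation (C : Chart p G ι e a α β h tx ty) {D : Ideal G.ring}
    (hD : D.map ι.toRingHom = Ideal.span {X 0}) (hb : IsBoundary G ι β D) : Presentation p G :=
  presentationOfFrame C.comp C.frame C.strong C.sigma_eq hD hb

omit [CharP k p] in
theorem Chart.isGood (C : Chart p G ι e a α β h none ty) {D : Ideal G.ring}
    (hD : D.map ι.toRingHom = Ideal.span {X 0}) (hb : IsBoundary G ι β D) :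
    IsGood p G D ((α : ℚ) / a) :=
  (C.presentation hD hb).isGood C.type_x

theorem Chart.isBad {δ : ℕ} (C : Chart p G ι e a α β h (some δ) ty) {D : Ideal G.ring}
    (hD : D.map ι.toRingHom = Ideal.span {X 0}) (hb : IsBoundary G ι β D) :
    IsBad p G D ((α : ℚ) / a) ((δ : ℚ) / (p ^ e : ℕ)) := by
  obtain ⟨r, B⟩ := C.type_x
  have := (C.presentation hD hb).isBad B
  rw [Nat.cast_pow]
  exact this

theorem Chart.isInvMON_one (C : Chart p G ι e a α β h tx ty) {D : Ideal G.ring}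
    (hD : D.map ι.toRingHom = Ideal.span {X 0}) (hE : G.E = [D]) (hβ : β = 0) :
    IsInvMON p G (invOne (p ^ e) ((α : ℚ) / a) tx) := by
  rcases tx with _ | δ
  · exact .good D _ hE (C.isGood hD (Or.inl ⟨hE, hβ⟩))
  · exact .bad D _ _ hE (C.isBad hD (Or.inl ⟨hE, hβ⟩))

theorem invTwo_comm (q : ℕ) (μ ν : ℚ) (tx ty : Option ℕ) :
    invTwo q μ ν tx ty = invTwo q ν μ ty tx := by
  rcases tx with _ | δ <;> rcases ty with _ | δ' <;> simp [invTwo, min_comm, max_comm]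

theorem Chart.isInvMON_two (C : Chart p G ι e a α β h tx ty) {D D' : Ideal G.ring}
    (hD : D.map ι.toRingHom = Ideal.span {X 0}) (hD' : D'.map ι.toRingHom = Ideal.span {X 1})
    (hE : G.E = [D, D'] ∨ G.E = [D', D]) :
    IsInvMON p G (invTwo (p ^ e) ((α : ℚ) / a) ((β : ℚ) / a) tx ty) := by
  wlog hE' : G.E = [D, D'] generalizing ι α β h tx ty D D'
  · rw [invTwo_comm]
    exact this C.swap (map_swap_X1 hD') (map_swap_X0 hD) hE.symm (hE.resolve_left hE')
  have hb : IsBoundary G ι β D := Or.inr ⟨D', hD', hE⟩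
  have hb' : IsBoundary G ((swapEquiv k).toAlgHom.comp ι) α D' :=
    Or.inr ⟨D, map_swap_X0 hD, hE.symm⟩
  rcases tx with _ | δ <;> rcases ty with _ | δ'
  · exact .good_good D D' _ _ hE' (C.isGood hD hb) (C.swap.isGood (map_swap_X1 hD') hb')
  · exact .bad_good D' D _ _ _ hE.symm (C.swap.isBad (map_swap_X1 hD') hb') (C.isGood hD hb)
  · exact .bad_good D D' _ _ _ hE (C.isBad hD hb) (C.swap.isGood (map_swap_X1 hD') hb')
  · exact .bad_bad D D' _ _ _ _ hE' (C.isBad hD hb) (C.swap.isBad (map_swap_X1 hD') hb')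

theorem Chart.type_unique [IsAlgClosed k] (C : Chart p G ι e a α β h tx ty)
    (C' : Chart p G ι' e' a' α' β' h' tx' ty') {D : Ideal G.ring}
    (hD : D.map ι.toRingHom = Ideal.span {X 0}) (hb : IsBoundary G ι β D)
    (hD' : D.map ι'.toRingHom = Ideal.span {X 0}) (hb' : IsBoundary G ι' β' D) : tx = tx' := by
  let P := C.presentation hD hb
  let P' := C'.presentation hD' hb'
  rcases tx with _ | δ <;> rcases tx' with _ | δ'
  · rfl
  · obtain ⟨r, B⟩ := C'.type_x
    exact (P.not_good_bad P' rfl C.type_x B).elim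
  · obtain ⟨r, B⟩ := C.type_x
    exact (P'.not_good_bad P rfl C'.type_x B).elim
  · obtain ⟨r, B⟩ := C.type_x
    obtain ⟨r', B'⟩ := C'.type_x
    rw [(P.bad_eq P' rfl B B').2]

omit [Fact (Nat.Prime p)] [CharP k p] in
theorem Presentation.exists_types (P : Presentation p G)
    (h1 : Adapted (p ^ P.e) P.a P.α P.β P.h 1 0) (h2 : Adapted (p ^ P.e) P.a P.α P.β P.h 0 1) :
    ∃ tx ty, Chart p G P.chart P.e P.a P.α P.β P.h tx ty := by
  obtain ⟨tx, hx⟩ := exists_divType h1.good_or_bad_x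
  obtain ⟨ty, hy⟩ := exists_divType h2.good_or_bad_y
  exact ⟨tx, ty, P.isCompletion, P.frame, P.strong, P.sigma_eq, hx, hy⟩

end ChartValues

/-! ### Bounds at a point which lies on no singular curve. -/

section Isolated
variable {k : Type u} [Field k] {p : ℕ} {G : TripletGerm.{u, v} k} [Fact p.Prime] [CharP k p]
  {ι : G.ring →ₐ[k] PS k} {e a α β : ℕ} {h : PS k} {tx ty : Option ℕ}

theorem noSing_comp {R : IdealisticFiltration (PS k)} (hN : ∀ Q, ¬ IsSingCurve R Q)
    (τ : PS k ≃ₐ[k] PS k) (Q : Ideal (PS k)) :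
    ¬ IsSingCurve (R.map τ.toAlgHom.toRingHom) Q := fun hQ => by
  have h1 := hQ.map τ.symm
  rw [filt_map_symm] at h1
  exact hN _ h1

omit [CharP k p] in
-- Otherwise the monomial and the constant term would both be divisible enough for `x = z = 0` to be
-- a singular curve.
theorem Chart.lt_of_good (C : Chart p G ι e a α β h none ty)
    (hN : ∀ Q, ¬ IsSingCurve (G.R.map ι.toRingHom) Q) : α < a := by
  by_contra hle
  rw [not_lt] at hle
  refine hN _ (C.frame.isSingCurve hle fun n hn2 hn => ?_)
  have h1 := C.type_x n hn2 hn
  have h2 : a * p ^ e ≤ a * n 0 := by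
    rw [mul_comm a]
    exact (Nat.mul_le_mul_left _ hle).trans h1
  exact Nat.le_of_mul_le_mul_left h2 C.frame.a_pos

omit [CharP k p] in
-- If `r ≥ q`, badness forces `α > a` and `x = z = 0` would be singular. Then `r + δ`, the degree of
-- a monomial of `h` other than `z ^ q`, exceeds `q`, so `δ` is positive.
theorem Chart.lt_of_bad (C : Chart p G ι e a α β h tx ty)
    (hN : ∀ Q, ¬ IsSingCurve (G.R.map ι.toRingHom) Q) {r δ : ℕ} (B : Bad (p ^ e) a α 0 1 h r δ) :
    r < p ^ e ∧ 0 < δ := by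
  have h1 : r < p ^ e := by
    by_contra hle
    rw [not_lt] at hle
    refine hN _ (C.frame.isSingCurve ?_ fun n hn2 hn => hle.trans (B.min n hn2 hn))
    have h2 := B.lt
    rw [mul_comm] at h2
    by_contra hlt
    have h3 := Nat.mul_le_mul hle (not_le.1 hlt).le
    omega
  refine ⟨h1, ?_⟩
  obtain ⟨n, hn2, hn0, hn1, hn, hnd⟩ := B.lead
  have h2 := C.strong.deg_lt hn (by rintro rfl; exact hnd fun i => by fin_cases i <;> simp)
  simp only [deg] at h2
  omega

omit [CharP k p] in
theorem Chart.pos_of_bad {δ : ℕ} (C : Chart p G ι e a α β h (some δ) ty)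
    (hN : ∀ Q, ¬ IsSingCurve (G.R.map ι.toRingHom) Q) : 0 < δ := by
  obtain ⟨r, B⟩ := C.type_x
  exact (C.lt_of_bad hN B).2

end Isolated

/-! ### Charts of the transform for the two kinds of centre. -/

section Lifting
variable {k : Type u} [Field k] [IsAlgClosed k] {p : ℕ} [Fact p.Prime] [CharP k p]
  {G G' : TripletGerm.{u, v} k} {J : Ideal G.ring} {φ : G.ring →ₐ[k] G'.ring} {t : G.ring}
  {ι : G.ring →ₐ[k] PS k} {e a α β : ℕ} {h : PS k} {tx ty : Option ℕ}

/-- The change of the type of the strict transform of a divisor. -/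
inductive Drop : Option ℕ → Option ℕ → Prop
  | good : Drop none none
  | bad {δ δ' : ℕ} (hlt : δ' < δ) : Drop (some δ) (some δ')

omit [IsAlgClosed k] in
theorem strong_mem {S : Finset (Fin 3)} (hS : IsCenter S) {q : ℕ} {h : PS k} (H : Strong q h)
    (hh : h ∈ varIdeal S ^ q) : h - X 2 ^ q ∈ mm k * varIdeal S ^ q := by
  refine mem_mm_mul_varIdeal_pow hS fun n hn => ⟨?_, mem_mm_pow.1 H n hn⟩
  have h1 := Ideal.sub_mem _ hh (Ideal.pow_mem_pow (X_mem_varIdeal (k := k) hS.2) q)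
  rw [varIdeal_pow] at h1
  exact h1 n hn

omit [IsAlgClosed k] in
theorem IsTransformAt.two_notMem (hT : IsTransformAt G J G' φ t)
    (C : Chart p G ι e a α β h tx ty) {S : Finset (Fin 3)} (hS : IsCenter S)
    (hJ : J.map ι.toRingHom = varIdeal S) {j : Fin 3 → G.ring} (hj : IsGens ι S J j)
    (hR : ∀ l, (G.R.map ι.toRingHom).level l ≤ varIdeal S ^ l)
    {w : Fin 3 → G'.ring} (hw : ∀ s ∈ S, φ (j s) = φ t * w s) (hG' : InSupport G') :
    w 2 ∈ maximalIdeal G'.ring :=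
  hT.blow.not_isUnit C.comp hS hj hJ (hw 2 hS.2) hT.filt hG'
    (fun l => C.comp.le_of_map_le (by rw [Ideal.map_pow, hJ]; exact hR l)) C.frame.h_mem
    (strong_mem hS C.strong (hR _ C.frame.h_mem))

omit [IsAlgClosed k] in
theorem InSupport.map_level_le (hG : InSupport G) (hι : IsCompletion ι) (l : ℕ) :
    (G.R.map ι.toRingHom).level l ≤ varIdeal Finset.univ ^ l := by
  refine (Ideal.map_mono (hG l)).trans ?_
  rw [Ideal.map_pow, ← mm_eq_varIdeal]
  exact Ideal.pow_right_mono hι.map_maximalIdeal _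

theorem isCenter_univ : IsCenter Finset.univ := ⟨Finset.mem_univ _, Finset.mem_univ _⟩

theorem isCenter_curve : IsCenter {0, 2} := ⟨by decide, by decide⟩

/-- The blow up of the point. -/
theorem IsTransformAt.exists_chart_point (hT : IsTransformAt G J G' φ t)
    (C : Chart p G ι e a α β h tx ty) (hA : Adapted (p ^ e) a α β h 1 1)
    (hJ : J.map ι.toRingHom = varIdeal Finset.univ) (hG : InSupport G) (hG' : InSupport G')
    (hN : ∀ Q, ¬ IsSingCurve (G.R.map ι.toRingHom) Q)
    {j : Fin 3 → G.ring} (hj : IsGens ι Finset.univ J j)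
    {w : Fin 3 → G'.ring} (hw : ∀ s ∈ Finset.univ, φ (j s) = φ t * w s) (hw0 : IsUnit (w 0)) :
    SigmaDrops p G G' ∨ ∃ (ψ : G'.ring →ₐ[k] PS k) (h' : PS k) (t' ty' : Option ℕ) (β' : ℕ),
      a ≤ α + β ∧ Chart p G' ψ e a (α + β - a) β' h' t' ty' ∧ ExcRel (p ^ e) a β tx ty t' ∧
      (Ideal.span {φ t}).map ψ.toRingHom = Ideal.span {X 0} ∧
      (∀ D : Ideal G.ring, D.map ι.toRingHom = Ideal.span {X 0} →
        saturation (D.map φ.toRingHom) (φ t) = ⊤) ∧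
      ((IsUnit (w 1) ∧ β' = 0 ∧ ∀ D : Ideal G.ring, D.map ι.toRingHom = Ideal.span {X 1} →
        saturation (D.map φ.toRingHom) (φ t) = ⊤) ∨
      (¬ IsUnit (w 1) ∧ β' = β ∧ Drop ty ty' ∧
        ∀ D : Ideal G.ring, D.map ι.toRingHom = Ideal.span {X 1} →
        saturation (D.map φ.toRingHom) (φ t) ≠ ⊤ ∧
        (saturation (D.map φ.toRingHom) (φ t)).map ψ.toRingHom = Ideal.span {X 1})) := by
  have hR := hG.map_level_le C.comp
  have hw2 := hT.two_notMem C isCenter_univ hJ hj hR hw hG'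
  have hind : ind Finset.univ 1 = 1 := by simp [ind]
  rcases hT.exists_frame C.comp isCenter_univ hJ hj hR hw hw0 hw2 hG' C.frame C.sigma_eq with
    hσ | ⟨c, ψ, h', h'', -, hc, hψ, hh', F, hst, hσ, hp, hex, hD0, hD1, hD2⟩
  · exact Or.inl hσ
  right
  rw [hind, one_mul] at F hp
  have hle := C.frame.le_of_center hR isCenter_univ
  rw [hind, one_mul] at hle
  obtain ⟨t', ht', hrel⟩ := exists_excRel hle hA C.strong.mem hh' C.type_x C.type_y
  have hc' := hc (Finset.mem_univ _)
  by_cases h0 : c = 0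
  · have hβ : blowBeta c β = β := if_pos h0
    rw [hβ] at F hp
    have E := expRel_of_transform isCenter_univ (fun _ => h0) hh' (hR _ C.frame.h_mem)
    rw [hind] at E
    obtain ⟨ty', hty', hdrop⟩ : ∃ ty', DivType (p ^ e) a β 1 0 h' ty' ∧ Drop ty ty' := by
      rcases ty with _ | δ
      · exact ⟨none, E.good_y C.type_y, .good⟩
      · obtain ⟨s, B⟩ := C.type_y
        obtain ⟨h1, h2⟩ := E.bad_y B
        refine ⟨some _, ⟨_, h2⟩, .bad ?_⟩
        -- Isolation gives `s < q`, hence `δ + s - q < δ`.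
        have h3 := (C.swap.lt_of_bad (by
          rw [filt_comp_equiv]; exact noSing_comp hN _) (B.swap swapExp_one swapExp_zero)).1
        omega
    exact ⟨ψ, h'', t', ty', β, hle, ⟨hψ, F, hst, hσ, hp.divType_x ht', hp.divType_y hty'⟩, hrel, hex,
      hD0, Or.inr ⟨hc'.1 h0, rfl, hdrop, fun D hD => hD2 D hD h0⟩⟩
  · have hβ : blowBeta c β = 0 := if_neg h0
    rw [hβ] at F hp
    -- The divisor `y = 0` is not in the boundary here; with exponent 0 it is vacuously good, so
    -- `none` is a harmless default.
    refine ⟨ψ, h'', t', none, 0, hle, ⟨hψ, F, hst, hσ, hp.divType_x ht', ?_⟩, hrel, hex,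
      hD0, Or.inl ⟨not_not.1 fun h1 => h0 (hc'.2 h1), rfl, fun D hD => hD1 D hD h0⟩⟩
    intro n _ _
    simp

/-- The blow up of a curve. -/
theorem IsTransformAt.exists_chart_curve (hT : IsTransformAt G J G' φ t)
    (C : Chart p G ι e a α β h tx ty) (hJ : J.map ι.toRingHom = varIdeal {0, 2})
    (hR : ∀ l, (G.R.map ι.toRingHom).level l ≤ varIdeal {0, 2} ^ l) (hG' : InSupport G') :
    SigmaDrops p G G' ∨ ∃ (ψ : G'.ring →ₐ[k] PS k) (h' : PS k) (ty' : Option ℕ),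
      a ≤ α ∧ Chart p G' ψ e a (α - a) β h' tx ty' ∧ Drop ty ty' ∧
      (Ideal.span {φ t}).map ψ.toRingHom = Ideal.span {X 0} ∧
      (∀ D : Ideal G.ring, D.map ι.toRingHom = Ideal.span {X 0} →
        saturation (D.map φ.toRingHom) (φ t) = ⊤) ∧
      (∀ D : Ideal G.ring, D.map ι.toRingHom = Ideal.span {X 1} →
        saturation (D.map φ.toRingHom) (φ t) ≠ ⊤ ∧
        (saturation (D.map φ.toRingHom) (φ t)).map ψ.toRingHom = Ideal.span {X 1}) := by
  obtain ⟨j, hj⟩ := C.comp.exists_isGens hJ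
  obtain ⟨w, hw, s, hs, hws⟩ := hT.blow.exists_units hj
  have hw2 := hT.two_notMem C isCenter_curve hJ hj hR hw hG'
  have hw0 : IsUnit (w 0) := by
    fin_cases s
    · exact hws
    · simp at hs
    · exact absurd hws hw2
  have hind : ind {0, 2} 1 = 0 := by simp [ind]
  rcases hT.exists_frame C.comp isCenter_curve hJ hj hR hw hw0 hw2 hG' C.frame C.sigma_eq with
    hσ | ⟨c, ψ, h', h'', hc, -, hψ, hh', F, hst, hσ, hp, hex, hD0, -, hD2⟩
  · exact Or.inl hσ
  right
  have h0 : c = 0 := hc (by decide)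
  have hle := C.frame.le_of_center hR isCenter_curve
  have hβ : blowBeta c β = β := if_pos h0
  rw [hind, zero_mul, add_zero] at hle F hp
  rw [hβ] at F hp
  -- With `ε = 0` the exponents of `x` fall by `q` and those of `y` stay, so `H_x` keeps its type
  -- while the `δ` of a bad `H_y` falls by `q`.
  have E := expRel_of_transform isCenter_curve (fun _ => h0) hh' (hR _ C.frame.h_mem)
  rw [hind] at E
  have htx : DivType (p ^ e) a (α - a) 0 1 h' tx := by
    rcases tx with _ | δ
    · exact E.good_x C.type_x
    · obtain ⟨r, B⟩ := C.type_x
      exact ⟨_, E.bad_x B⟩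
  obtain ⟨ty', hty', hdrop⟩ : ∃ ty', DivType (p ^ e) a β 1 0 h' ty' ∧ Drop ty ty' := by
    rcases ty with _ | δ
    · exact ⟨none, E.good_y C.type_y, .good⟩
    · obtain ⟨s, B⟩ := C.type_y
      obtain ⟨h1, h2⟩ := E.bad_y B
      refine ⟨some _, ⟨_, h2⟩, .bad ?_⟩
      have := Nat.pos_of_ne_zero (pNZ p e)
      omega
  exact ⟨ψ, h'', ty', hle, ⟨hψ, F, hst, hσ, hp.divType_x htx, hp.divType_y hty'⟩, hdrop, hex, hD0,
    fun D hD => hD2 D hD h0⟩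

end Lifting

/-! ### Lexicographic comparison of the values. -/

section Lex

theorem cons_lt_cons_of_lt {x y : ℚ} {l l' : List ℚ} (h : x < y) : x :: l < y :: l' :=
  List.cons_lt_cons_iff.2 (Or.inl h)

theorem cons_lt_cons_of_eq {x : ℚ} {l l' : List ℚ} (h : l < l') : x :: l < x :: l' :=
  List.cons_lt_cons_iff.2 (Or.inr ⟨rfl, h⟩)

/-- If the minima agree, the maxima are compared through the sums, because minimum plus maximum is
the sum of the two entries. -/
theorem min_max_lt {x y x' y' : ℚ} (hx : x' ≤ x) (hy : y' < y) :
    [min x' y', max x' y'] < [min x y, max x y] := by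
  rcases (min_le_min hx hy.le).lt_or_eq with h | h
  · exact cons_lt_cons_of_lt h
  · rw [h]
    refine cons_lt_cons_of_eq (cons_lt_cons_of_lt ?_)
    have h1 := min_add_max x y
    have h2 := min_add_max x' y'
    linarith

theorem max_min_lt {x y x' y' : ℚ} (hx : x' < x) (hy : y' ≤ y) :
    [min x' y', max x' y'] < [min x y, max x y] := by
  rw [min_comm, max_comm, min_comm x, max_comm x]
  exact min_max_lt hy hx

/-- Explains the second entry 0 of the values in the cases with only good divisors or one component:
in case of equal first entries it is smaller than the positive maximum. -/
theorem cons_zero_lt {x y c : ℚ} {l : List ℚ} (hx : c ≤ x) (hy : c ≤ y) (h : 0 < x ∨ 0 < y) :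
    c :: 0 :: l < [min x y, max x y] := by
  rcases (le_min hx hy).lt_or_eq with h1 | h1
  · exact cons_lt_cons_of_lt h1
  · rw [h1]
    exact cons_lt_cons_of_eq (cons_lt_cons_of_lt (lt_max_iff.2 h))

variable {q a α β : ℕ} {t tx ty ty' : Option ℕ}

theorem cast_div_pos {m n : ℕ} (hm : 0 < m) (hn : 0 < n) : (0 : ℚ) < (m : ℚ) / n :=
  div_pos (Nat.cast_pos.2 hm) (Nat.cast_pos.2 hn)

theorem cast_div_lt {m m' n : ℕ} (hm : m < m') (hn : 0 < n) : (m : ℚ) / n < (m' : ℚ) / n :=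
  div_lt_div_of_pos_right (Nat.cast_lt.2 hm) (Nat.cast_pos.2 hn)

theorem cast_div_le {m m' : ℕ} (n : ℕ) (hm : m ≤ m') : (m : ℚ) / n ≤ (m' : ℚ) / n :=
  div_le_div_of_nonneg_right (Nat.cast_le.2 hm) (Nat.cast_nonneg n)

theorem cast_div_nonneg (m n : ℕ) : (0 : ℚ) ≤ (m : ℚ) / n :=
  div_nonneg (Nat.cast_nonneg m) (Nat.cast_nonneg n)

theorem cast_div_lt_div {m m' n n' : ℕ} (hn : 0 < n) (hn' : 0 < n') (h : n' * m < n * m') :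
    (m : ℚ) / n < (m' : ℚ) / n' := by
  rw [div_lt_div_iff₀ (Nat.cast_pos.2 hn) (Nat.cast_pos.2 hn'), mul_comm (m : ℚ), mul_comm (m' : ℚ)]
  exact_mod_cast h

/-- The invariant decreases in the blow up of a curve, at a point of two components. -/
theorem invTwo_lt_of_curve (hq : 0 < q) {μ' μ : ℚ} (ν : ℚ) (hμ : μ' < μ) (hd : Drop ty ty') :
    invTwo q μ' ν tx ty' < invTwo q μ ν tx ty := by
  rcases tx with _ | δ <;> rcases hd with _ | ⟨hlt⟩
  · exact cons_lt_cons_of_eq (cons_lt_cons_of_eq (max_min_lt hμ le_rfl))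
  · exact max_min_lt (cast_div_lt hlt hq) le_rfl
  · exact min_max_lt le_rfl hμ
  · exact min_max_lt le_rfl (cast_div_lt hlt hq)

/-- The invariant decreases in the blow up of a curve, at a point of one component. -/
theorem invOne_lt_of_curve {μ' μ : ℚ} (hμ : μ' < μ) : invOne q μ' tx < invOne q μ tx := by
  rcases tx with _ | δ <;>
    exact cons_lt_cons_of_eq (cons_lt_cons_of_eq (cons_lt_cons_of_lt hμ))

/-- The invariant decreases in the blow up of a point of two components, at a point of the strict
transform of one of them. -/
theorem invTwo_lt_of_point (hq : 0 < q) (ha : 0 < a) (haα : a ≤ α + β) (R : ExcRel q a β tx ty t)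
    (hd : Drop ty ty') (hx : ∀ δ, tx = some δ → 0 < δ) (hy : ty = none → β < a) :
    invTwo q ((α + β - a : ℕ) / a) ((β : ℚ) / a) t ty' < invTwo q ((α : ℚ) / a) ((β : ℚ) / a) tx ty := by
  rcases hd with _ | ⟨hlt⟩
  · have hμ : ((α + β - a : ℕ) / a : ℚ) < (α : ℚ) / a := cast_div_lt (by have := hy rfl; omega) ha
    rcases tx with _ | δ
    · rw [R.good_good rfl rfl]
      exact cons_lt_cons_of_eq (cons_lt_cons_of_eq (max_min_lt hμ le_rfl))
    · rcases t with _ | δ'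
      · exact cons_zero_lt (cast_div_nonneg _ _) (cast_div_nonneg _ _)
          (Or.inl (cast_div_pos (hx δ rfl) hq))
      · exact min_max_lt (cast_div_le _ (R.of_bad _ _ rfl rfl)) hμ
  -- The entry of `H_y` falls from `ρ_y` to its new value. The other one, `μ_y` or `ρ_x` before and
  -- `μ_y` or the `ρ` of the exceptional divisor after, does not increase, by `ExcRel`.
  · rcases tx with _ | δ <;> rcases t with _ | δ'
    · exact max_min_lt (cast_div_lt hlt hq) le_rfl
    · simp only [invTwo]
      rw [min_comm, max_comm]
      exact max_min_lt (cast_div_lt hlt hq) (cast_div_lt_div hq ha (R.of_good _ rfl rfl)).le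
    · simp only [invTwo]
      rw [min_comm, max_comm]
      exact min_max_lt (cast_div_lt_div ha hq (R.bad_good _ rfl rfl)).le (cast_div_lt hlt hq)
    · exact min_max_lt (cast_div_le _ (R.of_bad _ _ rfl rfl)) (cast_div_lt hlt hq)

/-- The invariant decreases in the blow up of a point of two components, away from their strict
transforms. -/
theorem invOne_lt_invTwo (hq : 0 < q) (ha : 0 < a) (haα : a ≤ α + β) (R : ExcRel q a β tx ty t)
    (R' : ExcRel q a α ty tx t) (hx : ∀ δ, tx = some δ → 0 < δ) (hy : ∀ δ, ty = some δ → 0 < δ)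
    (hx' : tx = none → α < a) (hy' : ty = none → β < a) :
    invOne q ((α + β - a : ℕ) / a) t < invTwo q ((α : ℚ) / a) ((β : ℚ) / a) tx ty := by
  rcases tx with _ | δ <;> rcases ty with _ | ε
  · rw [R.good_good rfl rfl]
    have := hx' rfl
    have := hy' rfl
    exact cons_lt_cons_of_eq (cons_lt_cons_of_eq (cons_lt_cons_of_lt
      (lt_min (cast_div_lt (by omega) ha) (cast_div_lt (by omega) ha))))
  · have hp := Or.inl (b := 0 < (β : ℚ) / a) (cast_div_pos (hy ε rfl) hq)
    rcases t with _ | δ'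
    · exact cons_zero_lt (cast_div_nonneg _ _) (cast_div_nonneg _ _) hp
    · exact cons_zero_lt (cast_div_le _ (R'.of_bad _ _ rfl rfl))
        (cast_div_lt_div hq ha (R.of_good _ rfl rfl)).le hp
  · have hp := Or.inl (b := 0 < (α : ℚ) / a) (cast_div_pos (hx δ rfl) hq)
    rcases t with _ | δ'
    · exact cons_zero_lt (cast_div_nonneg _ _) (cast_div_nonneg _ _) hp
    · exact cons_zero_lt (cast_div_le _ (R.of_bad _ _ rfl rfl))
        (cast_div_lt_div hq ha (R'.of_good _ rfl rfl)).le hp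
  · have hp := Or.inl (b := 0 < (ε : ℚ) / q) (cast_div_pos (hx δ rfl) hq)
    rcases t with _ | δ'
    · exact cons_zero_lt (cast_div_nonneg _ _) (cast_div_nonneg _ _) hp
    · exact cons_zero_lt (cast_div_le _ (R.of_bad _ _ rfl rfl))
        (cast_div_le _ (R'.of_bad _ _ rfl rfl)) hp

/-- The invariant decreases in the blow up of a point of one component, away from its strict
transform. -/
theorem invOne_lt_of_point (hq : 0 < q) (ha : 0 < a) {δ : ℕ} (R : ExcRel q a β (some δ) ty t)
    (hδ : 0 < δ) (haα : a ≤ α) : invOne q ((α - a : ℕ) / a) t < invOne q ((α : ℚ) / a) (some δ) := by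
  rcases t with _ | δ'
  · exact cons_lt_cons_of_lt (cast_div_pos hδ hq)
  · rcases (cast_div_le q (R.of_bad _ _ rfl rfl)).lt_or_eq with h | h
    · exact cons_lt_cons_of_lt h
    · simp only [invOne]
      rw [h]
      exact cons_lt_cons_of_eq (cons_lt_cons_of_eq (cons_lt_cons_of_lt (cast_div_lt (by omega) ha)))

/-- The invariant decreases in the blow up of a point of one component, at the point of its strict
transform. -/
theorem invTwo_lt_invOne (hq : 0 < q) (μ' ν μ : ℚ) {δ : ℕ} (hd : Drop (some δ) ty') :
    invTwo q μ' ν t ty' < invOne q μ (some δ) := by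
  rcases hd with _ | ⟨hlt⟩
  rcases t with _ | δ'
  · exact cons_lt_cons_of_lt ((min_le_left _ _).trans_lt (cast_div_lt hlt hq))
  · exact cons_lt_cons_of_lt ((min_le_right _ _).trans_lt (cast_div_lt hlt hq))

end Lex

/-! ### The decrease for each configuration, with control of denominators. -/

section Step
variable {k : Type u} [Field k] {p : ℕ} {G G' : TripletGerm.{u, v} k}

/-- `N` is a common denominator of the entries of the invariant. -/
structure Denom (N q a α β : ℕ) : Prop where
  dvd_q : q ∣ N
  dvd_x : a ∣ N * α
  dvd_y : a ∣ N * β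

theorem Denom.swap {N q a α β : ℕ} (H : Denom N q a α β) : Denom N q a β α :=
  ⟨H.dvd_q, H.dvd_y, H.dvd_x⟩

/-- The new exponent of `x` is `α + β - a`, and subtracting `a` does not affect divisibility by `a`.
-/
theorem Denom.point {N q a α β β' : ℕ} (H : Denom N q a α β) (hβ : β' = 0 ∨ β' = β) :
    Denom N q a (α + β - a) β' := by
  refine ⟨H.dvd_q, ?_, ?_⟩
  · rw [Nat.mul_sub, mul_add]
    exact Nat.dvd_sub (dvd_add H.dvd_x H.dvd_y) (dvd_mul_left _ _)
  · rcases hβ with rfl | rfl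
    · simp
    · exact H.dvd_y

theorem Denom.curve {N q a α β : ℕ} (H : Denom N q a α β) : Denom N q a (α - a) β := by
  refine ⟨H.dvd_q, ?_, H.dvd_y⟩
  rw [Nat.mul_sub]
  exact Nat.dvd_sub H.dvd_x (dvd_mul_left _ _)

/-- A drop of `σ`, or a decrease of the invariant which keeps the common denominator. -/
def Decreases (p N : ℕ) (G G' : TripletGerm.{u, v} k) : Prop :=
  SigmaDrops p G G' ∨ (∃ P : Presentation p G', Denom N (p ^ P.e) P.a P.α P.β) ∧
    ∃ w w', IsInvMON p G w ∧ IsInvMON p G' w' ∧ w' < w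

variable [Fact p.Prime] [CharP k p]

theorem map_mm_equiv (τ : PS k ≃ₐ[k] PS k) : (mm k).map τ.toAlgHom.toRingHom = mm k := by
  have h1 : ∀ (τ : PS k ≃ₐ[k] PS k) {f}, f ∈ mm k → τ f ∈ mm k := fun τ f hf => by
    have := algHom_mem_mm_pow τ.toAlgHom (n := 1) (f := f) (by simpa using hf)
    simpa using this
  refine le_antisymm (Ideal.map_le_iff_le_comap.2 fun f hf => h1 τ hf) fun f hf => ?_
  have h2 := Ideal.mem_map_of_mem τ.toAlgHom.toRingHom (h1 τ.symm hf)
  have h3 : τ.toAlgHom.toRingHom (τ.symm f) = f := τ.apply_symm_apply f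
  rwa [h3] at h2

omit [Fact p.Prime] [CharP k p] in
theorem ideal_map_trans (I : Ideal (PS k)) (τ τ' : PS k ≃ₐ[k] PS k) :
    (I.map τ.toAlgHom.toRingHom).map τ'.toAlgHom.toRingHom =
      I.map (τ.trans τ').toAlgHom.toRingHom := by
  rw [Ideal.map_map]
  congr 1

theorem map_swap_univ {ι : G.ring →ₐ[k] PS k} {J : Ideal G.ring}
    (hJ : J.map ι.toRingHom = varIdeal Finset.univ) :
    J.map ((swapEquiv k).toAlgHom.comp ι).toRingHom = varIdeal Finset.univ := by
  rw [map_comp_equiv, hJ, ← mm_eq_varIdeal, map_mm_equiv]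

theorem IsGens.swap {ι : G.ring →ₐ[k] PS k} {J : Ideal G.ring} {j : Fin 3 → G.ring}
    (hι : IsCompletion ι) (hJ : J.map ι.toRingHom = varIdeal Finset.univ)
    (hj : IsGens ι Finset.univ J j) :
    IsGens ((swapEquiv k).toAlgHom.comp ι) Finset.univ J (j ∘ Equiv.swap 0 1) := by
  have hX : ∀ s : Fin 3, (X s : PS k) - (swapEquiv k).toAlgHom.comp ι (j (Equiv.swap 0 1 s)) =
      swapEquiv k (X (Equiv.swap 0 1 s) - ι (j (Equiv.swap 0 1 s))) := by
    intro s
    rw [map_sub]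
    congr 1
    fin_cases s
    · simp
    · simp
    · have : Equiv.swap (0 : Fin 3) 1 2 = 2 := by decide
      simp [this]
  have hsq : ∀ {f : PS k} (n : ℕ), f ∈ mm k ^ n → swapEquiv k f ∈ mm k ^ n := fun n hf =>
    algHom_mem_mm_pow (swapEquiv k).toAlgHom hf
  have hr : Set.range (j ∘ Equiv.swap 0 1) = Set.range j := (Equiv.swap 0 1).surjective.range_comp j
  obtain ⟨j', hj'⟩ := (hι.comp (swapEquiv k)).exists_isGens (map_swap_univ hJ)
  refine ⟨fun s _ => hj.mem _ (Finset.mem_univ _), fun s _ => ?_, fun s => ?_, ?_, ?_, hj'.map_max⟩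
  · have := hj.sub (Equiv.swap 0 1 s) (Finset.mem_univ _)
    rw [← mm_eq_varIdeal, ← pow_succ] at this ⊢
    rw [Function.comp_apply, hX]
    exact hsq _ this
  · rw [Function.comp_apply, hX]
    exact hsq _ (hj.sub_sq _)
  · rw [hj.span, Finset.coe_univ, Set.image_univ, Set.image_univ, hr]
  · rw [hj.max, hr]

variable [IsAlgClosed k] {J : Ideal G.ring} {φ : G.ring →ₐ[k] G'.ring} {t : G.ring}
  {ι : G.ring →ₐ[k] PS k} {e a α β N : ℕ} {h : PS k} {tx ty : Option ℕ}

omit [Fact (Nat.Prime p)] [CharP k p] [IsAlgClosed k] in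
theorem Chart.exists_denom {ι : G.ring →ₐ[k] PS k} (C : Chart p G ι e a α β h tx ty)
    {D : Ideal G.ring} (hD : D.map ι.toRingHom = Ideal.span {X 0}) (hb : IsBoundary G ι β D)
    (hd : Denom N (p ^ e) a α β) : ∃ P : Presentation p G, Denom N (p ^ P.e) P.a P.α P.β :=
  ⟨C.presentation hD hb, hd⟩

/-- The blow up of a point of two components. -/
theorem IsTransformAt.decreases_two (hT : IsTransformAt G J G' φ t)
    (C : Chart p G ι e a α β h tx ty) (hA : Adapted (p ^ e) a α β h 1 1)
    (hJ : J.map ι.toRingHom = varIdeal Finset.univ) (hG : InSupport G) (hG' : InSupport G')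
    (hN : ∀ Q, ¬ IsSingCurve (G.R.map ι.toRingHom) Q) {D D' : Ideal G.ring}
    (hD : D.map ι.toRingHom = Ideal.span {X 0}) (hD' : D'.map ι.toRingHom = Ideal.span {X 1})
    (hE : G.E = [D, D'] ∨ G.E = [D', D]) (hd : Denom N (p ^ e) a α β)
    {j : Fin 3 → G.ring} (hj : IsGens ι Finset.univ J j)
    {w : Fin 3 → G'.ring} (hw : ∀ s ∈ Finset.univ, φ (j s) = φ t * w s) (hw0 : IsUnit (w 0)) :
    Decreases p N G G' := by
  have hq := Nat.pos_of_ne_zero (pNZ p e)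
  have ha := C.frame.a_pos
  have hN' : ∀ Q, ¬ IsSingCurve (G.R.map ((swapEquiv k).toAlgHom.comp ι).toRingHom) Q := by
    rw [filt_comp_equiv]
    exact noSing_comp hN _
  have hx : ∀ δ, tx = some δ → 0 < δ := by
    rintro δ rfl
    exact C.pos_of_bad hN
  have hy : ∀ δ, ty = some δ → 0 < δ := by
    rintro δ rfl
    exact C.swap.pos_of_bad hN'
  have hx' : tx = none → α < a := by
    rintro rfl
    exact C.lt_of_good hN
  have hy' : ty = none → β < a := by
    rintro rfl
    exact C.swap.lt_of_good hN'
  have hI := C.isInvMON_two hD hD' hE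
  rcases hT.exists_chart_point C hA hJ hG hG' hN hj hw hw0 with
    hσ | ⟨ψ, h', t', ty', β', hle, C', R, hex, hsx, ⟨hw1, rfl, hsy⟩ | ⟨-, rfl, hdrop, hsy⟩⟩
  · exact Or.inl hσ
  · have hE' := hT.two D D' hE (hsx D hD) (hsy D' hD')
    -- Away from both strict transforms the point is seen in both charts. The second one gives the
    -- relations of the exceptional divisor with the roles of `H_x` and `H_y` exchanged, and its
    -- type is the same in both, being intrinsic.
    rcases hT.exists_chart_point C.swap hA.swap (map_swap_univ hJ) hG hG' hN'
      (hj.swap C.comp hJ) (w := w ∘ Equiv.swap 0 1) (fun s _ => hw _ (Finset.mem_univ _))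
      (by simpa using hw1) with
      hσ | ⟨ψ2, h2, t2, ty2, β2, -, C2, R2, hex2, -, ⟨-, rfl, -⟩ | ⟨hnu, -⟩⟩
    · exact Or.inl hσ
    · obtain rfl := C'.type_unique C2 hex (Or.inl ⟨hE', rfl⟩) hex2 (Or.inl ⟨hE', rfl⟩)
      exact Or.inr ⟨C'.exists_denom hex (Or.inl ⟨hE', rfl⟩) (hd.point (Or.inl rfl)), _, _, hI,
        C'.isInvMON_one hex hE' rfl, invOne_lt_invTwo hq ha hle R R2 hx hy hx' hy'⟩
    · exact absurd hw0 (by simpa using hnu)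
  · have hE' := hT.two' D D' hE (hsx D hD) (hsy D' hD').1
    have hm := (hsy D' hD').2
    exact Or.inr ⟨C'.exists_denom hex (Or.inr ⟨_, hm, Or.inl hE'⟩) (hd.point (Or.inr rfl)), _, _, hI,
      C'.isInvMON_two hex hm (Or.inl hE'), invTwo_lt_of_point hq ha hle R hdrop hx hy'⟩

/-- The blow up of a point of one component. -/
theorem IsTransformAt.decreases_one (hT : IsTransformAt G J G' φ t)
    (C : Chart p G ι e a α 0 h tx ty) (hA : Adapted (p ^ e) a α 0 h 1 1)
    (hJ : J.map ι.toRingHom = varIdeal Finset.univ) (hG : InSupport G) (hG' : InSupport G')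
    (hN : ∀ Q, ¬ IsSingCurve (G.R.map ι.toRingHom) Q) {D : Ideal G.ring}
    (hD : D.map ι.toRingHom = Ideal.span {X 0}) (hE : G.E = [D]) (hd : Denom N (p ^ e) a α 0)
    {j : Fin 3 → G.ring} (hj : IsGens ι Finset.univ J j)
    {w : Fin 3 → G'.ring} (hw : ∀ s ∈ Finset.univ, φ (j s) = φ t * w s)
    (hw01 : IsUnit (w 0) ∨ IsUnit (w 1)) : Decreases p N G G' := by
  have hq := Nat.pos_of_ne_zero (pNZ p e)
  have ha := C.frame.a_pos
  have hI := C.isInvMON_one hD hE rfl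
  have hlt : tx = none → α < a := by
    rintro rfl
    exact C.lt_of_good hN
  by_cases hw0 : IsUnit (w 0)
  · rcases hT.exists_chart_point C hA hJ hG hG' hN hj hw hw0 with
      hσ | ⟨ψ, h', t', ty', β', hle, C', R, hex, hsx, hβ⟩
    · exact Or.inl hσ
    obtain rfl : β' = 0 := by
      rcases hβ with ⟨-, h, -⟩ | ⟨-, h, -⟩ <;> exact h
    have hE' := hT.one D hE (hsx D hD)
    -- At an isolated point a single good component would have `α < a`, against the order of the
    -- monomial at a point of the support.
    rcases tx with _ | δ
    · have := hlt rfl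
      omega
    exact Or.inr ⟨C'.exists_denom hex (Or.inl ⟨hE', rfl⟩) (hd.point (Or.inl rfl)), _, _, hI,
      C'.isInvMON_one hex hE' rfl, invOne_lt_of_point hq ha R (C.pos_of_bad hN) hle⟩
  · rcases hT.exists_chart_point C.swap hA.swap (map_swap_univ hJ) hG hG'
      (by rw [filt_comp_equiv]; exact noSing_comp hN _)
      (hj.swap C.comp hJ) (w := w ∘ Equiv.swap 0 1) (fun s _ => hw _ (Finset.mem_univ _))
      (by simpa using hw01.resolve_left hw0) with
      hσ | ⟨ψ, h', t', ty', β', hle, C', R, hex, -, ⟨h0, -⟩ | ⟨-, rfl, hdrop, hsy⟩⟩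
    · exact Or.inl hσ
    · exact absurd (by simpa using h0) hw0
    · obtain ⟨hne, hm⟩ := hsy D (map_swap_X0 hD)
      have hE' := hT.one' D hE hne
      rcases tx with _ | δ
      · have := hlt rfl
        omega
      exact Or.inr ⟨C'.exists_denom hex (Or.inr ⟨_, hm, Or.inl hE'⟩) (hd.swap.point (Or.inr rfl)),
        _, _, hI, C'.isInvMON_two hex hm (Or.inl hE'), invTwo_lt_invOne hq _ _ _ hdrop⟩

/-- The blow up of the point. -/
theorem IsTransformAt.decreases_point (hT : IsTransformAt G J G' φ t) (P : Presentation p G)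
    (hJ : J.map P.chart.toRingHom = mm k) (hG : InSupport G) (hG' : InSupport G')
    (hN : ∀ Q, ¬ IsSingCurve (G.R.map P.chart.toRingHom) Q)
    (hd : Denom N (p ^ P.e) P.a P.α P.β) : Decreases p N G G' := by
  obtain ⟨τ, A, h1, h2, h3⟩ := P.exists_adapted
  have hJ' : J.map (P.adjust A).chart.toRingHom = varIdeal Finset.univ := by
    have h4 := map_comp_equiv P.chart τ J
    rw [hJ, map_mm_equiv, mm_eq_varIdeal] at h4
    exact h4
  have hN' : ∀ Q, ¬ IsSingCurve (G.R.map (P.adjust A).chart.toRingHom) Q := by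
    have h4 := filt_comp_equiv P.chart τ
    have h5 := noSing_comp hN τ
    rw [← h4] at h5
    exact h5
  obtain ⟨tx, ty, C⟩ := (P.adjust A).exists_types h1 h2
  have hA : Adapted (p ^ (P.adjust A).e) (P.adjust A).a (P.adjust A).α (P.adjust A).β
    (P.adjust A).h 1 1 := h3
  have hd' : Denom N (p ^ (P.adjust A).e) (P.adjust A).a (P.adjust A).α (P.adjust A).β := hd
  generalize P.adjust A = P at *
  obtain ⟨j, hj⟩ := C.comp.exists_isGens hJ'
  obtain ⟨w, hw, s, hs, hws⟩ := hT.blow.exists_units hj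
  have hw2 := hT.two_notMem C isCenter_univ hJ' hj (hG.map_level_le C.comp) hw hG'
  have hw01 : IsUnit (w 0) ∨ IsUnit (w 1) := by
    fin_cases s
    · exact Or.inl hws
    · exact Or.inr hws
    · exact absurd hws hw2
  rcases P.boundary with ⟨hE, hβ⟩ | ⟨Hy, hy, hE⟩
  · rw [hβ] at C hA hd'
    exact hT.decreases_one C hA hJ' hG hG' hN' P.Hx_eq hE hd' hj hw hw01
  · rcases hw01 with hw0 | hw1
    · exact hT.decreases_two C hA hJ' hG hG' hN' P.Hx_eq hy hE hd' hj hw hw0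
    · exact hT.decreases_two C.swap hA.swap (map_swap_univ hJ') hG hG'
        (by rw [filt_comp_equiv]; exact noSing_comp hN' _) (map_swap_X1 hy) (map_swap_X0 P.Hx_eq)
        hE.symm hd'.swap (hj.swap C.comp hJ') (w := w ∘ Equiv.swap 0 1)
        (fun s _ => hw _ (Finset.mem_univ _)) (by simpa using hw1)

/-- The blow up of a curve. -/
theorem IsTransformAt.decreases_curve (hT : IsTransformAt G J G' φ t) (P : Presentation p G)
    (hQ : IsSingCurve P.filt (J.map P.chart.toRingHom)) (h0 : X 0 ∈ J.map P.chart.toRingHom)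
    (hG' : InSupport G') (hd : Denom N (p ^ P.e) P.a P.α P.β) : Decreases p N G G' := by
  obtain ⟨P, C, hJ, hQ, hd⟩ : ∃ P : Presentation p G,
      (∃ tx ty, Chart p G P.chart P.e P.a P.α P.β P.h tx ty) ∧
      J.map P.chart.toRingHom = varIdeal {0, 2} ∧ IsSingCurve P.filt (varIdeal {0, 2}) ∧
      Denom N (p ^ P.e) P.a P.α P.β := by
    -- Coordinates are first adapted along the divisors and then the curve is straightened; the
    -- second adjustment does not destroy the first.
    obtain ⟨τ, A, h1, h2, -⟩ := P.exists_adapted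
    have hQ1 := hQ.map τ
    have h01 := Ideal.mem_map_of_mem τ.toAlgHom.toRingHom h0
    have h4 : τ.toAlgHom.toRingHom (X 0) = X 0 := A.X0
    rw [h4] at h01
    obtain ⟨τ', A', h5⟩ := hQ1.exists_adjust A.frame A.strong h01
    have hA := A.trans A'
    refine ⟨P.adjust hA, (P.adjust hA).exists_types (A'.adapted _ _ h1) (A'.adapted _ _ h2), ?_, ?_, hd⟩
    · rw [← h5]
      refine (map_comp_equiv P.chart (τ.trans τ') J).trans ?_
      exact (ideal_map_trans _ τ τ').symm
    · have h6 := hQ1.map τ'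
      rw [h5, map_trans, ← filt_comp_equiv] at h6
      exact h6
  obtain ⟨tx, ty, C⟩ := C
  have hq := Nat.pos_of_ne_zero (pNZ p P.e)
  rcases hT.exists_chart_curve C hJ hQ.level_le hG' with
    hσ | ⟨ψ, h', ty', hle, C', hdrop, hex, hsx, hsy⟩
  · exact Or.inl hσ
  have hμ : ((P.α - P.a : ℕ) / P.a : ℚ) < (P.α : ℚ) / P.a :=
    cast_div_lt (by have := P.a_pos; omega) P.a_pos
  rcases P.boundary with ⟨hE, hβ⟩ | ⟨Hy, hy, hE⟩
  · have hE' := hT.one P.Hx hE (hsx _ P.Hx_eq)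
    exact Or.inr ⟨C'.exists_denom hex (Or.inl ⟨hE', hβ⟩) hd.curve, _, _, C.isInvMON_one P.Hx_eq hE hβ,
      C'.isInvMON_one hex hE' hβ, invOne_lt_of_curve hμ⟩
  · obtain ⟨hne, hm⟩ := hsy Hy hy
    have hE' := hT.two' P.Hx Hy hE (hsx _ P.Hx_eq) hne
    exact Or.inr ⟨C'.exists_denom hex (Or.inr ⟨_, hm, Or.inl hE'⟩) hd.curve, _, _,
      C.isInvMON_two P.Hx_eq hy hE, C'.isInvMON_two hex hm (Or.inl hE'),
      invTwo_lt_of_curve hq _ hμ hdrop⟩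

/-- The prescribed blow up decreases the invariant. -/
theorem Presentation.decreases (P : Presentation p G) (hP : P.Prescribes (J.map P.chart.toRingHom))
    (hG : InSupport G) (hG' : InSupport G') (hT : IsTransform G J G')
    (hd : Denom N (p ^ P.e) P.a P.α P.β) : Decreases p N G G' := by
  obtain ⟨φ, t, hT⟩ := hT.exists_at
  rcases hP with ⟨hQ, hle, -⟩ | ⟨hN, hJ⟩
  · refine hT.decreases_curve P hQ (hle ?_) hG' hd
    rw [P.Hx_eq]
    exact Ideal.mem_span_singleton_self _
  · exact hT.decreases_point P hJ hG hG' hN hd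

end Step

/-! ### Descent and termination. -/

section Termination

/-- There is no infinite decreasing sequence of lists of bounded length, with entries of bounded
denominator. -/
theorem not_decreasing {N : ℕ} (hN : 0 < N) (n : ℕ) (l : ℕ → List ℚ) (hl : ∀ i, (l i).length ≤ n)
    (hm : ∀ i, ∀ x ∈ l i, ∃ m : ℕ, N * x = m) (hlt : ∀ i, l (i + 1) < l i) : False := by
  have hne : ∀ i, ∃ x t, l i = x :: t := by
    intro i
    rcases h : l i with _ | ⟨x, t⟩
    · have := hlt i
      rw [h] at this
      exact absurd this (List.not_lt_nil _)
    · exact ⟨x, t, rfl⟩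
  choose x t hxt using hne
  simp only [hxt, List.length_cons, List.mem_cons, forall_eq_or_imp] at hl hm hlt
  induction n generalizing l x t with
  | zero => exact absurd (hl 0) (by omega)
  | succ n ih =>
    choose m hxm using fun i => (hm i).1
    have hmx : ∀ {i j}, x i = x j ↔ m i = m j := by
      intro i j
      rw [← Nat.cast_inj (R := ℚ), ← hxm, ← hxm, mul_right_inj' (Nat.cast_pos.2 hN).ne']
    have hanti : Antitone m := by
      refine antitone_nat_of_succ_le fun i => ?_
      have h1 : x (i + 1) ≤ x i := by
        rcases List.cons_lt_cons_iff.1 (hlt i) with h | h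
        · exact h.le
        · exact h.1.le
      have h2 := mul_le_mul_of_nonneg_left h1 (Nat.cast_nonneg (α := ℚ) N)
      rw [hxm, hxm] at h2
      exact_mod_cast h2
    -- The first entries form a non-increasing sequence in a discrete set bounded below, so they are
    -- constant from `i0` on; from there the tails decrease strictly and are shorter.
    obtain ⟨i0, hi0⟩ : ∃ i0, ∀ i, m i0 ≤ m i := by
      obtain ⟨_, ⟨i0, rfl⟩, h⟩ := WellFounded.has_min (wellFounded_lt (α := ℕ)) (Set.range m)
        ⟨m 0, 0, rfl⟩
      exact ⟨i0, fun i => not_lt.1 (h _ ⟨i, rfl⟩)⟩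
    have hlt' : ∀ i, t (i0 + (i + 1)) < t (i0 + i) := by
      intro i
      have h1 : x (i0 + (i + 1)) = x (i0 + i) := hmx.2
        (((hanti (Nat.le_add_right _ _)).antisymm (hi0 _)).trans
          ((hanti (Nat.le_add_right _ _)).antisymm (hi0 _)).symm)
      rcases List.cons_lt_cons_iff.1 (hlt (i0 + i)) with h | h
      · exact absurd h1 h.ne
      · exact h.2
    have hne : ∀ i, ∃ y s, t (i0 + i) = y :: s := by
      intro i
      rcases h : t (i0 + i) with _ | ⟨y, s⟩
      · have := hlt' i
        rw [h] at this
        exact absurd this (List.not_lt_nil _)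
      · exact ⟨y, s, rfl⟩
    choose y s hys using hne
    refine ih (fun i => t (i0 + i)) y s hys (fun i => ?_) (fun i => ?_) fun i => ?_
    · have := hl (i0 + i)
      rw [hys] at this
      simpa using this
    · have := (hm (i0 + i)).2
      rw [hys] at this
      simpa using this
    · have := hlt' i
      rwa [hys, hys] at this

variable {k : Type u} [Field k] {p : ℕ} {G G' : TripletGerm.{u, v} k}

/-- The condition says that `N` times the rational number `α / a` is an integer, whatever fraction
represents it. -/
theorem dvd_of_mul_eq {N a a' α α' : ℕ} (ha : 0 < a) (h : α * a' = α' * a) (hd : a ∣ N * α) :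
    a' ∣ N * α' := by
  obtain ⟨m, hm⟩ := hd
  refine ⟨m, Nat.eq_of_mul_eq_mul_right ha ?_⟩
  calc N * α' * a = N * α * a' := by rw [mul_assoc, ← h, mul_assoc]
    _ = a' * m * a := by rw [hm]; ring

variable [Fact p.Prime] [CharP k p]

/-- A common denominator does not depend on the presentation. -/
theorem Denom.trans {N : ℕ} {P : Presentation p G} (hd : Denom N (p ^ P.e) P.a P.α P.β)
    (P' : Presentation p G) : Denom N (p ^ P'.e) P'.a P'.α P'.β := by
  have key : ∀ (P P' : Presentation p G), P.Hx = P'.Hx → P.a ∣ N * P.α → P'.a ∣ N * P'.α :=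
    fun P P' h => dvd_of_mul_eq P.a_pos (P.alpha_mul_eq P' h)
  have he : p ^ P'.e ∣ N := by
    rw [← P.e_eq P']
    exact hd.dvd_q
  rcases P.boundary with ⟨hE, hβ⟩ | ⟨Hy, hy, hE⟩ <;>
    rcases P'.boundary with ⟨hE', hβ'⟩ | ⟨Hy', hy', hE'⟩
  · have hx : P.Hx = P'.Hx := by
      rw [hE] at hE'
      simpa using hE'
    exact ⟨he, key P P' hx hd.dvd_x, by rw [hβ']; simp⟩
  · rcases hE' with h | h <;> rw [hE] at h <;> simp at h
  · rcases hE with h | h <;> rw [hE'] at h <;> simp at h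
  · let S := P.swap hy hE
    let S' := P'.swap hy' hE'
    have h1 : (P.Hx = P'.Hx ∧ Hy = Hy') ∨ (P.Hx = Hy' ∧ Hy = P'.Hx) := by
      rcases hE with h | h <;> rcases hE' with h' | h' <;> rw [h] at h' <;> simp at h' <;> tauto
    rcases h1 with ⟨h1, h2⟩ | ⟨h1, h2⟩
    · exact ⟨he, key P P' h1 hd.dvd_x, key S S' h2 hd.dvd_y⟩
    · exact ⟨he, key S P' h2 hd.dvd_y, key P S' h1 hd.dvd_x⟩

theorem exists_natCast_eq_mul_div {N m n : ℕ} (hn : 0 < n) (h : n ∣ N * m) :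
    ∃ i : ℕ, (N : ℚ) * ((m : ℚ) / n) = i := by
  obtain ⟨i, hi⟩ := h
  refine ⟨i, ?_⟩
  rw [← mul_div_assoc, div_eq_iff (Nat.cast_pos.2 hn).ne', mul_comm (i : ℚ)]
  exact_mod_cast hi

variable [IsAlgClosed k]

/-- Existence comes from coordinates adapted along both divisors at once. The entries are 0, a `μ`,
or `δ / q`, or a minimum or maximum of two such numbers, so `N` clears their denominators. -/
theorem Presentation.exists_isInvMON (P : Presentation p G) {N : ℕ}
    (hd : Denom N (p ^ P.e) P.a P.α P.β) :
    ∃ w, IsInvMON p G w ∧ w.length ≤ 4 ∧ ∀ x ∈ w, ∃ m : ℕ, N * x = m := by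
  obtain ⟨τ, A, h1, h2, -⟩ := P.exists_adapted
  obtain ⟨tx, ty, C⟩ := (P.adjust A).exists_types h1 h2
  have hd : Denom N (p ^ (P.adjust A).e) (P.adjust A).a (P.adjust A).α (P.adjust A).β := hd
  generalize P.adjust A = P at *
  have h0 : ∃ m : ℕ, (N : ℚ) * 0 = m := ⟨0, by simp⟩
  have hμ := exists_natCast_eq_mul_div P.a_pos hd.dvd_x
  have hν := exists_natCast_eq_mul_div P.a_pos hd.dvd_y
  have hδ : ∀ δ : ℕ, ∃ m : ℕ, (N : ℚ) * ((δ : ℚ) / (p ^ P.e : ℕ)) = m := fun δ =>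
    exists_natCast_eq_mul_div (Nat.pos_of_ne_zero (pNZ p P.e)) (hd.dvd_q.mul_right δ)
  have hmin : ∀ {x y : ℚ}, (∃ m : ℕ, N * x = m) → (∃ m : ℕ, N * y = m) → ∃ m : ℕ, N * min x y = m := by
    intro x y hx hy
    rcases min_choice x y with h | h <;> rw [h] <;> assumption
  have hmax : ∀ {x y : ℚ}, (∃ m : ℕ, N * x = m) → (∃ m : ℕ, N * y = m) → ∃ m : ℕ, N * max x y = m := by
    intro x y hx hy
    rcases max_choice x y with h | h <;> rw [h] <;> assumption
  rcases P.boundary with ⟨hE, hβ⟩ | ⟨Hy, hy, hE⟩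
  · refine ⟨_, C.isInvMON_one P.Hx_eq hE hβ, ?_⟩
    rcases tx with _ | δ <;>
      simp only [invOne, List.length_cons, List.length_nil, List.mem_cons, List.not_mem_nil, or_false,
        forall_eq_or_imp, forall_eq]
    · exact ⟨by norm_num, h0, h0, hμ⟩
    · exact ⟨by norm_num, hδ δ, h0, hμ⟩
  · refine ⟨_, C.isInvMON_two P.Hx_eq hy hE, ?_⟩
    rcases tx with _ | δ <;> rcases ty with _ | ε <;>
      simp only [invTwo, List.length_cons, List.length_nil, List.mem_cons, List.not_mem_nil, or_false,
        forall_eq_or_imp, forall_eq]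
    · exact ⟨by norm_num, h0, h0, hmin hμ hν, hmax hμ hν⟩
    · exact ⟨by norm_num, hmin (hδ ε) hν, hmax (hδ ε) hν⟩
    · exact ⟨by norm_num, hmin (hδ δ) hμ, hmax (hδ δ) hμ⟩
    · exact ⟨by norm_num, hmin (hδ δ) (hδ ε), hmax (hδ δ) (hδ ε)⟩

omit [Fact p.Prime] [CharP k p] [IsAlgClosed k] in
theorem Presentation.denom (P : Presentation p G) :
    Denom (p ^ P.e * P.a) (p ^ P.e) P.a P.α P.β :=
  ⟨dvd_mul_right _ _, (dvd_mul_left _ _).mul_right _, (dvd_mul_left _ _).mul_right _⟩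

theorem PrescribedCenter.decreases {J : Ideal G.ring} (hJ : PrescribedCenter p G J)
    (hG : InSupport G) (hG' : InSupport G') (hT : IsTransform G J G') {P : Presentation p G} {N : ℕ}
    (hd : Denom N (p ^ P.e) P.a P.α P.β) : Decreases p N G G' := by
  obtain ⟨P', hP'⟩ := hJ
  exact P'.decreases hP' hG hG' hT (hd.trans P')

/-- The procedure terminates. -/
theorem not_exists_sequence (G : ℕ → TripletGerm.{u, v} k) (J : ∀ i, Ideal (G i).ring)
    (h0 : MonomialCase p (G 0)) (hs : InSupport (G 0))
    (h : ∀ i, PrescribedCenter p (G i) (J i) ∧ IsTransform (G i) (J i) (G (i + 1)) ∧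
      InSupport (G (i + 1)) ∧ ¬ SigmaDrops p (G i) (G (i + 1))) : False := by
  obtain ⟨P0⟩ := h0
  have hsupp : ∀ i, InSupport (G i) := fun i => by
    rcases i with _ | i
    · exact hs
    · exact (h i).2.2.1
  -- The denominator is fixed at the first germ; each step only carries it along, so that all values
  -- lie in one lattice.
  obtain ⟨N, hN, hN0⟩ : ∃ N, 0 < N ∧ Denom N (p ^ P0.e) P0.a P0.α P0.β :=
    ⟨_, Nat.mul_pos (Nat.pos_of_ne_zero (pNZ p P0.e)) P0.a_pos, P0.denom⟩
  have hstep : ∀ i, (∃ P : Presentation p (G i), Denom N (p ^ P.e) P.a P.α P.β) →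
      (∃ P : Presentation p (G (i + 1)), Denom N (p ^ P.e) P.a P.α P.β) ∧
        ∃ w w', IsInvMON p (G i) w ∧ IsInvMON p (G (i + 1)) w' ∧ w' < w := by
    rintro i ⟨P, hd⟩
    exact ((h i).1.decreases (hsupp i) (hsupp (i + 1)) (h i).2.1 hd).resolve_left (h i).2.2.2
  have hden : ∀ i, ∃ P : Presentation p (G i), Denom N (p ^ P.e) P.a P.α P.β := by
    intro i
    induction i with
    | zero => exact ⟨P0, hN0⟩
    | succ i ih => exact (hstep i ih).1
  choose P hP using hden
  choose l hl hlen hm using fun i => (P i).exists_isInvMON (hP i)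
  refine not_decreasing hN 4 l hlen hm fun i => ?_
  obtain ⟨-, w, w', hw, hw', hlt⟩ := hstep i ⟨P i, hP i⟩
  rwa [(hl i).unique hw, (hl (i + 1)).unique hw']

end Termination

end

end IFP

theorem theorem1 {k : Type u} [Field k] [IsAlgClosed k] (p : ℕ) [Fact p.Prime]
    [CharP k p] :
    -- `inv_MON` is well defined at every point of the support in the monomial case
    (∀ G : IFP.TripletGerm.{u, v} k, G.R.IsIFG → IFP.MonomialCase p G → IFP.InSupport G →
      ∃! w : List ℚ, IFP.IsInvMON p G w) ∧
    -- the procedure always prescribes a centre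
    (∀ G : IFP.TripletGerm.{u, v} k, G.R.IsIFG → IFP.MonomialCase p G → IFP.InSupport G →
      ∃ (P : IFP.Presentation p G) (Q : Ideal (IFP.PS k)), P.Prescribes Q) ∧
    -- the trichotomy for the prescribed blow up
    (∀ (G G' : IFP.TripletGerm.{u, v} k) (J : Ideal G.ring), G.R.IsIFG →
      IFP.MonomialCase p G → IFP.InSupport G → IFP.PrescribedCenter p G J →
      IFP.IsTransform G J G' →
      ¬ IFP.InSupport G' ∨ IFP.SigmaDrops p G G' ∨
        (IFP.MonomialCase p G' ∧
          ∃ w w' : List ℚ, IFP.IsInvMON p G w ∧ IFP.IsInvMON p G' w' ∧ w' < w)) ∧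
    -- termination: no infinite sequence stays in the support without a drop of `σ`
    (¬ ∃ (G : ℕ → IFP.TripletGerm.{u, v} k) (J : ∀ i, Ideal (G i).ring),
      (G 0).R.IsIFG ∧ IFP.MonomialCase p (G 0) ∧ IFP.InSupport (G 0) ∧
      ∀ i, IFP.PrescribedCenter p (G i) (J i) ∧ IFP.IsTransform (G i) (J i) (G (i + 1)) ∧
        IFP.InSupport (G (i + 1)) ∧ ¬ IFP.SigmaDrops p (G i) (G (i + 1))) := by
  refine ⟨fun G _ hM _ => ?_, fun G _ hM _ => ?_, fun G G' J _ hM hG hJ hT => ?_, ?_⟩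
  · obtain ⟨P⟩ := hM
    obtain ⟨w, hw, -⟩ := P.exists_isInvMON P.denom
    exact ⟨w, hw, fun w' hw' => hw'.unique hw⟩
  · obtain ⟨P⟩ := hM
    exact P.exists_prescribes
  · obtain ⟨P⟩ := hM
    by_cases hG' : IFP.InSupport G'
    · rcases hJ.decreases hG hG' hT P.denom with h | ⟨⟨P', -⟩, hw⟩
      · exact Or.inr (Or.inl h)
      · exact Or.inr (Or.inr ⟨⟨P'⟩, hw⟩)
    · exact Or.inl hG'
  · rintro ⟨G, J, -, h0, hs, h⟩
    exact IFP.not_exists_sequence G J h0 hs h
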